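/- Let $q>0$ be real, $[x]=\frac{q^x-q^{-x}}{q-q^{-1}}$ ($[x]=x$ if $q=1$), $[n]!=[1][2]\cdots[n]$, $[0]!=1$, $(\alpha|q)_n=\prod_{k=0}^{n-1}[\alpha+k]$. Three spins (nonnegative integers or half-integers) satisfy the triangular condition if their sum is an integer and none exceeds the sum of the other two. All sums below run over the nonnegative integer values of the summation parameters for which all $q$-factorial arguments are nonnegative. Put $$\nabla[abc]=\left(\frac{[a+b-c]!\,[a-b+c]!\,[a+b+c+1]!}{[b+c-a]!}\right)^{1/2},$$ $$\left\{\begin{array}{ccc}a&b&e\\d&c&f\end{array}\right\}_q=\frac{\nabla[acf]\nabla[dbf]}{\nabla[abe]\nabla[dce]}\sum_z\frac{(-1)^{a+b+c+d+z}[c+f-a+z]!\,[b+f-d+z]!\,[a+d+e-f-z]!}{[z]!\,[a+c-f-z]!\,[b+d-f-z]!\,[e+f-a-d+z]!\,[2f+z+1]!}$$ if $(a,b,e),(d,c,e),(a,c,f),(d,b,f)$ satisfy the triangular condition, and $0$ otherwise. Let the spins $j_i,l_i,k_i$ ($1\le i\le 4$) be such that the triples $(j_1,l_1,k_1)$, $(j_3,l_1,k_2)$,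 $(j_1,l_2,k_3)$, $(j_3,l_2,k_4)$, $(j_2,l_3,k_1)$, $(j_4,l_3,k_2)$, $(j_2,l_4,k_3)$, $(j_4,l_4,k_4)$ satisfy the triangular condition, and let $$W=(-1)^{l_1-l_2-l_3+l_4}\sum_{x}[2x+1]\left\{\begin{array}{ccc}k_1&j_1&l_1\\j_3&k_2&x\end{array}\right\}_q\left\{\begin{array}{ccc}k_3&k_4&x\\j_3&j_1&l_2\end{array}\right\}_q\left\{\begin{array}{ccc}k_3&j_2&l_4\\j_4&k_4&x\end{array}\right\}_q\left\{\begin{array}{ccc}k_1&k_2&x\\j_4&j_2&l_3\end{array}\right\}_q$$ ($x$ running over all spins) be the $q$-$12j$ coefficient of the second kind $\left[\begin{smallmatrix}j_1&j_2&j_3&j_4\\l_1&l_2&l_3&l_4\\k_1&k_2&k_3&k_4\end{smallmatrix}\right]_q$. Then the following hold. (1) If $k_1=j_1+l_1$, then $$W=\frac{(-1)^{j_1+l_2-k_3}\nabla[k_1j_2l_3]\nabla[j_4k_2l_3]}{\nabla[j_1l_2k_3]\nabla[k_4j_3l_2]\nabla[k_3j_2l_4]\nabla[j_4k_4l_4]\nabla[l_1k_2j_3]}\left(\frac{[2l_1]![2j_1]!}{[2k_1+1]!}\right)^{1/2}$$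 $$\times\sum_{z_1,z_3,z_4}\frac{(-1)^{z_1+z_3}[l_2-j_3+k_4+z_1]!\,[j_1+j_3+k_3-k_4-z_1]!\,[2j_3-z_1]!\,[j_4+k_4-l_4+z_3]!}{[z_1]!\,[z_3]!\,[z_4]!\,[l_2+j_3-k_4-z_1]!\,[j_3-j_4-l_1+l_3+z_4-z_1]!\,[j_2-k_3+l_4-z_3]!}$$ $$\times\frac{[j_2+k_3-l_4+z_3]!\,[2l_4-z_3]!\,[j_2+l_3-k_1+z_4]!\,[k_2+l_3-j_4+z_4]!}{[k_3+j_1+j_3+j_4-l_4-z_1+z_3+1]!\,[k_4+l_1-l_3+l_4-j_3+z_1-z_3-z_4]!\,[k_3-k_1+l_3-l_4+z_3+z_4]!}$$ $$\times\frac{[k_1+k_3+k_4+j_4-l_3-z_4+1]!}{[k_1+j_2-l_3-z_4]!\,[k_2-l_3+j_4-z_4]!\,[2l_3+z_4+1]!}.$$ (2) If $k_1=j_1+l_1$ and $l_3=k_1+j_2$, then $$W=\frac{(-1)^{j_1+l_2-k_3+j_4+k_4+l_4}\nabla[l_3j_4k_2]\nabla[j_1{+}j_2,l_2,l_4]}{\nabla[j_1l_2k_3]\nabla[j_2k_3l_4]\nabla[l_1k_2j_3]\nabla[j_1{+}j_2,j_3,j_4]}\left(\frac{[2l_1]![2j_1]![2j_2]!}{[2k_1+1]\,[2l_3+1]!}\right)^{1/2}\left\{\begin{array}{ccc}j_1{+}j_2&l_4&l_2\\k_4&j_3&j_4\end{array}\right\}_q.$$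 (3) If $k_1=j_1+l_1$ and $l_3=k_1-j_2$, then $$W=\frac{(-1)^{j_1+l_2-k_3}([2l_1]![2j_1]![2j_2]![2l_3]!)^{1/2}\nabla[k_4l_4j_4]}{\nabla[l_3k_2j_4]\nabla[j_1l_2k_3]\nabla[k_4j_3l_2]\nabla[j_2k_3l_4]\nabla[l_1k_2j_3]}\,S_3,$$ $$S_3=\sum_{z,u}\frac{(-1)^{z+u}[l_2-j_3+k_4+z]!\,[l_1+k_2-j_3+z]!\,[j_1+j_3+k_3-k_4-z]!\,[2j_3-z]!}{[z]!\,[l_2+j_3-k_4-z]!\,[k_2-l_1+j_3-z]!\,[k_3+k_4-j_1-j_3+z]!}$$ $$\times\frac{[j_4-k_4+l_4+u]!\,[j_4+l_3-k_2+u]!\,[k_3+k_4+j_2-j_4-u]!\,[k_2+l_3+j_4+u+1]!}{[u]!\,[k_4-j_4+l_4-u]!\,[k_3-k_4-j_2+j_4+u]!\,[2j_4+u+1]!\,[j_1+j_2+j_3-j_4-z-u]!\,[l_1+l_3-j_3+j_4+z+u+1]!}.$$ (4) If $k_1=j_1+l_1$ and $j_4=l_4+k_4$, then $$W=\frac{(-1)^{j_1+l_2-k_3}\nabla[k_1j_2l_3]\nabla[j_4k_2l_3]}{\nabla[j_1l_2k_3]\nabla[k_4j_3l_2]\nabla[l_4k_3j_2]\nabla[l_1k_2j_3]}\left(\frac{[2l_1]![2j_1]![2l_4]![2k_4]!}{[2k_1+1]![2j_4+1]!}\right)^{1/2}S_4,$$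 $$S_4=\sum_{z}\frac{(-1)^{z}[l_2-j_3+k_4+z]!\,[j_4-j_3+j_2-j_1+z]!\,[l_1+k_2-j_3+z]!\,[2j_3-z]!}{[z]!\,[l_2+j_3-k_4-z]!\,[j_1+j_2+j_3-j_4-z]!\,[k_2+j_3-l_1-z]!}$$ $$\times\frac{[j_1+j_3+k_3-k_4-z]!}{[k_3+k_4-j_1-j_3+z]!\,[l_1-l_3-j_3+j_4+z]!\,[l_1+l_3-j_3+j_4+z+1]!}.$$ (5) If $k_1=j_1+l_1$ and $k_4=j_4+l_4$, then $$W=\frac{(-1)^{l_1-l_2-k_2+k_4}\nabla[k_1j_2l_3]\nabla[k_4j_3l_2]}{\nabla[j_1l_2k_3]\nabla[l_4k_3j_2]\nabla[j_4l_3k_2]\nabla[l_1k_2j_3]}\left(\frac{[2l_1]![2j_1]![2l_4]![2j_4]!}{[2k_1+1]![2k_4+1]!}\right)^{1/2}S_5,$$ $$S_5=\sum_{z}\frac{(-1)^{z}[j_2+l_3-k_1+z]!\,[k_1+k_2-j_2+j_4-z]!\,[l_4-k_3+j_2+z]!\,[j_3-j_4+j_2-j_1+z]!}{[z]!\,[k_1-j_2+l_3-z]!\,[k_2+j_2-k_1-j_4+z]!\,[j_1-j_2+j_3+j_4-z]!}$$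 $$\times\frac{[j_2+k_3+l_4+z+1]!}{[l_4-l_2-j_1+j_2+z]!\,[2j_2+z+1]!\,[l_2+l_4-j_1+j_2+z+1]!}.$$ (6) If $k_1=j_1+l_1$ and $l_3=k_2+j_4$, then $$W=\frac{(-1)^{j_1+l_2-k_3}\nabla[l_3j_2k_1]\,[k_1+k_3+k_4+j_4-l_3+1]!}{\nabla[j_1l_2k_3]\nabla[k_4j_3l_2]\nabla[k_3j_2l_4]\nabla[j_4k_4l_4]\nabla[l_1k_2j_3]}\left(\frac{[2l_1]![2j_1]![2k_2]![2j_4]!}{[2k_1+1]![2l_3+1]!}\right)^{1/2}S_6,$$ $$S_6=\sum_{z_1,z_3}\frac{(-1)^{z_1+z_3}[l_2-j_3+k_4+z_1]!\,[j_1+j_3+k_3-k_4-z_1]!\,[2j_3-z_1]!\,[2l_4-z_3]!}{[z_1]!\,[l_2+j_3-k_4-z_1]!\,[j_3+k_2-l_1-z_1]!\,[z_3]!\,[j_2-k_3+l_4-z_3]!}$$ $$\times\frac{[j_4+k_4-l_4+z_3]!\,[j_2+k_3-l_4+z_3]!}{[k_4+l_1-l_3+l_4-j_3+z_1-z_3]!\,[k_3-k_1+l_3-l_4+z_3]!\,[k_3+j_1+j_3+j_4-l_4-z_1+z_3+1]!}.$$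 (7) If $l_4=l_1+l_2+l_3$, then $$W=\frac{(-1)^{j_1-j_3-k_1+k_2}[2l_1]![2l_2]![2l_3]!\,\nabla[l_4k_3j_2]\nabla[l_4j_4k_4]}{[2l_4+1]!\,\nabla[l_1j_1k_1]\nabla[l_1k_2j_3]\nabla[l_2j_1k_3]\nabla[l_2j_3k_4]\nabla[l_3j_2k_1]\nabla[l_3k_2j_4]}.$$ Moreover, $S_4,S_5$ are balanced ${}_6F_5$ series and $S_3$, $S_6$ are balanced Kampé de Fériet series of type $F^{1:4}_{1:3}$ and $F^{1:3}_{1:2}$, in the following sense. Let $${}_6F_5\left[{\alpha\atop\beta};q,1\right]=\sum_{k\ge0}\frac{\prod_{i=1}^6(\alpha_i|q)_k}{(1|q)_k\prod_{i=1}^5(\beta_i|q)_k},\qquad F^{1:B}_{1:D}\left[{a\atop c}:{(b)\atop(d)};{(b')\atop(d')};1,1;q\right]=\sum_{s,t\ge0}\frac{(a|q)_{s+t}}{(c|q)_{s+t}}\,\frac{\prod_{i=1}^B(b_i|q)_s(b'_i|q)_t}{\prod_{i=1}^D(d_i|q)_s(d'_i|q)_t}\,\frac{1}{[s]![t]!}$$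 (terms with a vanishing numerator are $0$). Let $T_i$ be the summand of $S_i$ with all summation parameters equal to $0$ for $i=3,4,5$, and the summand with $z_1=l_2+j_3-k_4$, $z_3=0$ for $i=6$. If all $q$-factorial arguments in $T_i$ are nonnegative, then $S_i=T_i\cdot F_i$, where - $F_3=F^{1:4}_{1:3}$ with $a=-(j_1+j_2+j_3-j_4)$, $c=l_1+l_3-j_3+j_4+2$; $(b)=(l_2-j_3+k_4+1,\ l_1+k_2-j_3+1,\ -(l_2+j_3-k_4),\ -(k_2-l_1+j_3))$, $(d)=(-(j_1+j_3+k_3-k_4),\ -2j_3,\ k_3+k_4-j_1-j_3+1)$; $(b')=(j_4-k_4+l_4+1,\ j_4+l_3-k_2+1,\ k_2+l_3+j_4+2,\ -(k_4-j_4+l_4))$, $(d')=(-(k_3+k_4+j_2-j_4),\ k_3-k_4-j_2+j_4+1,\ 2j_4+2)$; - $F_4={}_6F_5$ with $\alpha=(l_2-j_3+k_4+1,\ j_4-j_3+j_2-j_1+1,\ l_1+k_2-j_3+1,\ -(l_2+j_3-k_4),\ -(j_1+j_2+j_3-j_4),\ -(k_2+j_3-l_1))$, $\beta=(-2j_3,\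 -(j_1+j_3+k_3-k_4),\ k_3+k_4-j_1-j_3+1,\ l_1-l_3-j_3+j_4+1,\ l_1+l_3-j_3+j_4+2)$; - $F_5={}_6F_5$ with $\alpha=(j_2+l_3-k_1+1,\ l_4-k_3+j_2+1,\ j_3-j_4+j_2-j_1+1,\ j_2+k_3+l_4+2,\ -(k_1-j_2+l_3),\ -(j_1-j_2+j_3+j_4))$, $\beta=(-(k_1+k_2-j_2+j_4),\ k_2+j_2-k_1-j_4+1,\ l_4-l_2-j_1+j_2+1,\ 2j_2+2,\ l_2+l_4-j_1+j_2+2)$; - $F_6=F^{1:3}_{1:2}$ with $a=-(l_1+l_2+l_4-l_3)$, $c=k_3+k_4+j_1+j_4-l_2-l_4+2$; $(b)=(j_1+k_3-l_2+1,\ j_3-l_2+k_4+1,\ -(l_2+j_3-k_4))$, $(d)=(-2l_2,\ k_2+k_4-l_1-l_2+1)$; $(b')=(j_4+k_4-l_4+1,\ j_2+k_3-l_4+1,\ -(j_2-k_3+l_4))$, $(d')=(-2l_4,\ k_3-k_1+l_3-l_4+1)$. -/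

import Mathlib

namespace QRecoupling

noncomputable section

/-- The `q`-number `[x] = (q^x - q^{-x}) / (q - q⁻¹)`, with its limit value `x` at `q = 1`. -/
def qNum (q x : ℝ) : ℝ :=
  if q = 1 then x else (q ^ x - q ^ (-x)) / (q - q⁻¹)

/-- The `q`-factorial `[n]! = [1][2]⋯[n]` of an integer `n`, here given as a real number
(only integers occur as arguments). It is set to `0` for `n < 0`. So, by `a / 0 = 0`, a summand
with a negative factorial argument is zero, whether the factorial stands in its numerator or in its
denominator: sums extend over the values of the summation parameters for which all
factorial arguments are nonnegative. -/
def qFac (q x : ℝ) : ℝ :=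
  if x < 0 then 0 else ∏ i ∈ Finset.range ⌊x⌋₊, qNum q (i + 1)

/-- The `q`-Pochhammer symbol `(α|q)_n = [α][α+1]⋯[α+n-1]`. -/
def qPoch (q α : ℝ) (n : ℕ) : ℝ :=
  ∏ k ∈ Finset.range n, qNum q (α + k)

/-- The sign `(-1)^x` of an integer `x` given as a real number. -/
def sign (x : ℝ) : ℝ := (-1 : ℝ) ^ ⌊x⌋

/-- A spin: a nonnegative integer or half-integer. -/
def IsSpin (j : ℝ) : Prop := ∃ n : ℕ, j = n / 2

/-- The triangular condition for three spins. -/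
def Triangle (a b c : ℝ) : Prop :=
  IsSpin a ∧ IsSpin b ∧ IsSpin c ∧ (∃ n : ℕ, a + b + c = n) ∧
    a ≤ b + c ∧ b ≤ a + c ∧ c ≤ a + b

/-- The asymmetric triangle coefficient `∇[abc]`. -/
def nab (q a b c : ℝ) : ℝ :=
  √(qFac q (a + b - c) * qFac q (a - b + c) * qFac q (a + b + c + 1) / qFac q (b + c - a))

open Classical in
/-- The `q`-`6j` coefficient `{a b e; d c f}_q` of `u_q(2)`; it vanishes unless the four
triangular conditions are satisfied. For `z > a + c - f` the summand is zero. -/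
def sixJ (q a b e d c f : ℝ) : ℝ :=
  if Triangle a b e ∧ Triangle d c e ∧ Triangle a c f ∧ Triangle d b f then
    nab q a c f * nab q d b f / (nab q a b e * nab q d c e) *
      ∑ z ∈ Finset.range (⌊a + c - f⌋₊ + 1),
        sign (a + b + c + d + z) * qFac q (c + f - a + z) * qFac q (b + f - d + z)
            * qFac q (a + d + e - f - z) /
          (qFac q z * qFac q (a + c - f - z) * qFac q (b + d - f - z)
            * qFac q (e + f - a - d + z) * qFac q (2 * f + z + 1))
  else 0

/-- The eight triangular conditions of the `12j` coefficient of the second kind. -/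
def Admissible (j₁ j₂ j₃ j₄ l₁ l₂ l₃ l₄ k₁ k₂ k₃ k₄ : ℝ) : Prop :=
  Triangle j₁ l₁ k₁ ∧ Triangle j₃ l₁ k₂ ∧ Triangle j₁ l₂ k₃ ∧ Triangle j₃ l₂ k₄ ∧
    Triangle j₂ l₃ k₁ ∧ Triangle j₄ l₃ k₂ ∧ Triangle j₂ l₄ k₃ ∧ Triangle j₄ l₄ k₄

/-- The `q`-`12j` coefficient of the second kind
`[j₁ j₂ j₃ j₄; l₁ l₂ l₃ l₄; k₁ k₂ k₃ k₄]_q`, as a sum over the intermediate spins `x = n / 2`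
of products of four `q`-`6j` coefficients. For `x > j₁ + j₃` the product vanishes. -/
def twelveJ (q j₁ j₂ j₃ j₄ l₁ l₂ l₃ l₄ k₁ k₂ k₃ k₄ : ℝ) : ℝ :=
  sign (l₁ - l₂ - l₃ + l₄) *
    ∑ n ∈ Finset.range (⌊2 * (j₁ + j₃)⌋₊ + 1),
      qNum q (n + 1) * sixJ q k₁ j₁ l₁ j₃ k₂ (n / 2) * sixJ q k₃ k₄ (n / 2) j₃ j₁ l₂
        * sixJ q k₃ j₂ l₄ j₄ k₄ (n / 2) * sixJ q k₁ k₂ (n / 2) j₄ j₂ l₃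

/-- The finite basic hypergeometric series
`_{p+1}F_p[α₁, …, α_{p+1}; β₁, …, β_p; q, x] = ∑_k (∏ (α_i|q)_k) / (∏ (β_i|q)_k (1|q)_k) x^k`. -/
def qHyp (q : ℝ) (α β : List ℝ) (x : ℝ) : ℝ :=
  ∑' k : ℕ, (α.map fun r => qPoch q r k).prod /
    ((β.map fun r => qPoch q r k).prod * qPoch q 1 k) * x ^ k

/-- The `q`-Kampé de Fériet function `F^{A:B}_{C:D}[(a)/(c) : (b)/(d); (b')/(d'); x, y; q]` in the
case `A = C`, in which the additional powers of `q` in the general definition are absent. The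
variables `x = q^{p+1}`, `y = q^{p'+1}` are `1` for balanced series. -/
def qKampe (q : ℝ) (a c b d b' d' : List ℝ) : ℝ :=
  ∑' st : ℕ × ℕ,
    (a.map fun r => qPoch q r (st.1 + st.2)).prod / (c.map fun r => qPoch q r (st.1 + st.2)).prod *
      ((b.map fun r => qPoch q r st.1).prod * (b'.map fun r => qPoch q r st.2).prod /
        ((d.map fun r => qPoch q r st.1).prod * (d'.map fun r => qPoch q r st.2).prod)) *
      ((q ^ (a.sum + b.sum - c.sum - d.sum + 1)) ^ st.1 *
        ((q ^ (a.sum + b'.sum - c.sum - d'.sum + 1)) ^ st.2)⁻¹ /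
          (qFac q st.1 * qFac q st.2))

end

end QRecoupling

open QRecoupling

/-! Everything rests on one quadratic identity of q-numbers, [a][b] = [c][a+b-c] + [a-c][b-c]. By
induction it gives the q-Pfaff–Saalschütz sum (`saalschuetz`); using Saalschütz twice gives the
Sears transformation of terminating balanced ₄φ₃ series (`sears`); and Sears brings the sum defining
a 6j coefficient into Racah's form (`dSum_eq_racah`). That form is symmetric in four upper
parameters and, up to a shift of the summation index, in three lower ones. Hence each 6j
coefficient, stripped of its triangle factors (`sixRed`), can be replaced by whichever asymmetric
sum `dSum` suits the summation over x.

The spins are encoded by integers, and the sum over x becomes a sum over i = x - j₁ - j₃ ≤ 0. Each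
triangle that contains x belongs to two of the four 6j coefficients, so its square root disappears,
and W is a product of eight x-independent triangle coefficients and a rational sum
(`twelveJ_eq_sum_wTerm`).

The sum over x is carried out by interpolation. Put σ = 2j₁ + 2j₃ + 1 and ν(i) = [i][i+σ], so that
ν(i) - ν(j) = [i-j][i+j+σ]. Then [2x+σ] with four factorials is a Lagrange weight on this lattice,
and a 6j sum times two factorials is a polynomial in ν(x) (`racahPoly`). The x-sum is thus a divided
difference of a product of Racah polynomials. Since ν is invariant under i ↦ -σ-i, nodes may
coincide; `divDiff` is therefore defined through polynomial remainders, and the zeros of Racah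
polynomials found by a further Sears transformation (`nodal_dvd_racahPoly`) remove the coinciding
nodes. The same zeros show that the rewritten summands vanish where a triangular condition on x
fails.

If k₁ = j₁ + l₁, the first 6j coefficient is a single term. Expanding the fourth and treating the
second and third as polynomials leads to Newton coefficients of nodal polynomials
(`divDiff_nodal_Ioc`) and to the triple sum (1). In (6) and (4) the second stretched triangle pins
one or two of its indices; in (2) one index is pinned and another is summed by Saalschütz. In (3)
and (5) two 6j coefficients are single terms and the x-sum is very-well-poised (`sum_wellpoised`,
`sum_wellpoised_three`), in (5) followed by a Saalschütz sum. In (7) the first and fourth 6j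
coefficients form a polynomial whose degree is so low that, after expanding the other two, only one
divided difference survives, and it is a product of leading coefficients.

For the hypergeometric forms each summand is divided by its initial value, the ratios of factorials
being Pochhammer symbols. -/

namespace QRecoupling
open Finset

/-! ### q-numbers, q-factorials and the Saalschütz summation -/

/-- The quadratic relation between `q`-numbers from which all identities below are derived. -/
theorem qNum_mul_qNum {q : ℝ} (hq : 0 < q) (a b c : ℝ) :
    qNum q a * qNum q b = qNum q c * qNum q (a + b - c) + qNum q (a - c) * qNum q (b - c) := by
  unfold qNum
  split_ifs with h
  · ring
  · have hq2 : q - q⁻¹ ≠ 0 := by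
      intro h0
      apply h
      have : q * q = 1 := by
        have : q = q⁻¹ := by linarith
        nth_rewrite 2 [this]
        exact mul_inv_cancel₀ hq.ne'
      nlinarith
    field_simp
    have ha := Real.rpow_pos_of_pos hq a
    have hb := Real.rpow_pos_of_pos hq b
    have hc := Real.rpow_pos_of_pos hq c
    simp only [Real.rpow_add hq, Real.rpow_neg hq.le, sub_eq_add_neg, neg_add, neg_neg]
    field_simp
    ring

theorem qNum_zero (q : ℝ) : qNum q 0 = 0 := by
  unfold qNum
  split_ifs <;> simp

theorem qNum_neg (q x : ℝ) : qNum q (-x) = -qNum q x := by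
  unfold qNum
  split_ifs
  · rfl
  · rw [neg_neg]; ring

theorem qNum_pos {q : ℝ} (hq : 0 < q) {x : ℝ} (hx : 0 < x) : 0 < qNum q x := by
  unfold qNum
  split_ifs with h
  · exact hx
  · rcases lt_or_gt_of_ne h with h1 | h1
    · apply div_pos_of_neg_of_neg
      · have := Real.rpow_lt_rpow_of_exponent_gt hq h1 (show -x < x by linarith)
        linarith
      · have := (one_lt_inv₀ hq).2 h1
        linarith
    · apply div_pos
      · have := Real.rpow_lt_rpow_of_exponent_lt h1 (show -x < x by linarith)
        linarith
      · have := inv_lt_one_of_one_lt₀ h1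
        linarith

/-- The `q`-number of an integer. -/
noncomputable def qi (q : ℝ) (n : ℤ) : ℝ := qNum q n

/-- The `q`-factorial of an integer. -/
noncomputable def fac (q : ℝ) (n : ℤ) : ℝ := qFac q n

/-- The `q`-Pochhammer symbol of an integer. -/
noncomputable def poch (q : ℝ) (a : ℤ) (n : ℕ) : ℝ := ∏ k ∈ range n, qi q (a + k)

section qi
variable {q : ℝ}

theorem qi_mul_qi (hq : 0 < q) (a b c : ℤ) :
    qi q a * qi q b = qi q c * qi q (a + b - c) + qi q (a - c) * qi q (b - c) := by
  have := qNum_mul_qNum hq a b c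
  simpa [qi] using this

theorem qi_mul_qi_of (hq : 0 < q) {a b c d e f : ℤ} (hd : d = a + b - c) (he : e = a - c)
    (hf : f = b - c) : qi q a * qi q b = qi q c * qi q d + qi q e * qi q f := by
  subst hd he hf
  exact qi_mul_qi hq a b c

theorem qi_zero (q : ℝ) : qi q 0 = 0 := by simp [qi, qNum_zero]

theorem qi_neg (q : ℝ) (n : ℤ) : qi q (-n) = -qi q n := by simp [qi, qNum_neg]

theorem qi_pos (hq : 0 < q) {n : ℤ} (hn : 0 < n) : 0 < qi q n :=
  qNum_pos hq (by exact_mod_cast hn)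

theorem qi_ne_zero (hq : 0 < q) {n : ℤ} (hn : n ≠ 0) : qi q n ≠ 0 := by
  rcases lt_or_gt_of_ne hn with h | h
  · have := qi_pos hq (show 0 < -n by omega)
    rw [qi_neg] at this
    linarith
  · exact (qi_pos hq h).ne'

theorem fac_of_neg (q : ℝ) {n : ℤ} (hn : n < 0) : fac q n = 0 := by
  have : (n : ℝ) < 0 := by exact_mod_cast hn
  simp [fac, qFac, this]

theorem fac_natCast (q : ℝ) (n : ℕ) : fac q n = ∏ i ∈ range n, qi q (i + 1) := by
  simp [fac, qFac, qi]

theorem fac_zero (q : ℝ) : fac q 0 = 1 := by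
  simpa using fac_natCast q 0

theorem fac_pos (hq : 0 < q) {n : ℤ} (hn : 0 ≤ n) : 0 < fac q n := by
  lift n to ℕ using hn
  rw [fac_natCast]
  exact prod_pos fun i _ => qi_pos hq (by omega)

theorem fac_ne_zero (hq : 0 < q) {n : ℤ} (hn : 0 ≤ n) : fac q n ≠ 0 := (fac_pos hq hn).ne'

theorem fac_eq_zero_iff (hq : 0 < q) {n : ℤ} : fac q n = 0 ↔ n < 0 :=
  ⟨fun h => by by_contra h0; exact fac_ne_zero hq (by omega) h, fac_of_neg q⟩

theorem fac_nonneg (hq : 0 < q) (n : ℤ) : 0 ≤ fac q n := by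
  rcases lt_or_ge n 0 with h | h
  · rw [fac_of_neg q h]
  · exact (fac_pos hq h).le

/-- For n < -1 both sides are 0 by convention. The exception n = -1 is genuine: [0]! = 1, while the
right side is 0. -/
theorem fac_succ {n : ℤ} (hn : n ≠ -1) : fac q (n + 1) = qi q (n + 1) * fac q n := by
  rcases lt_or_ge n 0 with h | h
  · rw [fac_of_neg q h, fac_of_neg q (show n + 1 < 0 by omega), mul_zero]
  · lift n to ℕ using h
    have := fac_natCast q (n + 1)
    rw [prod_range_succ, ← fac_natCast] at this
    rw [mul_comm]
    exact_mod_cast this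

theorem fac_eq_mul {n m : ℤ} (hn : n ≠ 0) (hm : m = n - 1) : fac q n = qi q n * fac q m := by
  subst hm
  have := fac_succ (q := q) (show n - 1 ≠ -1 by omega)
  rwa [sub_add_cancel] at this

/-- For reciprocals the recurrence has no exception, since at n = 0 both sides are 0. Denominators
with negative arguments therefore need no separate treatment. -/
theorem inv_fac_eq (hq : 0 < q) {n m : ℤ} (hm : m = n - 1) :
    (fac q m)⁻¹ = qi q n * (fac q n)⁻¹ := by
  rcases eq_or_ne n 0 with h | h
  · subst h hm
    rw [qi_zero, fac_of_neg q (by omega)]; simp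
  · rw [fac_eq_mul h hm, mul_inv, ← mul_assoc, mul_inv_cancel₀ (qi_ne_zero hq h), one_mul]

theorem poch_zero (q : ℝ) (a : ℤ) : poch q a 0 = 1 := by simp [poch]

theorem poch_succ (q : ℝ) (a : ℤ) (n : ℕ) : poch q a (n + 1) = poch q a n * qi q (a + n) := by
  simp [poch, prod_range_succ]

theorem poch_succ' (q : ℝ) (a : ℤ) (n : ℕ) : poch q a (n + 1) = qi q a * poch q (a + 1) n := by
  simp only [poch, prod_range_succ']
  rw [mul_comm]
  congr 1
  · simp
  · exact prod_congr rfl fun k _ => by congr 1; push_cast; ring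

theorem poch_mul (q : ℝ) (a : ℤ) (m n : ℕ) : poch q a m * poch q (a + m) n = poch q a (m + n) := by
  simp only [poch, prod_range_add]
  congr 1
  exact prod_congr rfl fun k _ => by congr 1; push_cast; ring

theorem poch_mul_of (q : ℝ) {a b : ℤ} {m n l : ℕ} (hb : b = a + m) (hl : l = m + n) :
    poch q a m * poch q b n = poch q a l := by
  subst hb hl
  exact poch_mul q a m n

/-- Reversal of a `q`-Pochhammer symbol. -/
theorem poch_reverse (q : ℝ) {a b : ℤ} {n : ℕ} (h : a + b = 1 - n) :
    poch q a n = (-1) ^ n * poch q b n := by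
  simp only [poch]
  rw [← prod_range_reflect, ← card_range n, ← prod_const, card_range, ← prod_mul_distrib]
  refine prod_congr rfl fun k hk => ?_
  rw [mem_range] at hk
  rw [neg_one_mul, ← qi_neg]
  congr 1
  omega

/-- Only the upper argument c must be nonnegative: if b < 0 ≤ c, the product runs through [0], and
the inverse of [b]! is 0 by convention. -/
theorem poch_eq_fac (hq : 0 < q) {a b c : ℤ} {n : ℕ} (hb : b = a - 1) (hc : c = b + n)
    (h : 0 ≤ c) : poch q a n = fac q c * (fac q b)⁻¹ := by
  subst hb
  induction n generalizing c with
  | zero =>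
    have : c = a - 1 := by simpa using hc
    rw [poch_zero, ← this, mul_inv_cancel₀ (fac_ne_zero hq h)]
  | succ n ih =>
    rcases eq_or_ne c 0 with h0 | h0
    · rw [poch, prod_eq_zero (i := n) (by simp), fac_of_neg q (n := a - 1) (by omega)]
      · simp
      · rw [show a + (n : ℤ) = 0 by omega, qi_zero]
    · rw [poch_succ, ih (c := c - 1) (by omega) (by omega), fac_eq_mul h0 rfl,
        show a + (n : ℤ) = c by omega]
      ring

/-- No bound on n is needed: for n > u both sides vanish. -/
theorem poch_neg_eq_fac (hq : 0 < q) {a u : ℤ} {n : ℕ} (ha : a = -u) (hu : 0 ≤ u) :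
    poch q a n = (-1) ^ n * (fac q u * (fac q (u - n))⁻¹) := by
  rw [poch_reverse q (b := u - n + 1) (by omega),
    poch_eq_fac hq (b := u - n) (c := u) (by omega) (by omega) hu]

/-- The symmetric `q`-binomial coefficient. -/
noncomputable def qbin (q : ℝ) (n k : ℕ) : ℝ := fac q n * ((fac q k)⁻¹ * (fac q (n - k))⁻¹)

theorem qbin_mul_qbin (hq : 0 < q) (n k i : ℕ) (hk : k ≤ n) (hi : i ≤ k) :
    qbin q n k * qbin q k i = qbin q n i * qbin q (n - i) (k - i) := by
  have hk' : fac q k ≠ 0 := fac_ne_zero hq (by omega)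
  have hi' : fac q (n - i : ℕ) ≠ 0 := fac_ne_zero hq (by omega)
  have e1 : ((n : ℤ) - i) = (n - i : ℕ) := by omega
  have e2 : (((n - i : ℕ) : ℤ) - (k - i : ℕ)) = n - k := by omega
  have e3 : ((k : ℤ) - i) = (k - i : ℕ) := by omega
  simp only [qbin, e1, e2, e3]
  field_simp

/-- The `q`-Pfaff–Saalschütz summation formula, free of denominators. -/
theorem saalschuetz (hq : 0 < q) (n : ℕ) (a b c : ℤ) :
    ∑ k ∈ range (n + 1), qbin q n k * poch q a k * poch q b k * poch q (a + b + c + k) (n - k) *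
      poch q c (n - k) = poch q (b + c) n * poch q (a + c) n := by
  induction n with
  | zero => simp [qbin, poch_zero, fac_zero]
  | succ n ih =>
    rw [poch_succ, poch_succ]
    have e : poch q (b + c) n * qi q (b + c + n) * (poch q (a + c) n * qi q (a + c + n)) =
        ∑ k ∈ range (n + 1), (qbin q n k * poch q a k * poch q b k *
            (poch q (a + b + c + k) (n - k) * qi q (a + b + c + n + k)) * poch q c (n + 1 - k) +
          qbin q n k * poch q a (k + 1) * poch q b (k + 1) *
            poch q (a + b + c + k) (n - k) * poch q c (n - k)) := by
      calc _ = (poch q (b + c) n * poch q (a + c) n) * (qi q (b + c + n) * qi q (a + c + n)) := by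
            ring
        _ = _ := by
          rw [← ih, sum_mul]
          refine sum_congr rfl fun k hk => ?_
          rw [mem_range] at hk
          rw [qi_mul_qi_of hq (c := a + k) (d := b + 2 * c + 2 * n - k) (e := b + c + n - a - k)
            (f := c + n - k) (by ring) (by ring) (by ring)]
          rw [show n + 1 - k = (n - k) + 1 by omega, poch_succ q c, poch_succ q a, poch_succ q b,
            show c + ((n - k : ℕ) : ℤ) = c + n - k by omega]
          have := qi_mul_qi_of hq (a := b + c + n) (b := a + c + n) (c := a + k)
            (d := b + 2 * c + 2 * n - k) (e := b + c + n - a - k)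
            (f := c + n - k) (by ring) (by ring) (by ring)
          -- The preceding splitting is undone here; the one that is used is [b+c+n][a+c+n] =
          -- [a+b+c+n+k][c+n-k] + [a+k][b+k]. Its two parts feed the terms k and k+1 of the sum for
          -- n+1.
          rw [← this, qi_mul_qi_of hq (a := b + c + n) (b := a + c + n)
            (c := a + b + c + n + k) (d := c + n - k) (e := -(a + k)) (f := -(b + k))
            (by ring) (by ring) (by ring), qi_neg, qi_neg]
          ring
    rw [e, sum_add_distrib, sum_range_succ', sum_range_succ]
    conv_rhs => rw [sum_range_succ', sum_range_succ]
    have hend : qbin q n n = qbin q (n + 1) (n + 1) := by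
      have h1 : fac q (n : ℤ) ≠ 0 := fac_ne_zero hq (by omega)
      have h2 : fac q ((n : ℤ) + 1) ≠ 0 := fac_ne_zero hq (by omega)
      simp only [qbin, sub_self, Nat.cast_add, Nat.cast_one]
      field_simp
    have h0 : qbin q n 0 = qbin q (n + 1) 0 := by
      have h1 : fac q (n : ℤ) ≠ 0 := fac_ne_zero hq (by omega)
      have h2 : fac q ((n : ℤ) + 1) ≠ 0 := fac_ne_zero hq (by omega)
      simp only [qbin, Nat.cast_add, Nat.cast_one, Nat.cast_zero, sub_zero]
      field_simp
    -- A q-Pascal rule: the two contributions to term k+1 recombine, once more by the quadratic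
    -- relation.
    have hmid : ∀ k ∈ range n,
        qbin q (n + 1) (k + 1) * poch q a (k + 1) * poch q b (k + 1) *
          poch q (a + b + c + (k + 1 : ℕ)) (n + 1 - (k + 1)) * poch q c (n + 1 - (k + 1)) =
        qbin q n (k + 1) * poch q a (k + 1) * poch q b (k + 1) *
            (poch q (a + b + c + (k + 1 : ℕ)) (n - (k + 1)) *
              qi q (a + b + c + n + (k + 1 : ℕ))) * poch q c (n + 1 - (k + 1)) +
          qbin q n k * poch q a (k + 1) * poch q b (k + 1) *
            poch q (a + b + c + k) (n - k) * poch q c (n - k) := by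
      intro k hk
      rw [mem_range] at hk
      obtain ⟨m, rfl⟩ : ∃ m, n = k + m + 1 := ⟨n - k - 1, by omega⟩
      rw [show k + m + 1 + 1 - (k + 1) = m + 1 by omega, show k + m + 1 - (k + 1) = m by omega,
        show k + m + 1 - k = m + 1 by omega, poch_succ q (a + b + c + (k + 1 : ℕ)) m,
        poch_succ' q (a + b + c + k) m,
        show a + b + c + (k : ℤ) + 1 = a + b + c + (k + 1 : ℕ) by push_cast; ring]
      have f1 : fac q ((k : ℤ) + m + 1) ≠ 0 := fac_ne_zero hq (by omega)
      have f2 : fac q (k : ℤ) ≠ 0 := fac_ne_zero hq (by omega)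
      have f3 : fac q (m : ℤ) ≠ 0 := fac_ne_zero hq (by omega)
      have g1 : qi q ((k : ℤ) + 1) ≠ 0 := qi_ne_zero hq (by omega)
      have g2 : qi q ((m : ℤ) + 1) ≠ 0 := qi_ne_zero hq (by omega)
      have key := qi_mul_qi_of hq (a := (k : ℤ) + m + 1 + 1) (b := a + b + c + (k + m + 1))
        (c := m + 1) (d := a + b + c + (k + m + 1) + (k + 1))
        (e := k + 1) (f := a + b + c + k) (by ring) (by ring) (by ring)
      simp only [qbin]
      push_cast
      rw [show (k : ℤ) + m + 1 + 1 - (k + 1) = m + 1 by ring,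
        show (k : ℤ) + m + 1 - (k + 1) = m by ring, show (k : ℤ) + m + 1 - k = m + 1 by ring,
        show a + b + c + ((k : ℤ) + 1) + m = a + b + c + (k + m + 1) by ring,
        fac_succ (n := (k : ℤ) + m + 1) (by omega), fac_succ (n := (k : ℤ)) (by omega),
        fac_succ (n := (m : ℤ)) (by omega)]
      field_simp
      linear_combination (
        poch q a (k + 1) * poch q b (k + 1) * poch q (a + b + c + ((k : ℤ) + 1)) m *
        poch q c (m + 1)) * key
    rw [sum_congr rfl hmid, sum_add_distrib, hend, h0]
    simp only [Nat.cast_zero, add_zero, Nat.sub_zero, Nat.sub_self, poch_zero, Nat.cast_add,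
      Nat.cast_one, poch_succ q (a + b + c) n]
    ring

end qi
end QRecoupling

/-! ### The Sears transformation -/

namespace QRecoupling
open Finset
section
variable {q : ℝ}

theorem sum_range_triangle (n : ℕ) (f : ℕ → ℕ → ℝ) :
    ∑ k ∈ range (n + 1), ∑ i ∈ range (k + 1), f k i =
      ∑ i ∈ range (n + 1), ∑ m ∈ range (n - i + 1), f (i + m) i := by
  rw [sum_comm' (t' := range (n + 1)) (s' := fun i => Ico i (n + 1))]
  · refine sum_congr rfl fun i hi => ?_
    rw [mem_range] at hi
    rw [sum_Ico_eq_sum_range, show n + 1 - i = n - i + 1 by omega]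
  · intro x y
    simp only [mem_range, mem_Ico]
    omega

/-- The Saalschütz formula read from right to left, with a free parameter d that is chosen later as
a denominator parameter. -/
theorem poch_mul_poch_expand (hq : 0 < q) (k : ℕ) (b c d : ℤ) :
    poch q b k * poch q c k = ∑ i ∈ range (k + 1), qbin q k i * poch q (d - b) i *
      poch q (d - c) i * poch q (d + i) (k - i) * poch q (b + c - d) (k - i) := by
  have := saalschuetz hq k (d - b) (d - c) (b + c - d)
  rw [show d - c + (b + c - d) = b by ring, show d - b + (b + c - d) = c by ring] at this
  rw [← this]
  refine sum_congr rfl fun i _ => ?_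
  rw [show d - b + (d - c) + (b + c - d) + (i : ℤ) = d + i by ring]

/-- The Sears transformation of terminating balanced `₄φ₃` series, free of denominators. -/
theorem sears (hq : 0 < q) (n : ℕ) {a b c d e f : ℤ} (h : d + e + f = a + b + c - n + 1) :
    ∑ k ∈ range (n + 1), (-1) ^ k * qbin q n k * poch q a k * poch q b k * poch q c k *
        poch q (d + k) (n - k) * poch q (e + k) (n - k) * poch q (f + k) (n - k) =
      ∑ k ∈ range (n + 1), (-1) ^ k * qbin q n k * poch q a k * poch q (d - b) k *
        poch q (d - c) k * poch q (d + k) (n - k) * poch q (e - a) (n - k) *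
        poch q (f - a) (n - k) := by
  -- After this expansion d - b and d - c carry only the inner index i; once the sums are
  -- interchanged, the sum over k - i is again of Saalschütz type.
  have h1 : ∀ k ∈ range (n + 1), (-1) ^ k * qbin q n k * poch q a k * poch q b k * poch q c k *
        poch q (d + k) (n - k) * poch q (e + k) (n - k) * poch q (f + k) (n - k) =
      ∑ i ∈ range (k + 1), (-1) ^ k * (qbin q n k * qbin q k i) * poch q a k *
        poch q (d - b) i * poch q (d - c) i * (poch q (d + i) (k - i) * poch q (d + k) (n - k)) *
        poch q (b + c - d) (k - i) * poch q (e + k) (n - k) * poch q (f + k) (n - k) := by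
    intro k _
    rw [show (-1) ^ k * qbin q n k * poch q a k * poch q b k * poch q c k *
        poch q (d + k) (n - k) * poch q (e + k) (n - k) * poch q (f + k) (n - k) =
        (poch q b k * poch q c k) * ((-1) ^ k * qbin q n k * poch q a k *
        poch q (d + k) (n - k) * poch q (e + k) (n - k) * poch q (f + k) (n - k)) by ring,
      poch_mul_poch_expand hq k b c d, sum_mul]
    exact sum_congr rfl fun i _ => by ring
  rw [sum_congr rfl h1, sum_range_triangle]
  refine sum_congr rfl fun i hi => ?_
  rw [mem_range] at hi
  have h3 : poch q (1 - ((n - i : ℕ) : ℤ) - (f - a)) (n - i) =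
      (-1) ^ (n - i) * poch q (f - a) (n - i) := poch_reverse q (by ring)
  -- The balancing condition enters here: it makes the second factor of the Saalschütz product a
  -- reversed (f - a)_{n-i}.
  have hs2 := saalschuetz hq (n - i) (a + i) (b + c - d) (e - a - (b + c - d))
  rw [show b + c - d + (e - a - (b + c - d)) = e - a by ring,
    show a + i + (e - a - (b + c - d)) = 1 - ((n - i : ℕ) : ℤ) - (f - a) by omega, h3] at hs2
  calc _ = (-1) ^ i * qbin q n i * poch q a i * poch q (d - b) i * poch q (d - c) i *
        poch q (d + i) (n - i) * (-1) ^ (n - i) *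
        ∑ m ∈ range (n - i + 1), qbin q (n - i) m * poch q (a + i) m * poch q (b + c - d) m *
          poch q (a + i + (b + c - d) + (e - a - (b + c - d)) + m) (n - i - m) *
          poch q (e - a - (b + c - d)) (n - i - m) := by
        rw [mul_sum]
        refine sum_congr rfl fun m hm => ?_
        rw [mem_range] at hm
        rw [qbin_mul_qbin hq n (i + m) i (by omega) (by omega), Nat.add_sub_cancel_left,
          poch_mul_of q (a := d + i) (b := d + (i + m : ℕ)) (l := n - i)
            (by push_cast; ring) (by omega),
          ← poch_mul q a i m, show n - (i + m) = n - i - m by omega,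
          show a + i + (b + c - d) + (e - a - (b + c - d)) + (m : ℤ) = e + (i + m : ℕ) by
            push_cast; ring,
          poch_reverse q (a := f + (i + m : ℕ)) (b := e - a - (b + c - d)) (n := n - i - m)
            (by push_cast; omega),
          show n - i = m + (n - i - m) by omega, pow_add (-1) m, pow_add (-1) i m]
        rw [show m + (n - i - m) - m = n - i - m by omega]
        ring
    _ = _ := by
        rw [hs2]
        have : ((-1 : ℝ)) ^ (n - i) * (-1) ^ (n - i) = 1 := by
          rw [← mul_pow]; simp
        linear_combination ((-1) ^ i * qbin q n i * poch q a i * poch q (d - b) i *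
          poch q (d - c) i * poch q (d + i) (n - i) * poch q (e - a) (n - i) *
          poch q (f - a) (n - i)) * this

end
end QRecoupling

/-! ### Sums of 6j type and Racah's symmetric form -/

namespace QRecoupling
open Finset
section
variable {q : ℝ}

theorem sum_range_eq_finsum {f : ℤ → ℝ} {n : ℤ} (h : ∀ z, f z ≠ 0 → 0 ≤ z ∧ z ≤ n) :
    ∑ z ∈ range (n.toNat + 1), f z = ∑ᶠ z, f z := by
  rw [finsum_eq_sum_of_support_subset (s := (range (n.toNat + 1)).map Nat.castEmbedding)]
  · simp
  · intro z hz
    obtain ⟨h1, h2⟩ := h z hz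
    simp only [coe_map, Set.mem_image, mem_coe, mem_range, Nat.castEmbedding_apply]
    exact ⟨z.toNat, by omega, by omega⟩

theorem finsum_shift (f : ℤ → ℝ) (c : ℤ) : ∑ᶠ z, f (z + c) = ∑ᶠ z, f z :=
  finsum_comp_equiv (Equiv.addRight c)

/-- The general term of the sums in the definition of the `q`-`6j` coefficients. -/
noncomputable def dTerm (q : ℝ) (u₁ u₂ u₃ v₁ v₂ v₃ v₄ z : ℤ) : ℝ :=
  (-1) ^ z * fac q (u₁ + z) * fac q (u₂ + z) * fac q (u₃ - z) /
    (fac q z * fac q (v₁ - z) * fac q (v₂ - z) * fac q (v₃ + z) * fac q (v₄ + z))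

/-- The sum in the definition of the `q`-`6j` coefficients. -/
noncomputable def dSum (q : ℝ) (u₁ u₂ u₃ v₁ v₂ v₃ v₄ : ℤ) : ℝ :=
  ∑ z ∈ range (v₁.toNat + 1), dTerm q u₁ u₂ u₃ v₁ v₂ v₃ v₄ z

/-- The general term of the symmetric Racah form of the `q`-`6j` coefficients. -/
noncomputable def rTerm (q : ℝ) (t p₁ p₂ p₃ p₄ s₁ s₂ z : ℤ) : ℝ :=
  (-1) ^ z * fac q (t - z) / (fac q z * fac q (p₁ - z) * fac q (p₂ - z) * fac q (p₃ - z) *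
    fac q (p₄ - z) * fac q (s₁ + z) * fac q (s₂ + z))

/-- Because factorials of negative integers are 0, a nonzero summand carries all its range
conditions with it. Supports of sums are later compared by extracting these inequalities. -/
theorem dTerm_ne_zero {u₁ u₂ u₃ v₁ v₂ v₃ v₄ z : ℤ} (h : dTerm q u₁ u₂ u₃ v₁ v₂ v₃ v₄ z ≠ 0) :
    0 ≤ u₁ + z ∧ 0 ≤ u₂ + z ∧ z ≤ u₃ ∧ 0 ≤ z ∧ z ≤ v₁ ∧ z ≤ v₂ ∧ 0 ≤ v₃ + z ∧ 0 ≤ v₄ + z := by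
  refine ⟨?_, ?_, ?_, ?_, ?_, ?_, ?_, ?_⟩ <;> by_contra hn <;> apply h <;> unfold dTerm
  · rw [fac_of_neg q (n := u₁ + z) (by omega)]; simp
  · rw [fac_of_neg q (n := u₂ + z) (by omega)]; simp
  · rw [fac_of_neg q (n := u₃ - z) (by omega)]; simp
  · rw [fac_of_neg q (n := z) (by omega)]; simp
  · rw [fac_of_neg q (n := v₁ - z) (by omega)]; simp
  · rw [fac_of_neg q (n := v₂ - z) (by omega)]; simp
  · rw [fac_of_neg q (n := v₃ + z) (by omega)]; simp
  · rw [fac_of_neg q (n := v₄ + z) (by omega)]; simp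

theorem exists_dTerm_ne_zero {u₁ u₂ u₃ v₁ v₂ v₃ v₄ : ℤ} (h : dSum q u₁ u₂ u₃ v₁ v₂ v₃ v₄ ≠ 0) :
    ∃ y : ℕ, dTerm q u₁ u₂ u₃ v₁ v₂ v₃ v₄ y ≠ 0 := by
  by_contra! hn
  exact h (sum_eq_zero fun y _ => hn y)

theorem rTerm_ne_zero {t p₁ p₂ p₃ p₄ s₁ s₂ z : ℤ} (h : rTerm q t p₁ p₂ p₃ p₄ s₁ s₂ z ≠ 0) :
    0 ≤ z ∧ z ≤ p₁ ∧ z ≤ p₂ ∧ z ≤ p₃ ∧ z ≤ p₄ ∧ 0 ≤ s₁ + z ∧ 0 ≤ s₂ + z := by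
  refine ⟨?_, ?_, ?_, ?_, ?_, ?_, ?_⟩ <;> by_contra hn <;> apply h <;> unfold rTerm
  · rw [fac_of_neg q (n := z) (by omega)]; simp
  · rw [fac_of_neg q (n := p₁ - z) (by omega)]; simp
  · rw [fac_of_neg q (n := p₂ - z) (by omega)]; simp
  · rw [fac_of_neg q (n := p₃ - z) (by omega)]; simp
  · rw [fac_of_neg q (n := p₄ - z) (by omega)]; simp
  · rw [fac_of_neg q (n := s₁ + z) (by omega)]; simp
  · rw [fac_of_neg q (n := s₂ + z) (by omega)]; simp

theorem dSum_eq_finsum (u₁ u₂ u₃ v₁ v₂ v₃ v₄ : ℤ) :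
    dSum q u₁ u₂ u₃ v₁ v₂ v₃ v₄ = ∑ᶠ z, dTerm q u₁ u₂ u₃ v₁ v₂ v₃ v₄ z :=
  sum_range_eq_finsum fun z hz => by have := dTerm_ne_zero hz; omega

theorem neg_one_pow_mul_self (n : ℕ) : (-1 : ℝ) ^ n * (-1) ^ n = 1 := by
  rw [← mul_pow]; simp

/-- Identifies the 6j summand with the left side of the Sears formula for a = -v₂, b = u₁+1, c =
u₂+1, d = v₃+1, e = -u₃, f = v₄+1, up to a factor free of k. Here v₃ itself may be negative. -/
theorem sears_term_eq_dTerm (hq : 0 < q) {n k : ℕ} (hk : k ≤ n) {u₁ u₂ u₃ v₂ v₃ v₄ : ℤ}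
    (hu₁ : 0 ≤ u₁) (hu₂ : 0 ≤ u₂) (hv₂ : 0 ≤ v₂) (hv₄ : 0 ≤ v₄) (hu₃ : n ≤ u₃) (hv₃ : 0 ≤ v₃ + n) :
    (-1) ^ k * qbin q n k * poch q (-v₂) k * poch q (u₁ + 1) k * poch q (u₂ + 1) k *
      poch q (v₃ + 1 + k) (n - k) * poch q (-u₃ + k) (n - k) * poch q (v₄ + 1 + k) (n - k) =
    (-1) ^ n * (fac q n * fac q v₂ * fac q (v₃ + n) * fac q (v₄ + n) /
      (fac q u₁ * fac q u₂ * fac q (u₃ - n))) * dTerm q u₁ u₂ u₃ n v₂ v₃ v₄ k := by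
  rw [poch_neg_eq_fac hq (u := v₂) rfl hv₂,
    poch_eq_fac hq (b := u₁) (c := u₁ + k) (by ring) rfl (by omega),
    poch_eq_fac hq (b := u₂) (c := u₂ + k) (by ring) rfl (by omega),
    poch_eq_fac hq (a := v₃ + 1 + k) (b := v₃ + k) (c := v₃ + n) (by ring) (by omega) hv₃,
    poch_eq_fac hq (a := v₄ + 1 + k) (b := v₄ + k) (c := v₄ + n) (by ring) (by omega) (by omega),
    poch_neg_eq_fac hq (u := u₃ - k) (by ring) (by omega),
    show u₃ - (k : ℤ) - ((n - k : ℕ) : ℤ) = u₃ - n by omega]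
  have : ((-1 : ℝ)) ^ n = (-1) ^ (n - k) * (-1) ^ k := by rw [← pow_add]; congr 1; omega
  rw [this]
  unfold dTerm qbin
  rw [zpow_natCast]
  simp only [div_eq_mul_inv, mul_inv]
  ring

/-- The transformation of the sum of a `q`-`6j` coefficient into the symmetric Racah form. -/
theorem dSum_eq_racah (hq : 0 < q) {u₁ u₂ u₃ v₁ v₂ v₃ v₄ : ℤ}
    (hu₁ : 0 ≤ u₁) (hu₂ : 0 ≤ u₂) (hv₁ : 0 ≤ v₁) (hv₂ : 0 ≤ v₂) (hv₄ : 0 ≤ v₄)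
    (h31 : v₁ ≤ u₃) (h32 : v₂ ≤ u₃) (h13 : v₃ ≤ u₁) (h23 : v₃ ≤ u₂)
    (hb : u₁ + u₂ + u₃ + 1 = v₁ + v₂ + v₃ + v₄) :
    dSum q u₁ u₂ u₃ v₁ v₂ v₃ v₄ * (fac q (v₁ + v₄) * fac q (v₂ + v₄)) =
      fac q u₁ * fac q u₂ * fac q (u₃ - v₁) * fac q (u₃ - v₂) * fac q (u₁ - v₃) * fac q (u₂ - v₃) *
        ∑ᶠ z, rTerm q (v₁ + v₂ + v₄) v₁ v₂ (u₁ - v₃) (u₂ - v₃) v₃ (u₃ - v₁ - v₂) z := by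
  rw [← sum_range_eq_finsum (n := v₁) fun z hz => by have := rTerm_ne_zero hz; omega]
  lift v₁ to ℕ using hv₁ with n
  unfold dSum
  rw [Int.toNat_natCast]
  -- If v₃ + v₁ < 0, no z satisfies -v₃ ≤ z ≤ v₁, and both sums vanish.
  rcases lt_or_ge (v₃ + n) 0 with h | h
  · rw [sum_eq_zero, sum_eq_zero]
    · simp
    · intro k hk
      rw [mem_range] at hk
      by_contra h0
      have := rTerm_ne_zero h0
      omega
    · intro k hk
      rw [mem_range] at hk
      by_contra h0
      have := dTerm_ne_zero h0
      omega
  have key := sears hq n (a := -v₂) (b := u₁ + 1) (c := u₂ + 1) (d := v₃ + 1) (e := -u₃)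
    (f := v₄ + 1) (by omega)
  rw [sum_congr rfl fun k hk => sears_term_eq_dTerm hq (by rw [mem_range] at hk; omega) hu₁ hu₂
    hv₂ hv₄ h31 h, ← mul_sum] at key
  have h2 : ∀ k ∈ range (n + 1), (-1) ^ k * qbin q n k * poch q (-v₂) k *
      poch q (v₃ + 1 - (u₁ + 1)) k * poch q (v₃ + 1 - (u₂ + 1)) k * poch q (v₃ + 1 + k) (n - k) *
      poch q (-u₃ - -v₂) (n - k) * poch q (v₄ + 1 - -v₂) (n - k) =
      (-1) ^ n * (fac q n * fac q v₂ * fac q (u₁ - v₃) * fac q (u₂ - v₃) * fac q (v₃ + n) *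
        fac q (u₃ - v₂) / fac q (v₂ + v₄)) *
        rTerm q (n + v₂ + v₄) n v₂ (u₁ - v₃) (u₂ - v₃) v₃ (u₃ - n - v₂) k := by
    intro k hk
    rw [mem_range] at hk
    rw [poch_neg_eq_fac hq (u := v₂) rfl hv₂,
      poch_neg_eq_fac hq (u := u₁ - v₃) (by ring) (by omega),
      poch_neg_eq_fac hq (u := u₂ - v₃) (by ring) (by omega),
      poch_eq_fac hq (b := v₃ + k) (c := v₃ + n) (by ring) (by omega) h,
      poch_neg_eq_fac hq (u := u₃ - v₂) (by ring) (by omega),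
      poch_eq_fac hq (b := v₂ + v₄) (c := n + v₂ + v₄ - k) (by ring) (by omega) (by omega),
      show u₃ - v₂ - ((n - k : ℕ) : ℤ) = u₃ - n - v₂ + k by omega]
    have : ((-1 : ℝ)) ^ n = (-1) ^ (n - k) * (-1) ^ k := by rw [← pow_add]; congr 1; omega
    rw [this]
    unfold rTerm qbin
    rw [zpow_natCast]
    simp only [div_eq_mul_inv, mul_inv]
    linear_combination ((-1 : ℝ) ^ k * (-1) ^ k * (-1) ^ (n - k) * fac q n * (fac q k)⁻¹ *
      (fac q (n - k))⁻¹ * fac q v₂ * (fac q (v₂ - k))⁻¹ * fac q (u₁ - v₃) *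
      (fac q (u₁ - v₃ - k))⁻¹ * fac q (u₂ - v₃) * (fac q (u₂ - v₃ - k))⁻¹ * fac q (v₃ + n) *
      (fac q (v₃ + k))⁻¹ * fac q (u₃ - v₂) * (fac q (u₃ - n - v₂ + k))⁻¹ *
      fac q (n + v₂ + v₄ - k) * (fac q (v₂ + v₄))⁻¹) * neg_one_pow_mul_self k
  rw [sum_congr rfl h2, ← mul_sum] at key
  have f1 := fac_ne_zero hq hu₁
  have f2 := fac_ne_zero hq hu₂
  have f3 := fac_ne_zero hq (show 0 ≤ u₃ - n by omega)
  have f4 := fac_ne_zero hq (show 0 ≤ (n : ℤ) by omega)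
  have f5 := fac_ne_zero hq hv₂
  have f6 := fac_ne_zero hq h
  have f7 := fac_ne_zero hq (show 0 ≤ v₂ + v₄ by omega)
  have f8 : (-1 : ℝ) ^ n ≠ 0 := by simp
  field_simp at key
  rw [add_comm (n : ℤ) v₄]
  linear_combination key

/-- A vanishing condition: outside the triangular region the sums of `q`-`6j` type vanish. -/
theorem dSum_eq_zero (hq : 0 < q) {u₁ u₂ u₃ v₁ v₂ v₃ v₄ : ℤ}
    (hu₂ : 0 ≤ u₂) (hv₁ : 0 ≤ v₁) (hv₂ : 0 ≤ v₂) (hv₄ : 0 ≤ v₄)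
    (h31 : v₁ ≤ u₃) (h32 : v₂ ≤ u₃) (h23 : v₃ ≤ u₂)
    (hb : u₁ + u₂ + u₃ + 1 = v₁ + v₂ + v₃ + v₄) (h : v₄ ≤ u₁) :
    dSum q u₁ u₂ u₃ v₁ v₂ v₃ v₄ = 0 := by
  lift v₁ to ℕ using hv₁ with n
  unfold dSum
  rw [Int.toNat_natCast]
  rcases lt_or_ge (v₃ + n) 0 with h3 | h3
  · refine sum_eq_zero fun k hk => ?_
    rw [mem_range] at hk
    by_contra h0
    have := dTerm_ne_zero h0
    omega
  -- Compared with `dSum_eq_racah`, v₃ and v₄ exchange their roles, so that d - b = v₄ - u₁ is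
  -- nonpositive.
  have key := sears hq n (a := -v₂) (b := u₁ + 1) (c := u₂ + 1) (d := v₄ + 1) (e := -u₃)
    (f := v₃ + 1) (by omega)
  rw [sum_eq_zero (f := fun k => (-1) ^ k * qbin q n k * poch q (-v₂) k *
    poch q (v₄ + 1 - (u₁ + 1)) k * poch q (v₄ + 1 - (u₂ + 1)) k * poch q (v₄ + 1 + k) (n - k) *
    poch q (-u₃ - -v₂) (n - k) * poch q (v₃ + 1 - -v₂) (n - k))] at key
  · have h2 : ∀ k ∈ range (n + 1), (-1) ^ k * qbin q n k * poch q (-v₂) k * poch q (u₁ + 1) k *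
        poch q (u₂ + 1) k * poch q (v₄ + 1 + k) (n - k) * poch q (-u₃ + k) (n - k) *
        poch q (v₃ + 1 + k) (n - k) =
        (-1) ^ n * (fac q n * fac q v₂ * fac q (v₃ + n) * fac q (v₄ + n) /
          (fac q u₁ * fac q u₂ * fac q (u₃ - n))) * dTerm q u₁ u₂ u₃ n v₂ v₃ v₄ k := by
      intro k hk
      rw [mem_range] at hk
      rw [← sears_term_eq_dTerm hq (by omega) (by omega) hu₂ hv₂ hv₄ h31 h3]
      ring
    rw [sum_congr rfl h2, ← mul_sum] at key
    have f1 := fac_ne_zero hq (show 0 ≤ u₁ by omega)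
    have f2 := fac_ne_zero hq hu₂
    have f3 := fac_ne_zero hq (show 0 ≤ u₃ - n by omega)
    have f4 := fac_ne_zero hq (show 0 ≤ (n : ℤ) by omega)
    have f5 := fac_ne_zero hq hv₂
    have f6 := fac_ne_zero hq h3
    have f7 := fac_ne_zero hq (show 0 ≤ v₄ + n by omega)
    have f8 : (-1 : ℝ) ^ n ≠ 0 := by simp
    refine (mul_eq_zero.1 key).resolve_left ?_
    positivity
  · intro k hk
    rw [mem_range] at hk
    -- Every transformed term has a zero factor: (v₄-u₁)_k if k > u₁-v₄; otherwise (v₂-u₃)_{n-k},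
    -- since the balance and v₃ ≤ u₂ force n-k > u₃-v₂.
    rcases le_or_gt (k : ℤ) (u₁ - v₄) with h1 | h1
    · rw [poch_neg_eq_fac hq (a := -u₃ - -v₂) (u := u₃ - v₂) (by ring) (by omega),
        fac_of_neg q (n := u₃ - v₂ - ((n - k : ℕ) : ℤ)) (by omega)]
      simp
    · rw [poch_neg_eq_fac hq (a := v₄ + 1 - (u₁ + 1)) (u := u₁ - v₄) (by ring) (by omega),
        fac_of_neg q (n := u₁ - v₄ - k) (by omega)]
      simp

/-- The `q`-Pfaff–Saalschütz formula in terms of `q`-factorials. -/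
theorem saalschuetz_fac (hq : 0 < q) (n : ℕ) {α ε δ m : ℤ} (hα : 0 ≤ α) (hε : n ≤ ε)
    (hδ : α < δ) (hb : δ - ε = α - m - n + 1) :
    ∑ k ∈ range (n + 1), (-1) ^ k * fac q (α + k) * fac q (ε - k) /
      (fac q k * fac q (n - k) * fac q (m - k) * fac q (δ + k)) =
    fac q α * fac q (ε - n) * fac q (δ - α + n - 1) * fac q (δ + m + n) /
      (fac q n * fac q m * fac q (δ + n) * fac q (δ - α - 1) * fac q (δ + m)) := by
  rcases lt_or_ge m 0 with hm | hm
  · rw [fac_of_neg q hm, sum_eq_zero]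
    · simp
    · intro k _
      rw [fac_of_neg q (n := m - k) (by omega)]
      simp
  -- By the balance `hb` the last Pochhammer symbol (δ-α+m)_{n-k} is [ε-k]!/[ε-n]!.
  have key := saalschuetz hq n (α + 1) (-m) (δ - α + m)
  rw [show -m + (δ - α + m) = δ - α by ring, show α + 1 + (δ - α + m) = δ + m + 1 by ring,
    poch_eq_fac hq (a := δ - α) (b := δ - α - 1) (c := δ - α + n - 1) rfl (by ring) (by omega),
    poch_eq_fac hq (a := δ + m + 1) (b := δ + m) (c := δ + m + n) (by ring) rfl (by omega)] at key
  have h2 : ∀ k ∈ range (n + 1), qbin q n k * poch q (α + 1) k * poch q (-m) k *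
      poch q (α + 1 + -m + (δ - α + m) + k) (n - k) * poch q (δ - α + m) (n - k) =
      (fac q n * fac q m * fac q (δ + n) / (fac q α * fac q (ε - n))) *
      ((-1) ^ k * fac q (α + k) * fac q (ε - k) /
      (fac q k * fac q (n - k) * fac q (m - k) * fac q (δ + k))) := by
    intro k hk
    rw [mem_range] at hk
    rw [poch_eq_fac hq (b := α) (c := α + k) (by ring) rfl (by omega),
      poch_neg_eq_fac hq (u := m) rfl hm,
      poch_eq_fac hq (b := δ + k) (c := δ + n) (by ring) (by omega) (by omega),
      poch_eq_fac hq (a := δ - α + m) (b := ε - n) (c := ε - k) (by omega) (by omega) (by omega)]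
    unfold qbin
    simp only [div_eq_mul_inv, mul_inv]
    ring
  rw [sum_congr rfl h2, ← mul_sum] at key
  have f1 := fac_ne_zero hq hα
  have f2 := fac_ne_zero hq (show 0 ≤ ε - n by omega)
  have f3 := fac_ne_zero hq (show 0 ≤ (n : ℤ) by omega)
  have f4 := fac_ne_zero hq hm
  have f5 := fac_ne_zero hq (show 0 ≤ δ + n by omega)
  have f6 := fac_ne_zero hq (show 0 ≤ δ - α - 1 by omega)
  have f7 := fac_ne_zero hq (show 0 ≤ δ + m by omega)
  rw [div_mul_eq_mul_div, div_eq_iff (by positivity)] at key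
  rw [eq_div_iff (by positivity)]
  field_simp at key
  linear_combination key

end
end QRecoupling

/-! ### Divided differences on the lattice ν -/

namespace QRecoupling
open Finset Polynomial Lagrange
section
variable {q : ℝ}

/-- The lattice `ν(i) = [i][i + σ]`. -/
noncomputable def nu (q : ℝ) (σ i : ℤ) : ℝ := qi q i * qi q (i + σ)

/-- The quadratic relation with c = i+j+σ. Two lattice points have the same ν only if they are equal
or reflections of each other under i ↦ -σ-i. -/
theorem nu_sub_nu (hq : 0 < q) (σ i j : ℤ) : nu q σ i - nu q σ j = qi q (i - j) * qi q (i + j + σ) := by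
  have := qi_mul_qi_of hq (a := i) (b := i + σ) (c := j) (d := 2 * i + σ - j) (e := i - j)
    (f := i + σ - j) (by ring) (by ring) (by ring)
  have h2 := qi_mul_qi_of hq (a := i) (b := i + σ) (c := -j) (d := 2 * i + σ + j) (e := i + j)
    (f := i + σ + j) (by ring) (by ring) (by ring)
  have h3 := qi_mul_qi_of hq (a := i) (b := i + σ) (c := i + j + σ) (d := i - j) (e := -(j + σ))
    (f := -j) (by ring) (by ring) (by ring)
  rw [qi_neg, qi_neg] at h3
  unfold nu
  linear_combination h3

/-- The divided difference of a polynomial over a set of (possibly coinciding) nodes. -/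
noncomputable def divDiff {ι : Type*} (s : Finset ι) (v : ι → ℝ) (P : ℝ[X]) : ℝ :=
  (P %ₘ nodal s v).coeff (#s - 1)

section divDiff
variable {ι : Type*} {s t : Finset ι} {v : ι → ℝ}

theorem divDiff_empty (v : ι → ℝ) (P : ℝ[X]) : divDiff ∅ v P = 0 := by
  simp [divDiff]

theorem divDiff_add (P Q : ℝ[X]) : divDiff s v (P + Q) = divDiff s v P + divDiff s v Q := by
  simp [divDiff, add_modByMonic]

theorem divDiff_smul (c : ℝ) (P : ℝ[X]) : divDiff s v (c • P) = c * divDiff s v P := by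
  simp [divDiff, smul_modByMonic]

theorem divDiff_sum {κ : Type*} (u : Finset κ) (P : κ → ℝ[X]) :
    divDiff s v (∑ k ∈ u, P k) = ∑ k ∈ u, divDiff s v (P k) := by
  classical
  induction u using Finset.induction_on with
  | empty => simp [divDiff]
  | insert a u ha ih => rw [sum_insert ha, sum_insert ha, divDiff_add, ih]

theorem mul_modByMonic_mul {R P Q : ℝ[X]} (hR : R.Monic) (hQ : Q.Monic) :
    (R * P) %ₘ (R * Q) = R * (P %ₘ Q) := by
  refine (div_modByMonic_unique (P /ₘ Q) (R * (P %ₘ Q)) (hR.mul hQ) ⟨?_, ?_⟩).2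
  · rw [mul_assoc, ← mul_add, modByMonic_add_div]
  · rw [degree_mul, degree_mul]
    have h1 := degree_modByMonic_lt P hQ
    have h2 : R.degree ≠ ⊥ := by simpa [degree_eq_bot] using hR.ne_zero
    exact WithBot.add_lt_add_left h2 h1

/-- A common factor of the polynomial and the modulus passes through the remainder; being monic, it
does not change the top coefficient. No distinctness of nodes is required, which is the reason for
defining `divDiff` through remainders. -/
theorem divDiff_nodal_mul [DecidableEq ι] (hst : Disjoint s t) (P : ℝ[X]) :
    divDiff (s ∪ t) v (nodal t v * P) = divDiff s v P := by
  have hn : nodal (s ∪ t) v = nodal t v * nodal s v := by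
    simp only [nodal]; rw [prod_union hst, mul_comm]
  unfold divDiff
  rw [hn, mul_modByMonic_mul nodal_monic nodal_monic]
  rcases s.eq_empty_or_nonempty with rfl | hs
  · simp
  · have hc : 0 < #s := card_pos.2 hs
    have hd : (P %ₘ nodal s v).natDegree ≤ #s - 1 := by
      have := degree_modByMonic_lt P (nodal_monic (s := s) (v := v))
      rw [degree_nodal] at this
      by_cases h0 : P %ₘ nodal s v = 0
      · simp [h0]
      · have := (natDegree_lt_iff_degree_lt h0).2 ‹_›
        omega
    rw [card_union_of_disjoint hst, show #s + #t - 1 = #t + (#s - 1) by omega,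
      coeff_mul_add_eq_of_natDegree_le (by rw [natDegree_nodal]) hd]
    have : (nodal t v).coeff #t = 1 := by
      have := nodal_monic (s := t) (v := v)
      rwa [Monic, leadingCoeff, natDegree_nodal] at this
    rw [this, one_mul]

theorem eval_modByMonic_nodal (P : ℝ[X]) {i : ι} (hi : i ∈ s) :
    (P %ₘ nodal s v).eval (v i) = P.eval (v i) := by
  conv_rhs => rw [← modByMonic_add_div P (nodal s v)]
  simp [eval_nodal_at_node hi]

/-- For distinct nodes the remainder is the Lagrange interpolant, and its top coefficient is the
classical sum. -/
theorem divDiff_eq_sum [DecidableEq ι] (hv : Set.InjOn v s) (P : ℝ[X]) :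
    divDiff s v P = ∑ x ∈ s, P.eval (v x) / ∏ y ∈ s.erase x, (v x - v y) := by
  rcases s.eq_empty_or_nonempty with rfl | hs
  · simp [divDiff]
  unfold divDiff
  rw [coeff_eq_sum (v := v) hv]
  · exact sum_congr rfl fun x hx => by rw [eval_modByMonic_nodal P hx]
  · have := degree_modByMonic_lt P (nodal_monic (s := s) (v := v))
    rwa [degree_nodal] at this

/-- Such a polynomial is its own remainder. In particular the value is 0 if the degree is below #s -
1. -/
theorem divDiff_of_natDegree_lt {P : ℝ[X]} (h : P.natDegree < #s) :
    divDiff s v P = P.coeff (#s - 1) := by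
  unfold divDiff
  rw [(modByMonic_eq_self_iff nodal_monic).2]
  rw [degree_nodal]
  exact lt_of_le_of_lt degree_le_natDegree (by exact_mod_cast h)

end divDiff

theorem nu_injOn (hq : 0 < q) {σ : ℤ} {s : Set ℤ}
    (h : ∀ x ∈ s, ∀ y ∈ s, x ≠ y → x + y + σ ≠ 0) : Set.InjOn (nu q σ) s := by
  intro x hx y hy hxy
  by_contra hne
  have := nu_sub_nu hq σ x y
  rw [hxy, sub_self] at this
  exact mul_ne_zero (qi_ne_zero hq (by omega)) (qi_ne_zero hq (h x hx y hy hne)) this.symm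

theorem prod_nu_sub_above (hq : 0 < q) (σ x : ℤ) (hx : 0 ≤ 2 * x + σ) (n : ℕ) :
    (∏ y ∈ Ioc x (x + n), (nu q σ x - nu q σ y)) * fac q (2 * x + σ) =
      (-1) ^ n * fac q n * fac q (2 * x + σ + n) := by
  induction n with
  | zero => simp [fac_zero]
  | succ n ih =>
    have : Ioc x (x + (n + 1 : ℕ)) = insert (x + (n + 1 : ℕ)) (Ioc x (x + n)) := by
      ext y; simp only [mem_Ioc, mem_insert]; omega
    rw [this, prod_insert (by simp), mul_assoc, ih, nu_sub_nu hq,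
      show x - (x + ((n + 1 : ℕ) : ℤ)) = -((n : ℤ) + 1) by push_cast; ring, qi_neg,
      show x + (x + ((n + 1 : ℕ) : ℤ)) + σ = 2 * x + σ + n + 1 by push_cast; ring]
    push_cast
    rw [fac_succ (n := (n : ℤ)) (by omega), ← add_assoc,
      fac_succ (n := 2 * x + σ + (n : ℤ)) (by omega)]
    ring

theorem prod_nu_sub_below (hq : 0 < q) (σ x : ℤ) (n : ℕ) (hx : 0 ≤ 2 * x + σ - 1 - n) :
    (∏ y ∈ Ico (x - n) x, (nu q σ x - nu q σ y)) * fac q (2 * x + σ - 1 - n) =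
      fac q n * fac q (2 * x + σ - 1) := by
  induction n with
  | zero => simp [fac_zero]
  | succ n ih =>
    have : Ico (x - (n + 1 : ℕ)) x = insert (x - (n + 1 : ℕ)) (Ico (x - n) x) := by
      ext y; simp only [mem_Ico, mem_insert]; omega
    have ih := ih (by omega)
    rw [fac_eq_mul (n := 2 * x + σ - 1 - n) (m := 2 * x + σ - 1 - (n + 1 : ℕ)) (by omega)
      (by push_cast; ring)] at ih
    rw [this, prod_insert (by simp only [mem_Ico]; push_cast; omega), nu_sub_nu hq,
      show x - (x - ((n + 1 : ℕ) : ℤ)) = (n : ℤ) + 1 by push_cast; ring,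
      show x + (x - ((n + 1 : ℕ) : ℤ)) + σ = 2 * x + σ - 1 - n by push_cast; ring]
    rw [show (((n + 1 : ℕ) : ℤ)) = (n : ℤ) + 1 by push_cast; ring] at *
    rw [fac_succ (n := (n : ℤ)) (by omega)]
    linear_combination qi q ((n : ℤ) + 1) * ih

/-- The weights of the divided differences over the lattice `ν`. -/
theorem prod_nu_sub_erase (hq : 0 < q) {σ B J x : ℤ} (hB : B ≤ x) (hJ : x ≤ J)
    (h : 0 ≤ x + B + σ - 1) :
    (∏ y ∈ (Icc B J).erase x, (nu q σ x - nu q σ y))⁻¹ =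
      (-1) ^ (J - x) * qi q (2 * x + σ) * fac q (x + B + σ - 1) /
        (fac q (x - B) * fac q (J - x) * fac q (x + J + σ)) := by
  obtain ⟨m, rfl⟩ : ∃ m : ℕ, J = x + m := ⟨(J - x).toNat, by omega⟩
  obtain ⟨n, rfl⟩ : ∃ n : ℕ, B = x - n := ⟨(x - B).toNat, by omega⟩
  have hs : (Icc (x - n) (x + m)).erase x = Ico (x - n) x ∪ Ioc x (x + m) := by
    ext y; simp only [mem_erase, mem_Icc, mem_union, mem_Ico, mem_Ioc]; omega
  have hd : Disjoint (Ico (x - n) x) (Ioc x (x + m)) := by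
    rw [disjoint_left]; intro y; simp only [mem_Ico, mem_Ioc]; omega
  have h1 := prod_nu_sub_above hq σ x (by omega) m
  have h2 := prod_nu_sub_below hq σ x n (by omega)
  rw [fac_eq_mul (n := 2 * x + σ) (m := 2 * x + σ - 1) (by omega) rfl] at h1
  rw [hs, prod_union hd, show x + (m : ℤ) - x = m by ring, zpow_natCast,
    show x - (x - (n : ℤ)) = n by ring, show x + (x - (n : ℤ)) + σ - 1 = 2 * x + σ - 1 - n by ring,
    show x + (x + (m : ℤ)) + σ = 2 * x + σ + m by ring]
  have f1 := fac_ne_zero hq (show 0 ≤ 2 * x + σ - 1 - n by omega)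
  have f2 := fac_ne_zero hq (show 0 ≤ 2 * x + σ - 1 by omega)
  have f3 := fac_ne_zero hq (show 0 ≤ (n : ℤ) by omega)
  have f4 := fac_ne_zero hq (show 0 ≤ (m : ℤ) by omega)
  have f5 := fac_ne_zero hq (show 0 ≤ 2 * x + σ + m by omega)
  have f6 := qi_ne_zero hq (show 2 * x + σ ≠ 0 by omega)
  have e1 : (∏ y ∈ Ico (x - n) x, (nu q σ x - nu q σ y)) =
      fac q n * fac q (2 * x + σ - 1) / fac q (2 * x + σ - 1 - n) := by
    rw [eq_div_iff f1, h2]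
  have e2 : (∏ y ∈ Ioc x (x + m), (nu q σ x - nu q σ y)) =
      (-1) ^ m * fac q m * fac q (2 * x + σ + m) / (qi q (2 * x + σ) * fac q (2 * x + σ - 1)) := by
    rw [eq_div_iff (by positivity), h1]
  rw [e1, e2]
  have := neg_one_pow_mul_self m
  have f7 : (-1 : ℝ) ^ m ≠ 0 := by simp
  field_simp
  linear_combination -this

/-- A divided difference over an interval of the lattice `ν` as a weighted sum. The lattice points
in the lower part of the interval may coincide in pairs; they do not contribute if the polynomial
vanishes there with multiplicity. -/
theorem divDiff_Icc_eq_sum (hq : 0 < q) {σ B J : ℤ} (hJ : 0 ≤ J + B + σ) {P : ℝ[X]}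
    (hP : nodal (Icc B (-σ - B)) (nu q σ) ∣ P) :
    divDiff (Icc B J) (nu q σ) P =
      ∑ x ∈ Icc B J, (-1) ^ (J - x) * qi q (2 * x + σ) * fac q (x + B + σ - 1) /
        (fac q (x - B) * fac q (J - x) * fac q (x + J + σ)) * P.eval (nu q σ x) := by
  obtain ⟨R, hR⟩ := hP
  -- On s no two points are reflections of each other, so ν is injective there. The remaining points
  -- form the interval from B to -σ-B, which is mapped to itself by the reflection and whose nodal
  -- polynomial divides P.
  set s := (Icc B J).filter (fun x => 0 ≤ x + B + σ - 1) with hs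
  have hst : Disjoint s (Icc B (-σ - B)) := by
    rw [disjoint_left]; intro y; simp only [hs, mem_filter, mem_Icc]; omega
  have hun : Icc B J = s ∪ Icc B (-σ - B) := by
    ext y; simp only [hs, mem_filter, mem_Icc, mem_union]; omega
  have hinj : Set.InjOn (nu q σ) s := by
    apply nu_injOn hq
    intro x hx y hy hxy
    simp only [hs, coe_filter, mem_Icc, Set.mem_ofPred_eq] at hx hy
    omega
  conv_lhs => rw [hR, hun]
  have hite : ∀ f : ℤ → ℝ, ∑ x ∈ s, f x = ∑ x ∈ Icc B J, if 0 ≤ x + B + σ - 1 then f x else 0 :=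
    fun f => sum_filter _ _
  rw [divDiff_nodal_mul hst, divDiff_eq_sum hinj, hite]
  refine sum_congr rfl fun x hx => ?_
  rw [mem_Icc] at hx
  split_ifs with h
  · rw [← prod_nu_sub_erase hq hx.1 hx.2 h, hR, eval_mul, eval_nodal]
    have herase : (Icc B J).erase x = s.erase x ∪ Icc B (-σ - B) := by
      ext y; simp only [hs, mem_erase, mem_filter, mem_Icc, mem_union]; omega
    rw [herase, prod_union (disjoint_of_subset_left (erase_subset _ _) hst), mul_inv,
      div_eq_mul_inv]
    have hne : ∏ y ∈ Icc B (-σ - B), (nu q σ x - nu q σ y) ≠ 0 := by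
      rw [prod_ne_zero_iff]
      intro y hy
      rw [mem_Icc] at hy
      rw [nu_sub_nu hq]
      exact mul_ne_zero (qi_ne_zero hq (by omega)) (qi_ne_zero hq (by omega))
    field_simp
  -- The points outside s have weight 0, since [x+B+σ-1]! has a negative argument.
  · rw [fac_of_neg q (n := x + B + σ - 1) (by omega)]
    simp

/-- Write X - ν(K) = (X - ν(M)) + (ν(M) - ν(K)): the first part removes the node M, the second is a
scalar. -/
theorem divDiff_nodal_rec (hq : 0 < q) {σ B M C K : ℤ} (hB : B ≤ M) (hC : C < K) :
    divDiff (Icc B M) (nu q σ) (nodal (Ioc C K) (nu q σ)) =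
      divDiff (Icc B (M - 1)) (nu q σ) (nodal (Ioc C (K - 1)) (nu q σ)) +
        qi q (M - K) * qi q (M + K + σ) *
          divDiff (Icc B M) (nu q σ) (nodal (Ioc C (K - 1)) (nu q σ)) := by
  have h1 : Ioc C K = insert K (Ioc C (K - 1)) := by
    ext y; simp only [mem_Ioc, mem_insert]; omega
  have h2 : nodal (Ioc C K) (nu q σ) = nodal {M} (nu q σ) * nodal (Ioc C (K - 1)) (nu q σ) +
      (qi q (M - K) * qi q (M + K + σ)) • nodal (Ioc C (K - 1)) (nu q σ) := by
    rw [h1, nodal_insert_eq_nodal (by simp), ← nu_sub_nu hq, smul_eq_C_mul]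
    simp only [nodal, prod_singleton, C_sub]
    ring
  have h3 : Icc B M = Icc B (M - 1) ∪ {M} := by
    ext y; simp only [mem_Icc, mem_union, mem_singleton]; omega
  rw [h2, divDiff_add, divDiff_smul]
  congr 1
  conv_lhs => rw [h3]
  rw [divDiff_nodal_mul (by simp)]

theorem divDiff_one (q : ℝ) (σ B M : ℤ) :
    divDiff (Icc B M) (nu q σ) 1 = if M = B then 1 else 0 := by
  rcases lt_or_ge M B with h | h
  · rw [Icc_eq_empty (by omega), divDiff_empty, if_neg (by omega)]
  · rw [divDiff_of_natDegree_lt (by simp; omega), coeff_one, Int.card_Icc]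
    congr 1
    simp only [eq_iff_iff]
    omega

/-- Newton coefficients of a product over an interval that extends above the nodes. -/
theorem divDiff_nodal_Ioc (hq : 0 < q) {σ B C K : ℤ} (hCK : C ≤ K) {M : ℤ} (hM : M ≤ K) :
    divDiff (Icc B M) (nu q σ) (nodal (Ioc C K) (nu q σ)) =
      (-1) ^ (B + K - M - C) * fac q (K - M) * fac q (K - C) /
        (fac q (M - B) * fac q (C - B) * fac q (B + K - M - C)) *
        poch q (M + C + σ + 1) (B + K - M - C).toNat := by
  induction K, hCK using Int.leInduction generalizing M with
  | base =>
    rw [Ioc_self, nodal_empty, divDiff_one]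
    split_ifs with h
    · subst h
      have := fac_ne_zero hq (show 0 ≤ C - M by omega)
      simp [fac_zero, poch_zero]
      field_simp
    · rcases lt_or_gt_of_ne h with h | h
      · rw [fac_of_neg q (n := M - B) (by omega)]; simp
      · rw [fac_of_neg q (n := B + C - M - C) (by omega)]; simp
  | succ K hK ih =>
    rcases lt_or_ge M B with h | h
    · rw [Icc_eq_empty (by omega), divDiff_empty, fac_of_neg q (n := M - B) (by omega)]; simp
    rw [divDiff_nodal_rec hq h (by omega), show K + 1 - 1 = K by ring, ih (by omega)]
    rw [show B + K - (M - 1) - C = B + (K + 1) - M - C by ring,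
      show K - (M - 1) = K + 1 - M by ring]
    rcases lt_or_ge (B + (K + 1) - M - C) 0 with hn | hn
    · rcases eq_or_lt_of_le hM with h1 | h1
      · subst h1
        rw [fac_of_neg q hn, sub_self, qi_zero]; simp
      · rw [ih (M := M) (by omega), fac_of_neg q hn, fac_of_neg q (n := B + K - M - C) (by omega)]
        simp
    -- For M = K+1 the induction hypothesis does not cover the second term of the recursion, but its
    -- coefficient ν(M) - ν(K+1) is 0.
    rcases eq_or_lt_of_le hM with h1 | h1
    · subst h1
      rw [sub_self, qi_zero]
      rcases lt_or_ge C B with h2 | h2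
      · rw [fac_of_neg q (n := C - B) (by omega)]; simp
      · have h0 : B = C := by omega
        subst h0
        have := fac_ne_zero hq (show 0 ≤ K - B by omega)
        have := fac_ne_zero hq (show 0 ≤ K + 1 - B by omega)
        rw [show B + (K + 1) - (K + 1) - B = 0 by ring, show K + 1 - 1 - B = K - B by ring]
        simp [fac_zero, poch_zero]
        field_simp
    rw [ih (M := M) (by omega)]
    generalize hN : B + (K + 1) - M - C = N at *
    have e3 : (fac q (M - 1 - B))⁻¹ = qi q (M - B) * (fac q (M - B))⁻¹ :=
      inv_fac_eq hq (by ring)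
    rw [show B + K - M - C = N - 1 by omega]
    have e4 : (fac q (N - 1))⁻¹ = qi q N * (fac q N)⁻¹ := inv_fac_eq hq rfl
    have e5 : fac q (K + 1 - C) = qi q (K + 1 - C) * fac q (K - C) :=
      fac_eq_mul (by omega) (by ring)
    have e6 : fac q (K + 1 - M) = qi q (K + 1 - M) * fac q (K - M) :=
      fac_eq_mul (by omega) (by ring)
    rcases eq_or_lt_of_le hn with h2 | h2
    · subst h2
      rw [fac_of_neg q (n := 0 - 1) (by omega)]
      simp only [div_eq_mul_inv, mul_inv, e3, e5, e6, Int.toNat_zero, poch_zero]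
      rw [show K + 1 - C = M - B by omega]
      simp
      ring
    · obtain ⟨m, rfl⟩ : ∃ m : ℕ, N = m + 1 := ⟨(N - 1).toNat, by omega⟩
      rw [show ((m : ℤ) + 1).toNat = m + 1 by omega, show ((m : ℤ) + 1 - 1).toNat = m by omega,
        poch_succ' q (M - 1 + C + σ + 1), poch_succ q (M + C + σ + 1),
        show M - 1 + C + σ + 1 = M + C + σ by ring, zpow_add_one₀ (by norm_num),
        show (m : ℤ) + 1 - 1 = m by ring]
      rw [show (m : ℤ) + 1 - 1 = m by ring] at e4
      -- With m + 1 = B + (K+1) - M - C the recursion reduces to [K+1-C][M+C+σ+1+m] = [M+K+1+σ][m+1]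
      -- + [M+C+σ][M-B].
      have key := qi_mul_qi_of hq (a := K + 1 - C) (b := M + C + σ + 1 + m) (c := M + (K + 1) + σ)
        (d := m + 1) (e := -(M + C + σ)) (f := -(M - B)) (by omega) (by omega) (by omega)
      rw [qi_neg, qi_neg] at key
      simp only [div_eq_mul_inv, mul_inv, e3, e4, e5, e6,
        show M - (K + 1) = -(K + 1 - M) by ring, qi_neg]
      linear_combination (-1 : ℝ) ^ (m : ℤ) * qi q (K + 1 - M) * fac q (K - M) *
        fac q (K - C) * (fac q (M - B))⁻¹ * (fac q (C - B))⁻¹ * (fac q ((m : ℤ) + 1))⁻¹ *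
        poch q (M + C + σ + 1) m * key

/-- Newton coefficients of a product over an interval that ends below the largest node and starts
below the smallest one. -/
theorem divDiff_nodal_Ioc' (hq : 0 < q) {σ B C K : ℤ} (hCK : C ≤ K) (hCB : C < B) {M : ℤ}
    (hM : K < M) :
    divDiff (Icc B M) (nu q σ) (nodal (Ioc C K) (nu q σ)) =
      fac q (B - C - 1) * fac q (K - C) /
        (fac q (M - B) * fac q (M - K - 1) * fac q (B + K - M - C)) *
        poch q (M + C + σ + 1) (B + K - M - C).toNat := by
  induction K, hCK using Int.leInduction generalizing M with
  | base =>
    rw [Ioc_self, nodal_empty, divDiff_one]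
    split_ifs with h
    · subst h
      have := fac_ne_zero hq (show 0 ≤ M - C - 1 by omega)
      simp [fac_zero, poch_zero]
      field_simp
    · rcases lt_or_gt_of_ne h with h | h
      · rw [fac_of_neg q (n := M - B) (by omega)]; simp
      · rw [fac_of_neg q (n := B + C - M - C) (by omega)]; simp
  | succ K hK ih =>
    rcases lt_or_ge M B with h | h
    · rw [Icc_eq_empty (by omega), divDiff_empty, fac_of_neg q (n := M - B) (by omega)]; simp
    -- Here K+1 < M, so the induction hypothesis applies to M - 1 as well as to M and no boundary
    -- case arises.
    rw [divDiff_nodal_rec hq h (by omega), show K + 1 - 1 = K by ring, ih (by omega),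
      ih (M := M) (by omega)]
    rw [show B + K - (M - 1) - C = B + (K + 1) - M - C by ring,
      show M - 1 - K - 1 = M - (K + 1) - 1 by ring]
    generalize hN : B + (K + 1) - M - C = N at *
    have e3 : (fac q (M - 1 - B))⁻¹ = qi q (M - B) * (fac q (M - B))⁻¹ :=
      inv_fac_eq hq (by ring)
    rw [show B + K - M - C = N - 1 by omega]
    have e4 : (fac q (N - 1))⁻¹ = qi q N * (fac q N)⁻¹ := inv_fac_eq hq rfl
    have e5 : fac q (K + 1 - C) = qi q (K + 1 - C) * fac q (K - C) :=
      fac_eq_mul (by omega) (by ring)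
    have e6 : (fac q (M - (K + 1) - 1))⁻¹ = qi q (M - (K + 1)) * (fac q (M - K - 1))⁻¹ := by
      rw [show M - K - 1 = M - (K + 1) by ring]
      exact inv_fac_eq hq rfl
    rcases lt_or_ge N 0 with h2 | h2
    · rw [fac_of_neg q h2, fac_of_neg q (n := N - 1) (by omega)]; simp
    rcases eq_or_lt_of_le h2 with h2 | h2
    · subst h2
      rw [fac_of_neg q (n := 0 - 1) (by omega)]
      simp only [div_eq_mul_inv, mul_inv, e3, e5, e6, Int.toNat_zero, poch_zero]
      rw [show K + 1 - C = M - B by omega]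
      simp
      ring
    · obtain ⟨m, rfl⟩ : ∃ m : ℕ, N = m + 1 := ⟨(N - 1).toNat, by omega⟩
      rw [show ((m : ℤ) + 1).toNat = m + 1 by omega, show ((m : ℤ) + 1 - 1).toNat = m by omega,
        poch_succ' q (M - 1 + C + σ + 1), poch_succ q (M + C + σ + 1),
        show M - 1 + C + σ + 1 = M + C + σ by ring]
      rw [show (m : ℤ) + 1 - 1 = m by ring] at e4
      have key := qi_mul_qi_of hq (a := K + 1 - C) (b := M + C + σ + 1 + m) (c := M + (K + 1) + σ)
        (d := m + 1) (e := -(M + C + σ)) (f := -(M - B)) (by omega) (by omega) (by omega)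
      rw [qi_neg, qi_neg] at key
      rw [show (m : ℤ) + 1 - 1 = m by ring]
      simp only [div_eq_mul_inv, mul_inv, e3, e4, e5, e6]
      linear_combination -fac q (B - C - 1) * qi q (M - (K + 1)) * (fac q (M - K - 1))⁻¹ *
        fac q (K - C) * (fac q (M - B))⁻¹ * (fac q ((m : ℤ) + 1))⁻¹ *
        poch q (M + C + σ + 1) m * key

end
end QRecoupling

/-! ### Very-well-poised sums and Racah polynomials -/

namespace QRecoupling
open Finset Polynomial Lagrange
section
variable {q : ℝ}

/-- A telescoping sum. -/
theorem sum_wellpoised_telescope (hq : 0 < q) {σ B D : ℤ} (h : 0 < B + D + σ) {M : ℤ}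
    (hM : B - 1 ≤ M) :
    ∑ x ∈ Icc B M, qi q (2 * x + σ) * fac q (x + B + σ - 1) * fac q (x + D + σ - 1) *
        ((fac q (x - B))⁻¹ * (fac q (x - D))⁻¹) =
      fac q (M + B + σ) * fac q (M + D + σ) * (fac q (M - B))⁻¹ * (fac q (M - D))⁻¹ *
        (qi q (B + D + σ))⁻¹ := by
  induction M, hM using Int.leInduction with
  | base => rw [Icc_eq_empty (by omega), fac_of_neg q (n := B - 1 - B) (by omega)]; simp
  | succ M hM ih =>
    have : Icc B (M + 1) = insert (M + 1) (Icc B M) := by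
      ext y; simp only [mem_Icc, mem_insert]; omega
    rw [this, sum_insert (by simp), ih]
    rcases lt_or_ge (M + 1) D with h1 | h1
    · rw [fac_of_neg q (n := M + 1 - D) (by omega), fac_of_neg q (n := M - D) (by omega)]; simp
    have e1 : fac q (M + 1 + B + σ) = qi q (M + 1 + B + σ) * fac q (M + B + σ) :=
      fac_eq_mul (by omega) (by ring)
    have e2 : fac q (M + 1 + D + σ) = qi q (M + 1 + D + σ) * fac q (M + D + σ) :=
      fac_eq_mul (by omega) (by ring)
    have e3 : (fac q (M - B))⁻¹ = qi q (M + 1 - B) * (fac q (M + 1 - B))⁻¹ :=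
      inv_fac_eq hq (by ring)
    have e4 : (fac q (M - D))⁻¹ = qi q (M + 1 - D) * (fac q (M + 1 - D))⁻¹ :=
      inv_fac_eq hq (by ring)
    -- This relation says that the next summand is the difference of two consecutive values of the
    -- closed form.
    have key := qi_mul_qi_of hq (a := M + 1 + B + σ) (b := M + 1 + D + σ) (c := 2 * (M + 1) + σ)
      (d := B + D + σ) (e := -(M + 1 - B)) (f := -(M + 1 - D)) (by ring) (by ring) (by ring)
    rw [qi_neg, qi_neg] at key
    have hn := qi_ne_zero hq h.ne'
    rw [show M + 1 + B + σ - 1 = M + B + σ by ring, show M + 1 + D + σ - 1 = M + D + σ by ring,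
      e1, e2, e3, e4]
    field_simp
    linear_combination -fac q (M + B + σ) * fac q (M + D + σ) * (fac q (M + 1 - B))⁻¹ *
      (fac q (M + 1 - D))⁻¹ * key

/-- A summation formula of very-well-poised type. -/
theorem sum_wellpoised (hq : 0 < q) {σ B D : ℤ} (h : 0 < B + D + σ) {K : ℤ} (hK : B - 1 ≤ K) {M : ℤ}
    (hM : M ≤ K) :
    ∑ x ∈ Icc B M, qi q (2 * x + σ) * fac q (x + B + σ - 1) * fac q (x + D + σ - 1) *
        (fac q (K - x) * fac q (K + x + σ)) * ((fac q (x - B))⁻¹ * (fac q (x - D))⁻¹ *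
          ((fac q (M - x))⁻¹ * (fac q (M + x + σ))⁻¹)) =
      fac q (K - M) * fac q (K + B + σ) * fac q (K + D + σ) * fac q (B + D + σ - 1) *
        ((fac q (M - B))⁻¹ * (fac q (M - D))⁻¹ * (fac q (B + D + σ + K - M))⁻¹) := by
  induction K, hK using Int.leInduction generalizing M with
  | base => rw [Icc_eq_empty (by omega), fac_of_neg q (n := M - B) (by omega)]; simp
  | succ K hK ih =>
    rcases lt_or_ge M B with hB | hB
    · rw [Icc_eq_empty (by omega), fac_of_neg q (n := M - B) (by omega)]; simp
    rcases lt_or_ge M D with hD | hD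
    · rw [fac_of_neg q (n := M - D) (by omega), sum_eq_zero]
      · simp
      · intro x hx
        rw [mem_Icc] at hx
        rw [fac_of_neg q (n := x - D) (by omega)]; simp
    -- At M = K+1 the factorials containing K+1 cancel against those containing M, and the
    -- telescoping sum remains.
    rcases eq_or_lt_of_le hM with hM' | hM'
    · subst hM'
      have := sum_wellpoised_telescope hq h (M := K + 1) (by omega)
      rw [show B + D + σ + (K + 1) - (K + 1) = B + D + σ by ring, sub_self, fac_zero,
        fac_eq_mul (n := B + D + σ) (by omega) rfl, mul_inv]
      have hn := fac_ne_zero hq (show 0 ≤ B + D + σ - 1 by omega)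
      trans (fac q (K + 1 + B + σ) * fac q (K + 1 + D + σ) * (fac q (K + 1 - B))⁻¹ *
        (fac q (K + 1 - D))⁻¹ * (qi q (B + D + σ))⁻¹)
      · rw [← this]
        refine sum_congr rfl fun x hx => ?_
        rw [mem_Icc] at hx
        rcases lt_or_ge x D with h1 | h1
        · rw [fac_of_neg q (n := x - D) (by omega)]; simp
        have f1 := fac_ne_zero hq (show 0 ≤ K + 1 - x by omega)
        have f2 := fac_ne_zero hq (show 0 ≤ K + 1 + x + σ by omega)
        field_simp
      · field_simp
    have i1 := ih (M := M) (by omega)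
    have i2 := ih (M := M - 1) (by omega)
    have hsub : Icc B (M - 1) ⊆ Icc B M := Icc_subset_Icc le_rfl (by omega)
    rw [sum_subset hsub (by
      intro x hx hx'
      rw [mem_Icc] at hx hx'
      rw [fac_of_neg q (n := M - 1 - x) (by omega)]; simp)] at i2
    -- Termwise, [K+1-x][K+1+x+σ] = ν(K+1) - ν(x) is split at ν(M): one part is a multiple of the
    -- sum for (K, M), the other is the sum for (K, M-1).
    trans qi q (K + 1 - M) * qi q (K + 1 + M + σ) * (fac q (K - M) * fac q (K + B + σ) *
        fac q (K + D + σ) * fac q (B + D + σ - 1) *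
        ((fac q (M - B))⁻¹ * (fac q (M - D))⁻¹ * (fac q (B + D + σ + K - M))⁻¹)) +
        (fac q (K - (M - 1)) * fac q (K + B + σ) * fac q (K + D + σ) * fac q (B + D + σ - 1) *
        ((fac q (M - 1 - B))⁻¹ * (fac q (M - 1 - D))⁻¹ * (fac q (B + D + σ + K - (M - 1)))⁻¹))
    · rw [← i1, ← i2, mul_sum, ← sum_add_distrib]
      refine sum_congr rfl fun x hx => ?_
      rw [mem_Icc] at hx
      rcases lt_or_ge x D with h1 | h1
      · rw [fac_of_neg q (n := x - D) (by omega)]; simp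
      have e1 : fac q (K + 1 - x) = qi q (K + 1 - x) * fac q (K - x) :=
        fac_eq_mul (by omega) (by ring)
      have e2 : fac q (K + 1 + x + σ) = qi q (K + 1 + x + σ) * fac q (K + x + σ) :=
        fac_eq_mul (by omega) (by ring)
      have e3 : (fac q (M - 1 - x))⁻¹ = qi q (M - x) * (fac q (M - x))⁻¹ :=
        inv_fac_eq hq (by ring)
      have e4 : (fac q (M - 1 + x + σ))⁻¹ = qi q (M + x + σ) * (fac q (M + x + σ))⁻¹ :=
        inv_fac_eq hq (by ring)
      have k1 := nu_sub_nu hq σ (K + 1) x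
      have k2 := nu_sub_nu hq σ (K + 1) M
      have k3 := nu_sub_nu hq σ M x
      rw [e1, e2, e3, e4]
      linear_combination (qi q (2 * x + σ) * fac q (x + B + σ - 1) * fac q (x + D + σ - 1) *
        (fac q (K - x) * fac q (K + x + σ)) * ((fac q (x - B))⁻¹ * (fac q (x - D))⁻¹ *
          ((fac q (M - x))⁻¹ * (fac q (M + x + σ))⁻¹))) * (k2 + k3 - k1)
    · have e1 : fac q (K + 1 - M) = qi q (K + 1 - M) * fac q (K - M) :=
        fac_eq_mul (by omega) (by ring)
      have e2 : fac q (K + 1 + B + σ) = qi q (K + 1 + B + σ) * fac q (K + B + σ) :=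
        fac_eq_mul (by omega) (by ring)
      have e3 : fac q (K + 1 + D + σ) = qi q (K + 1 + D + σ) * fac q (K + D + σ) :=
        fac_eq_mul (by omega) (by ring)
      have e4 : (fac q (M - 1 - B))⁻¹ = qi q (M - B) * (fac q (M - B))⁻¹ := inv_fac_eq hq (by ring)
      have e5 : (fac q (M - 1 - D))⁻¹ = qi q (M - D) * (fac q (M - D))⁻¹ := inv_fac_eq hq (by ring)
      have e6 : (fac q (B + D + σ + K - M))⁻¹ = qi q (B + D + σ + (K + 1) - M) *
        (fac q (B + D + σ + (K + 1) - M))⁻¹ := inv_fac_eq hq (by ring)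
      have key := qi_mul_qi_of hq (a := K + 1 + B + σ) (b := K + 1 + D + σ) (c := K + 1 + M + σ)
        (d := B + D + σ + (K + 1) - M) (e := -(M - B)) (f := -(M - D)) (by ring) (by ring) (by ring)
      rw [qi_neg, qi_neg] at key
      rw [show K - (M - 1) = K + 1 - M by ring,
        show B + D + σ + K - (M - 1) = B + D + σ + (K + 1) - M by ring, e1, e2, e3, e4, e5, e6]
      linear_combination -qi q (K + 1 - M) * fac q (K - M) * fac q (K + B + σ) *
        fac q (K + D + σ) * fac q (B + D + σ - 1) * (fac q (M - B))⁻¹ * (fac q (M - D))⁻¹ *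
        (fac q (B + D + σ + (K + 1) - M))⁻¹ * key

/-- The sum of a `q`-`6j` coefficient, multiplied by two `q`-factorials, as a polynomial in `ν(x)`. -/
noncomputable def racahPoly (q : ℝ) (σ α β γ m C : ℤ) (n : ℕ) : ℝ[X] :=
  ∑ k ∈ range (n + 1), ((-1) ^ k * fac q (α + k) * fac q (β + k) * fac q (γ - k) /
    (fac q k * fac q (n - k) * fac q (m - k))) •
      ((-1) ^ (n - k) * nodal (Ioc (C + k) (C + n)) (nu q σ) : ℝ[X])

theorem nu_reflect (q : ℝ) (σ y : ℤ) : nu q σ (-σ - y) = nu q σ y := by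
  unfold nu
  rw [show -σ - y + σ = -y by ring, show -σ - y = -(y + σ) by ring, qi_neg, qi_neg]
  ring

/-- Each factor splits as -[y-x][x+y+σ], and both strings are quotients of factorials. The two
bounds on x make the numerators nonzero, so the right side vanishes exactly when x or its reflection
is one of the nodes. -/
theorem eval_nodal_Ioc (hq : 0 < q) (σ : ℤ) {C x : ℤ} {n : ℕ} (hx : x ≤ C + n)
    (hx' : 0 ≤ C + n + x + σ) :
    (-1) ^ n * (nodal (Ioc C (C + n)) (nu q σ)).eval (nu q σ x) =
      fac q (C + n - x) * fac q (C + n + x + σ) * ((fac q (C - x))⁻¹ * (fac q (C + x + σ))⁻¹) := by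
  rw [eval_nodal]
  induction n with
  | zero =>
    have f1 := fac_ne_zero hq (show 0 ≤ C - x by simpa using hx)
    have f2 := fac_ne_zero hq (show 0 ≤ C + x + σ by simpa using hx')
    simp
    field_simp
  | succ n ih =>
    have h1 : Ioc C (C + (n + 1 : ℕ)) = insert (C + (n + 1 : ℕ)) (Ioc C (C + n)) := by
      ext y; simp only [mem_Ioc, mem_insert]; omega
    rw [h1, prod_insert (by simp), nu_sub_nu hq]
    rcases eq_or_lt_of_le hx with h2 | h2
    · rw [h2, sub_self, qi_zero, fac_of_neg q (n := C - (C + (n + 1 : ℕ))) (by omega)]; simp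
    rcases eq_or_lt_of_le hx' with h3 | h3
    · rw [show x + (C + ((n + 1 : ℕ) : ℤ)) + σ = 0 by omega, qi_zero,
        fac_of_neg q (n := C + x + σ) (by omega)]; simp
    have ih := ih (by omega) (by omega)
    rw [show x - (C + ((n + 1 : ℕ) : ℤ)) = -(C + ((n + 1 : ℕ) : ℤ) - x) by ring, qi_neg, pow_succ,
      fac_eq_mul (n := C + ((n + 1 : ℕ) : ℤ) - x) (m := C + n - x) (by omega)
        (by push_cast; ring),
      fac_eq_mul (n := C + ((n + 1 : ℕ) : ℤ) + x + σ) (m := C + n + x + σ) (by omega)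
        (by push_cast; ring),
      show x + (C + ((n + 1 : ℕ) : ℤ)) + σ = C + ((n + 1 : ℕ) : ℤ) + x + σ by ring]
    linear_combination qi q (C + ((n + 1 : ℕ) : ℤ) - x) * qi q (C + ((n + 1 : ℕ) : ℤ) + x + σ) * ih

/-- This explains the definition: multiplied by [C+n-x]![C+n+x+σ]!, the x-dependent denominators of
the k-th summand become the nodal polynomial of the points above C+k. The bounds on x keep these two
factorials nonzero. -/
theorem racahPoly_eval (hq : 0 < q) {σ α β γ m C x : ℤ} {n : ℕ} (hx : x ≤ C + n)
    (hx' : 0 ≤ C + n + x + σ) :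
    (racahPoly q σ α β γ m C n).eval (nu q σ x) =
      fac q (C + n - x) * fac q (C + n + x + σ) * dSum q α β γ n m (C - x) (C + x + σ) := by
  unfold racahPoly dSum
  rw [eval_finsetSum, Int.toNat_natCast, mul_sum]
  refine sum_congr rfl fun k hk => ?_
  rw [mem_range] at hk
  obtain ⟨l, rfl⟩ : ∃ l, n = k + l := ⟨n - k, by omega⟩
  have := eval_nodal_Ioc hq σ (C := C + k) (x := x) (n := l) (by push_cast at hx; omega)
    (by push_cast at hx'; omega)
  rw [show C + (k : ℤ) + l = C + (k + l : ℕ) by push_cast; ring] at this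
  rw [eval_smul, eval_mul, show k + l - k = l by omega]
  simp only [eval_pow, eval_neg, eval_one]
  rw [this]
  unfold dTerm
  rw [zpow_natCast, show C - x + (k : ℤ) = C + k - x by ring,
    show C + x + σ + (k : ℤ) = C + k + x + σ by ring]
  simp only [smul_eq_mul, div_eq_mul_inv, mul_inv]
  ring

/-- A Sears transformation shows that the polynomial has many zeros. -/
theorem nodal_dvd_racahPoly (hq : 0 < q) {σ α β γ m C L R : ℤ} {n : ℕ} (hα : 0 ≤ α) (hβ : 0 ≤ β)
    (hγ : n ≤ γ) (hm : 0 ≤ m) (hmγ : m ≤ γ) (hb : α + β + γ + 1 = n + m + 2 * C + σ)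
    (hL : L = C - α) (hR : R = C - α + n + m - γ) :
    nodal (Ico L R) (nu q σ) ∣ racahPoly q σ α β γ m C n := by
  set c : ℝ := (-1) ^ n * (fac q n * fac q m / (fac q α * fac q β * fac q (γ - n))) with hc
  -- G is the right side of the Sears formula: all its x-dependent products start at the same point
  -- L, so the root sets are nested.
  set G : ℝ[X] := ∑ k ∈ range (n + 1), ((-1) ^ k * qbin q n k * poch q (α + 1) k *
    poch q (-γ - -m) k * poch q (-γ - (β + 1)) k * poch q (-γ + k) (n - k)) •
      ((-1) ^ (n - k) * nodal (Ico L (L + (n - k : ℕ))) (nu q σ) : ℝ[X]) with hG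
  have hpoch : ∀ (L : ℤ) (l : ℕ) (x : ℤ), poch q (L - x) l * poch q (L + x + σ) l =
      (-1) ^ l * (nodal (Ico L (L + l)) (nu q σ)).eval (nu q σ x) := by
    intro L l x
    rw [eval_nodal]
    induction l with
    | zero => simp [poch_zero]
    | succ l ih =>
      have h1 : Ico L (L + (l + 1 : ℕ)) = insert (L + l) (Ico L (L + l)) := by
        ext y; simp only [mem_Ico, mem_insert]; omega
      rw [h1, prod_insert (by simp), nu_sub_nu hq, poch_succ, poch_succ, pow_succ,
        show x - (L + (l : ℤ)) = -(L - x + l) by ring, qi_neg,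
        show x + (L + (l : ℤ)) + σ = L + x + σ + l by ring]
      linear_combination qi q (L - x + l) * qi q (L + x + σ + l) * ih
  have hcP : c • racahPoly q σ α β γ m C n = G := by
    -- Sears gives equality at every integer x, and ν takes infinitely many values, being injective
    -- on x ≥ |σ|.
    apply eq_of_infinite_eval_eq
    have hinf : Set.Infinite (nu q σ '' Set.Ici |σ|) := by
      refine (Set.infinite_image_iff (nu_injOn hq ?_)).2 (Set.Ici_infinite _)
      intro x hx y hy hxy
      rw [Set.mem_Ici] at hx hy
      have := neg_abs_le σ
      have := abs_nonneg σ
      omega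
    refine hinf.mono ?_
    rintro _ ⟨x, -, rfl⟩
    have key := sears hq n (a := α + 1) (b := -m) (c := β + 1) (d := -γ) (e := C - x + 1)
      (f := C + x + σ + 1) (by omega)
    simp only [Set.mem_ofPred_eq, hG, eval_smul, racahPoly, eval_finsetSum, smul_eq_mul, eval_mul,
      eval_pow, eval_neg, eval_one, ← hpoch]
    rw [mul_sum]
    have hl : C - x + 1 - (α + 1) = L - x := by omega
    have hl' : C + x + σ + 1 - (α + 1) = L + x + σ := by omega
    rw [hl, hl'] at key
    refine Eq.trans (sum_congr rfl fun k hk => ?_) (key.trans (sum_congr rfl fun k _ => by ring))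
    rw [mem_range] at hk
    have h1 : Ioc (C + (k : ℤ)) (C + n) = Ico (C + k + 1) (C + k + 1 + (n - k : ℕ)) := by
      ext y; simp only [mem_Ioc, mem_Ico]; omega
    rw [h1, ← hpoch, poch_eq_fac hq (b := α) (c := α + k) (by ring) rfl (by omega),
      poch_neg_eq_fac hq (u := m) rfl hm,
      poch_eq_fac hq (a := β + 1) (b := β) (c := β + k) (by ring) rfl (by omega),
      poch_neg_eq_fac hq (a := -γ + k) (u := γ - k) (by ring) (by omega),
      show γ - (k : ℤ) - ((n - k : ℕ) : ℤ) = γ - n by omega,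
      show C + (k : ℤ) + 1 - x = C - x + 1 + k by ring,
      show C + (k : ℤ) + 1 + x + σ = C + x + σ + 1 + k by ring]
    have : ((-1 : ℝ)) ^ n = (-1) ^ (n - k) * (-1) ^ k := by rw [← pow_add]; congr 1; omega
    rw [hc, this]
    unfold qbin
    simp only [div_eq_mul_inv, mul_inv]
    ring
  have hc0 : c ≠ 0 := by
    have f1 := fac_ne_zero hq (show 0 ≤ (n : ℤ) by omega)
    have f2 := fac_ne_zero hq hα
    have f3 := fac_ne_zero hq hβ
    have f4 := fac_ne_zero hq hm
    have f5 := fac_ne_zero hq (show 0 ≤ γ - n by omega)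
    rw [hc]
    positivity
  have hdvd : nodal (Ico L R) (nu q σ) ∣ G := by
    refine dvd_sum fun k hk => ?_
    rw [mem_range] at hk
    -- The factor (m-γ)_k kills the terms with k > γ - m; for the others the root interval, of
    -- length n - k, reaches at least to R = L + n - (γ - m).
    rcases le_or_gt (k : ℤ) (γ - m) with h | h
    · refine dvd_smul_of_dvd _ (Dvd.dvd.mul_left ?_ _)
      exact prod_dvd_prod_of_subset _ _ _ (Ico_subset_Ico le_rfl (by omega))
    · rw [poch_neg_eq_fac hq (a := -γ - -m) (u := γ - m) (by ring) (by omega),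
        fac_of_neg q (n := γ - m - k) (by omega)]
      simp
  rw [← hcP] at hdvd
  have := dvd_smul_of_dvd c⁻¹ hdvd
  rwa [smul_smul, inv_mul_cancel₀ hc0, one_smul] at this

/-- Each zero comes with its reflection, because ν cannot distinguish the two. This detects violated
triangular conditions on x that the factorials alone do not see. -/
theorem racahPoly_eval_eq_zero (hq : 0 < q) {σ α β γ m C L R x : ℤ} {n : ℕ} (hα : 0 ≤ α)
    (hβ : 0 ≤ β) (hγ : n ≤ γ) (hm : 0 ≤ m) (hmγ : m ≤ γ)
    (hb : α + β + γ + 1 = n + m + 2 * C + σ) (hL : L = C - α) (hR : R = C - α + n + m - γ)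
    (h : L ≤ x ∧ x < R ∨ L ≤ -σ - x ∧ -σ - x < R) :
    (racahPoly q σ α β γ m C n).eval (nu q σ x) = 0 := by
  obtain ⟨P, hP⟩ := nodal_dvd_racahPoly hq hα hβ hγ hm hmγ hb hL hR
  rw [hP, eval_mul]
  rcases h with h | h
  · rw [eval_nodal_at_node (mem_Ico.2 h), zero_mul]
  · rw [← nu_reflect, eval_nodal_at_node (mem_Ico.2 h), zero_mul]

end
end QRecoupling

/-! ### Triangle coefficients and reduced 6j coefficients -/

namespace QRecoupling
open Finset
section
variable {q : ℝ}

theorem qFac_eq_fac (q : ℝ) {x : ℝ} {n : ℤ} (h : x = n) : qFac q x = fac q n := by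
  rw [h]; rfl

/-- `ring` does not cancel a factorial against its inverse; the cancelling pairs are supplied
explicitly as a factor 1 by means of this lemma. -/
theorem prod_fac_mul_inv (hq : 0 < q) (l : List ℤ) (h : l.Forall (0 ≤ ·)) :
    (l.map fun n => fac q n * (fac q n)⁻¹).prod = 1 := by
  refine List.prod_eq_one fun x hx => ?_
  obtain ⟨n, hn, rfl⟩ := List.mem_map.1 hx
  exact mul_inv_cancel₀ (fac_ne_zero hq (List.forall_iff_forall_mem.1 h n hn))

theorem sign_eq_zpow {x : ℝ} {n : ℤ} (h : x = n) : sign x = (-1) ^ n := by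
  rw [h, sign, Int.floor_intCast]

theorem neg_one_zpow_congr {m n : ℤ} (h : (m - n) % 2 = 0) : (-1 : ℝ) ^ m = (-1) ^ n := by
  obtain ⟨k, hk⟩ : ∃ k, m = n + 2 * k := ⟨(m - n) / 2, by omega⟩
  rw [hk, zpow_add₀ (by norm_num), zpow_mul]
  simp

/-- The symmetric triangle coefficient. -/
noncomputable def tri (q a b c : ℝ) : ℝ :=
  √(qFac q (a + b - c) * qFac q (a + c - b) * qFac q (b + c - a) * qFac q (a + b + c + 1))

theorem tri_swap (q a b c : ℝ) : tri q a b c = tri q b a c := by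
  unfold tri
  congr 1
  rw [add_comm b a]
  ring

theorem tri_rotate (q a b c : ℝ) : tri q a b c = tri q b c a := by
  unfold tri
  congr 1
  rw [show b + a - c = a + b - c by ring, show c + a - b = a + c - b by ring,
    show b + c + a + 1 = a + b + c + 1 by ring]
  ring

section tri
variable {a b c : ℝ} {x y z s : ℤ}

theorem tri_mul_self (hq : 0 < q) (hz : a + b - c = z) (hy : a + c - b = y) (hx : b + c - a = x)
    (hs : s = x + y + z + 1) :
    tri q a b c * tri q a b c = fac q x * fac q y * fac q z * fac q s := by
  have h : a + b + c + 1 = s := by rw [hs]; push_cast; linarith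
  rw [tri, qFac_eq_fac q hz, qFac_eq_fac q hy, qFac_eq_fac q hx, qFac_eq_fac q h,
    Real.mul_self_sqrt]
  · ring
  · exact mul_nonneg (mul_nonneg (mul_nonneg (fac_nonneg hq _) (fac_nonneg hq _))
      (fac_nonneg hq _)) (fac_nonneg hq _)

theorem tri_eq_zero (hz : a + b - c = z) (hy : a + c - b = y) (hx : b + c - a = x)
    (h : ¬(0 ≤ x ∧ 0 ≤ y ∧ 0 ≤ z)) : tri q a b c = 0 := by
  rw [tri, qFac_eq_fac q hz, qFac_eq_fac q hy, qFac_eq_fac q hx]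
  have : fac q x = 0 ∨ fac q y = 0 ∨ fac q z = 0 := by
    by_contra! h'
    apply h
    refine ⟨?_, ?_, ?_⟩ <;> by_contra! hn
    · exact h'.1 (fac_of_neg q hn)
    · exact h'.2.1 (fac_of_neg q hn)
    · exact h'.2.2 (fac_of_neg q hn)
  rcases this with h | h | h <;> simp [h]

theorem tri_pos (hq : 0 < q) (hz : a + b - c = z) (hy : a + c - b = y) (hx : b + c - a = x)
    (h : 0 ≤ x ∧ 0 ≤ y ∧ 0 ≤ z) : 0 < tri q a b c := by
  have hs : a + b + c + 1 = (x + y + z + 1 : ℤ) := by push_cast; linarith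
  rw [tri, qFac_eq_fac q hz, qFac_eq_fac q hy, qFac_eq_fac q hx, qFac_eq_fac q hs]
  have h1 := fac_pos hq h.1
  have h2 := fac_pos hq h.2.1
  have h3 := fac_pos hq h.2.2
  have h4 := fac_pos hq (show 0 ≤ x + y + z + 1 by omega)
  positivity

theorem nab_eq_tri_div (hq : 0 < q) (hx : b + c - a = x) :
    nab q a b c = tri q a b c / fac q x := by
  unfold nab tri
  rw [qFac_eq_fac q hx, show a - b + c = a + c - b by ring]
  rcases lt_or_ge x 0 with h | h
  · simp [fac_of_neg q h]
  · have hp := fac_pos hq h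
    rw [show qFac q (a + b - c) * qFac q (a + c - b) * qFac q (a + b + c + 1) / fac q x =
      qFac q (a + b - c) * qFac q (a + c - b) * fac q x * qFac q (a + b + c + 1) /
        (fac q x * fac q x) by field_simp, Real.sqrt_div' _ (by positivity),
      Real.sqrt_mul_self hp.le]

/-- The square of `tri` is a product of four factorials, so dividing by ∇ amounts to multiplying by
`tri` and inverse factorials. In the final formulas all square roots are brought to this shape and
matched as `tri` factors. -/
theorem inv_nab_eq (hq : 0 < q) (hz : a + b - c = z) (hy : a + c - b = y) (hx : b + c - a = x)
    (hs : s = x + y + z + 1) (h : 0 ≤ x ∧ 0 ≤ y ∧ 0 ≤ z) :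
    (nab q a b c)⁻¹ = tri q a b c * ((fac q y)⁻¹ * (fac q z)⁻¹ * (fac q s)⁻¹) := by
  rw [nab_eq_tri_div hq hx]
  have h0 := tri_pos hq hz hy hx h
  have h1 := fac_pos hq h.1
  have h2 := fac_pos hq h.2.1
  have h3 := fac_pos hq h.2.2
  have h4 := fac_pos hq (show 0 ≤ s by omega)
  have := tri_mul_self hq hz hy hx hs
  field_simp
  linear_combination -this

/-- Each doubled spin is the sum of two of the excesses x, y, z, and the perimeter is the sum of all
three; their being nonnegative integers contains every part of the triangular condition. -/
theorem triangle_iff (hz : a + b - c = z) (hy : a + c - b = y) (hx : b + c - a = x) :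
    Triangle a b c ↔ 0 ≤ x ∧ 0 ≤ y ∧ 0 ≤ z := by
  constructor
  · rintro ⟨-, -, -, -, h1, h2, h3⟩
    refine ⟨?_, ?_, ?_⟩
    · exact_mod_cast (show (0 : ℝ) ≤ x by linarith)
    · exact_mod_cast (show (0 : ℝ) ≤ y by linarith)
    · exact_mod_cast (show (0 : ℝ) ≤ z by linarith)
  · rintro ⟨h1, h2, h3⟩
    have h1' : (0 : ℝ) ≤ x := by exact_mod_cast h1
    have h2' : (0 : ℝ) ≤ y := by exact_mod_cast h2
    have h3' : (0 : ℝ) ≤ z := by exact_mod_cast h3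
    lift x to ℕ using h1
    lift y to ℕ using h2
    lift z to ℕ using h3
    push_cast at *
    refine ⟨⟨y + z, ?_⟩, ⟨x + z, ?_⟩, ⟨x + y, ?_⟩, ⟨x + y + z, ?_⟩, ?_, ?_, ?_⟩ <;>
      push_cast <;> linarith

end tri

/-- The symmetric Racah sum. -/
noncomputable def racah (q : ℝ) (p₁ p₂ p₃ p₄ s₁ s₂ : ℤ) : ℝ :=
  ∑ᶠ z, rTerm q (p₁ + p₂ + p₃ + p₄ + s₁ + s₂ + 1) p₁ p₂ p₃ p₄ s₁ s₂ z

/-- The summand depends on the four p symmetrically. The transpositions below generate all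
permutations of p₁, …, p₄, and `racah_shift` together with `racah_swap_s` permutes the three numbers
0, s₁, s₂: these are the 4!·3! symmetries of the 6j coefficient. -/
theorem racah_swap₁₂ (q : ℝ) (p₁ p₂ p₃ p₄ s₁ s₂ : ℤ) :
    racah q p₁ p₂ p₃ p₄ s₁ s₂ = racah q p₂ p₁ p₃ p₄ s₁ s₂ := by
  unfold racah
  rw [add_comm p₂ p₁]
  refine finsum_congr fun z => ?_
  unfold rTerm
  rw [mul_right_comm (fac q z)]

theorem racah_swap_pairs (q : ℝ) (p₁ p₂ p₃ p₄ s₁ s₂ : ℤ) :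
    racah q p₁ p₂ p₃ p₄ s₁ s₂ = racah q p₃ p₄ p₁ p₂ s₁ s₂ := by
  unfold racah
  rw [show p₃ + p₄ + p₁ + p₂ = p₁ + p₂ + p₃ + p₄ by ring]
  refine finsum_congr fun z => ?_
  unfold rTerm
  congr 1
  ring

theorem racah_swap₂₃ (q : ℝ) (p₁ p₂ p₃ p₄ s₁ s₂ : ℤ) :
    racah q p₁ p₂ p₃ p₄ s₁ s₂ = racah q p₁ p₃ p₂ p₄ s₁ s₂ := by
  unfold racah
  rw [add_right_comm p₁ p₂ p₃]
  refine finsum_congr fun z => ?_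
  unfold rTerm
  congr 1
  ring

theorem racah_swap_s (q : ℝ) (p₁ p₂ p₃ p₄ s₁ s₂ : ℤ) :
    racah q p₁ p₂ p₃ p₄ s₁ s₂ = racah q p₁ p₂ p₃ p₄ s₂ s₁ := by
  unfold racah
  rw [add_right_comm _ s₁ s₂]
  refine finsum_congr fun z => ?_
  unfold rTerm
  congr 1
  ring

theorem racah_shift (q : ℝ) (p₁ p₂ p₃ p₄ s₁ s₂ : ℤ) :
    racah q p₁ p₂ p₃ p₄ s₁ s₂ =
      (-1) ^ s₂ * racah q (p₁ + s₂) (p₂ + s₂) (p₃ + s₂) (p₄ + s₂) (s₁ - s₂) (-s₂) := by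
  unfold racah
  rw [← finsum_shift (rTerm q _ (p₁ + s₂) _ _ _ _ _) s₂, ← smul_eq_mul, smul_finsum]
  refine finsum_congr fun z => ?_
  unfold rTerm
  rw [zpow_add₀ (by norm_num), smul_eq_mul,
    show p₁ + s₂ + (p₂ + s₂) + (p₃ + s₂) + (p₄ + s₂) + (s₁ - s₂) + -s₂ + 1 - (z + s₂) =
      p₁ + p₂ + p₃ + p₄ + s₁ + s₂ + 1 - z by ring, show -s₂ + (z + s₂) = z by ring,
    show p₁ + s₂ - (z + s₂) = p₁ - z by ring, show p₂ + s₂ - (z + s₂) = p₂ - z by ring,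
    show p₃ + s₂ - (z + s₂) = p₃ - z by ring, show p₄ + s₂ - (z + s₂) = p₄ - z by ring,
    show s₁ - s₂ + (z + s₂) = s₁ + z by ring, add_comm s₂ z]
  have : (-1 : ℝ) ^ s₂ * (-1) ^ s₂ = 1 := by rw [← mul_zpow]; simp
  simp only [div_eq_mul_inv, mul_inv]
  linear_combination -(-1) ^ z * fac q (p₁ + p₂ + p₃ + p₄ + s₁ + s₂ + 1 - z) * (fac q z)⁻¹ *
    (fac q (p₁ - z))⁻¹ * (fac q (p₂ - z))⁻¹ * (fac q (p₃ - z))⁻¹ * (fac q (p₄ - z))⁻¹ *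
    (fac q (s₁ + z))⁻¹ * (fac q (z + s₂))⁻¹ * this

/-- A stretched triangle: p₁ + s₁ is one of the excesses, and when it is 0 the bounds -s₁ ≤ z ≤ p₁
leave only z = p₁. -/
theorem racah_eq_single {p₁ p₂ p₃ p₄ s₁ s₂ z₀ : ℤ} (h : z₀ = p₁) (hs : s₁ = -p₁) :
    racah q p₁ p₂ p₃ p₄ s₁ s₂ = (-1) ^ z₀ * fac q (p₂ + p₃ + p₄ + s₂ + 1 - z₀) /
      (fac q z₀ * fac q (p₂ - z₀) * fac q (p₃ - z₀) * fac q (p₄ - z₀) * fac q (s₂ + z₀)) := by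
  subst h hs
  unfold racah
  rw [finsum_eq_single _ z₀]
  · unfold rTerm
    rw [sub_self, neg_add_cancel, fac_zero,
      show z₀ + p₂ + p₃ + p₄ + -z₀ + s₂ + 1 - z₀ = p₂ + p₃ + p₄ + s₂ + 1 - z₀ by ring]
    simp
  · intro z hz
    by_contra h0
    have := rTerm_ne_zero h0
    omega

/-- The Racah sum as one of the asymmetric sums. -/
theorem racah_eq_dSum (hq : 0 < q) {p₁ p₂ p₃ p₄ s₁ s₂ u₁ u₂ u₃ v₁ v₂ v₃ v₄ r₁ r₂ t₁ t₂ : ℤ}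
    (hu₁ : u₁ = p₃ + s₁) (hu₂ : u₂ = p₄ + s₁) (hu₃ : u₃ = p₁ + p₂ + s₂) (hv₁ : v₁ = p₁)
    (hv₂ : v₂ = p₂) (hv₃ : v₃ = s₁) (hv₄ : v₄ = p₃ + p₄ + s₁ + s₂ + 1) (hr₁ : r₁ = p₁ + s₂)
    (hr₂ : r₂ = p₂ + s₂) (ht₁ : t₁ = p₂ + v₄) (ht₂ : t₂ = p₁ + v₄) (hp₁ : 0 ≤ p₁) (hp₂ : 0 ≤ p₂)
    (hp₃ : 0 ≤ p₃) (hp₄ : 0 ≤ p₄) (h₃₁ : 0 ≤ p₃ + s₁) (h₄₁ : 0 ≤ p₄ + s₁) (h₁₂ : 0 ≤ r₁)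
    (h₂₂ : 0 ≤ r₂) (h₄ : 0 ≤ v₄) :
    racah q p₁ p₂ p₃ p₄ s₁ s₂ =
      fac q t₁ * fac q t₂ / (fac q u₁ * fac q u₂ * fac q r₁ * fac q r₂ * fac q p₃ * fac q p₄) *
        dSum q u₁ u₂ u₃ v₁ v₂ v₃ v₄ := by
  subst hv₁ hv₂ hv₃
  have := dSum_eq_racah hq (u₁ := u₁) (u₂ := u₂) (u₃ := u₃) (v₁ := v₁) (v₂ := v₂) (v₃ := v₃)
    (v₄ := v₄) (by omega) (by omega) (by omega) (by omega) (by omega) (by omega) (by omega)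
    (by omega) (by omega) (by omega)
  rw [show u₁ - v₃ = p₃ by omega, show u₂ - v₃ = p₄ by omega, show u₃ - v₁ = r₂ by omega,
    show u₃ - v₂ = r₁ by omega, show r₂ - v₂ = s₂ by omega, ← ht₁, ← ht₂,
    show v₁ + v₂ + v₄ = v₁ + v₂ + p₃ + p₄ + v₃ + s₂ + 1 by omega] at this
  have f1 := fac_ne_zero hq (show 0 ≤ u₁ by omega)
  have f2 := fac_ne_zero hq (show 0 ≤ u₂ by omega)
  have f3 := fac_ne_zero hq (show 0 ≤ r₁ by omega)
  have f4 := fac_ne_zero hq (show 0 ≤ r₂ by omega)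
  have f5 := fac_ne_zero hq hp₃
  have f6 := fac_ne_zero hq hp₄
  unfold racah
  field_simp
  linear_combination -this

/-- The asymmetric sum is invariant under a shift of its summation parameter. -/
theorem dSum_shift (q : ℝ) {u₁ u₂ u₃ v₁ v₂ v₃ v₄ u₁' u₂' u₃' v₁' v₂' v₄' : ℤ} (hu₁ : u₁' = u₁ - v₃)
    (hu₂ : u₂' = u₂ - v₃) (hu₃ : u₃' = u₃ + v₃) (hv₁ : v₁' = v₁ + v₃) (hv₂ : v₂' = v₂ + v₃)
    (hv₄ : v₄' = v₄ - v₃) :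
    dSum q u₁ u₂ u₃ v₁ v₂ v₃ v₄ = (-1) ^ v₃ * dSum q u₁' u₂' u₃' v₁' v₂' (-v₃) v₄' := by
  subst hu₁ hu₂ hu₃ hv₁ hv₂ hv₄
  rw [dSum_eq_finsum, dSum_eq_finsum, ← finsum_shift (dTerm q (u₁ - v₃) _ _ _ _ _ _) v₃, ← smul_eq_mul, smul_finsum]
  refine finsum_congr fun z => ?_
  unfold dTerm
  rw [zpow_add₀ (by norm_num), smul_eq_mul, show u₁ - v₃ + (z + v₃) = u₁ + z by ring,
    show u₂ - v₃ + (z + v₃) = u₂ + z by ring, show u₃ + v₃ - (z + v₃) = u₃ - z by ring,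
    show v₁ + v₃ - (z + v₃) = v₁ - z by ring, show v₂ + v₃ - (z + v₃) = v₂ - z by ring,
    show -v₃ + (z + v₃) = z by ring, show v₄ - v₃ + (z + v₃) = v₄ + z by ring, add_comm v₃ z]
  have : (-1 : ℝ) ^ v₃ * (-1) ^ v₃ = 1 := by rw [← mul_zpow]; simp
  simp only [div_eq_mul_inv, mul_inv]
  linear_combination -(-1) ^ z * fac q (u₁ + z) * fac q (u₂ + z) * fac q (u₃ - z) * (fac q z)⁻¹ *
    (fac q (v₁ - z))⁻¹ * (fac q (v₂ - z))⁻¹ * (fac q (z + v₃))⁻¹ * (fac q (v₄ + z))⁻¹ * this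

/-- The `q`-`6j` coefficients without the triangle coefficients. -/
noncomputable def sixRed (q : ℝ) (p₁ p₂ p₃ p₄ s₁ s₂ : ℤ) : ℝ :=
  (-1) ^ (p₁ + p₂ + p₃ + p₄ + s₁ + s₂) * racah q p₁ p₂ p₃ p₄ s₁ s₂ *
    ((fac q (p₂ + p₃ + p₄ + s₁ + s₂ + 1))⁻¹ * (fac q (p₁ + p₃ + p₄ + s₁ + s₂ + 1))⁻¹ *
      (fac q (p₁ + p₂ + p₄ + s₁ + s₂ + 1))⁻¹ * (fac q (p₁ + p₂ + p₃ + s₁ + s₂ + 1))⁻¹)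

/-- The formula needs integrality only. Where a triangular condition fails, the left side is 0 by
definition and one of the four `tri` vanishes. -/
theorem sixJ_eq_tri_mul (hq : 0 < q) {a b e d c f : ℝ} {p₁ p₂ p₃ p₄ s₁ s₂ : ℤ}
    (h₁ : a + c - f = p₁) (h₂ : b + d - f = p₂) (h₃ : c + d - e = p₃) (h₄ : a + b - e = p₄)
    (h₅ : e + f - a - d = s₁) (h₆ : e + f - b - c = s₂) :
    sixJ q a b e d c f =
      tri q a b e * tri q d c e * tri q a c f * tri q d b f * sixRed q p₁ p₂ p₃ p₄ s₁ s₂ := by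
  have t11 : a + e - b = (p₁ + s₂ : ℤ) := by push_cast; linarith
  have t12 : b + e - a = (p₂ + s₁ : ℤ) := by push_cast; linarith
  have t20 : d + c - e = p₃ := by linarith
  have t21 : d + e - c = (p₂ + s₂ : ℤ) := by push_cast; linarith
  have t22 : c + e - d = (p₁ + s₁ : ℤ) := by push_cast; linarith
  have t31 : a + f - c = (p₄ + s₂ : ℤ) := by push_cast; linarith
  have t32 : c + f - a = (p₃ + s₁ : ℤ) := by push_cast; linarith
  have t40 : d + b - f = p₂ := by linarith
  have t41 : d + f - b = (p₃ + s₂ : ℤ) := by push_cast; linarith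
  have t42 : b + f - d = (p₄ + s₁ : ℤ) := by push_cast; linarith
  have T1 := triangle_iff h₄ t11 t12
  have T2 := triangle_iff t20 t21 t22
  have T3 := triangle_iff h₁ t31 t32
  have T4 := triangle_iff t40 t41 t42
  unfold sixJ
  split_ifs with hT
  · rw [T1, T2, T3, T4] at hT
    obtain ⟨g1, g2, g3, g4⟩ := hT
    rw [nab_eq_tri_div hq t32, nab_eq_tri_div hq t42, nab_eq_tri_div hq t12,
      nab_eq_tri_div hq t22]
    have hsum : ∑ z ∈ range (⌊a + c - f⌋₊ + 1),
        sign (a + b + c + d + z) * qFac q (c + f - a + z) * qFac q (b + f - d + z)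
            * qFac q (a + d + e - f - z) /
          (qFac q z * qFac q (a + c - f - z) * qFac q (b + d - f - z)
            * qFac q (e + f - a - d + z) * qFac q (2 * f + z + 1)) =
        (-1) ^ (p₁ + p₂ + p₃ + p₄ + s₁ + s₂) * dSum q (p₃ + s₁) (p₄ + s₁) (p₁ + p₂ + s₂) p₁ p₂ s₁
          (p₃ + p₄ + s₁ + s₂ + 1) := by
      unfold dSum
      rw [h₁, ← Int.floor_toNat, Int.floor_intCast, mul_sum]
      refine sum_congr rfl fun z _ => ?_
      rw [sign_eq_zpow (n := p₁ + p₂ + p₃ + p₄ + s₁ + s₂ + z) (by push_cast; linarith),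
        qFac_eq_fac q (n := p₃ + s₁ + z) (by push_cast; linarith),
        qFac_eq_fac q (n := p₄ + s₁ + z) (by push_cast; linarith),
        qFac_eq_fac q (n := p₁ + p₂ + s₂ - z) (by push_cast; linarith),
        qFac_eq_fac q (n := z) (by push_cast; rfl),
        qFac_eq_fac q (n := p₁ - z) (by push_cast; linarith),
        qFac_eq_fac q (n := p₂ - z) (by push_cast; linarith),
        qFac_eq_fac q (n := s₁ + z) (by push_cast; linarith),
        qFac_eq_fac q (n := p₃ + p₄ + s₁ + s₂ + 1 + z) (by push_cast; linarith), dTerm,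
        zpow_add₀ (by norm_num)]
      ring
    rw [hsum, sixRed, racah_eq_dSum hq rfl rfl rfl rfl rfl rfl rfl rfl rfl rfl rfl
      (by omega) (by omega) (by omega) (by omega) (by omega) (by omega) (by omega) (by omega)
      (by omega)]
    have s1 := tri_mul_self hq h₄ t11 t12 (s := p₁ + p₂ + p₄ + s₁ + s₂ + 1) (by ring)
    have s2 := tri_mul_self hq t20 t21 t22 (s := p₁ + p₂ + p₃ + s₁ + s₂ + 1) (by ring)
    have r1 := tri_pos hq h₄ t11 t12 g1
    have r2 := tri_pos hq t20 t21 t22 g2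
    rw [show p₂ + (p₃ + p₄ + s₁ + s₂ + 1) = p₂ + p₃ + p₄ + s₁ + s₂ + 1 by ring,
      show p₁ + (p₃ + p₄ + s₁ + s₂ + 1) = p₁ + p₃ + p₄ + s₁ + s₂ + 1 by ring]
    have f1 := fac_pos hq (show 0 ≤ p₂ + p₃ + p₄ + s₁ + s₂ + 1 by omega)
    have f2 := fac_pos hq (show 0 ≤ p₁ + p₃ + p₄ + s₁ + s₂ + 1 by omega)
    have f3 := fac_pos hq (show 0 ≤ p₁ + p₂ + p₄ + s₁ + s₂ + 1 by omega)
    have f4 := fac_pos hq (show 0 ≤ p₁ + p₂ + p₃ + s₁ + s₂ + 1 by omega)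
    have f5 := fac_pos hq g1.1
    have f6 := fac_pos hq g2.1
    have f7 := fac_pos hq g3.1
    have f8 := fac_pos hq g4.1
    have f9 := fac_pos hq g1.2.1
    have f10 := fac_pos hq g1.2.2
    have f11 := fac_pos hq g2.2.1
    have f12 := fac_pos hq g2.2.2
    generalize tri q a b e = A at *
    generalize tri q d c e = B at *
    -- The two ∇ in the denominator leave inverse `tri` factors; each is rewritten as `tri` over its
    -- rational square.
    have e1 : A⁻¹ = A * (fac q (p₂ + s₁) * fac q (p₁ + s₂) * fac q p₄ *
        fac q (p₁ + p₂ + p₄ + s₁ + s₂ + 1))⁻¹ := by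
      rw [← s1]; field_simp
    have e2 : B⁻¹ = B * (fac q (p₁ + s₁) * fac q (p₂ + s₂) * fac q p₃ *
        fac q (p₁ + p₂ + p₃ + s₁ + s₂ + 1))⁻¹ := by
      rw [← s2]; field_simp
    simp only [div_eq_mul_inv, mul_inv, e1, e2, inv_inv]
    field_simp
  · rw [T1, T2, T3, T4] at hT
    symm
    by_cases c1 : 0 ≤ p₂ + s₁ ∧ 0 ≤ p₁ + s₂ ∧ 0 ≤ p₄
    · by_cases c2 : 0 ≤ p₁ + s₁ ∧ 0 ≤ p₂ + s₂ ∧ 0 ≤ p₃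
      · by_cases c3 : 0 ≤ p₃ + s₁ ∧ 0 ≤ p₄ + s₂ ∧ 0 ≤ p₁
        · rw [tri_eq_zero t40 t41 t42 fun c4 => hT ⟨c1, c2, c3, c4⟩]; simp
        · rw [tri_eq_zero h₁ t31 t32 c3]; simp
      · rw [tri_eq_zero t20 t21 t22 c2]; simp
    · rw [tri_eq_zero h₄ t11 t12 c1]; simp

end
end QRecoupling

/-! ### The 12j coefficient as a rational sum in integer parameters -/

namespace QRecoupling
open Finset
section
variable {q : ℝ}

/-- Passes from the doubled intermediate spin n = 2x to i = (n - N)/2. It will be used with N =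
2(j₁+j₃), so that i = x - j₁ - j₃; the n of the other parity contribute nothing. -/
theorem sum_range_half {F : ℕ → ℝ} {g : ℤ → ℝ} {N : ℕ} {L : ℤ} (hL : L ≤ -N)
    (hFg : ∀ i : ℤ, i ≤ 0 → ∀ n : ℕ, (n : ℤ) = N + 2 * i → F n = g i)
    (hF : ∀ n : ℕ, ((N : ℤ) - n) % 2 = 1 → F n = 0) (hg : ∀ i : ℤ, N + 2 * i < 0 → g i = 0) :
    ∑ n ∈ range (N + 1), F n = ∑ i ∈ Icc L 0, g i := by
  symm
  rw [← sum_filter_of_ne (p := fun i => 0 ≤ N + 2 * i) (s := Icc L 0)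
    (fun i _ hi => by by_contra h; exact hi (hg i (by omega)))]
  refine sum_of_injOn (fun i => (N + 2 * i).toNat) ?_ ?_ ?_ ?_
  · intro i hi j hj hij
    simp only [coe_filter, mem_Icc, Set.mem_ofPred_eq] at hi hj
    simp only at hij
    omega
  · intro i hi
    simp only [coe_filter, mem_Icc, Set.mem_ofPred_eq] at hi
    simp only [coe_range, Set.mem_Iio]
    omega
  · intro n hn hn'
    rw [mem_range] at hn
    apply hF
    by_contra h
    apply hn'
    refine ⟨((n : ℤ) - N) / 2, ?_, ?_⟩
    · simp only [coe_filter, mem_Icc, Set.mem_ofPred_eq]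
      omega
    · simp only
      omega
  · intro i hi
    simp only [mem_filter, mem_Icc] at hi
    exact (hFg i (by omega) _ (by omega)).symm

/-- The summand of the `q`-`12j` coefficient of the second kind without the outer triangle
coefficients. -/
noncomputable def wTerm (q : ℝ) (a₁ a₃ b₁ b₂ b₃ m₁ m₂ m₃ m₄ m₅ m₆ m₇ i : ℤ) : ℝ :=
  qi q (2 * i + (a₁ + a₃ + 1)) *
    (fac q (a₃ + m₁ - m₂ + i) * fac q (a₁ - m₁ + m₂ + i) * fac q (b₁ - m₁ - m₂ - i) *
      fac q (b₁ - m₁ - m₂ + i + (a₁ + a₃ + 1))) *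
    (fac q (a₁ + i) * fac q (a₃ + i) * fac q (-i) * fac q (i + (a₁ + a₃ + 1))) *
    (fac q (a₃ + m₃ - m₄ + i) * fac q (a₁ - m₃ + m₄ + i) * fac q (b₂ - m₃ - m₄ - i) *
      fac q (b₂ - m₃ - m₄ + i + (a₁ + a₃ + 1))) *
    (fac q (a₁ - m₁ + m₂ + m₅ - m₆ + i) * fac q (a₃ + m₁ - m₂ + m₆ - m₅ + i) *
      fac q (b₁ - m₁ - m₂ - b₃ + m₅ + m₆ - i) *
      fac q (b₁ - m₁ - m₂ - b₃ + m₅ + m₆ + i + (a₁ + a₃ + 1))) *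
    (sixRed q (b₁ - m₁ - m₂ - i) (-i) (a₃ - m₂) (a₁ - m₁) (m₁ + i) (m₂ + i) *
    sixRed q (a₁ - m₃) (a₃ - m₄) (-i) (b₂ - m₃ - m₄ - i) (m₃ + i) (m₄ + i) *
    sixRed q (b₂ - m₃ - m₄ - i) (b₁ - m₁ - m₂ - b₃ + m₅ + m₆ - i)
      (a₃ + b₁ - b₃ - m₄ - m₂ + m₆ + m₃ - m₁ + m₅ - m₇) (a₁ + b₁ - 2 * m₁ - b₃ + 2 * m₅ - m₇)
      (m₇ - (b₁ - m₁ - m₂ - b₃ + m₅ + m₆) + i) (2 * m₁ - b₁ + b₃ - 2 * m₅ - m₃ + m₄ + m₇ + i) *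
    sixRed q (a₁ + b₁ - 2 * m₁ - b₃ + m₅) (a₃ + b₁ - 2 * m₂ - b₃ + m₆)
      (b₁ - m₁ - m₂ - b₃ + m₅ + m₆ - i) (b₁ - m₁ - m₂ - i) (b₃ - m₆ - (b₁ - m₁ - m₂) + i)
      (b₃ - m₅ - (b₁ - m₁ - m₂) + i))

/-- The triangles (k₁,k₂,x), (j₁,j₃,x), (k₃,k₄,x), (j₂,j₄,x) occur in two 6j coefficients each, so
their `tri` appear squared and become products of factorials. The remaining eight `tri` do not
depend on x. -/
theorem twelveJ_eq_sum_wTerm (hq : 0 < q) {j₁ j₂ j₃ j₄ l₁ l₂ l₃ l₄ k₁ k₂ k₃ k₄ : ℝ}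
    {a₁ a₃ b₁ b₂ b₃ m₁ m₂ m₃ m₄ m₅ m₆ m₇ L : ℤ} (hj₁ : 2 * j₁ = a₁) (hj₃ : 2 * j₃ = a₃)
    (hl₁ : 2 * l₁ = b₁) (hl₂ : 2 * l₂ = b₂) (hl₃ : 2 * l₃ = b₃) (hk₁ : j₁ + l₁ - k₁ = m₁)
    (hk₂ : j₃ + l₁ - k₂ = m₂) (hk₃ : j₁ + l₂ - k₃ = m₃) (hk₄ : j₃ + l₂ - k₄ = m₄)
    (hj₂ : j₂ + l₃ - k₁ = m₅) (hj₄ : j₄ + l₃ - k₂ = m₆) (hl₄ : j₂ + l₄ - k₃ = m₇)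
    (ha : 0 ≤ a₁ + a₃) (hL : L ≤ -(a₁ + a₃)) :
    twelveJ q j₁ j₂ j₃ j₄ l₁ l₂ l₃ l₄ k₁ k₂ k₃ k₄ =
      (-1) ^ (m₁ - m₃ + m₇ - m₅) *
        (tri q k₁ j₁ l₁ * tri q j₃ k₂ l₁ * tri q k₃ j₁ l₂ * tri q j₃ k₄ l₂ * tri q k₃ j₂ l₄ *
          tri q j₄ k₄ l₄ * tri q k₁ j₂ l₃ * tri q j₄ k₂ l₃) *
        ∑ i ∈ Icc L 0, wTerm q a₁ a₃ b₁ b₂ b₃ m₁ m₂ m₃ m₄ m₅ m₆ m₇ i := by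
  unfold twelveJ
  rw [sign_eq_zpow (n := m₁ - m₃ + m₇ - m₅) (by push_cast; linarith), mul_assoc]
  congr 1
  rw [mul_sum]
  have hN : ⌊2 * (j₁ + j₃)⌋₊ = (a₁ + a₃).toNat := by
    rw [show 2 * (j₁ + j₃) = ((a₁ + a₃ : ℤ) : ℝ) by push_cast; linarith, ← Int.floor_toNat,
      Int.floor_intCast]
  rw [hN]
  apply sum_range_half (by omega)
  · intro i hi n hn
    rw [Int.toNat_of_nonneg ha] at hn
    have hx : (n : ℝ) / 2 = j₁ + j₃ + i := by
      have : (n : ℝ) = a₁ + a₃ + 2 * i := by exact_mod_cast hn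
      linarith
    rw [hx]
    rw [sixJ_eq_tri_mul hq (a := k₁) (b := j₁) (e := l₁) (d := j₃) (c := k₂)
      (p₁ := b₁ - m₁ - m₂ - i) (p₂ := -i) (p₃ := a₃ - m₂) (p₄ := a₁ - m₁) (s₁ := m₁ + i)
      (s₂ := m₂ + i) (by push_cast; linarith) (by push_cast; linarith) (by push_cast; linarith)
      (by push_cast; linarith) (by push_cast; linarith) (by push_cast; linarith),
      sixJ_eq_tri_mul hq (a := k₃) (b := k₄) (d := j₃) (c := j₁) (f := l₂)
      (p₁ := a₁ - m₃) (p₂ := a₃ - m₄) (p₃ := -i) (p₄ := b₂ - m₃ - m₄ - i) (s₁ := m₃ + i)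
      (s₂ := m₄ + i) (by push_cast; linarith) (by push_cast; linarith) (by push_cast; linarith)
      (by push_cast; linarith) (by push_cast; linarith) (by push_cast; linarith),
      sixJ_eq_tri_mul hq (a := k₃) (b := j₂) (e := l₄) (d := j₄) (c := k₄)
      (p₁ := b₂ - m₃ - m₄ - i) (p₂ := b₁ - m₁ - m₂ - b₃ + m₅ + m₆ - i)
      (p₃ := a₃ + b₁ - b₃ - m₄ - m₂ + m₆ + m₃ - m₁ + m₅ - m₇)
      (p₄ := a₁ + b₁ - 2 * m₁ - b₃ + 2 * m₅ - m₇)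
      (s₁ := m₇ - (b₁ - m₁ - m₂ - b₃ + m₅ + m₆) + i)
      (s₂ := 2 * m₁ - b₁ + b₃ - 2 * m₅ - m₃ + m₄ + m₇ + i) (by push_cast; linarith)
      (by push_cast; linarith) (by push_cast; linarith)
      (by push_cast; linarith) (by push_cast; linarith) (by push_cast; linarith),
      sixJ_eq_tri_mul hq (a := k₁) (b := k₂) (d := j₄) (c := j₂) (f := l₃)
      (p₁ := a₁ + b₁ - 2 * m₁ - b₃ + m₅) (p₂ := a₃ + b₁ - 2 * m₂ - b₃ + m₆)
      (p₃ := b₁ - m₁ - m₂ - b₃ + m₅ + m₆ - i) (p₄ := b₁ - m₁ - m₂ - i)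
      (s₁ := b₃ - m₆ - (b₁ - m₁ - m₂) + i) (s₂ := b₃ - m₅ - (b₁ - m₁ - m₂) + i)
      (by push_cast; linarith) (by push_cast; linarith) (by push_cast; linarith)
      (by push_cast; linarith) (by push_cast; linarith) (by push_cast; linarith)]
    have e1 := tri_mul_self hq (a := k₁) (b := k₂) (c := j₁ + j₃ + i) (z := b₁ - m₁ - m₂ - i)
      (y := a₁ - m₁ + m₂ + i) (x := a₃ + m₁ - m₂ + i) (s := b₁ - m₁ - m₂ + i + (a₁ + a₃ + 1))
      (by push_cast; linarith) (by push_cast; linarith) (by push_cast; linarith) (by ring)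
    have e2 := tri_mul_self hq (a := j₃) (b := j₁) (c := j₁ + j₃ + i) (z := -i)
      (y := a₃ + i) (x := a₁ + i) (s := i + (a₁ + a₃ + 1))
      (by push_cast; linarith) (by push_cast; linarith) (by push_cast; linarith) (by ring)
    have e3 := tri_mul_self hq (a := k₃) (b := k₄) (c := j₁ + j₃ + i) (z := b₂ - m₃ - m₄ - i)
      (y := a₁ - m₃ + m₄ + i) (x := a₃ + m₃ - m₄ + i) (s := b₂ - m₃ - m₄ + i + (a₁ + a₃ + 1))
      (by push_cast; linarith) (by push_cast; linarith) (by push_cast; linarith) (by ring)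
    have e4 := tri_mul_self hq (a := j₄) (b := j₂) (c := j₁ + j₃ + i)
      (z := b₁ - m₁ - m₂ - b₃ + m₅ + m₆ - i)
      (y := a₃ + m₁ - m₂ + m₆ - m₅ + i) (x := a₁ - m₁ + m₂ + m₅ - m₆ + i)
      (s := b₁ - m₁ - m₂ - b₃ + m₅ + m₆ + i + (a₁ + a₃ + 1))
      (by push_cast; linarith) (by push_cast; linarith) (by push_cast; linarith) (by ring)
    have e5 : qNum q (n + 1) = qi q (2 * i + (a₁ + a₃ + 1)) := by
      unfold qi
      congr 1
      push_cast
      linarith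
    unfold wTerm
    rw [e5, ← e1, ← e2, ← e3, ← e4]
    ring
  · intro n hn
    have : ¬Triangle j₃ j₁ (n / 2) := by
      rintro ⟨-, -, -, ⟨k, hk⟩, -⟩
      have : (a₁ : ℝ) + a₃ + n = 2 * k := by linarith
      have : a₁ + a₃ + n = 2 * k := by exact_mod_cast this
      omega
    have h0 : sixJ q k₁ j₁ l₁ j₃ k₂ (n / 2) = 0 := by
      unfold sixJ
      rw [if_neg fun h => this h.2.2.2]
    rw [h0]; simp
  · intro i hi
    rw [Int.toNat_of_nonneg ha] at hi
    have : fac q (a₁ + i) * fac q (a₃ + i) = 0 := by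
      rcases lt_or_ge (a₁ + i) 0 with h | h
      · rw [fac_of_neg q h, zero_mul]
      · rw [fac_of_neg q (n := a₃ + i) (by omega), mul_zero]
    unfold wTerm
    rw [this]
    simp

end
end QRecoupling

/-! ### Asymmetric forms of 6j coefficients and x-sums of two of them -/

namespace QRecoupling
open Finset Polynomial Lagrange
section
variable {q : ℝ}

theorem sixRed_swap₁₂ (q : ℝ) (p₁ p₂ p₃ p₄ s₁ s₂ : ℤ) :
    sixRed q p₁ p₂ p₃ p₄ s₁ s₂ = sixRed q p₂ p₁ p₃ p₄ s₁ s₂ := by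
  unfold sixRed
  rw [racah_swap₁₂, add_comm p₂ p₁]
  ring

theorem sixRed_swap_pairs (q : ℝ) (p₁ p₂ p₃ p₄ s₁ s₂ : ℤ) :
    sixRed q p₁ p₂ p₃ p₄ s₁ s₂ = sixRed q p₃ p₄ p₁ p₂ s₁ s₂ := by
  unfold sixRed
  rw [racah_swap_pairs, show p₃ + p₄ + p₁ + p₂ = p₁ + p₂ + p₃ + p₄ by ring,
    show p₄ + p₁ + p₂ = p₁ + p₂ + p₄ by ring, show p₃ + p₁ + p₂ = p₁ + p₂ + p₃ by ring,
    show p₃ + p₄ + p₂ = p₂ + p₃ + p₄ by ring, show p₃ + p₄ + p₁ = p₁ + p₃ + p₄ by ring]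
  ring

theorem sixRed_swap₂₃ (q : ℝ) (p₁ p₂ p₃ p₄ s₁ s₂ : ℤ) :
    sixRed q p₁ p₂ p₃ p₄ s₁ s₂ = sixRed q p₁ p₃ p₂ p₄ s₁ s₂ := by
  unfold sixRed
  rw [racah_swap₂₃, show p₁ + p₃ + p₂ = p₁ + p₂ + p₃ by ring, add_comm p₃ p₂]
  ring

theorem sixRed_swap_s (q : ℝ) (p₁ p₂ p₃ p₄ s₁ s₂ : ℤ) :
    sixRed q p₁ p₂ p₃ p₄ s₁ s₂ = sixRed q p₁ p₂ p₃ p₄ s₂ s₁ := by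
  unfold sixRed
  rw [racah_swap_s]
  simp only [add_right_comm _ s₁ s₂]

/-- The sign that `racah_shift` produces is absorbed by the sign in `sixRed`, which is thus
invariant without any correction. -/
theorem sixRed_shift (q : ℝ) {p₁ p₂ p₃ p₄ s₁ s₂ p₁' p₂' p₃' p₄' s₁' s₂' : ℤ} (h₁ : p₁' = p₁ + s₂)
    (h₂ : p₂' = p₂ + s₂) (h₃ : p₃' = p₃ + s₂) (h₄ : p₄' = p₄ + s₂) (hs₁ : s₁' = s₁ - s₂)
    (hs₂ : s₂' = -s₂) : sixRed q p₁ p₂ p₃ p₄ s₁ s₂ = sixRed q p₁' p₂' p₃' p₄' s₁' s₂' := by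
  subst h₁ h₂ h₃ h₄ hs₁ hs₂
  unfold sixRed
  rw [racah_shift]
  have : (-1 : ℝ) ^ (p₁ + s₂ + (p₂ + s₂) + (p₃ + s₂) + (p₄ + s₂) + (s₁ - s₂) + -s₂) =
      (-1) ^ (p₁ + p₂ + p₃ + p₄ + s₁ + s₂) * (-1) ^ s₂ := by
    rw [← zpow_add₀ (by norm_num)]; congr 1; ring
  rw [this, show p₂ + s₂ + (p₃ + s₂) + (p₄ + s₂) + (s₁ - s₂) + -s₂ = p₂ + p₃ + p₄ + s₁ + s₂ by ring,
    show p₁ + s₂ + (p₃ + s₂) + (p₄ + s₂) + (s₁ - s₂) + -s₂ = p₁ + p₃ + p₄ + s₁ + s₂ by ring,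
    show p₁ + s₂ + (p₂ + s₂) + (p₄ + s₂) + (s₁ - s₂) + -s₂ = p₁ + p₂ + p₄ + s₁ + s₂ by ring,
    show p₁ + s₂ + (p₂ + s₂) + (p₃ + s₂) + (s₁ - s₂) + -s₂ = p₁ + p₂ + p₃ + s₁ + s₂ by ring]
  ring

theorem sixRed_eq_single (hq : 0 < q) {p₁ p₂ p₃ p₄ s₁ s₂ e t₂ t₃ t₄ r₂ r₃ r₄ s : ℤ} (hs₁ : s₁ = -p₁)
    (ht₂ : t₂ = p₃ + p₄ + s₂ + 1) (ht₃ : t₃ = p₂ + p₄ + s₂ + 1) (ht₄ : t₄ = p₂ + p₃ + s₂ + 1)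
    (hr₂ : r₂ = p₂ - p₁) (hr₃ : r₃ = p₃ - p₁) (hr₄ : r₄ = p₄ - p₁) (hs : s = s₂ + p₁)
    (he : (e - (p₁ + p₂ + p₃ + p₄ + s₂)) % 2 = 0) (h0 : 0 ≤ p₂ + p₃ + p₄ + s₂ + 1 - p₁) :
    sixRed q p₁ p₂ p₃ p₄ s₁ s₂ = (-1) ^ e *
      ((fac q p₁)⁻¹ * (fac q r₂)⁻¹ * (fac q r₃)⁻¹ * (fac q r₄)⁻¹ * (fac q s)⁻¹ * (fac q t₂)⁻¹ *
        (fac q t₃)⁻¹ * (fac q t₄)⁻¹) := by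
  unfold sixRed
  rw [racah_eq_single rfl hs₁, ← hr₂, ← hr₃, ← hr₄, ← hs,
    show p₁ + p₃ + p₄ + s₁ + s₂ + 1 = t₂ by omega, show p₁ + p₂ + p₄ + s₁ + s₂ + 1 = t₃ by omega,
    show p₁ + p₂ + p₃ + s₁ + s₂ + 1 = t₄ by omega,
    show p₂ + p₃ + p₄ + s₁ + s₂ + 1 = p₂ + p₃ + p₄ + s₂ + 1 - p₁ by omega]
  have := fac_ne_zero hq h0
  have he' : (-1 : ℝ) ^ e = (-1) ^ (p₁ + p₂ + p₃ + p₄ + s₁ + s₂) * (-1) ^ p₁ := by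
    rw [← zpow_add₀ (by norm_num)]
    apply neg_one_zpow_congr
    omega
  rw [he']
  simp only [div_eq_mul_inv, mul_inv]
  field_simp

theorem sixRed_eq_dSum (hq : 0 < q) {p₁ p₂ p₃ p₄ s₁ s₂ e u₁ u₂ u₃ v₁ v₂ v₃ v₄ r₁ r₂ t₃ t₄ : ℤ}
    (hu₁ : u₁ = p₃ + s₁) (hu₂ : u₂ = p₄ + s₁) (hu₃ : u₃ = p₁ + p₂ + s₂) (hv₁ : v₁ = p₁)
    (hv₂ : v₂ = p₂) (hv₃ : v₃ = s₁) (hv₄ : v₄ = p₃ + p₄ + s₁ + s₂ + 1) (hr₁ : r₁ = p₁ + s₂)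
    (hr₂ : r₂ = p₂ + s₂) (ht₃ : t₃ = p₁ + p₂ + p₄ + s₁ + s₂ + 1)
    (ht₄ : t₄ = p₁ + p₂ + p₃ + s₁ + s₂ + 1) (he : (e - (p₁ + p₂ + p₃ + p₄ + s₁ + s₂)) % 2 = 0)
    (h : 0 ≤ p₁ ∧ 0 ≤ p₂ ∧ 0 ≤ p₃ ∧ 0 ≤ p₄ ∧ 0 ≤ p₃ + s₁ ∧ 0 ≤ p₄ + s₁ ∧ 0 ≤ r₁ ∧ 0 ≤ r₂ ∧
      0 ≤ v₄) :
    sixRed q p₁ p₂ p₃ p₄ s₁ s₂ = (-1) ^ e * dSum q u₁ u₂ u₃ v₁ v₂ v₃ v₄ *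
      ((fac q u₁)⁻¹ * (fac q u₂)⁻¹ * (fac q r₁)⁻¹ * (fac q r₂)⁻¹ * (fac q p₃)⁻¹ * (fac q p₄)⁻¹ *
        (fac q t₃)⁻¹ * (fac q t₄)⁻¹) := by
  unfold sixRed
  rw [racah_eq_dSum hq hu₁ hu₂ hu₃ hv₁ hv₂ hv₃ hv₄ hr₁ hr₂ rfl rfl (by omega) (by omega) (by omega)
    (by omega) (by omega) (by omega) (by omega) (by omega) (by omega), ← ht₃, ← ht₄,
    neg_one_zpow_congr he, show p₂ + p₃ + p₄ + s₁ + s₂ + 1 = p₂ + v₄ by omega,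
    show p₁ + p₃ + p₄ + s₁ + s₂ + 1 = p₁ + v₄ by omega]
  have f1 := fac_ne_zero hq (show 0 ≤ p₂ + v₄ by omega)
  have f2 := fac_ne_zero hq (show 0 ≤ p₁ + v₄ by omega)
  simp only [div_eq_mul_inv, mul_inv]
  field_simp (disch := assumption)

/-- In the applications p₁, p₂ decrease and s₁, s₂ increase with x. Shifting the summation index by
s₁ leaves x only in v₃ and v₄, which is the form covered by `racahPoly_eval`. -/
theorem sixRed_eq_dSum_shift (hq : 0 < q)
    {p₁ p₂ p₃ p₄ s₁ s₂ e u₁ u₂ u₃ v₁ v₂ v₃ v₄ r₁ r₂ t₃ t₄ w₁ w₂ : ℤ}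
    (hu₁ : u₁ = p₃ + s₁) (hu₂ : u₂ = p₄ + s₁) (hr₁ : r₁ = p₁ + s₂) (hr₂ : r₂ = p₂ + s₂)
    (ht₃ : t₃ = p₁ + p₂ + p₄ + s₁ + s₂ + 1) (ht₄ : t₄ = p₁ + p₂ + p₃ + s₁ + s₂ + 1)
    (hw₁ : w₁ = p₃) (hw₂ : w₂ = p₄) (hu₃ : u₃ = p₁ + p₂ + s₁ + s₂) (hv₁ : v₁ = p₁ + s₁)
    (hv₂ : v₂ = p₂ + s₁) (hv₃ : v₃ = -s₁) (hv₄ : v₄ = p₃ + p₄ + s₂ + 1)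
    (he : (e - (p₁ + p₂ + p₃ + p₄ + s₂)) % 2 = 0)
    (h : 0 ≤ p₁ ∧ 0 ≤ p₂ ∧ 0 ≤ p₃ ∧ 0 ≤ p₄ ∧ 0 ≤ p₃ + s₁ ∧ 0 ≤ p₄ + s₁ ∧ 0 ≤ r₁ ∧ 0 ≤ r₂ ∧
      0 ≤ p₃ + p₄ + s₁ + s₂ + 1) :
    sixRed q p₁ p₂ p₃ p₄ s₁ s₂ = (-1) ^ e * dSum q w₁ w₂ u₃ v₁ v₂ v₃ v₄ *
      ((fac q u₁)⁻¹ * (fac q u₂)⁻¹ * (fac q r₁)⁻¹ * (fac q r₂)⁻¹ * (fac q p₃)⁻¹ * (fac q p₄)⁻¹ *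
        (fac q t₃)⁻¹ * (fac q t₄)⁻¹) := by
  rw [sixRed_eq_dSum hq hu₁ hu₂ rfl rfl rfl rfl rfl hr₁ hr₂ ht₃ ht₄
    (e := p₁ + p₂ + p₃ + p₄ + s₁ + s₂) (by simp) h,
    dSum_shift q (u₁' := w₁) (u₂' := w₂) (u₃' := u₃) (v₁' := v₁) (v₂' := v₂) (v₄' := v₄) (by omega)
      (by omega) (by omega) (by omega) (by omega) (by omega), ← hv₃]
  have : (-1 : ℝ) ^ e = (-1) ^ (p₁ + p₂ + p₃ + p₄ + s₁ + s₂) * (-1) ^ s₁ := by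
    rw [← zpow_add₀ (by norm_num)]
    apply neg_one_zpow_congr
    omega
  rw [this]
  ring

/-- Since L₂ + L₃ = 1 - σ, reflection carries the zeros of Q to an interval that ends just below L₂,
where those of P begin. Together they cover the symmetric interval on which nodes coincide. -/
theorem nodal_dvd_mul {σ L₂ R₂ L₃ R₃ B : ℤ} {P Q : ℝ[X]} (hP : nodal (Ico L₂ R₂) (nu q σ) ∣ P)
    (hQ : nodal (Ico L₃ R₃) (nu q σ) ∣ Q) (hL : L₂ + L₃ = 1 - σ) (h₂ : 1 - σ - R₂ ≤ B)
    (h₃ : 1 - σ - R₃ ≤ B) : nodal (Icc B (-σ - B)) (nu q σ) ∣ P * Q := by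
  have hrefl : nodal (Ico L₃ R₃) (nu q σ) = nodal (Ico (1 - σ - R₃) L₂) (nu q σ) := by
    unfold nodal
    refine prod_nbij' (fun y => -σ - y) (fun y => -σ - y) ?_ ?_ ?_ ?_ ?_
    · intro y hy; rw [mem_Ico] at *; omega
    · intro y hy; rw [mem_Ico] at *; omega
    · intro y _; ring
    · intro y _; ring
    · intro y _; rw [nu_reflect]
  have hsplit : nodal (Icc B (-σ - B)) (nu q σ) =
      nodal ((Icc B (-σ - B)).filter (fun y => L₂ ≤ y)) (nu q σ) *
        nodal ((Icc B (-σ - B)).filter (fun y => ¬ L₂ ≤ y)) (nu q σ) :=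
    (prod_filter_mul_prod_filter_not _ _ _).symm
  rw [hsplit]
  rw [hrefl] at hQ
  refine mul_dvd_mul (dvd_trans ?_ hP) (dvd_trans ?_ hQ)
  · refine prod_dvd_prod_of_subset _ _ _ fun y hy => ?_
    simp only [mem_filter, mem_Icc, mem_Ico] at *
    omega
  · refine prod_dvd_prod_of_subset _ _ _ fun y hy => ?_
    simp only [mem_filter, mem_Icc, mem_Ico] at *
    omega

/-- The first factor removes the nodes above M, and a Newton coefficient remains. If M < B - 1 it
contains the full nodal polynomial, and both sides are 0. -/
theorem divDiff_nodal_mul_nodal (hq : 0 < q) {σ B C K M : ℤ} (hC : C ≤ K) (hMK : M ≤ K)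
    (hM : M ≤ 0) (hB : 0 ≤ B + K + σ) :
    divDiff (Icc B 0) (nu q σ) (nodal (Ioc M 0) (nu q σ) * nodal (Ioc C K) (nu q σ)) =
      (-1) ^ (B + K - M - C) * fac q (K - M) * fac q (K - C) * fac q (B + K + σ) *
        ((fac q (M - B))⁻¹ * (fac q (C - B))⁻¹ * (fac q (B + K - M - C))⁻¹ *
          (fac q (M + C + σ))⁻¹) := by
  rcases lt_or_ge M (B - 1) with h | h
  · rw [fac_of_neg q (n := M - B) (by omega)]
    have hd : nodal (Icc B 0) (nu q σ) ∣ nodal (Ioc M 0) (nu q σ) * nodal (Ioc C K) (nu q σ) := by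
      refine Dvd.dvd.mul_right (prod_dvd_prod_of_subset _ _ _ fun y hy => ?_) _
      simp only [mem_Icc, mem_Ioc] at *
      omega
    rw [divDiff, (modByMonic_eq_zero_iff_dvd nodal_monic).2 hd]
    simp
  · have h1 : Icc B 0 = Icc B M ∪ Ioc M 0 := by
      ext y; simp only [mem_Icc, mem_union, mem_Ioc]; omega
    have h2 : Disjoint (Icc B M) (Ioc M 0) := by
      rw [disjoint_left]; intro y; simp only [mem_Icc, mem_Ioc]; omega
    rw [h1, divDiff_nodal_mul h2, divDiff_nodal_Ioc hq hC hMK]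
    rcases lt_or_ge (B + K - M - C) 0 with hn | hn
    · rw [fac_of_neg q hn]; simp
    · rw [poch_eq_fac hq (b := M + C + σ) (c := B + K + σ) (by ring) (by omega) hB]
      simp only [div_eq_mul_inv, mul_inv]
      ring

/-- The left side is a divided difference of the product of two Racah polynomials: the factorials
[-x]![x+σ]! belonging to the first cancel those of the Lagrange weight, and [K-x]![K+x+σ]! belong to
the second. Expanding both polynomials leaves divided differences of products of nodal polynomials.
-/
theorem sum_mul_dSum_mul_dSum (hq : 0 < q) {σ B K n₂ n₃ α₂ β₂ γ₂ m₂ α₃ β₃ γ₃ m₃ C₃ : ℤ}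
    (hn₂ : 0 ≤ n₂) (hn₃ : 0 ≤ n₃) (hK : K = m₂ - n₂) (hK' : K = C₃ + n₃) (hB : 0 ≤ B + σ)
    (hBK : 0 ≤ B + K + σ)
    (hdvd : nodal (Icc B (-σ - B)) (nu q σ) ∣ racahPoly q σ α₂ β₂ γ₂ m₂ (-n₂) n₂.toNat *
      racahPoly q σ α₃ β₃ γ₃ m₃ C₃ n₃.toNat) :
    ∑ x ∈ Icc B 0, (-1) ^ x * qi q (2 * x + σ) * (fac q (x + B + σ - 1) * (fac q (x - B))⁻¹) *
      (fac q (K - x) * fac q (K + x + σ)) * dSum q α₂ β₂ γ₂ n₂ m₂ (-n₂ - x) (-n₂ + x + σ) *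
      dSum q α₃ β₃ γ₃ n₃ m₃ (C₃ - x) (C₃ + x + σ) =
    ∑ w ∈ range (n₂.toNat + 1), ∑ z ∈ range (n₃.toNat + 1),
      (-1) ^ B * ((-1) ^ (w + z) * fac q (α₂ + w) * fac q (β₂ + w) * fac q (γ₂ - w) *
        fac q (α₃ + z) * fac q (β₃ + z) * fac q (γ₃ - z) * fac q (B + K + σ) *
        ((fac q w)⁻¹ * (fac q (n₂ - w))⁻¹ * (fac q z)⁻¹ * (fac q (m₃ - z))⁻¹ *
          (fac q (w - n₂ - B))⁻¹ * (fac q (C₃ + z - B))⁻¹ * (fac q (B + n₃ + n₂ - w - z))⁻¹ *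
          (fac q (w - n₂ + C₃ + z + σ))⁻¹)) := by
  lift n₂ to ℕ using hn₂
  lift n₃ to ℕ using hn₃
  simp only [Int.toNat_natCast] at *
  trans divDiff (Icc B 0) (nu q σ) (racahPoly q σ α₂ β₂ γ₂ m₂ (-n₂) n₂ *
    racahPoly q σ α₃ β₃ γ₃ m₃ C₃ n₃)
  · rw [divDiff_Icc_eq_sum hq (by omega) hdvd]
    refine sum_congr rfl fun x hx => ?_
    rw [mem_Icc] at hx
    rcases lt_or_ge (x + B + σ - 1) 0 with h1 | h1
    · rw [fac_of_neg q h1]; simp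
    have e : (racahPoly q σ α₂ β₂ γ₂ m₂ (-n₂) n₂).eval (nu q σ x) = fac q (0 - x) *
        fac q (x + 0 + σ) * dSum q α₂ β₂ γ₂ n₂ m₂ (-n₂ - x) (-n₂ + x + σ) := by
      rw [racahPoly_eval hq (by omega) (by omega), neg_add_cancel, zero_add, add_zero]
    rw [eval_mul, e]
    have f1 := fac_ne_zero hq (show 0 ≤ 0 - x by omega)
    have f2 := fac_ne_zero hq (show 0 ≤ x + 0 + σ by omega)
    have hs : (-1 : ℝ) ^ (0 - x) = (-1) ^ x := neg_one_zpow_congr (by omega)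
    rw [hs]
    -- For x > K the second polynomial cannot be evaluated by `racahPoly_eval`, but then the first
    -- 6j sum has no nonzero term, because K = m₂ - n₂.
    rcases le_or_gt x K with h2 | h2
    · rw [racahPoly_eval hq (by omega) (by omega), ← hK']
      field_simp
    · have : dSum q α₂ β₂ γ₂ n₂ m₂ (-n₂ - x) (-n₂ + x + σ) = 0 := by
        refine sum_eq_zero fun z _ => ?_
        by_contra h0
        have := dTerm_ne_zero h0
        omega
      rw [this]; simp
  · unfold racahPoly
    rw [sum_mul_sum, divDiff_sum]
    refine sum_congr rfl fun w hw => ?_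
    rw [divDiff_sum]
    refine sum_congr rfl fun z hz => ?_
    rw [mem_range] at hw hz
    -- The factor 1/[m₂-w]! of the polynomial is absent on the right. For w > m₂ the right side
    -- vanishes nevertheless: C₃+z-B and B+n₃+n₂-w-z add up to m₂-w, so one of them is negative.
    rcases lt_or_ge m₂ w with h | h
    · rw [fac_of_neg q (n := m₂ - w) (by omega)]
      have : fac q (C₃ + z - B) = 0 ∨ fac q ((w : ℤ) - n₂ - B) = 0 ∨
          fac q (B + n₃ + n₂ - w - z) = 0 := by
        simp only [fac_eq_zero_iff hq]; omega
      rcases this with h | h | h <;> rw [h] <;> simp [divDiff]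
    have key := divDiff_nodal_mul_nodal hq (σ := σ) (B := B) (C := C₃ + z) (K := K) (M := w - n₂)
      (by omega) (by omega) (by omega) hBK
    have hp : ∀ (a b : ℝ) (s t : ℕ) (P Q : ℝ[X]), (a • ((-1) ^ s * P) * b • ((-1) ^ t * Q) : ℝ[X]) =
        (a * b * ((-1) ^ s * (-1) ^ t)) • (P * Q) := by
      intro a b s t P Q
      simp only [smul_eq_C_mul, C_mul, C_pow, C_neg, C_1]
      ring
    rw [hp, divDiff_smul, ← hK', neg_add_cancel, show -(n₂ : ℤ) + w = w - n₂ by ring, key]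
    have f1 := fac_ne_zero hq (show 0 ≤ m₂ - w by omega)
    have f2 := fac_ne_zero hq (show 0 ≤ (n₃ : ℤ) - z by omega)
    have hsg : (-1 : ℝ) ^ (n₂ - w) * (-1) ^ (n₃ - z) * (-1) ^ (B + K - (w - n₂) - (C₃ + z)) =
        (-1) ^ B := by
      rw [← zpow_natCast, ← zpow_natCast, ← zpow_add₀ (by norm_num), ← zpow_add₀ (by norm_num)]
      apply neg_one_zpow_congr
      omega
    rw [show K - ((w : ℤ) - n₂) = m₂ - w by omega, show K - (C₃ + z) = n₃ - z by omega,
      ← hsg, pow_add, show B + (n₃ : ℤ) + n₂ - w - z = B + K - (w - n₂) - (C₃ + z) by omega,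
      show (w : ℤ) - n₂ + C₃ + z + σ = w - n₂ + (C₃ + z) + σ by ring]
    have g1 := mul_inv_cancel₀ f1
    have g2 := mul_inv_cancel₀ f2
    simp only [div_eq_mul_inv, mul_inv]
    linear_combination ((-1) ^ w * fac q (α₂ + w) * fac q (β₂ + w) * fac q (γ₂ - w) *
      ((fac q w)⁻¹ * (fac q (n₂ - w))⁻¹) * ((-1) ^ z * fac q (α₃ + z) * fac q (β₃ + z) *
      fac q (γ₃ - z) * ((fac q z)⁻¹ * (fac q (m₃ - z))⁻¹)) * ((-1) ^ (n₂ - w) * (-1) ^ (n₃ - z)) *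
      ((-1) ^ (B + K - (w - n₂) - (C₃ + z)) * fac q (B + K + σ) * ((fac q (w - n₂ - B))⁻¹ *
      (fac q (C₃ + z - B))⁻¹ * (fac q (B + K - (w - n₂) - (C₃ + z)))⁻¹ *
      (fac q (w - n₂ + (C₃ + z) + σ))⁻¹))) *
      (g1 * (fac q (n₃ - z) * (fac q (n₃ - z))⁻¹) + g2)

end
end QRecoupling

/-! ### One stretched triangle: the triple sum -/

namespace QRecoupling
open Finset Polynomial Lagrange
section
variable {q : ℝ}

/-- The triangular conditions of the `12j` coefficient in terms of integer parameters. -/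
def IntAdmissible (a₁ a₃ b₁ b₂ b₃ m₁ m₂ m₃ m₄ m₅ m₆ m₇ : ℤ) : Prop :=
  (0 ≤ m₁ ∧ 0 ≤ a₁ - m₁ ∧ 0 ≤ b₁ - m₁) ∧ (0 ≤ m₂ ∧ 0 ≤ a₃ - m₂ ∧ 0 ≤ b₁ - m₂) ∧
  (0 ≤ m₃ ∧ 0 ≤ a₁ - m₃ ∧ 0 ≤ b₂ - m₃) ∧ (0 ≤ m₄ ∧ 0 ≤ a₃ - m₄ ∧ 0 ≤ b₂ - m₄) ∧
  (0 ≤ m₅ ∧ 0 ≤ a₁ + b₁ - 2 * m₁ - b₃ + m₅ ∧ 0 ≤ b₃ - m₅) ∧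
  (0 ≤ m₆ ∧ 0 ≤ a₃ + b₁ - 2 * m₂ - b₃ + m₆ ∧ 0 ≤ b₃ - m₆) ∧
  (0 ≤ m₇ ∧ 0 ≤ a₁ + b₁ - 2 * m₁ - b₃ + 2 * m₅ - m₇ ∧
    0 ≤ b₂ - b₁ + b₃ - 2 * m₃ + 2 * m₁ - 2 * m₅ + m₇) ∧
  (0 ≤ m₁ - m₂ - m₃ + m₄ - m₅ + m₆ + m₇ ∧
    0 ≤ a₃ + b₁ - b₃ - m₄ - m₂ + m₆ + m₃ - m₁ + m₅ - m₇ ∧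
    0 ≤ b₂ - m₄ - b₁ + b₃ + m₂ - m₆ - m₃ + m₁ - m₅ + m₇)

/-- The triangular conditions that contain the intermediate spin. -/
def InRange (a₁ a₃ b₁ b₂ b₃ m₁ m₂ m₃ m₄ m₅ m₆ i : ℤ) : Prop :=
  (0 ≤ a₃ + m₁ - m₂ + i ∧ 0 ≤ a₁ - m₁ + m₂ + i ∧ 0 ≤ b₁ - m₁ - m₂ - i) ∧
    (0 ≤ a₁ + i ∧ 0 ≤ a₃ + i ∧ 0 ≤ -i) ∧
    (0 ≤ a₃ + m₃ - m₄ + i ∧ 0 ≤ a₁ - m₃ + m₄ + i ∧ 0 ≤ b₂ - m₃ - m₄ - i) ∧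
    (0 ≤ a₁ - m₁ + m₂ + m₅ - m₆ + i ∧ 0 ≤ a₃ + m₁ - m₂ + m₆ - m₅ + i ∧
      0 ≤ b₁ - m₁ - m₂ - b₃ + m₅ + m₆ - i)

theorem wTerm_eq_zero (hq : 0 < q) {a₁ a₃ b₁ b₂ b₃ m₁ m₂ m₃ m₄ m₅ m₆ m₇ i : ℤ}
    (h : ¬InRange a₁ a₃ b₁ b₂ b₃ m₁ m₂ m₃ m₄ m₅ m₆ i) :
    wTerm q a₁ a₃ b₁ b₂ b₃ m₁ m₂ m₃ m₄ m₅ m₆ m₇ i = 0 := by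
  by_contra h0
  unfold wTerm at h0
  simp only [mul_eq_zero, not_or, fac_eq_zero_iff hq] at h0
  unfold InRange at h
  omega

theorem mul_sum_range_mul_sum_range (X : ℝ) (f g : ℕ → ℝ) (m n : ℕ) :
    X * (∑ w ∈ range m, f w) * (∑ u ∈ range n, g u) =
      ∑ w ∈ range m, ∑ u ∈ range n, X * f w * g u := by
  simp only [mul_assoc, sum_mul_sum]
  simp only [mul_sum]

theorem sum_range_toNat_congr {f : ℤ → ℝ} {m n : ℤ} (hm : 0 ≤ m) (hn : 0 ≤ n)
    (h : ∀ z : ℤ, 0 ≤ z → f z ≠ 0 → z ≤ m ∧ z ≤ n) :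
    ∑ z ∈ range (m.toNat + 1), f z = ∑ z ∈ range (n.toNat + 1), f z := by
  have key : ∀ k : ℤ, min m n ≤ k → ∑ z ∈ range (k.toNat + 1), f z =
      ∑ z ∈ range ((min m n).toNat + 1), f z := by
    intro k hk
    symm
    apply sum_subset
    · intro z hz; rw [mem_range] at *; omega
    · intro z hz hz'
      rw [mem_range] at hz hz'
      by_contra h0
      have := h z (by omega) h0
      omega
  rw [key m (by omega), key n (by omega)]

variable {a₁ a₃ b₁ b₂ b₃ m₂ m₃ m₄ m₅ m₆ m₇ : ℤ}

/-- Since m₁ = 0, the first 6j coefficient is a single term. The second and third take the form of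
Racah polynomials; in the fourth x enters only through u₃ and v₃, so that each of its summands
supplies the lower half of a Lagrange weight. -/
theorem wTerm_stretched_of_pos (hq : 0 < q)
    (h : IntAdmissible a₁ a₃ b₁ b₂ b₃ 0 m₂ m₃ m₄ m₅ m₆ m₇) {i : ℤ}
    (hi : InRange a₁ a₃ b₁ b₂ b₃ 0 m₂ m₃ m₄ m₅ m₆ i) :
    wTerm q a₁ a₃ b₁ b₂ b₃ 0 m₂ m₃ m₄ m₅ m₆ m₇ i = (-1) ^ (m₂ + m₄ + m₅ + m₆ + m₇ + b₁ + b₃) *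
      ((fac q (b₁ - m₂))⁻¹ * (fac q m₂)⁻¹ * (fac q (b₁ + a₁ + 1))⁻¹ * (fac q (b₁ - m₂ + a₃ + 1))⁻¹ *
        ((fac q m₃)⁻¹ * (fac q (b₂ - m₄))⁻¹ * (fac q (a₁ - m₃))⁻¹ * (fac q (a₃ - m₄))⁻¹ *
          (fac q (b₂ - m₄ + a₃ + 1))⁻¹ * (fac q (a₁ + b₂ - m₃ + 1))⁻¹) *
        ((fac q (b₂ - b₁ + b₃ - 2 * m₃ - 2 * m₅ + m₇))⁻¹ *
          (fac q (-m₂ - m₃ + m₄ - m₅ + m₆ + m₇))⁻¹ *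
          (fac q (a₃ + b₁ - b₃ - m₄ - m₂ + m₆ + m₃ + m₅ - m₇))⁻¹ *
          (fac q (a₁ + b₁ - b₃ + 2 * m₅ - m₇))⁻¹ * (fac q (a₁ + b₂ - 2 * m₃ + m₇ + 1))⁻¹ *
          (fac q (a₃ + b₂ - m₄ - m₂ + m₆ - m₅ - m₃ + m₇ + 1))⁻¹) *
        ((fac q m₅)⁻¹ * (fac q (b₃ - m₆))⁻¹)) *
      ((-1) ^ i * qi q (2 * i + (a₁ + a₃ + 1)) *
        (fac q (b₂ - m₃ - m₄ - i) * fac q (b₂ - m₃ - m₄ + i + (a₁ + a₃ + 1))) *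
        dSum q (a₁ - m₃) (a₃ - m₄) b₂ m₄ (b₂ - m₃) (-m₄ - i) (-m₄ + i + (a₁ + a₃ + 1)) *
        dSum q (a₃ + b₁ - b₃ - m₄ - m₂ + m₆ + m₃ + m₅ - m₇) (a₁ + b₁ - b₃ + 2 * m₅ - m₇)
          (b₂ - b₁ + b₃ - 2 * m₃ - 2 * m₅ + 2 * m₇) (b₂ - m₄ - b₁ + b₃ + m₂ - m₆ - m₃ - m₅ + m₇) m₇
          (b₁ - m₂ - b₃ + m₅ + m₆ - m₇ - i)
          (b₁ - m₂ - b₃ + m₅ + m₆ - m₇ + i + (a₁ + a₃ + 1)) *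
        dSum q m₅ (b₃ - m₆) (b₁ - m₂ - b₃ + m₆ + (a₁ + a₃ + 1) - 1 + i) (a₁ + b₁ - b₃ + m₅)
          (a₃ + b₁ - 2 * m₂ - b₃ + m₆) (-(b₁ - m₂ - b₃ + m₆) + i) (b₃ + 1)) := by
  unfold IntAdmissible at h
  unfold InRange at hi
  unfold wTerm
  simp only [sub_zero, add_zero, mul_zero, zero_add, zero_sub] at h ⊢
  rw [sixRed_swap₁₂ q (b₁ - m₂ - i),
    sixRed_eq_single hq (e := b₁ - m₂ + a₁ + a₃ + i) (t₂ := i + (a₁ + a₃ + 1))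
      (t₃ := b₁ + a₁ + 1) (t₄ := b₁ - m₂ + a₃ + 1) (r₂ := b₁ - m₂) (r₃ := a₃ - m₂ + i)
      (r₄ := a₁ + i) (s := m₂) (by ring) (by ring) (by ring) (by ring) (by ring) (by ring) (by ring)
      (by ring) (by omega) (by omega),
    sixRed_swap_pairs q (a₁ - m₃), sixRed_swap_s q (-i) _ (a₁ - m₃),
    sixRed_eq_dSum_shift hq (e := b₂ - m₃ + a₁ + a₃ + i) (w₁ := a₁ - m₃) (w₂ := a₃ - m₄) (u₃ := b₂)
      (v₁ := m₄) (v₂ := b₂ - m₃) (v₃ := -m₄ - i) (v₄ := -m₄ + i + (a₁ + a₃ + 1))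
      (u₁ := a₁ - m₃ + m₄ + i) (u₂ := a₃ + i) (r₁ := m₃) (r₂ := b₂ - m₄)
      (t₃ := b₂ - m₄ + a₃ + 1) (t₄ := a₁ + b₂ - m₃ + 1) (by ring) (by ring) (by ring) (by ring)
      (by ring) (by ring) (by ring) (by ring) (by ring) (by ring) (by ring) (by ring) (by ring)
      (by omega) (by omega),
    sixRed_eq_dSum_shift hq (p₁ := b₂ - m₃ - m₄ - i)
      (e := b₂ + a₁ + a₃ + m₃ + m₄ + m₇ + i) (w₁ := a₃ + b₁ - b₃ - m₄ - m₂ + m₆ + m₃ + m₅ - m₇)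
      (w₂ := a₁ + b₁ - b₃ + 2 * m₅ - m₇) (u₃ := b₂ - b₁ + b₃ - 2 * m₃ - 2 * m₅ + 2 * m₇)
      (v₁ := b₂ - m₄ - b₁ + b₃ + m₂ - m₆ - m₃ - m₅ + m₇) (v₂ := m₇)
      (v₃ := b₁ - m₂ - b₃ + m₅ + m₆ - m₇ - i)
      (v₄ := b₁ - m₂ - b₃ + m₅ + m₆ - m₇ + i + (a₁ + a₃ + 1))
      (u₁ := a₃ + m₃ - m₄ + i) (u₂ := a₁ + m₂ + m₅ - m₆ + i)
      (r₁ := b₂ - b₁ + b₃ - 2 * m₃ - 2 * m₅ + m₇) (r₂ := -m₂ - m₃ + m₄ - m₅ + m₆ + m₇)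
      (t₃ := a₁ + b₂ - 2 * m₃ + m₇ + 1) (t₄ := a₃ + b₂ - m₄ - m₂ + m₆ - m₅ - m₃ + m₇ + 1)
      (by ring) (by ring) (by ring) (by ring)
      (by ring) (by ring) (by ring) (by ring) (by ring) (by ring) (by ring) (by ring) (by ring)
      (by omega) (by omega),
    sixRed_eq_dSum hq (p₁ := a₁ + b₁ - b₃ + m₅)
      (e := a₁ + a₃ + b₃ + m₅ + m₆) (u₁ := m₅) (u₂ := b₃ - m₆)
      (u₃ := b₁ - m₂ - b₃ + m₆ + (a₁ + a₃ + 1) - 1 + i) (v₁ := a₁ + b₁ - b₃ + m₅)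
      (v₂ := a₃ + b₁ - 2 * m₂ - b₃ + m₆) (v₃ := -(b₁ - m₂ - b₃ + m₆) + i) (v₄ := b₃ + 1)
      (r₁ := a₁ + m₂ + i) (r₂ := a₃ - m₂ + m₆ - m₅ + i) (t₃ := b₁ - m₂ + i + (a₁ + a₃ + 1))
      (t₄ := b₁ - m₂ - b₃ + m₅ + m₆ + i + (a₁ + a₃ + 1))
      (by ring) (by ring) (by ring) (by ring) (by ring) (by ring) (by ring) (by ring) (by ring)
      (by ring) (by ring) (by omega) (by omega)]
  have hsg : (-1 : ℝ) ^ (b₁ - m₂ + a₁ + a₃ + i) * (-1) ^ (b₂ - m₃ + a₁ + a₃ + i) *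
      (-1) ^ (b₂ + a₁ + a₃ + m₃ + m₄ + m₇ + i) * (-1) ^ (a₁ + a₃ + b₃ + m₅ + m₆) =
      (-1) ^ (m₂ + m₄ + m₅ + m₆ + m₇ + b₁ + b₃) * (-1) ^ i := by
    simp only [← zpow_add₀ (show (-1 : ℝ) ≠ 0 by norm_num)]
    apply neg_one_zpow_congr
    omega
  have hpairs := prod_fac_mul_inv hq [a₃ - m₂ + i, a₁ + m₂ + i, b₁ - m₂ - i, a₁ + i, a₃ + i, -i,
      a₃ + m₃ - m₄ + i, a₁ - m₃ + m₄ + i, a₁ + m₂ + m₅ - m₆ + i, a₃ - m₂ + m₆ - m₅ + i,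
      b₁ - m₂ - b₃ + m₅ + m₆ - i, i + (a₁ + a₃ + 1), b₁ - m₂ + i + (a₁ + a₃ + 1),
      b₁ - m₂ - b₃ + m₅ + m₆ + i + (a₁ + a₃ + 1)]
    (by simp only [List.Forall]; omega)
  simp only [List.map_cons, List.map_nil, List.prod_cons, List.prod_nil] at hpairs
  have hg : ∀ E C s a b c d e : ℝ, E * s * (C * (a * b * c * d * e)) =
      E * C * (s * a * b * c * d * e) := by intros; ring
  refine Eq.trans ?_ (hg _ _ _ _ _ _ _ _)
  refine Eq.trans ?_ (congrArg (· * _) hsg)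
  refine Eq.trans ?_ ((congrArg (· * _) hpairs).trans (one_mul _))
  ring

/-- The summand of the triple sum for one stretched triangle. -/
noncomputable def tripleTerm (q : ℝ) (a₁ a₃ b₁ b₂ b₃ m₂ m₃ m₄ m₅ m₆ m₇ z₁ z₃ z₄ : ℤ) : ℝ :=
  (-1) ^ (z₁ + z₃) * fac q (b₂ - m₄ + z₁) * fac q (a₁ - m₃ + m₄ - z₁) * fac q (a₃ - z₁) *
    fac q (a₃ + b₁ - b₃ - m₄ - m₂ + m₆ + m₃ + m₅ - m₇ + z₃) *
    fac q (a₁ + b₁ - b₃ + 2 * m₅ - m₇ + z₃) *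
    fac q (b₂ - b₁ + b₃ - 2 * m₃ - 2 * m₅ + 2 * m₇ - z₃) *
    fac q (m₅ + z₄) * fac q (b₃ - m₆ + z₄) *
    fac q (a₁ + a₃ + 1 + b₁ - m₂ - b₃ + m₆ + b₂ - m₃ - m₄ - z₄) *
    ((fac q z₁)⁻¹ * (fac q z₃)⁻¹ * (fac q z₄)⁻¹ * (fac q (m₄ - z₁))⁻¹ *
      (fac q (m₂ - m₆ + b₃ - b₁ + z₄ - z₁))⁻¹ * (fac q (m₇ - z₃))⁻¹ *
      (fac q (a₁ + a₃ + 1 + b₁ - m₂ - b₃ + m₅ + m₆ - m₇ - z₁ + z₃))⁻¹ *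
      (fac q (b₂ - m₃ - m₄ - m₅ + m₇ + z₁ - z₃ - z₄))⁻¹ * (fac q (m₅ - m₇ + z₃ + z₄))⁻¹ *
      (fac q (a₁ + b₁ - b₃ + m₅ - z₄))⁻¹ * (fac q (a₃ + b₁ - 2 * m₂ - b₃ + m₆ - z₄))⁻¹ *
      (fac q (b₃ + 1 + z₄))⁻¹)

/-- Interpolation needs the summand on a full lattice interval, also where a triangular condition on
x fails. There the right side vanishes: a nonzero value would keep i off the zeros of both Racah
polynomials and inside all factorial ranges, which together imply the triangular conditions. -/
theorem wTerm_stretched (hq : 0 < q)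
    (h : IntAdmissible a₁ a₃ b₁ b₂ b₃ 0 m₂ m₃ m₄ m₅ m₆ m₇) {i : ℤ} (hi : i ≤ 0) :
    wTerm q a₁ a₃ b₁ b₂ b₃ 0 m₂ m₃ m₄ m₅ m₆ m₇ i = (-1) ^ (m₂ + m₄ + m₅ + m₆ + m₇ + b₁ + b₃) *
      ((fac q (b₁ - m₂))⁻¹ * (fac q m₂)⁻¹ * (fac q (b₁ + a₁ + 1))⁻¹ * (fac q (b₁ - m₂ + a₃ + 1))⁻¹ *
        ((fac q m₃)⁻¹ * (fac q (b₂ - m₄))⁻¹ * (fac q (a₁ - m₃))⁻¹ * (fac q (a₃ - m₄))⁻¹ *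
          (fac q (b₂ - m₄ + a₃ + 1))⁻¹ * (fac q (a₁ + b₂ - m₃ + 1))⁻¹) *
        ((fac q (b₂ - b₁ + b₃ - 2 * m₃ - 2 * m₅ + m₇))⁻¹ *
          (fac q (-m₂ - m₃ + m₄ - m₅ + m₆ + m₇))⁻¹ *
          (fac q (a₃ + b₁ - b₃ - m₄ - m₂ + m₆ + m₃ + m₅ - m₇))⁻¹ *
          (fac q (a₁ + b₁ - b₃ + 2 * m₅ - m₇))⁻¹ * (fac q (a₁ + b₂ - 2 * m₃ + m₇ + 1))⁻¹ *
          (fac q (a₃ + b₂ - m₄ - m₂ + m₆ - m₅ - m₃ + m₇ + 1))⁻¹) *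
        ((fac q m₅)⁻¹ * (fac q (b₃ - m₆))⁻¹)) *
      ((-1) ^ i * qi q (2 * i + (a₁ + a₃ + 1)) *
        (fac q (b₂ - m₃ - m₄ - i) * fac q (b₂ - m₃ - m₄ + i + (a₁ + a₃ + 1))) *
        dSum q (a₁ - m₃) (a₃ - m₄) b₂ m₄ (b₂ - m₃) (-m₄ - i) (-m₄ + i + (a₁ + a₃ + 1)) *
        dSum q (a₃ + b₁ - b₃ - m₄ - m₂ + m₆ + m₃ + m₅ - m₇) (a₁ + b₁ - b₃ + 2 * m₅ - m₇)
          (b₂ - b₁ + b₃ - 2 * m₃ - 2 * m₅ + 2 * m₇) (b₂ - m₄ - b₁ + b₃ + m₂ - m₆ - m₃ - m₅ + m₇) m₇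
          (b₁ - m₂ - b₃ + m₅ + m₆ - m₇ - i)
          (b₁ - m₂ - b₃ + m₅ + m₆ - m₇ + i + (a₁ + a₃ + 1)) *
        dSum q m₅ (b₃ - m₆) (b₁ - m₂ - b₃ + m₆ + (a₁ + a₃ + 1) - 1 + i) (a₁ + b₁ - b₃ + m₅)
          (a₃ + b₁ - 2 * m₂ - b₃ + m₆) (-(b₁ - m₂ - b₃ + m₆) + i) (b₃ + 1)) := by
  by_cases hp : InRange a₁ a₃ b₁ b₂ b₃ 0 m₂ m₃ m₄ m₅ m₆ i
  · exact wTerm_stretched_of_pos hq h hp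
  rw [wTerm_eq_zero hq hp]
  symm
  by_contra h0
  apply hp
  unfold InRange
  unfold IntAdmissible at h
  rw [mul_eq_zero, not_or] at h0
  obtain ⟨-, h0⟩ := h0
  rw [mul_eq_zero, not_or, mul_eq_zero, not_or, mul_eq_zero, not_or] at h0
  obtain ⟨⟨⟨h1, h2⟩, h3⟩, h4⟩ := h0
  simp only [mul_eq_zero, not_or, fac_eq_zero_iff hq] at h1
  obtain ⟨y, hy⟩ := exists_dTerm_ne_zero h4
  have hy := dTerm_ne_zero hy
  have e2 : (racahPoly q (a₁ + a₃ + 1) (a₁ - m₃) (a₃ - m₄) b₂ (b₂ - m₃) (-m₄) m₄.toNat).eval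
      (nu q (a₁ + a₃ + 1) i) ≠ 0 := by
    rw [racahPoly_eval hq (by omega) (by omega), Int.toNat_of_nonneg (by omega)]
    exact mul_ne_zero (mul_ne_zero (fac_ne_zero hq (by omega)) (fac_ne_zero hq (by omega))) h2
  have e3 : (racahPoly q (a₁ + a₃ + 1) (a₃ + b₁ - b₃ - m₄ - m₂ + m₆ + m₃ + m₅ - m₇)
      (a₁ + b₁ - b₃ + 2 * m₅ - m₇) (b₂ - b₁ + b₃ - 2 * m₃ - 2 * m₅ + 2 * m₇) m₇
      (b₁ - m₂ - b₃ + m₅ + m₆ - m₇)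
      (b₂ - m₄ - b₁ + b₃ + m₂ - m₆ - m₃ - m₅ + m₇).toNat).eval (nu q (a₁ + a₃ + 1) i) ≠ 0 := by
    rw [racahPoly_eval hq (by omega) (by omega), Int.toNat_of_nonneg (by omega)]
    exact mul_ne_zero (mul_ne_zero (fac_ne_zero hq (by omega)) (fac_ne_zero hq (by omega))) h3
  have e2' := mt (racahPoly_eval_eq_zero hq (L := m₃ - m₄ - a₁) (R := -a₁) (by omega) (by omega)
    (by omega) (by omega) (by omega) (by omega) (by omega) (by omega)) e2
  have e3' := mt (racahPoly_eval_eq_zero hq (L := m₄ - m₃ - a₃) (R := m₅ - m₆ + m₂ - a₃) (by omega)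
    (by omega) (by omega) (by omega) (by omega) (by omega) (by omega) (by omega)) e3
  -- A nonzero summand of the third 6j sum gives the upper bound i ≤ b₁ - m₂ - b₃ + m₅ + m₆, that is
  -- x ≤ j₂ + j₄.
  have h3' : ∃ z : ℕ, (z : ℤ) ≤ m₇ ∧ 0 ≤ b₁ - m₂ - b₃ + m₅ + m₆ - m₇ - i + z := by
    by_contra! hn
    refine h3 (sum_eq_zero fun z _ => ?_)
    by_contra hz
    have := dTerm_ne_zero hz
    have := hn z
    omega
  omega

theorem tripleTerm_ne_zero (hq : 0 < q) {z₁ z₃ z₄ : ℤ}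
    (h : tripleTerm q a₁ a₃ b₁ b₂ b₃ m₂ m₃ m₄ m₅ m₆ m₇ z₁ z₃ z₄ ≠ 0) :
    (0 ≤ z₁ ∧ 0 ≤ z₃ ∧ 0 ≤ z₄ ∧ z₁ ≤ m₄ ∧ z₃ ≤ m₇) ∧ 0 ≤ m₂ - m₆ + b₃ - b₁ + z₄ - z₁ ∧
      0 ≤ b₂ - m₃ - m₄ - m₅ + m₇ + z₁ - z₃ - z₄ ∧ 0 ≤ m₅ - m₇ + z₃ + z₄ ∧
      z₄ ≤ a₁ + b₁ - b₃ + m₅ ∧ z₄ ≤ a₃ + b₁ - 2 * m₂ - b₃ + m₆ := by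
  unfold tripleTerm at h
  simp only [ne_eq, mul_eq_zero, not_or, inv_eq_zero, fac_eq_zero_iff hq] at h
  omega

/-- The constant factor of the triple sum. -/
noncomputable def stretchedConst (q : ℝ) (a₁ a₃ b₁ b₂ b₃ m₂ m₃ m₄ m₅ m₆ m₇ : ℤ) : ℝ :=
      ((fac q (b₁ - m₂))⁻¹ * (fac q m₂)⁻¹ * (fac q (b₁ + a₁ + 1))⁻¹ * (fac q (b₁ - m₂ + a₃ + 1))⁻¹ *
        ((fac q m₃)⁻¹ * (fac q (b₂ - m₄))⁻¹ * (fac q (a₁ - m₃))⁻¹ * (fac q (a₃ - m₄))⁻¹ *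
          (fac q (b₂ - m₄ + a₃ + 1))⁻¹ * (fac q (a₁ + b₂ - m₃ + 1))⁻¹) *
        ((fac q (b₂ - b₁ + b₃ - 2 * m₃ - 2 * m₅ + m₇))⁻¹ *
          (fac q (-m₂ - m₃ + m₄ - m₅ + m₆ + m₇))⁻¹ *
          (fac q (a₃ + b₁ - b₃ - m₄ - m₂ + m₆ + m₃ + m₅ - m₇))⁻¹ *
          (fac q (a₁ + b₁ - b₃ + 2 * m₅ - m₇))⁻¹ * (fac q (a₁ + b₂ - 2 * m₃ + m₇ + 1))⁻¹ *
          (fac q (a₃ + b₂ - m₄ - m₂ + m₆ - m₅ - m₃ + m₇ + 1))⁻¹) *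
        ((fac q m₅)⁻¹ * (fac q (b₃ - m₆))⁻¹))

theorem sum_wTerm_stretched (hq : 0 < q)
    (h : IntAdmissible a₁ a₃ b₁ b₂ b₃ 0 m₂ m₃ m₄ m₅ m₆ m₇) {L : ℤ} (hL : L ≤ -(a₁ + a₃)) :
    ∑ i ∈ Icc L 0, wTerm q a₁ a₃ b₁ b₂ b₃ 0 m₂ m₃ m₄ m₅ m₆ m₇ i =
      (-1) ^ (m₅ + m₇) * stretchedConst q a₁ a₃ b₁ b₂ b₃ m₂ m₃ m₄ m₅ m₆ m₇ *
      ∑ z₁ ∈ range (m₄.toNat + 1), ∑ z₃ ∈ range (m₇.toNat + 1),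
        ∑ z₄ ∈ range ((a₁ + b₁ - b₃ + m₅).toNat + 1),
          tripleTerm q a₁ a₃ b₁ b₂ b₃ m₂ m₃ m₄ m₅ m₆ m₇ z₁ z₃ z₄ := by
  rw [sum_congr rfl fun i hi => wTerm_stretched hq h (mem_Icc.1 hi).2, ← mul_sum]
  have hsg : (-1 : ℝ) ^ (m₂ + m₄ + m₅ + m₆ + m₇ + b₁ + b₃) =
      (-1) ^ (m₅ + m₇) * (-1) ^ (m₂ + m₄ + m₆ + b₁ + b₃) := by
    rw [← zpow_add₀ (by norm_num)]; congr 1; ring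
  rw [hsg, mul_assoc ((-1 : ℝ) ^ (m₅ + m₇)), mul_comm ((-1 : ℝ) ^ (m₂ + m₄ + m₆ + b₁ + b₃)),
    ← mul_assoc, mul_assoc _ ((-1 : ℝ) ^ (m₂ + m₄ + m₆ + b₁ + b₃))]
  unfold stretchedConst
  congr 1
  unfold IntAdmissible at h
  simp only [sum_comm (s := range (m₇.toNat + 1))]
  rw [sum_comm (s := range (m₄.toNat + 1))]
  have hd : ∀ i : ℤ, dSum q m₅ (b₃ - m₆) (b₁ - m₂ - b₃ + m₆ + (a₁ + a₃ + 1) - 1 + i)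
      (a₁ + b₁ - b₃ + m₅) (a₃ + b₁ - 2 * m₂ - b₃ + m₆) (-(b₁ - m₂ - b₃ + m₆) + i) (b₃ + 1) =
      ∑ y ∈ range ((a₁ + b₁ - b₃ + m₅).toNat + 1), dTerm q m₅ (b₃ - m₆)
        (b₁ - m₂ - b₃ + m₆ + (a₁ + a₃ + 1) - 1 + i) (a₁ + b₁ - b₃ + m₅)
        (a₃ + b₁ - 2 * m₂ - b₃ + m₆) (-(b₁ - m₂ - b₃ + m₆) + i) (b₃ + 1) y := fun i => rfl
  simp only [hd]
  rw [sum_congr rfl fun i _ => mul_sum _ _ _, sum_comm, mul_sum]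
  refine sum_congr rfl fun y hy => ?_
  rw [mem_range] at hy
  rcases lt_or_ge (a₃ + b₁ - 2 * m₂ - b₃ + m₆) y with hy2 | hy2
  · rw [sum_eq_zero, sum_eq_zero]
    · simp
    · intro z _
      refine sum_eq_zero fun w _ => ?_
      by_contra h0
      have := tripleTerm_ne_zero hq h0
      omega
    · intro i _
      unfold dTerm
      rw [fac_of_neg q (n := a₃ + b₁ - 2 * m₂ - b₃ + m₆ - y) (by omega)]
      simp
  -- For a fixed index y of the fourth 6j sum, x occurs in its summand only as [x+B+σ-1]!/[x-B]!;
  -- hence B is the lower end of the interpolation interval.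
  set B : ℤ := b₁ - m₂ - b₃ + m₆ - y with hB
  set c : ℝ := (-1) ^ y * fac q (m₅ + y) * fac q (b₃ - m₆ + y) * ((fac q y)⁻¹ *
    (fac q (a₁ + b₁ - b₃ + m₅ - y))⁻¹ * (fac q (a₃ + b₁ - 2 * m₂ - b₃ + m₆ - y))⁻¹ *
    (fac q (b₃ + 1 + y))⁻¹) with hc
  have core := sum_mul_dSum_mul_dSum hq (σ := a₁ + a₃ + 1) (B := B) (K := b₂ - m₃ - m₄) (n₂ := m₄)
    (n₃ := b₂ - m₄ - b₁ + b₃ + m₂ - m₆ - m₃ - m₅ + m₇) (α₂ := a₁ - m₃) (β₂ := a₃ - m₄) (γ₂ := b₂)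
    (m₂ := b₂ - m₃) (α₃ := a₃ + b₁ - b₃ - m₄ - m₂ + m₆ + m₃ + m₅ - m₇)
    (β₃ := a₁ + b₁ - b₃ + 2 * m₅ - m₇) (γ₃ := b₂ - b₁ + b₃ - 2 * m₃ - 2 * m₅ + 2 * m₇) (m₃ := m₇)
    (C₃ := b₁ - m₂ - b₃ + m₅ + m₆ - m₇) (by omega) (by omega) (by omega) (by omega) (by omega)
    (by omega) (nodal_dvd_mul (L₂ := m₃ - m₄ - a₁) (R₂ := -a₁) (L₃ := m₄ - m₃ - a₃)
      (R₃ := m₅ - m₆ + m₂ - a₃)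
      (nodal_dvd_racahPoly hq (by omega) (by omega) (by omega) (by omega) (by omega) (by omega)
        (by omega) (by omega))
      (nodal_dvd_racahPoly hq (by omega) (by omega) (by omega) (by omega) (by omega) (by omega)
        (by omega) (by omega)) (by omega) (by omega) (by omega))
  trans (-1) ^ (m₂ + m₄ + m₆ + b₁ + b₃) * (c * ∑ x ∈ Icc B 0, (-1) ^ x * qi q (2 * x + (a₁ + a₃ + 1)) *
      (fac q (x + B + (a₁ + a₃ + 1) - 1) * (fac q (x - B))⁻¹) *
      (fac q (b₂ - m₃ - m₄ - x) * fac q (b₂ - m₃ - m₄ + x + (a₁ + a₃ + 1))) *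
      dSum q (a₁ - m₃) (a₃ - m₄) b₂ m₄ (b₂ - m₃) (-m₄ - x) (-m₄ + x + (a₁ + a₃ + 1)) *
        dSum q (a₃ + b₁ - b₃ - m₄ - m₂ + m₆ + m₃ + m₅ - m₇) (a₁ + b₁ - b₃ + 2 * m₅ - m₇)
          (b₂ - b₁ + b₃ - 2 * m₃ - 2 * m₅ + 2 * m₇) (b₂ - m₄ - b₁ + b₃ + m₂ - m₆ - m₃ - m₅ + m₇) m₇
          (b₁ - m₂ - b₃ + m₅ + m₆ - m₇ - x)
          (b₁ - m₂ - b₃ + m₅ + m₆ - m₇ + x + (a₁ + a₃ + 1)))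
  · congr 1
    rw [mul_sum]
    have hterm : ∀ i : ℤ, dTerm q m₅ (b₃ - m₆)
        (b₁ - m₂ - b₃ + m₆ + (a₁ + a₃ + 1) - 1 + i) (a₁ + b₁ - b₃ + m₅)
        (a₃ + b₁ - 2 * m₂ - b₃ + m₆) (-(b₁ - m₂ - b₃ + m₆) + i) (b₃ + 1) y =
        c * (fac q (i + B + (a₁ + a₃ + 1) - 1) * (fac q (i - B))⁻¹) := by
      intro i
      rw [hc, dTerm, show b₁ - m₂ - b₃ + m₆ + (a₁ + a₃ + 1) - 1 + i - y =
        i + B + (a₁ + a₃ + 1) - 1 by omega, show -(b₁ - m₂ - b₃ + m₆) + i + y = i - B by omega,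
        zpow_natCast]
      simp only [div_eq_mul_inv, mul_inv]
      ring
    rw [sum_congr rfl fun i _ => congrArg _ (hterm i)]
    -- The summand is supported on points of both intervals, starting at L and at B, so either may
    -- serve as the range.
    have hsub : ∀ L' ≤ max L B, ∀ f : ℤ → ℝ, (∀ i, f i ≠ 0 → 0 ≤ i - B ∧
        0 ≤ i + B + (a₁ + a₃ + 1) - 1) → ∑ i ∈ Icc (max L B) 0, f i = ∑ i ∈ Icc L' 0, f i := by
      intro L' hL' f hf
      apply sum_subset (Icc_subset_Icc hL' le_rfl)
      intro i hi hi'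
      by_contra h0
      have := hf i h0
      rw [mem_Icc] at hi hi'
      omega
    rw [← hsub L (le_max_left _ _), ← hsub B (le_max_right _ _)]
    · refine sum_congr rfl fun i _ => ?_
      ring
    · intro i h0
      simp only [ne_eq, mul_eq_zero, not_or, inv_eq_zero, fac_eq_zero_iff hq] at h0
      omega
    · intro i h0
      simp only [ne_eq, mul_eq_zero, not_or, inv_eq_zero, fac_eq_zero_iff hq] at h0
      omega
  -- The index z₁ of the triple sum counts the index of the second 6j sum from its upper end m₄.
  rw [core, mul_sum, mul_sum, ← sum_range_reflect]
  refine sum_congr rfl fun z hz => ?_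
  rw [mem_range] at hz
  rw [← sum_range_toNat_congr (n := m₇)
    (m := b₂ - m₄ - b₁ + b₃ + m₂ - m₆ - m₃ - m₅ + m₇)
    (f := fun w => tripleTerm q a₁ a₃ b₁ b₂ b₃ m₂ m₃ m₄ m₅ m₆ m₇ z w y) (by omega) (by omega)
    (fun w _ h0 => by have := tripleTerm_ne_zero hq h0; omega), mul_sum, mul_sum]
  refine sum_congr rfl fun w hw => ?_
  have hz' : ((m₄.toNat + 1 - 1 - z : ℕ) : ℤ) = m₄ - z := by omega
  rw [hz']
  have hsg : (-1 : ℝ) ^ (m₂ + m₄ + m₆ + b₁ + b₃) * (-1) ^ y * (-1) ^ B *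
      (-1) ^ (m₄.toNat + 1 - 1 - z + w) = (-1) ^ ((z : ℤ) + w) := by
    rw [← zpow_natCast, ← zpow_natCast]
    simp only [← zpow_add₀ (show (-1 : ℝ) ≠ 0 by norm_num)]
    apply neg_one_zpow_congr
    push_cast
    omega
  unfold tripleTerm
  rw [hc, show a₁ - m₃ + (m₄ - z) = a₁ - m₃ + m₄ - z by ring,
    show a₃ - m₄ + (m₄ - z) = a₃ - z by ring, show b₂ - (m₄ - z) = b₂ - m₄ + z by ring,
    show B + (b₂ - m₃ - m₄) + (a₁ + a₃ + 1) =
      a₁ + a₃ + 1 + b₁ - m₂ - b₃ + m₆ + b₂ - m₃ - m₄ - y by omega,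
    show m₄ - (m₄ - (z : ℤ)) = z by ring,
    show m₄ - (z : ℤ) - m₄ - B = m₂ - m₆ + b₃ - b₁ + y - z by omega,
    show b₁ - m₂ - b₃ + m₅ + m₆ - m₇ + w - B = m₅ - m₇ + w + y by omega,
    show B + (b₂ - m₄ - b₁ + b₃ + m₂ - m₆ - m₃ - m₅ + m₇) + m₄ - (m₄ - z) - w =
      b₂ - m₃ - m₄ - m₅ + m₇ + z - w - y by omega,
    show m₄ - (z : ℤ) - m₄ + (b₁ - m₂ - b₃ + m₅ + m₆ - m₇) + w + (a₁ + a₃ + 1) =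
      a₁ + a₃ + 1 + b₁ - m₂ - b₃ + m₅ + m₆ - m₇ - z + w by omega]
  simp only [mul_assoc] at hsg ⊢
  rw [← hsg]
  ring

end
end QRecoupling

/-! ### Translation between spins and integer parameters -/

namespace QRecoupling
open Finset
section
variable {q : ℝ}

/-- The spins of a `12j` coefficient in terms of integer parameters. -/
def HasParams (j₁ j₂ j₃ j₄ l₁ l₂ l₃ l₄ k₁ k₂ k₃ k₄ : ℝ)
    (a₁ a₃ b₁ b₂ b₃ m₁ m₂ m₃ m₄ m₅ m₆ m₇ : ℤ) : Prop :=
  (2 * j₁ = a₁ ∧ 2 * j₃ = a₃ ∧ 2 * l₁ = b₁ ∧ 2 * l₂ = b₂ ∧ 2 * l₃ = b₃) ∧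
    j₁ + l₁ - k₁ = m₁ ∧ j₃ + l₁ - k₂ = m₂ ∧ j₁ + l₂ - k₃ = m₃ ∧ j₃ + l₂ - k₄ = m₄ ∧
    j₂ + l₃ - k₁ = m₅ ∧ j₄ + l₃ - k₂ = m₆ ∧ j₂ + l₄ - k₃ = m₇

theorem Triangle.exists_int {a b c : ℝ} (h : Triangle a b c) :
    (∃ n : ℤ, 2 * a = n) ∧ (∃ n : ℤ, 2 * b = n) ∧ ∃ n : ℤ, a + b - c = n := by
  obtain ⟨⟨x, hx⟩, ⟨y, hy⟩, ⟨z, hz⟩, ⟨s, hs⟩, -⟩ := h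
  refine ⟨⟨x, ?_⟩, ⟨y, ?_⟩, ⟨s - z, ?_⟩⟩ <;> push_cast <;> linarith

/-- Five doubled spins and seven excesses determine all twelve spins. The eighth excess j₄ + l₄ - k₄
is then m₁ - m₂ - m₃ + m₄ - m₅ + m₆ + m₇. -/
theorem Admissible.exists_params {j₁ j₂ j₃ j₄ l₁ l₂ l₃ l₄ k₁ k₂ k₃ k₄ : ℝ}
    (h : Admissible j₁ j₂ j₃ j₄ l₁ l₂ l₃ l₄ k₁ k₂ k₃ k₄) :
    ∃ a₁ a₃ b₁ b₂ b₃ m₁ m₂ m₃ m₄ m₅ m₆ m₇ : ℤ,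
      HasParams j₁ j₂ j₃ j₄ l₁ l₂ l₃ l₄ k₁ k₂ k₃ k₄ a₁ a₃ b₁ b₂ b₃ m₁ m₂ m₃ m₄ m₅ m₆ m₇ ∧
      IntAdmissible a₁ a₃ b₁ b₂ b₃ m₁ m₂ m₃ m₄ m₅ m₆ m₇ := by
  obtain ⟨t1, t2, t3, t4, t5, t6, t7, t8⟩ := h
  obtain ⟨⟨a₁, ha₁⟩, ⟨b₁, hb₁⟩, ⟨m₁, hm₁⟩⟩ := t1.exists_int
  obtain ⟨⟨a₃, ha₃⟩, -, ⟨m₂, hm₂⟩⟩ := t2.exists_int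
  obtain ⟨-, ⟨b₂, hb₂⟩, ⟨m₃, hm₃⟩⟩ := t3.exists_int
  obtain ⟨-, -, ⟨m₄, hm₄⟩⟩ := t4.exists_int
  obtain ⟨-, ⟨b₃, hb₃⟩, ⟨m₅, hm₅⟩⟩ := t5.exists_int
  obtain ⟨-, -, ⟨m₆, hm₆⟩⟩ := t6.exists_int
  obtain ⟨-, -, ⟨m₇, hm₇⟩⟩ := t7.exists_int
  refine ⟨a₁, a₃, b₁, b₂, b₃, m₁, m₂, m₃, m₄, m₅, m₆, m₇,
    ⟨⟨ha₁, ha₃, hb₁, hb₂, hb₃⟩, hm₁, hm₂, hm₃, hm₄, hm₅, hm₆, hm₇⟩, ?_⟩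
  have s1 := (triangle_iff (x := b₁ - m₁) (y := a₁ - m₁) (z := m₁) hm₁ (by push_cast; linarith)
    (by push_cast; linarith)).1 t1
  have s2 := (triangle_iff (x := b₁ - m₂) (y := a₃ - m₂) (z := m₂) hm₂ (by push_cast; linarith)
    (by push_cast; linarith)).1 t2
  have s3 := (triangle_iff (x := b₂ - m₃) (y := a₁ - m₃) (z := m₃) hm₃ (by push_cast; linarith)
    (by push_cast; linarith)).1 t3
  have s4 := (triangle_iff (x := b₂ - m₄) (y := a₃ - m₄) (z := m₄) hm₄ (by push_cast; linarith)
    (by push_cast; linarith)).1 t4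
  have s5 := (triangle_iff (x := b₃ - m₅) (y := a₁ + b₁ - 2 * m₁ - b₃ + m₅) (z := m₅) hm₅
    (by push_cast; linarith) (by push_cast; linarith)).1 t5
  have s6 := (triangle_iff (x := b₃ - m₆) (y := a₃ + b₁ - 2 * m₂ - b₃ + m₆) (z := m₆) hm₆
    (by push_cast; linarith) (by push_cast; linarith)).1 t6
  have s7 := (triangle_iff (x := b₂ - b₁ + b₃ - 2 * m₃ + 2 * m₁ - 2 * m₅ + m₇)
    (y := a₁ + b₁ - 2 * m₁ - b₃ + 2 * m₅ - m₇) (z := m₇) hm₇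
    (by push_cast; linarith) (by push_cast; linarith)).1 t7
  have s8 := (triangle_iff (x := b₂ - m₄ - b₁ + b₃ + m₂ - m₆ - m₃ + m₁ - m₅ + m₇)
    (y := a₃ + b₁ - b₃ - m₄ - m₂ + m₆ + m₃ - m₁ + m₅ - m₇)
    (z := m₁ - m₂ - m₃ + m₄ - m₅ + m₆ + m₇) (by push_cast; linarith)
    (by push_cast; linarith) (by push_cast; linarith)).1 t8
  unfold IntAdmissible
  omega

theorem natFloor_eq_toNat {x : ℝ} {n : ℤ} (h : x = n) : ⌊x⌋₊ = n.toNat := by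
  rw [h, ← Int.floor_toNat, Int.floor_intCast]

/-- Serves to compare two products written in the same order and grouping factor by factor; each
pair of factors is then settled by linear arithmetic in its argument. -/
theorem mul_congr {a b c d : ℝ} (h : a = c) (h' : b = d) : a * b = c * d := by rw [h, h']

theorem neg_one_pow_eq_zpow {m : ℕ} {n : ℤ} (h : (m : ℤ) = n) : (-1 : ℝ) ^ m = (-1) ^ n := by
  rw [← h, zpow_natCast]

theorem tri_stretched (hq : 0 < q) {a b c : ℝ} {x y s : ℤ} (hx : 2 * a = x) (hy : 2 * b = y)
    (hc : c = a + b) (hs : s = x + y + 1) :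
    tri q a b c * tri q a b c = fac q x * fac q y * fac q s := by
  rw [tri_mul_self hq (x := y) (y := x) (z := 0) (s := s) (by push_cast; linarith)
    (by linarith) (by linarith) (by omega), fac_zero]
  ring

theorem tri_reverse (q a b c : ℝ) : tri q a b c = tri q c b a := by
  rw [tri_rotate, tri_swap]

theorem tri_nonneg (q a b c : ℝ) : 0 ≤ tri q a b c := Real.sqrt_nonneg _

/-- The square root in the formulas for a stretched triangle. -/
theorem sqrt_stretched (hq : 0 < q) {a b c : ℝ} {x y s : ℤ} (hx : 2 * a = x) (hy : 2 * b = y)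
    (hc : c = a + b) (hs : s = x + y + 1) (hx0 : 0 ≤ x) (hy0 : 0 ≤ y) :
    √(qFac q (2 * a) * qFac q (2 * b) / qFac q (2 * c + 1)) = tri q a b c * (fac q s)⁻¹ := by
  have hs' : 2 * c + 1 = s := by rw [hs, hc]; push_cast; linarith
  rw [qFac_eq_fac q hx, qFac_eq_fac q hy, qFac_eq_fac q hs']
  have f1 := fac_pos hq hx0
  have f2 := fac_pos hq hy0
  have f3 := fac_pos hq (show 0 ≤ s by omega)
  have := tri_stretched hq hx hy hc hs
  have := tri_nonneg q a b c
  rw [Real.sqrt_eq_iff_mul_self_eq (by positivity) (by positivity)]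
  field_simp
  linarith

variable {j₁ j₂ j₃ j₄ l₁ l₂ l₃ l₄ k₁ k₂ k₃ k₄ : ℝ} {a₁ a₃ b₁ b₂ b₃ m₁ m₂ m₃ m₄ m₅ m₆ m₇ : ℤ}

theorem twelveJ_eq_tripleSum (hq : 0 < q)
    (hp : HasParams j₁ j₂ j₃ j₄ l₁ l₂ l₃ l₄ k₁ k₂ k₃ k₄ a₁ a₃ b₁ b₂ b₃ 0 m₂ m₃ m₄ m₅ m₆ m₇)
    (h : IntAdmissible a₁ a₃ b₁ b₂ b₃ 0 m₂ m₃ m₄ m₅ m₆ m₇) :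
    twelveJ q j₁ j₂ j₃ j₄ l₁ l₂ l₃ l₄ k₁ k₂ k₃ k₄ =
      (-1) ^ m₃ *
        (tri q j₁ l₁ k₁ * tri q l₁ k₂ j₃ * tri q j₁ l₂ k₃ * tri q k₄ j₃ l₂ * tri q k₃ j₂ l₄ *
          tri q j₄ k₄ l₄ * tri q k₁ j₂ l₃ * tri q j₄ k₂ l₃) *
        stretchedConst q a₁ a₃ b₁ b₂ b₃ m₂ m₃ m₄ m₅ m₆ m₇ *
      ∑ z₁ ∈ range (m₄.toNat + 1), ∑ z₃ ∈ range (m₇.toNat + 1),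
        ∑ z₄ ∈ range ((a₁ + b₁ - b₃ + m₅).toNat + 1),
          tripleTerm q a₁ a₃ b₁ b₂ b₃ m₂ m₃ m₄ m₅ m₆ m₇ z₁ z₃ z₄ := by
  have h' := h
  unfold IntAdmissible at h'
  obtain ⟨⟨hj₁, hj₃, hl₁, hl₂, hl₃⟩, hk₁, hk₂, hk₃, hk₄, hj₂, hj₄, hl₄⟩ := hp
  rw [twelveJ_eq_sum_wTerm hq hj₁ hj₃ hl₁ hl₂ hl₃ hk₁ hk₂ hk₃ hk₄ hj₂ hj₄ hl₄ (L := -(a₁ + a₃))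
    (by omega) le_rfl, sum_wTerm_stretched hq h le_rfl,
    show (-1 : ℝ) ^ m₃ = (-1) ^ (0 - m₃ + m₇ - m₅) * (-1) ^ (m₅ + m₇) by
      rw [← zpow_add₀ (by norm_num)]; exact neg_one_zpow_congr (by omega),
    tri_rotate q k₁ j₁ l₁, tri_rotate q l₁ k₂ j₃, tri_swap q k₂ j₃ l₁, tri_rotate q k₃ j₁ l₂,
    tri_swap q k₄ j₃ l₂]
  ring

theorem HasParams.inv_nab (hq : 0 < q)
    (hp : HasParams j₁ j₂ j₃ j₄ l₁ l₂ l₃ l₄ k₁ k₂ k₃ k₄ a₁ a₃ b₁ b₂ b₃ 0 m₂ m₃ m₄ m₅ m₆ m₇)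
    (h : IntAdmissible a₁ a₃ b₁ b₂ b₃ 0 m₂ m₃ m₄ m₅ m₆ m₇) :
    (nab q j₁ l₂ k₃)⁻¹ = tri q j₁ l₂ k₃ *
      ((fac q (a₁ - m₃))⁻¹ * (fac q m₃)⁻¹ * (fac q (a₁ + b₂ - m₃ + 1))⁻¹) ∧
    (nab q k₄ j₃ l₂)⁻¹ = tri q k₄ j₃ l₂ *
      ((fac q (b₂ - m₄))⁻¹ * (fac q (a₃ - m₄))⁻¹ * (fac q (b₂ - m₄ + a₃ + 1))⁻¹) ∧
    (nab q k₃ j₂ l₄)⁻¹ = tri q k₃ j₂ l₄ * ((fac q (b₂ - b₁ + b₃ - 2 * m₃ - 2 * m₅ + m₇))⁻¹ *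
      (fac q (a₁ + b₁ - b₃ + 2 * m₅ - m₇))⁻¹ * (fac q (a₁ + b₂ - 2 * m₃ + m₇ + 1))⁻¹) ∧
    (nab q j₄ k₄ l₄)⁻¹ = tri q j₄ k₄ l₄ * ((fac q (-m₂ - m₃ + m₄ - m₅ + m₆ + m₇))⁻¹ *
      (fac q (a₃ + b₁ - b₃ - m₄ - m₂ + m₆ + m₃ + m₅ - m₇))⁻¹ *
      (fac q (a₃ + b₂ - m₄ - m₂ + m₆ - m₅ - m₃ + m₇ + 1))⁻¹) ∧
    (nab q l₁ k₂ j₃)⁻¹ = tri q l₁ k₂ j₃ *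
      ((fac q m₂)⁻¹ * (fac q (b₁ - m₂))⁻¹ * (fac q (b₁ - m₂ + a₃ + 1))⁻¹) := by
  unfold IntAdmissible at h
  obtain ⟨⟨hj₁, hj₃, hl₁, hl₂, hl₃⟩, hk₁, hk₂, hk₃, hk₄, hj₂, hj₄, hl₄⟩ := hp
  rw [Int.cast_zero] at hk₁
  refine ⟨inv_nab_eq hq (x := b₂ - m₃) (by linarith) (by push_cast; linarith)
      (by push_cast; linarith) (by ring) (by omega),
    inv_nab_eq hq (x := m₄) (by push_cast; linarith) (by push_cast; linarith) (by linarith)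
      (by ring) (by omega),
    inv_nab_eq hq (x := m₇) (by push_cast; linarith) (by push_cast; linarith) (by linarith)
      (by ring) (by omega),
    inv_nab_eq hq (x := b₂ - m₄ - b₁ + b₃ + m₂ - m₆ - m₃ - m₅ + m₇) (by push_cast; linarith)
      (by push_cast; linarith) (by push_cast; linarith) (by ring) (by omega),
    inv_nab_eq hq (x := a₃ - m₂) (by push_cast; linarith) (by linarith) (by push_cast; linarith)
      (by ring) (by omega)⟩

theorem twelveJ_stretched (hq : 0 < q)
    (h : Admissible j₁ j₂ j₃ j₄ l₁ l₂ l₃ l₄ k₁ k₂ k₃ k₄) (hk : k₁ = j₁ + l₁) :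
    twelveJ q j₁ j₂ j₃ j₄ l₁ l₂ l₃ l₄ k₁ k₂ k₃ k₄ =
        sign (j₁ + l₂ - k₃) * nab q k₁ j₂ l₃ * nab q j₄ k₂ l₃ /
          (nab q j₁ l₂ k₃ * nab q k₄ j₃ l₂ * nab q k₃ j₂ l₄ * nab q j₄ k₄ l₄ * nab q l₁ k₂ j₃) *
        √(qFac q (2 * l₁) * qFac q (2 * j₁) / qFac q (2 * k₁ + 1)) *
        ∑ z₁ ∈ Finset.range (⌊l₂ + j₃ - k₄⌋₊ + 1), ∑ z₃ ∈ Finset.range (⌊j₂ - k₃ + l₄⌋₊ + 1),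
          ∑ z₄ ∈ Finset.range (⌊k₁ + j₂ - l₃⌋₊ + 1),
          (-1) ^ (z₁ + z₃) * qFac q (l₂ - j₃ + k₄ + z₁) * qFac q (j₁ + j₃ + k₃ - k₄ - z₁)
            * qFac q (2 * j₃ - z₁) * qFac q (j₄ + k₄ - l₄ + z₃) * qFac q (j₂ + k₃ - l₄ + z₃)
            * qFac q (2 * l₄ - z₃) * qFac q (j₂ + l₃ - k₁ + z₄) * qFac q (k₂ + l₃ - j₄ + z₄)
            * qFac q (k₁ + k₃ + k₄ + j₄ - l₃ - z₄ + 1) /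
          (qFac q z₁ * qFac q z₃ * qFac q z₄ * qFac q (l₂ + j₃ - k₄ - z₁)
            * qFac q (j₃ - j₄ - l₁ + l₃ + z₄ - z₁) * qFac q (j₂ - k₃ + l₄ - z₃)
            * qFac q (k₃ + j₁ + j₃ + j₄ - l₄ - z₁ + z₃ + 1)
            * qFac q (k₄ + l₁ - l₃ + l₄ - j₃ + z₁ - z₃ - z₄)
            * qFac q (k₃ - k₁ + l₃ - l₄ + z₃ + z₄) * qFac q (k₁ + j₂ - l₃ - z₄)
            * qFac q (k₂ - l₃ + j₄ - z₄) * qFac q (2 * l₃ + z₄ + 1)) := by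
  obtain ⟨a₁, a₃, b₁, b₂, b₃, m₁, m₂, m₃, m₄, m₅, m₆, m₇, hp, hA⟩ := h.exists_params
  obtain rfl : m₁ = 0 := by
    have : (m₁ : ℝ) = 0 := by obtain ⟨-, h1, -⟩ := hp; linarith
    exact_mod_cast this
  rw [twelveJ_eq_tripleSum hq hp hA]
  have hA' := hA
  have hp' := hp
  unfold IntAdmissible at hA'
  obtain ⟨⟨hj₁, hj₃, hl₁, hl₂, hl₃⟩, hk₁, hk₂, hk₃, hk₄, hj₂, hj₄, hl₄⟩ := hp'
  congr 1
  · rw [mul_comm (qFac q (2 * l₁)), sqrt_stretched hq hj₁ hl₁ hk (s := b₁ + a₁ + 1) (by ring)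
      (by omega) (by omega), sign_eq_zpow hk₃,
      nab_eq_tri_div hq (show j₂ + l₃ - k₁ = m₅ by linarith),
      nab_eq_tri_div hq (show k₂ + l₃ - j₄ = (b₃ - m₆ : ℤ) by push_cast; linarith)]
    obtain ⟨e1, e2, e3, e4, e5⟩ := hp.inv_nab hq hA
    simp only [div_eq_mul_inv, mul_inv, e1, e2, e3, e4, e5]
    unfold stretchedConst
    ring
  · rw [natFloor_eq_toNat (show l₂ + j₃ - k₄ = m₄ by linarith),
      natFloor_eq_toNat (show j₂ - k₃ + l₄ = m₇ by linarith),
      natFloor_eq_toNat (show k₁ + j₂ - l₃ = (a₁ + b₁ - b₃ + m₅ : ℤ) by push_cast; linarith)]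
    refine sum_congr rfl fun z₁ _ => sum_congr rfl fun z₃ _ => sum_congr rfl fun z₄ _ => ?_
    symm
    unfold tripleTerm
    simp only [div_eq_mul_inv, mul_inv]
    repeat' apply mul_congr
    · exact neg_one_pow_eq_zpow (by push_cast; rfl)
    all_goals first
      | rfl
      | exact qFac_eq_fac q (by push_cast; linarith)
      | exact congrArg _ (qFac_eq_fac q (by push_cast; linarith))

end
end QRecoupling

/-! ### A second stretched triangle in the triple sum: the remote and the first antipode case -/

namespace QRecoupling
open Finset
section
variable {q : ℝ}

/-- The point z₀ need not lie in the range; if it does not, f z₀ = 0 and every term vanishes. -/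
theorem sum_range_toNat_eq_single {f : ℤ → ℝ} {m z₀ : ℤ}
    (h : ∀ z : ℤ, f z ≠ 0 → z = z₀ ∧ 0 ≤ z ∧ z ≤ m) :
    ∑ z ∈ range (m.toNat + 1), f z = f z₀ := by
  by_cases h0 : f z₀ = 0
  · rw [h0]
    refine sum_eq_zero fun z _ => ?_
    by_contra hz
    exact hz ((h z hz).1 ▸ h0)
  · have h1 := h z₀ h0
    rw [sum_eq_single_of_mem z₀.toNat (by rw [mem_range]; omega), Int.toNat_of_nonneg h1.2.1]
    intro z _ hz
    by_contra hz'
    have := h z hz'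
    omega

theorem sqrt_stretched₂ (hq : 0 < q) {a b c a' b' c' : ℝ} {x y s x' y' s' : ℤ} (hx : 2 * a = x)
    (hy : 2 * b = y) (hc : c = a + b) (hs : s = x + y + 1) (hx' : 2 * a' = x') (hy' : 2 * b' = y')
    (hc' : c' = a' + b') (hs' : s' = x' + y' + 1) (h : 0 ≤ x ∧ 0 ≤ y ∧ 0 ≤ x' ∧ 0 ≤ y') :
    √(qFac q (2 * a) * qFac q (2 * b) * qFac q (2 * a') * qFac q (2 * b') /
      (qFac q (2 * c + 1) * qFac q (2 * c' + 1))) =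
      tri q a b c * (fac q s)⁻¹ * (tri q a' b' c' * (fac q s')⁻¹) := by
  rw [← sqrt_stretched hq hx hy hc hs h.1 h.2.1,
    ← sqrt_stretched hq hx' hy' hc' hs' h.2.2.1 h.2.2.2, ← Real.sqrt_mul]
  · congr 1
    rw [div_mul_div_comm]
    ring
  · rw [qFac_eq_fac q hx, qFac_eq_fac q hy, qFac_eq_fac q (show 2 * c + 1 = (s : ℝ) by
      rw [hs, hc]; push_cast; linarith)]
    exact div_nonneg (mul_nonneg (fac_nonneg hq _) (fac_nonneg hq _)) (fac_nonneg hq _)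

variable {j₁ j₂ j₃ j₄ l₁ l₂ l₃ l₄ k₁ k₂ k₃ k₄ : ℝ}

/-- The double sum for the stretched triangles with sums `k₁` and `l₃`. -/
noncomputable def remoteSum (q j₁ j₂ j₃ j₄ l₁ l₂ l₃ l₄ k₁ k₂ k₃ k₄ : ℝ) : ℝ :=
  ∑ z₁ ∈ Finset.range (⌊l₂ + j₃ - k₄⌋₊ + 1), ∑ z₃ ∈ Finset.range (⌊j₂ - k₃ + l₄⌋₊ + 1),
    (-1) ^ (z₁ + z₃) * qFac q (l₂ - j₃ + k₄ + z₁) * qFac q (j₁ + j₃ + k₃ - k₄ - z₁)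
      * qFac q (2 * j₃ - z₁) * qFac q (2 * l₄ - z₃) * qFac q (j₄ + k₄ - l₄ + z₃)
      * qFac q (j₂ + k₃ - l₄ + z₃) /
    (qFac q z₁ * qFac q (l₂ + j₃ - k₄ - z₁) * qFac q (j₃ + k₂ - l₁ - z₁)
      * qFac q z₃ * qFac q (j₂ - k₃ + l₄ - z₃)
      * qFac q (k₄ + l₁ - l₃ + l₄ - j₃ + z₁ - z₃) * qFac q (k₃ - k₁ + l₃ - l₄ + z₃)
      * qFac q (k₃ + j₁ + j₃ + j₄ - l₄ - z₁ + z₃ + 1))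

/-- The upper bound k₂ - l₃ + j₄ of z₄ is 0, so z₄ = 0 in the triple sum. -/
theorem twelveJ_stretched_remote (hq : 0 < q)
    (h : Admissible j₁ j₂ j₃ j₄ l₁ l₂ l₃ l₄ k₁ k₂ k₃ k₄) (hk : k₁ = j₁ + l₁) (hl : l₃ = k₂ + j₄) :
    twelveJ q j₁ j₂ j₃ j₄ l₁ l₂ l₃ l₄ k₁ k₂ k₃ k₄ =
        sign (j₁ + l₂ - k₃) * nab q l₃ j₂ k₁ * qFac q (k₁ + k₃ + k₄ + j₄ - l₃ + 1) /
          (nab q j₁ l₂ k₃ * nab q k₄ j₃ l₂ * nab q k₃ j₂ l₄ * nab q j₄ k₄ l₄ * nab q l₁ k₂ j₃) *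
        √(qFac q (2 * l₁) * qFac q (2 * j₁) * qFac q (2 * k₂) * qFac q (2 * j₄) /
          (qFac q (2 * k₁ + 1) * qFac q (2 * l₃ + 1))) *
        remoteSum q j₁ j₂ j₃ j₄ l₁ l₂ l₃ l₄ k₁ k₂ k₃ k₄ := by
  obtain ⟨a₁, a₃, b₁, b₂, b₃, m₁, m₂, m₃, m₄, m₅, m₆, m₇, hp, hA⟩ := h.exists_params
  obtain rfl : m₁ = 0 := by
    have : (m₁ : ℝ) = 0 := by obtain ⟨-, h1, -⟩ := hp; linarith
    exact_mod_cast this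
  unfold remoteSum
  rw [twelveJ_eq_tripleSum hq hp hA]
  have hA' := hA
  have hp' := hp
  unfold IntAdmissible at hA'
  obtain ⟨⟨hj₁, hj₃, hl₁, hl₂, hl₃⟩, hk₁, hk₂, hk₃, hk₄, hj₂, hj₄, hl₄⟩ := hp'
  have h0 : a₃ + b₁ - 2 * m₂ - b₃ + m₆ = 0 := by
    have : (a₃ : ℝ) + b₁ - 2 * m₂ - b₃ + m₆ = 0 := by linarith
    exact_mod_cast this
  rw [natFloor_eq_toNat (show l₂ + j₃ - k₄ = m₄ by linarith),
    natFloor_eq_toNat (show j₂ - k₃ + l₄ = m₇ by linarith), mul_sum, mul_sum]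
  refine sum_congr rfl fun z₁ _ => ?_
  rw [mul_sum, mul_sum]
  refine sum_congr rfl fun z₃ _ => ?_
  rw [sum_range_toNat_eq_single (z₀ := 0)
    (f := fun z => tripleTerm q a₁ a₃ b₁ b₂ b₃ m₂ m₃ m₄ m₅ m₆ m₇ z₁ z₃ z)
    (fun z hz => by have := tripleTerm_ne_zero hq hz; omega)]
  have hs : (-1) ^ (z₁ + z₃) * qFac q (l₂ - j₃ + k₄ + z₁) * qFac q (j₁ + j₃ + k₃ - k₄ - z₁)
            * qFac q (2 * j₃ - z₁) * qFac q (2 * l₄ - z₃) * qFac q (j₄ + k₄ - l₄ + z₃)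
            * qFac q (j₂ + k₃ - l₄ + z₃) /
          (qFac q z₁ * qFac q (l₂ + j₃ - k₄ - z₁) * qFac q (j₃ + k₂ - l₁ - z₁)
            * qFac q z₃ * qFac q (j₂ - k₃ + l₄ - z₃)
            * qFac q (k₄ + l₁ - l₃ + l₄ - j₃ + z₁ - z₃) * qFac q (k₃ - k₁ + l₃ - l₄ + z₃)
            * qFac q (k₃ + j₁ + j₃ + j₄ - l₄ - z₁ + z₃ + 1)) =
      (-1) ^ ((z₁ : ℤ) + z₃) * fac q (b₂ - m₄ + z₁) * fac q (a₁ - m₃ + m₄ - z₁) * fac q (a₃ - z₁) *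
        fac q (b₂ - b₁ + b₃ - 2 * m₃ - 2 * m₅ + 2 * m₇ - z₃) *
        fac q (a₃ + b₁ - b₃ - m₄ - m₂ + m₆ + m₃ + m₅ - m₇ + z₃) *
        fac q (a₁ + b₁ - b₃ + 2 * m₅ - m₇ + z₃) *
        ((fac q z₁)⁻¹ * (fac q (m₄ - z₁))⁻¹ *
        (fac q (m₂ - m₆ + b₃ - b₁ - z₁))⁻¹ * (fac q z₃)⁻¹ * (fac q (m₇ - z₃))⁻¹ *
        (fac q (b₂ - m₃ - m₄ - m₅ + m₇ + z₁ - z₃))⁻¹ * (fac q (m₅ - m₇ + z₃))⁻¹ *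
        (fac q (a₁ + a₃ + 1 + b₁ - m₂ - b₃ + m₅ + m₆ - m₇ - z₁ + z₃))⁻¹) := by
    have h0' : (a₃ : ℝ) + b₁ - 2 * m₂ - b₃ + m₆ = 0 := by exact_mod_cast h0
    simp only [div_eq_mul_inv, mul_inv]
    repeat' apply mul_congr
    · exact neg_one_pow_eq_zpow (by push_cast; rfl)
    all_goals first
      | rfl
      | exact qFac_eq_fac q (by push_cast; linarith)
      | exact congrArg _ (qFac_eq_fac q (by push_cast; linarith))
  rw [hs, sqrt_stretched₂ hq hl₁ hj₁ (by rw [hk, add_comm]) (s := b₁ + a₁ + 1) (by ring)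
    (x' := a₃ + b₁ - 2 * m₂) (y' := b₃ - a₃ - b₁ + 2 * m₂) (by push_cast; linarith)
    (by have h0' : (a₃ : ℝ) + b₁ - 2 * m₂ - b₃ + m₆ = 0 := by exact_mod_cast h0
        push_cast; linarith) hl
    (s' := b₃ + 1) (by ring) (by omega), sign_eq_zpow hk₃,
    nab_eq_tri_div hq (show j₂ + k₁ - l₃ = (a₁ + b₁ - b₃ + m₅ : ℤ) by push_cast; linarith),
    qFac_eq_fac q (show k₁ + k₃ + k₄ + j₄ - l₃ + 1 =
      (a₁ + a₃ + 1 + b₁ - m₂ - b₃ + m₆ + b₂ - m₃ - m₄ : ℤ) by push_cast; linarith)]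
  obtain ⟨e1, e2, e3, e4, e5⟩ := hp.inv_nab hq hA
  simp only [div_eq_mul_inv, mul_inv, e1, e2, e3, e4, e5]
  have hpairs : (fac q m₅ * (fac q m₅)⁻¹) * (fac q (b₃ - m₆) * (fac q (b₃ - m₆))⁻¹) = 1 := by
    rw [mul_inv_cancel₀ (fac_ne_zero hq (by omega)), mul_inv_cancel₀ (fac_ne_zero hq (by omega)),
      one_mul]
  refine Eq.trans ?_ ((congrArg (· * _) hpairs).trans (one_mul _))
  unfold stretchedConst tripleTerm
  simp only [add_zero, sub_zero, h0, fac_zero, inv_one, mul_one]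
  rw [tri_swap q l₁ j₁, tri_swap q j₄ k₂, tri_reverse q l₃ j₂]
  ring

/-- The single sum for antipode stretched triangles with sums `k₁` and `j₄`. -/
noncomputable def antipodeSum (q j₁ j₂ j₃ j₄ l₁ l₂ l₃ k₂ k₃ k₄ : ℝ) : ℝ :=
  ∑ z ∈ Finset.range (⌊l₂ + j₃ - k₄⌋₊ + 1),
    (-1) ^ z * qFac q (l₂ - j₃ + k₄ + z) * qFac q (j₄ - j₃ + j₂ - j₁ + z)
      * qFac q (l₁ + k₂ - j₃ + z) * qFac q (2 * j₃ - z)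
      * qFac q (j₁ + j₃ + k₃ - k₄ - z) /
    (qFac q z * qFac q (l₂ + j₃ - k₄ - z) * qFac q (j₁ + j₂ + j₃ - j₄ - z)
      * qFac q (k₂ + j₃ - l₁ - z) * qFac q (k₃ + k₄ - j₁ - j₃ + z)
      * qFac q (l₁ - l₃ - j₃ + j₄ + z) * qFac q (l₁ + l₃ - j₃ + j₄ + z + 1))

/-- With l₄ + k₄ = j₄ the lower bound for z₄ coincides with the upper bound for z₃ + z₄. Therefore
z₃ = 0 and z₄ is a function of z₁. -/
theorem twelveJ_stretched_antipode (hq : 0 < q)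
    (h : Admissible j₁ j₂ j₃ j₄ l₁ l₂ l₃ l₄ k₁ k₂ k₃ k₄) (hk : k₁ = j₁ + l₁) (hj : j₄ = l₄ + k₄) :
      twelveJ q j₁ j₂ j₃ j₄ l₁ l₂ l₃ l₄ k₁ k₂ k₃ k₄ =
        sign (j₁ + l₂ - k₃) * nab q k₁ j₂ l₃ * nab q j₄ k₂ l₃ /
          (nab q j₁ l₂ k₃ * nab q k₄ j₃ l₂ * nab q l₄ k₃ j₂ * nab q l₁ k₂ j₃) *
        √(qFac q (2 * l₁) * qFac q (2 * j₁) * qFac q (2 * l₄) * qFac q (2 * k₄) /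
          (qFac q (2 * k₁ + 1) * qFac q (2 * j₄ + 1))) *
        antipodeSum q j₁ j₂ j₃ j₄ l₁ l₂ l₃ k₂ k₃ k₄ := by
  obtain ⟨a₁, a₃, b₁, b₂, b₃, m₁, m₂, m₃, m₄, m₅, m₆, m₇, hp, hA⟩ := h.exists_params
  obtain rfl : m₁ = 0 := by
    have : (m₁ : ℝ) = 0 := by obtain ⟨-, h1, -⟩ := hp; linarith
    exact_mod_cast this
  unfold antipodeSum
  rw [twelveJ_eq_tripleSum hq hp hA]
  have hA' := hA
  have hp' := hp
  unfold IntAdmissible at hA'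
  obtain ⟨⟨hj₁, hj₃, hl₁, hl₂, hl₃⟩, hk₁, hk₂, hk₃, hk₄, hj₂, hj₄, hl₄⟩ := hp'
  have h0' : (b₂ : ℝ) - m₄ - b₁ + b₃ + m₂ - m₆ - m₃ - m₅ + m₇ = 0 := by linarith
  have h0 : b₂ - m₄ - b₁ + b₃ + m₂ - m₆ - m₃ - m₅ + m₇ = 0 := by exact_mod_cast h0'
  rw [natFloor_eq_toNat (show l₂ + j₃ - k₄ = m₄ by linarith), mul_sum, mul_sum]
  refine sum_congr rfl fun z hz => ?_
  rw [mem_range] at hz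
  rw [sum_range_toNat_eq_single (z₀ := 0) (f := fun w => ∑ z₄ ∈
      range ((a₁ + b₁ - b₃ + m₅).toNat + 1), tripleTerm q a₁ a₃ b₁ b₂ b₃ m₂ m₃ m₄ m₅ m₆ m₇ z w z₄)
    (fun w hw => by
      obtain ⟨y, -, hy⟩ := exists_ne_zero_of_sum_ne_zero hw
      have := tripleTerm_ne_zero hq hy
      omega),
    sum_range_toNat_eq_single (z₀ := b₁ - b₃ - m₂ + m₆ + z)
    (f := fun w => tripleTerm q a₁ a₃ b₁ b₂ b₃ m₂ m₃ m₄ m₅ m₆ m₇ z 0 w)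
    (fun w hw => by have := tripleTerm_ne_zero hq hw; omega)]
  have hs : (-1) ^ z * qFac q (l₂ - j₃ + k₄ + z) * qFac q (j₄ - j₃ + j₂ - j₁ + z)
            * qFac q (l₁ + k₂ - j₃ + z) * qFac q (2 * j₃ - z)
            * qFac q (j₁ + j₃ + k₃ - k₄ - z) /
          (qFac q z * qFac q (l₂ + j₃ - k₄ - z) * qFac q (j₁ + j₂ + j₃ - j₄ - z)
            * qFac q (k₂ + j₃ - l₁ - z) * qFac q (k₃ + k₄ - j₁ - j₃ + z)
            * qFac q (l₁ - l₃ - j₃ + j₄ + z) * qFac q (l₁ + l₃ - j₃ + j₄ + z + 1)) =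
      (-1) ^ (z : ℤ) * fac q (b₂ - m₄ + z) * fac q (m₅ + (b₁ - b₃ - m₂ + m₆ + z)) *
        fac q (b₃ - m₆ + (b₁ - b₃ - m₂ + m₆ + z)) * fac q (a₃ - z) * fac q (a₁ - m₃ + m₄ - z) *
        ((fac q z)⁻¹ * (fac q (m₄ - z))⁻¹ *
          (fac q (a₁ + b₁ - b₃ + m₅ - (b₁ - b₃ - m₂ + m₆ + z)))⁻¹ *
          (fac q (a₃ + b₁ - 2 * m₂ - b₃ + m₆ - (b₁ - b₃ - m₂ + m₆ + z)))⁻¹ *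
          (fac q (m₅ - m₇ + (b₁ - b₃ - m₂ + m₆ + z)))⁻¹ * (fac q (b₁ - b₃ - m₂ + m₆ + z))⁻¹ *
          (fac q (b₃ + 1 + (b₁ - b₃ - m₂ + m₆ + z)))⁻¹) := by
    simp only [div_eq_mul_inv, mul_inv]
    repeat' apply mul_congr
    · exact neg_one_pow_eq_zpow rfl
    all_goals first
      | rfl
      | exact qFac_eq_fac q (by push_cast; linarith)
      | exact congrArg _ (qFac_eq_fac q (by push_cast; linarith))
  rw [hs, sqrt_stretched₂ hq hl₁ hj₁ (by rw [hk, add_comm]) (s := b₁ + a₁ + 1) (by ring)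
    (x' := b₂ - b₁ + b₃ - 2 * m₃ - 2 * m₅ + 2 * m₇) (y' := a₃ + b₂ - 2 * m₄) (by push_cast; linarith)
    (by push_cast; linarith) hj
    (s' := a₃ + b₂ - m₄ - m₂ + m₆ - m₅ - m₃ + m₇ + 1) (by omega) (by omega), sign_eq_zpow hk₃,
    nab_eq_tri_div hq (show j₂ + l₃ - k₁ = m₅ by linarith),
    nab_eq_tri_div hq (show k₂ + l₃ - j₄ = (b₃ - m₆ : ℤ) by push_cast; linarith)]
  obtain ⟨e1, e2, e3, e4, e5⟩ := hp.inv_nab hq hA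
  have e3' := inv_nab_eq hq (a := l₄) (b := k₃) (c := j₂) (z := b₂ - b₁ + b₃ - 2 * m₃ - 2 * m₅ + m₇)
    (y := m₇) (x := a₁ + b₁ - b₃ + 2 * m₅ - m₇) (s := a₁ + b₂ - 2 * m₃ + m₇ + 1)
    (by push_cast; linarith) (by linarith) (by push_cast; linarith) (by ring) (by omega)
  simp only [div_eq_mul_inv, mul_inv, e1, e2, e3', e5]
  have hpairs := prod_fac_mul_inv hq [a₃ + b₁ - b₃ - m₄ - m₂ + m₆ + m₃ + m₅ - m₇,
      -m₂ - m₃ + m₄ - m₅ + m₆ + m₇, a₁ + b₁ - b₃ + 2 * m₅ - m₇,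
      a₁ + a₃ + 1 + b₁ - m₂ - b₃ + m₅ + m₆ - m₇ - z]
    (by simp only [List.Forall]; omega)
  simp only [List.map_cons, List.map_nil, List.prod_cons, List.prod_nil] at hpairs
  refine Eq.trans ?_ ((congrArg (· * _) hpairs).trans (one_mul _))
  unfold stretchedConst tripleTerm
  rw [show b₂ - b₁ + b₃ - 2 * m₃ - 2 * m₅ + 2 * m₇ - 0 = -m₂ - m₃ + m₄ - m₅ + m₆ + m₇ by omega,
    show m₂ - m₆ + b₃ - b₁ + (b₁ - b₃ - m₂ + m₆ + z) - z = 0 by ring,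
    show b₂ - m₃ - m₄ - m₅ + m₇ + z - 0 - (b₁ - b₃ - m₂ + m₆ + z) = 0 by omega,
    show a₁ + a₃ + 1 + b₁ - m₂ - b₃ + m₆ + b₂ - m₃ - m₄ - (b₁ - b₃ - m₂ + m₆ + z) =
      a₁ + a₃ + 1 + b₁ - m₂ - b₃ + m₅ + m₆ - m₇ - z by omega]
  simp only [add_zero, sub_zero, fac_zero, inv_one, mul_one]
  rw [tri_swap q l₁ j₁, tri_reverse q l₄ k₃, tri_rotate q j₄ k₄, tri_swap q k₄ l₄,
    tri_swap q j₂ k₃]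
  ring

end
end QRecoupling

/-! ### Adjacent consecutive stretched triangles -/

namespace QRecoupling
open Finset
section
variable {q : ℝ} {a₁ a₃ b₁ b₂ b₃ m₂ m₃ m₄ m₅ m₆ m₇ : ℤ}

/-- Here k₁ + j₂ = l₃ forces z₄ = 0. Then [j₂+k₃-l₄+z₃]! cancels [k₃-k₁+l₃-l₄+z₃]!, and the sum over
z₃ becomes a Saalschütz sum. -/
theorem sum_tripleTerm_adjacent (hq : 0 < q)
    (h : IntAdmissible a₁ a₃ b₁ b₂ b₃ 0 m₂ m₃ m₄ m₅ m₆ m₇) (h0 : a₁ + b₁ - b₃ + m₅ = 0) :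
    ∑ z₁ ∈ range (m₄.toNat + 1), ∑ z₃ ∈ range (m₇.toNat + 1),
        ∑ z₄ ∈ range ((a₁ + b₁ - b₃ + m₅).toNat + 1),
          tripleTerm q a₁ a₃ b₁ b₂ b₃ m₂ m₃ m₄ m₅ m₆ m₇ z₁ z₃ z₄ =
      fac q m₅ * fac q (b₃ - m₆) * fac q (a₃ + b₁ - b₃ - m₄ - m₂ + m₆ + m₃ + m₅ - m₇) *
        fac q (b₂ - b₁ + b₃ - 2 * m₃ - 2 * m₅ + m₇) *
        fac q (a₃ + b₂ - m₄ - m₂ + m₆ - m₅ - m₃ + m₇ + 1) *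
        ((fac q (a₃ + b₁ - 2 * m₂ - b₃ + m₆))⁻¹ * (fac q (b₃ + 1))⁻¹ * (fac q m₇)⁻¹) *
      ∑ z ∈ range (m₄.toNat + 1), (-1) ^ z * fac q (a₃ - z) * fac q (a₁ - m₃ + m₄ + m₇ - z) *
        fac q (b₂ - m₄ + z) * ((fac q z)⁻¹ * (fac q (m₂ - m₆ + b₃ - b₁ - z))⁻¹ *
          (fac q (b₂ - m₃ - m₄ - m₅ + m₇ + z))⁻¹ * (fac q (m₄ - z))⁻¹ *
          (fac q (a₁ + a₃ + 1 + b₁ - m₂ - b₃ + m₅ + m₆ - z))⁻¹) := by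
  rw [mul_sum]
  unfold IntAdmissible at h
  refine sum_congr rfl fun z hz => ?_
  rw [mem_range] at hz
  have key := saalschuetz_fac hq m₇.toNat
    (α := a₃ + b₁ - b₃ - m₄ - m₂ + m₆ + m₃ + m₅ - m₇)
    (ε := b₂ - b₁ + b₃ - 2 * m₃ - 2 * m₅ + 2 * m₇)
    (δ := a₁ + a₃ + 1 + b₁ - m₂ - b₃ + m₅ + m₆ - m₇ - z)
    (m := b₂ - m₃ - m₄ - m₅ + m₇ + z) (by omega) (by omega) (by omega) (by omega)
  have hm : ((m₇.toNat : ℕ) : ℤ) = m₇ := by omega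
  rw [hm] at key
  rw [show b₂ - b₁ + b₃ - 2 * m₃ - 2 * m₅ + 2 * m₇ - m₇ = b₂ - b₁ + b₃ - 2 * m₃ - 2 * m₅ + m₇ by
      ring, show a₁ + a₃ + 1 + b₁ - m₂ - b₃ + m₅ + m₆ - m₇ - z -
        (a₃ + b₁ - b₃ - m₄ - m₂ + m₆ + m₃ + m₅ - m₇) + m₇ - 1 = a₁ - m₃ + m₄ + m₇ - z by ring,
    show a₁ + a₃ + 1 + b₁ - m₂ - b₃ + m₅ + m₆ - m₇ - z +
      (b₂ - m₃ - m₄ - m₅ + m₇ + z) + m₇ = a₃ + b₂ - m₄ - m₂ + m₆ - m₅ - m₃ + m₇ + 1 by omega,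
    show a₁ + a₃ + 1 + b₁ - m₂ - b₃ + m₅ + m₆ - m₇ - z + m₇ =
      a₁ + a₃ + 1 + b₁ - m₂ - b₃ + m₅ + m₆ - z by ring,
    show a₁ + a₃ + 1 + b₁ - m₂ - b₃ + m₅ + m₆ - m₇ - z -
        (a₃ + b₁ - b₃ - m₄ - m₂ + m₆ + m₃ + m₅ - m₇) - 1 = a₁ - m₃ + m₄ - z by ring,
    show a₁ + a₃ + 1 + b₁ - m₂ - b₃ + m₅ + m₆ - m₇ - z +
      (b₂ - m₃ - m₄ - m₅ + m₇ + z) =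
      a₁ + a₃ + 1 + b₁ - m₂ - b₃ + m₆ + b₂ - m₃ - m₄ by ring] at key
  trans ((-1) ^ z * fac q (b₂ - m₄ + z) * fac q (a₁ - m₃ + m₄ - z) * fac q (a₃ - z) *
    fac q m₅ * fac q (b₃ - m₆) * fac q (a₁ + a₃ + 1 + b₁ - m₂ - b₃ + m₆ + b₂ - m₃ - m₄) *
    ((fac q z)⁻¹ * (fac q (m₄ - z))⁻¹ * (fac q (m₂ - m₆ + b₃ - b₁ - z))⁻¹ *
      (fac q (a₃ + b₁ - 2 * m₂ - b₃ + m₆))⁻¹ * (fac q (b₃ + 1))⁻¹)) *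
    ∑ k ∈ range (m₇.toNat + 1), (-1) ^ k *
      fac q (a₃ + b₁ - b₃ - m₄ - m₂ + m₆ + m₃ + m₅ - m₇ + k) *
      fac q (b₂ - b₁ + b₃ - 2 * m₃ - 2 * m₅ + 2 * m₇ - k) /
      (fac q k * fac q (m₇ - k) * fac q (b₂ - m₃ - m₄ - m₅ + m₇ + z - k) *
        fac q (a₁ + a₃ + 1 + b₁ - m₂ - b₃ + m₅ + m₆ - m₇ - z + k))
  · rw [mul_sum]
    refine sum_congr rfl fun w _ => ?_
    rw [h0, Int.toNat_zero, zero_add, sum_range_one]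
    have hc := mul_inv_cancel₀ (fac_ne_zero hq (show 0 ≤ m₅ - m₇ + w by omega))
    unfold tripleTerm
    simp only [Nat.cast_zero, add_zero, sub_zero, h0, fac_zero, inv_one, mul_one,
      div_eq_mul_inv, mul_inv]
    rw [show a₁ + b₁ - b₃ + 2 * m₅ - m₇ + w = m₅ - m₇ + w by omega, zpow_add₀ (by norm_num),
      zpow_natCast, zpow_natCast]
    refine Eq.trans ?_ ((congrArg (· * _) hc).trans (one_mul _))
    ring
  · rw [key]
    have h1 := mul_inv_cancel₀ (fac_ne_zero hq (show 0 ≤ a₁ - m₃ + m₄ - z by omega))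
    have h2 := mul_inv_cancel₀ (fac_ne_zero hq
      (show 0 ≤ a₁ + a₃ + 1 + b₁ - m₂ - b₃ + m₆ + b₂ - m₃ - m₄ by omega))
    have h12 := congrArg₂ (· * ·) h1 h2
    simp only [mul_one] at h12
    refine Eq.trans ?_ ((congrArg (· * _) h12).trans (one_mul _))
    simp only [div_eq_mul_inv, mul_inv]
    ring

/-- Reversal of the order of summation, z ↦ v₁ - z; the limits m and v₁ both bound the support. -/
theorem sum_range_eq_dSum {u₁ u₂ u₃ v₁ v₂ v₃ v₄ m : ℤ} {x₁ x₂ x₃ y₂ y₄ : ℤ} (hq : 0 < q)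
    (hm : 0 ≤ m) (hv : 0 ≤ v₁) (hx₁ : x₁ = u₁ + v₁) (hx₂ : x₂ = u₂ + v₁) (hx₃ : x₃ = u₃ - v₁)
    (hy₂ : y₂ = v₂ - v₁) (hv₃ : v₃ = m - v₁) (hy₄ : y₄ = v₄ + v₁) :
    ∑ z ∈ range (m.toNat + 1), (-1) ^ z * fac q (x₁ - z) * fac q (x₂ - z) * fac q (x₃ + z) *
      ((fac q z)⁻¹ * (fac q (v₁ - z))⁻¹ * (fac q (y₂ + z))⁻¹ * (fac q (m - z))⁻¹ *
        (fac q (y₄ - z))⁻¹) = (-1) ^ v₁ * dSum q u₁ u₂ u₃ v₁ v₂ v₃ v₄ := by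
  have := sum_range_toNat_congr (f := fun z => (-1) ^ z * fac q (x₁ - z) * fac q (x₂ - z) *
    fac q (x₃ + z) * ((fac q z)⁻¹ * (fac q (v₁ - z))⁻¹ * (fac q (y₂ + z))⁻¹ * (fac q (m - z))⁻¹ *
        (fac q (y₄ - z))⁻¹)) hm hv (fun z _ h => by
      simp only [ne_eq, mul_eq_zero, not_or, inv_eq_zero, fac_eq_zero_iff hq] at h
      omega)
  simp only [zpow_natCast] at this
  rw [this, dSum, mul_sum, ← sum_range_reflect]
  refine sum_congr rfl fun z hz => ?_
  rw [mem_range] at hz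
  unfold dTerm
  have hz' : ((v₁.toNat + 1 - 1 - z : ℕ) : ℤ) = v₁ - z := by omega
  rw [← zpow_natCast, hz', show x₁ - (v₁ - z) = u₁ + z by omega,
    show x₂ - (v₁ - z) = u₂ + z by omega, show x₃ + (v₁ - z) = u₃ - z by omega,
    show v₁ - (v₁ - (z : ℤ)) = z by omega, show y₂ + (v₁ - z) = v₂ - z by omega,
    show m - (v₁ - z) = v₃ + z by omega, show y₄ - (v₁ - z) = v₄ + z by omega,
    show (-1 : ℝ) ^ (v₁ - (z : ℤ)) = (-1) ^ v₁ * (-1) ^ (z : ℤ) by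
      rw [← zpow_add₀ (by norm_num)]; exact neg_one_zpow_congr (by omega)]
  simp only [div_eq_mul_inv, mul_inv]
  ring

/-- In spins the hypothesis is j₁ + j₂ + j₄ < j₃, so no x satisfies both j₃ - j₁ ≤ x and x ≤ j₂ +
j₄. -/
theorem sum_wTerm_eq_zero (hq : 0 < q) {m₁ L : ℤ} (h : a₁ + b₁ - m₁ - m₂ - b₃ + m₅ + m₆ < 0) :
    ∑ i ∈ Icc L 0, wTerm q a₁ a₃ b₁ b₂ b₃ m₁ m₂ m₃ m₄ m₅ m₆ m₇ i = 0 := by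
  refine sum_eq_zero fun i _ => ?_
  by_contra h0
  unfold wTerm at h0
  simp only [mul_eq_zero, not_or, fac_eq_zero_iff hq] at h0
  omega

variable {j₁ j₂ j₃ j₄ l₁ l₂ l₃ l₄ k₁ k₂ k₃ k₄ : ℝ}

theorem sqrt_stretched_adjacent (hq : 0 < q) {a b c d e : ℝ} {x y w s t : ℤ} (hx : 2 * a = x)
    (hy : 2 * b = y) (hw : 2 * d = w) (hc : c = a + b) (he : e = c + d) (hs : s = x + y + 1)
    (ht : t = x + y + w + 1) (hx0 : 0 ≤ x) (hy0 : 0 ≤ y) (hw0 : 0 ≤ w) :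
    √(qFac q (2 * a) * qFac q (2 * b) * qFac q (2 * d) / (qNum q (2 * c + 1) * qFac q (2 * e + 1))) =
      tri q a b c * (fac q s)⁻¹ * (tri q c d e * (fac q t)⁻¹) := by
  have hc2 : 2 * c = (x + y : ℤ) := by rw [hc]; push_cast; linarith
  have hs' : 2 * c + 1 = s := by rw [hs, hc2]; push_cast; ring
  rw [← sqrt_stretched hq hx hy hc hs hx0 hy0,
    ← sqrt_stretched hq hc2 hw he (s := t) (by omega) (by omega) hw0, ← Real.sqrt_mul]
  · congr 1
    -- The second stretched triangle has [2c]! in its numerator; together with [2c+1]! of the first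
    -- it leaves the single q-number [2c+1].
    have e1 : qFac q (2 * c + 1) = qNum q (2 * c + 1) * qFac q (2 * c) := by
      rw [qFac_eq_fac q hs', qFac_eq_fac q hc2, fac_eq_mul (n := s) (m := x + y) (by omega)
        (by omega), hs']
      rfl
    rw [e1]
    have := fac_pos hq (show 0 ≤ x + y by omega)
    have e2 : qFac q (2 * c) ≠ 0 := by rw [qFac_eq_fac q hc2]; exact this.ne'
    rw [div_mul_div_comm]
    field_simp
  · rw [qFac_eq_fac q hx, qFac_eq_fac q hy, qFac_eq_fac q hs']
    exact div_nonneg (mul_nonneg (fac_nonneg hq _) (fac_nonneg hq _)) (fac_nonneg hq _)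

theorem twelveJ_stretched_adjacent (hq : 0 < q)
    (h : Admissible j₁ j₂ j₃ j₄ l₁ l₂ l₃ l₄ k₁ k₂ k₃ k₄) (hk : k₁ = j₁ + l₁) (hl : l₃ = k₁ + j₂) :
      twelveJ q j₁ j₂ j₃ j₄ l₁ l₂ l₃ l₄ k₁ k₂ k₃ k₄ =
        sign (j₁ + l₂ - k₃ + j₄ + k₄ + l₄) * nab q l₃ j₄ k₂ * nab q (j₁ + j₂) l₂ l₄ /
          (nab q j₁ l₂ k₃ * nab q j₂ k₃ l₄ * nab q l₁ k₂ j₃ * nab q (j₁ + j₂) j₃ j₄) *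
        √(qFac q (2 * l₁) * qFac q (2 * j₁) * qFac q (2 * j₂) /
          (qNum q (2 * k₁ + 1) * qFac q (2 * l₃ + 1))) *
        sixJ q (j₁ + j₂) l₄ l₂ k₄ j₃ j₄ := by
  obtain ⟨a₁, a₃, b₁, b₂, b₃, m₁, m₂, m₃, m₄, m₅, m₆, m₇, hp, hA⟩ := h.exists_params
  obtain rfl : m₁ = 0 := by
    have : (m₁ : ℝ) = 0 := by obtain ⟨-, h1, -⟩ := hp; linarith
    exact_mod_cast this
  have hA' := hA
  have hp' := hp
  unfold IntAdmissible at hA'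
  obtain ⟨⟨hj₁, hj₃, hl₁, hl₂, hl₃⟩, hk₁, hk₂, hk₃, hk₄, hj₂, hj₄, hl₄⟩ := hp'
  have h0' : (a₁ : ℝ) + b₁ - b₃ + m₅ = 0 := by linarith
  have h0 : a₁ + b₁ - b₃ + m₅ = 0 := by exact_mod_cast h0'
  have g1 : j₁ + j₂ + j₃ - j₄ = (m₂ - m₆ + b₃ - b₁ : ℤ) := by push_cast; linarith
  have g2 : j₁ + j₂ + j₄ - j₃ = (m₆ - m₂ : ℤ) := by push_cast; linarith
  have g3 : l₂ + l₄ - (j₁ + j₂) = (b₂ - m₃ - m₅ + m₇ : ℤ) := by push_cast; linarith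
  have g4 : j₃ + j₄ - (j₁ + j₂) = (a₃ - (m₂ - m₆ + b₃ - b₁) : ℤ) := by push_cast; linarith
  have g5 : j₁ + j₂ + l₄ - l₂ = (a₁ - m₃ + m₇ : ℤ) := by push_cast; linarith
  have g6 : j₁ + j₂ + l₂ - l₄ = (m₃ + m₅ - m₇ : ℤ) := by push_cast; linarith
  -- These are the excesses of the new triangles (j₁+j₂, j₃, j₄) and (j₁+j₂, l₂, l₄) that
  -- admissibility does not control. If one of them is negative, both sides are 0.
  by_cases hT : 0 ≤ m₂ - m₆ + b₃ - b₁ ∧ 0 ≤ m₆ - m₂ ∧ 0 ≤ b₂ - m₃ - m₅ + m₇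
  · rw [twelveJ_eq_tripleSum hq hp hA, sum_tripleTerm_adjacent hq hA h0,
      sum_range_eq_dSum hq (u₁ := a₃ - (m₂ - m₆ + b₃ - b₁))
        (u₂ := a₁ - m₃ + m₄ + m₇ - (m₂ - m₆ + b₃ - b₁)) (u₃ := b₂ - m₄ + (m₂ - m₆ + b₃ - b₁))
        (v₂ := b₂ - m₄ - b₁ + b₃ + m₂ - m₆ - m₃ - m₅ + m₇) (v₃ := m₄ - (m₂ - m₆ + b₃ - b₁))
        (v₄ := a₁ + a₃ + 1 + b₁ - m₂ - b₃ + m₅ + m₆ - (m₂ - m₆ + b₃ - b₁)) (by omega) (by omega)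
        (by ring) (by ring) (by ring) (by ring) (by ring) (by ring),
      sixJ_eq_tri_mul hq (p₁ := m₂ - m₆ + b₃ - b₁)
        (p₂ := b₂ - m₄ - b₁ + b₃ + m₂ - m₆ - m₃ - m₅ + m₇) (p₃ := a₃ - m₄) (p₄ := a₁ - m₃ + m₇)
        (s₁ := m₄ - (m₂ - m₆ + b₃ - b₁)) (s₂ := m₆ - m₂ - a₁ + m₃ - m₇) (by push_cast; linarith)
        (by push_cast; linarith) (by push_cast; linarith) (by push_cast; linarith)
        (by push_cast; linarith) (by push_cast; linarith),
      sixRed_eq_dSum hq (u₁ := a₃ - (m₂ - m₆ + b₃ - b₁)) (e := b₂ - b₁ + b₃ - m₄ - m₃ - m₅ + m₇ + a₃)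
        (u₂ := a₁ - m₃ + m₄ + m₇ - (m₂ - m₆ + b₃ - b₁)) (u₃ := b₂ - m₄ + (m₂ - m₆ + b₃ - b₁))
        (v₁ := m₂ - m₆ + b₃ - b₁) (v₂ := b₂ - m₄ - b₁ + b₃ + m₂ - m₆ - m₃ - m₅ + m₇)
        (v₃ := m₄ - (m₂ - m₆ + b₃ - b₁))
        (v₄ := a₁ + a₃ + 1 + b₁ - m₂ - b₃ + m₅ + m₆ - (m₂ - m₆ + b₃ - b₁)) (r₁ := m₃ + m₅ - m₇)
        (r₂ := b₂ - m₄) (t₃ := a₁ + b₂ - m₃ + m₇ + 1) (t₄ := b₂ - m₄ + a₃ + 1)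
        (by omega) (by omega) (by omega) rfl rfl rfl (by omega) (by omega) (by omega) (by omega)
        (by omega) (by omega) (by omega)]
    obtain ⟨e1, -, -, -, e5⟩ := hp.inv_nab hq hA
    have e3 := inv_nab_eq hq (a := j₂) (b := k₃) (c := l₄) (z := a₁ + b₁ - b₃ + 2 * m₅ - m₇)
      (y := m₇) (x := b₂ - b₁ + b₃ - 2 * m₃ - 2 * m₅ + m₇) (s := a₁ + b₂ - 2 * m₃ + m₇ + 1)
      (by push_cast; linarith) (by linarith) (by push_cast; linarith) (by ring) (by omega)
    have E1 : tri q (j₁ + j₂) l₂ l₄ * (fac q (b₂ - m₃ - m₅ + m₇))⁻¹ * tri q (j₁ + j₂) l₄ l₂ =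
        fac q (a₁ - m₃ + m₇) * fac q (m₃ + m₅ - m₇) * fac q (a₁ + b₂ - m₃ + m₇ + 1) := by
      have := tri_mul_self hq (a := j₁ + j₂) (b := l₂) (c := l₄) g6 g5 g3
        (s := a₁ + b₂ - m₃ + m₇ + 1) (by omega)
      rw [tri_rotate q (j₁ + j₂) l₄, tri_reverse q l₄]
      have h1 := fac_ne_zero hq hT.2.2
      field_simp
      linear_combination this
    have E2 : (nab q (j₁ + j₂) j₃ j₄)⁻¹ * tri q (j₁ + j₂) j₃ j₄ =
        fac q (a₃ - (m₂ - m₆ + b₃ - b₁)) := by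
      have := tri_mul_self hq (a := j₁ + j₂) (b := j₃) (c := j₄) g1 g2 g4 rfl
      rw [inv_nab_eq hq g1 g2 g4 rfl (by omega)]
      have h1 := fac_ne_zero hq hT.1
      have h2 := fac_ne_zero hq hT.2.1
      have h3 := fac_ne_zero hq (show 0 ≤ a₃ - (m₂ - m₆ + b₃ - b₁) + (m₆ - m₂) +
        (m₂ - m₆ + b₃ - b₁) + 1 by omega)
      field_simp
      linear_combination this
    rw [sqrt_stretched_adjacent hq hl₁ hj₁ (show 2 * j₂ = m₅ by linarith)
        (by rw [hk, add_comm]) hl (s := b₁ + a₁ + 1)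
        (t := b₃ + 1) (by ring) (by omega) (by omega) (by omega) (by omega),
      sign_eq_zpow (n := m₃ + (a₃ + b₂ - m₄ - m₂ + m₆ - m₅ - m₃ + m₇)) (by push_cast; linarith),
      nab_eq_tri_div hq (show j₄ + k₂ - l₃ = (a₃ + b₁ - 2 * m₂ - b₃ + m₆ : ℤ) by
        push_cast; linarith),
      nab_eq_tri_div hq (show l₂ + l₄ - (j₁ + j₂) = (b₂ - m₃ - m₅ + m₇ : ℤ) from g3)]
    have hsg : (-1 : ℝ) ^ m₃ * (-1) ^ (m₂ - m₆ + b₃ - b₁) =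
        (-1) ^ (m₃ + (a₃ + b₂ - m₄ - m₂ + m₆ - m₅ - m₃ + m₇)) *
        (-1) ^ (b₂ - b₁ + b₃ - m₄ - m₃ - m₅ + m₇ + a₃) := by
      simp only [← zpow_add₀ (show (-1 : ℝ) ≠ 0 by norm_num)]
      apply neg_one_zpow_congr
      omega
    have hg : ∀ sg n1 tA w n2 n3 n4 nB sq tA' tD tB tF X : ℝ, sg * n1 * (tA * w) *
        (n2 * n3 * n4 * nB) * sq * (tA' * tD * tB * tF * X) =
        (tA * w * tA') * (nB * tB) * (sg * n1 * (n2 * n3 * n4) * sq * (tD * tF * X)) := by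
      intros; ring
    have hg' : ∀ s T K P s' X : ℝ, s * T * K * (P * (s' * X)) = s * s' * (T * K * P * X) := by
      intros; ring
    refine (hg' _ _ _ _ _ _).trans ?_
    rw [hsg]
    simp only [div_eq_mul_inv, mul_inv, e1, e3, e5]
    rw [hg, E1, E2]
    have hc : ∀ n : ℤ, 0 ≤ n → fac q n * (fac q n)⁻¹ = 1 :=
      fun n hn => mul_inv_cancel₀ (fac_ne_zero hq hn)
    have hL : (fac q m₅ * (fac q m₅)⁻¹) * (fac q (b₃ - m₆) * (fac q (b₃ - m₆))⁻¹) *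
        (fac q (a₃ + b₁ - b₃ - m₄ - m₂ + m₆ + m₃ + m₅ - m₇) *
          (fac q (a₃ + b₁ - b₃ - m₄ - m₂ + m₆ + m₃ + m₅ - m₇))⁻¹) *
        (fac q (b₂ - b₁ + b₃ - 2 * m₃ - 2 * m₅ + m₇) *
          (fac q (b₂ - b₁ + b₃ - 2 * m₃ - 2 * m₅ + m₇))⁻¹) *
        (fac q (a₃ + b₂ - m₄ - m₂ + m₆ - m₅ - m₃ + m₇ + 1) *
          (fac q (a₃ + b₂ - m₄ - m₂ + m₆ - m₅ - m₃ + m₇ + 1))⁻¹) = 1 := by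
      rw [hc _ (by omega), hc _ (by omega), hc _ (by omega), hc _ (by omega), hc _ (by omega)]
      norm_num
    have hR : (fac q (a₁ - m₃ + m₇) * (fac q (a₁ - m₃ + m₇))⁻¹) *
        (fac q (m₃ + m₅ - m₇) * (fac q (m₃ + m₅ - m₇))⁻¹) *
        (fac q (a₁ + b₂ - m₃ + m₇ + 1) * (fac q (a₁ + b₂ - m₃ + m₇ + 1))⁻¹) *
        (fac q (a₃ - (m₂ - m₆ + b₃ - b₁)) * (fac q (a₃ - (m₂ - m₆ + b₃ - b₁)))⁻¹) = 1 := by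
      rw [hc _ (by omega), hc _ (by omega), hc _ (by omega), hc _ (by omega)]
      norm_num
    rw [show a₁ - m₃ + m₄ + m₇ - (m₂ - m₆ + b₃ - b₁) = -m₂ - m₃ + m₄ - m₅ + m₆ + m₇ by omega,
      tri_swap q l₁ j₁, tri_rotate q l₃ j₄, tri_swap q j₂ k₃, tri_rotate q k₄ l₄,
      tri_rotate q l₄ j₄]
    refine (mul_one _).symm.trans ((congrArg (_ * ·) hR.symm).trans
      (Eq.trans ?_ ((congrArg (_ * ·) hL).trans (mul_one _))))
    unfold stretchedConst
    ring
  · have hs0 : sixJ q (j₁ + j₂) l₄ l₂ k₄ j₃ j₄ = 0 := by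
      unfold sixJ
      rw [if_neg]
      rintro ⟨t1, -, t3, -⟩
      have h3 := (triangle_iff g1 g2 g4).1 t3
      have h1 := (triangle_iff (a := j₁ + j₂) (b := l₄) (c := l₂) g5 g6
        (x := b₂ - m₃ - m₅ + m₇) (by linarith)).1 t1
      omega
    rw [hs0, mul_zero]
    -- For j₁ + j₂ + j₄ ≥ j₃ each term of the single sum contains the inverse of a factorial of a
    -- negative integer; otherwise the range of x is empty.
    by_cases h2 : 0 ≤ m₆ - m₂
    · rw [twelveJ_eq_tripleSum hq hp hA, sum_tripleTerm_adjacent hq hA h0,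
        sum_eq_zero, mul_zero, mul_zero]
      intro z hz
      rw [mem_range] at hz
      by_contra hn
      simp only [mul_eq_zero, not_or, inv_eq_zero, fac_eq_zero_iff hq] at hn
      omega
    · rw [twelveJ_eq_sum_wTerm hq hj₁ hj₃ hl₁ hl₂ hl₃ hk₁ hk₂ hk₃ hk₄ hj₂ hj₄ hl₄ (by omega)
        le_rfl, sum_wTerm_eq_zero hq (by omega), mul_zero]

end
end QRecoupling

/-! ### Merging stretched triangles -/

namespace QRecoupling
open Finset
section
variable {q : ℝ} {a₁ a₃ b₁ b₂ b₃ m₂ m₃ m₄ m₆ m₇ : ℤ}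

/-- The constant factor of the double sum for two merging stretched triangles. -/
noncomputable def mergedConst (q : ℝ) (a₁ a₃ b₁ b₂ b₃ m₂ m₃ m₄ m₆ m₇ : ℤ) : ℝ :=
  (fac q (b₁ - m₂))⁻¹ * (fac q m₂)⁻¹ * (fac q (b₁ + a₁ + 1))⁻¹ * (fac q (b₁ - m₂ + a₃ + 1))⁻¹ *
    ((fac q m₃)⁻¹ * (fac q (b₂ - m₄))⁻¹ * (fac q (a₁ - m₃))⁻¹ * (fac q (a₃ - m₄))⁻¹ *
      (fac q (b₂ - m₄ + a₃ + 1))⁻¹ * (fac q (a₁ + b₂ - m₃ + 1))⁻¹) *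
    ((fac q (-m₂ - m₃ + m₄ + m₆ + m₇))⁻¹ * (fac q (a₁ + b₁ - b₃ - m₇))⁻¹ * (fac q m₇)⁻¹ *
      (fac q (a₁ + b₂ - 2 * m₃ + m₇ + 1))⁻¹) *
    ((fac q (b₃ - m₆))⁻¹ * (fac q m₆)⁻¹ * (fac q (a₃ + b₁ - 2 * m₂ + m₆ + 1))⁻¹ *
      (fac q (b₁ + a₁ + 1))⁻¹)

/-- With m₁ = m₅ = 0 the first and fourth 6j coefficients are single terms. The third is moved by
the symmetries to a form with x in u₁ and v₂, so that its summand has the shape [x+B+σ-1]!/[x-B]!.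
-/
theorem wTerm_merged_of_pos (hq : 0 < q)
    (h : IntAdmissible a₁ a₃ b₁ b₂ b₃ 0 m₂ m₃ m₄ 0 m₆ m₇) {i : ℤ}
    (hi : InRange a₁ a₃ b₁ b₂ b₃ 0 m₂ m₃ m₄ 0 m₆ i) :
    wTerm q a₁ a₃ b₁ b₂ b₃ 0 m₂ m₃ m₄ 0 m₆ m₇ i = (-1) ^ (m₄ + m₇) *
      mergedConst q a₁ a₃ b₁ b₂ b₃ m₂ m₃ m₄ m₆ m₇ *
      (qi q (2 * i + (a₁ + a₃ + 1)) * fac q (i + (m₂ - a₃) + (a₁ + a₃ + 1) - 1) *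
        (fac q (i - (m₂ - a₃)))⁻¹ *
        (fac q (b₁ - m₂ - i) * fac q (b₁ - m₂ + i + (a₁ + a₃ + 1))) *
        dSum q (a₁ - m₃) (a₃ - m₄) b₂ m₄ (b₂ - m₃) (-m₄ - i) (-m₄ + i + (a₁ + a₃ + 1)) *
        dSum q (a₃ - m₂ + m₆ + i) (-m₂ - m₃ + m₄ + m₆ + m₇) (a₁ + b₂ + m₂ - m₃ - m₄ - m₆)
          (b₂ - m₄ - b₁ + b₃ + m₂ - m₆ - m₃ + m₇) (a₁ + m₂ - m₆ + i) (m₄ - m₃ - m₂ + m₆)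
          (a₃ + b₁ - b₃ - 2 * m₂ + 2 * m₆ + 1)) := by
  unfold IntAdmissible at h
  unfold InRange at hi
  unfold wTerm
  simp only [sub_zero, add_zero, mul_zero, zero_add, zero_sub] at h ⊢
  rw [sixRed_swap₁₂ q (b₁ - m₂ - i),
    sixRed_eq_single hq (e := b₁ - m₂ + a₁ + a₃ + i) (t₂ := i + (a₁ + a₃ + 1))
      (t₃ := b₁ + a₁ + 1) (t₄ := b₁ - m₂ + a₃ + 1) (r₂ := b₁ - m₂) (r₃ := a₃ - m₂ + i)
      (r₄ := a₁ + i) (s := m₂) (by ring) (by ring) (by ring) (by ring) (by ring) (by ring) (by ring)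
      (by ring) (by omega) (by omega),
    sixRed_swap_pairs q (a₁ - m₃), sixRed_swap_s q (-i) _ (a₁ - m₃),
    sixRed_eq_dSum_shift hq (e := b₂ - m₃ + a₁ + a₃ + i) (w₁ := a₁ - m₃) (w₂ := a₃ - m₄) (u₃ := b₂)
      (v₁ := m₄) (v₂ := b₂ - m₃) (v₃ := -m₄ - i) (v₄ := -m₄ + i + (a₁ + a₃ + 1))
      (u₁ := a₁ - m₃ + m₄ + i) (u₂ := a₃ + i) (r₁ := m₃) (r₂ := b₂ - m₄)
      (t₃ := b₂ - m₄ + a₃ + 1) (t₄ := a₁ + b₂ - m₃ + 1) (by ring) (by ring) (by ring) (by ring)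
      (by ring) (by ring) (by ring) (by ring) (by ring) (by ring) (by ring) (by ring) (by ring)
      (by omega) (by omega),
    sixRed_swap_s q (b₂ - m₃ - m₄ - i),
    sixRed_shift q (p₁' := b₂ - m₄ - b₁ + b₃ + m₂ - m₆ - m₃ + m₇) (p₂' := m₇)
      (p₃' := a₃ + m₃ - m₄ + i) (p₄' := a₁ + m₂ - m₆ + i) (s₁' := m₄ - m₃ - m₂ + m₆)
      (s₂' := b₁ - m₂ - b₃ + m₆ - m₇ - i) (by ring) (by ring) (by ring) (by ring) (by ring)
      (by ring),
    sixRed_swap_pairs q _ m₇, sixRed_swap₁₂ q _ (a₁ + m₂ - m₆ + i), sixRed_swap₂₃ q (a₁ + m₂ - m₆ + i),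
    sixRed_swap₁₂ q (a₁ + m₂ - m₆ + i),
    sixRed_eq_dSum hq (e := b₂ - m₄ - m₃ + a₁ + a₃ + m₇ + i) (u₁ := a₃ - m₂ + m₆ + i)
      (u₂ := -m₂ - m₃ + m₄ + m₆ + m₇) (u₃ := a₁ + b₂ + m₂ - m₃ - m₄ - m₆)
      (v₁ := b₂ - m₄ - b₁ + b₃ + m₂ - m₆ - m₃ + m₇) (v₂ := a₁ + m₂ - m₆ + i)
      (v₃ := m₄ - m₃ - m₂ + m₆) (v₄ := a₃ + b₁ - b₃ - 2 * m₂ + 2 * m₆ + 1)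
      (r₁ := b₂ - m₃ - m₄ - i) (r₂ := a₁ + b₁ - b₃ - m₇) (t₃ := a₁ + b₂ - 2 * m₃ + m₇ + 1)
      (t₄ := b₂ - m₃ - m₄ + i + (a₁ + a₃ + 1))
      (by ring) (by ring) (by ring) (by ring) (by ring) (by ring) (by ring) (by ring) (by ring)
      (by ring) (by ring) (by omega) (by omega),
    sixRed_swap_pairs q (a₁ + b₁ - b₃),
    sixRed_eq_single hq (p₁ := b₁ - m₂ - b₃ + m₆ - i) (e := b₁ - m₂ + a₁ + a₃ + i)
      (t₂ := b₁ - m₂ - b₃ + m₆ + i + (a₁ + a₃ + 1)) (t₃ := a₃ + b₁ - 2 * m₂ + m₆ + 1)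
      (t₄ := b₁ + a₁ + 1) (r₂ := b₃ - m₆) (r₃ := a₁ + m₂ - m₆ + i)
      (r₄ := a₃ - m₂ + i) (s := m₆) (by ring) (by ring) (by ring) (by ring) (by ring) (by ring)
      (by ring) (by ring) (by omega) (by omega)]
  have hsg : (-1 : ℝ) ^ (b₁ - m₂ + a₁ + a₃ + i) * (-1) ^ (b₂ - m₃ + a₁ + a₃ + i) *
      (-1) ^ (b₂ - m₄ - m₃ + a₁ + a₃ + m₇ + i) * (-1) ^ (b₁ - m₂ + a₁ + a₃ + i) =
      (-1) ^ (m₄ + m₇) := by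
    simp only [← zpow_add₀ (show (-1 : ℝ) ≠ 0 by norm_num)]
    apply neg_one_zpow_congr
    omega
  have hpairs := prod_fac_mul_inv hq [a₃ - m₂ + i, a₁ + i, a₃ + i, -i, i + (a₁ + a₃ + 1),
      a₃ + m₃ - m₄ + i, a₁ - m₃ + m₄ + i, b₂ - m₃ - m₄ - i, b₂ - m₃ - m₄ + i + (a₁ + a₃ + 1),
      a₁ + m₂ - m₆ + i, a₃ - m₂ + m₆ + i, b₁ - m₂ - b₃ + m₆ - i,
      b₁ - m₂ - b₃ + m₆ + i + (a₁ + a₃ + 1)]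
    (by simp only [List.Forall]; omega)
  simp only [List.map_cons, List.map_nil, List.prod_cons, List.prod_nil] at hpairs
  have hg : ∀ C s a b c d e f : ℝ, s * C * (a * b * c * d * e * f) =
      s * (C * (a * b * c * d * e * f)) := by intros; ring
  refine Eq.trans ?_ (hg _ _ _ _ _ _ _ _).symm
  refine Eq.trans ?_ (congrArg (· * _) hsg)
  refine Eq.trans ?_ ((congrArg (· * _) hpairs).trans (one_mul _))
  rw [show i - (m₂ - a₃) = a₃ - m₂ + i by ring,
    show i + (m₂ - a₃) + (a₁ + a₃ + 1) - 1 = a₁ + m₂ + i by ring]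
  unfold mergedConst
  ring

/-- Where the triangular conditions on x fail, the right side vanishes by index ranges, by the zeros
of the Racah polynomial of the second 6j, or by `dSum_eq_zero`, which settles x > j₂ + j₄. -/
theorem wTerm_merged (hq : 0 < q)
    (h : IntAdmissible a₁ a₃ b₁ b₂ b₃ 0 m₂ m₃ m₄ 0 m₆ m₇) {i : ℤ} (hi : i ≤ 0) :
    wTerm q a₁ a₃ b₁ b₂ b₃ 0 m₂ m₃ m₄ 0 m₆ m₇ i = (-1) ^ (m₄ + m₇) *
      mergedConst q a₁ a₃ b₁ b₂ b₃ m₂ m₃ m₄ m₆ m₇ *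
      (qi q (2 * i + (a₁ + a₃ + 1)) * fac q (i + (m₂ - a₃) + (a₁ + a₃ + 1) - 1) *
        (fac q (i - (m₂ - a₃)))⁻¹ *
        (fac q (b₁ - m₂ - i) * fac q (b₁ - m₂ + i + (a₁ + a₃ + 1))) *
        dSum q (a₁ - m₃) (a₃ - m₄) b₂ m₄ (b₂ - m₃) (-m₄ - i) (-m₄ + i + (a₁ + a₃ + 1)) *
        dSum q (a₃ - m₂ + m₆ + i) (-m₂ - m₃ + m₄ + m₆ + m₇) (a₁ + b₂ + m₂ - m₃ - m₄ - m₆)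
          (b₂ - m₄ - b₁ + b₃ + m₂ - m₆ - m₃ + m₇) (a₁ + m₂ - m₆ + i) (m₄ - m₃ - m₂ + m₆)
          (a₃ + b₁ - b₃ - 2 * m₂ + 2 * m₆ + 1)) := by
  by_cases hp : InRange a₁ a₃ b₁ b₂ b₃ 0 m₂ m₃ m₄ 0 m₆ i
  · exact wTerm_merged_of_pos hq h hp
  rw [wTerm_eq_zero hq hp]
  symm
  by_contra h0
  apply hp
  unfold InRange
  unfold IntAdmissible at h
  rw [mul_eq_zero, not_or] at h0
  obtain ⟨-, h0⟩ := h0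
  rw [mul_eq_zero, not_or, mul_eq_zero, not_or] at h0
  obtain ⟨⟨h1, h2⟩, h3⟩ := h0
  simp only [mul_eq_zero, not_or, inv_eq_zero, fac_eq_zero_iff hq] at h1
  obtain ⟨y, hy⟩ := exists_dTerm_ne_zero h3
  have hy := dTerm_ne_zero hy
  obtain ⟨w, hw⟩ := exists_dTerm_ne_zero h2
  have hw := dTerm_ne_zero hw
  have e2 : (racahPoly q (a₁ + a₃ + 1) (a₁ - m₃) (a₃ - m₄) b₂ (b₂ - m₃) (-m₄) m₄.toNat).eval
      (nu q (a₁ + a₃ + 1) i) ≠ 0 := by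
    rw [racahPoly_eval hq (by omega) (by omega), Int.toNat_of_nonneg (by omega)]
    exact mul_ne_zero (mul_ne_zero (fac_ne_zero hq (by omega)) (fac_ne_zero hq (by omega))) h2
  have e2' := mt (racahPoly_eval_eq_zero hq (L := m₃ - m₄ - a₁) (R := -a₁) (by omega) (by omega)
    (by omega) (by omega) (by omega) (by omega) (by omega) (by omega)) e2
  have e3 : ¬ b₁ - m₂ - b₃ + m₆ - i < 0 := fun hn => h3 (dSum_eq_zero hq (by omega) (by omega)
    (by omega) (by omega) (by omega) (by omega) (by omega) (by ring) (by omega))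
  omega

theorem sum_Icc_congr_of_ne_zero {f : ℤ → ℝ} {a b c d : ℤ}
    (h : ∀ i, f i ≠ 0 → (a ≤ i ∧ i ≤ b) ∧ c ≤ i ∧ i ≤ d) :
    ∑ i ∈ Icc a b, f i = ∑ i ∈ Icc c d, f i := by
  have key : ∀ a' b' : ℤ, a' ≤ max a c → min b d ≤ b' →
      ∑ i ∈ Icc (max a c) (min b d), f i = ∑ i ∈ Icc a' b', f i := by
    intro a' b' ha hb
    apply sum_subset (Icc_subset_Icc ha hb)
    intro i _ hi'
    by_contra h0
    have := h i h0
    rw [mem_Icc] at hi'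
    omega
  rw [← key a b (le_max_left _ _) (min_le_left _ _),
    ← key c d (le_max_right _ _) (min_le_right _ _)]

theorem sum_wTerm_merged (hq : 0 < q)
    (h : IntAdmissible a₁ a₃ b₁ b₂ b₃ 0 m₂ m₃ m₄ 0 m₆ m₇) {L : ℤ} (hL : L ≤ -(a₁ + a₃)) :
    ∑ i ∈ Icc L 0, wTerm q a₁ a₃ b₁ b₂ b₃ 0 m₂ m₃ m₄ 0 m₆ m₇ i = (-1) ^ m₇ *
      mergedConst q a₁ a₃ b₁ b₂ b₃ m₂ m₃ m₄ m₆ m₇ * fac q (b₁ + a₁ + 1) *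
      ∑ z ∈ range (m₄.toNat + 1),
        ∑ u ∈ range ((b₂ - m₄ - b₁ + b₃ + m₂ - m₆ - m₃ + m₇).toNat + 1),
          ((-1) ^ (z + u) * fac q (b₂ - m₄ + z) * fac q (b₁ - m₂ + z) *
            fac q (a₁ - m₃ + m₄ - z) * fac q (a₃ - z) *
            fac q (-m₂ - m₃ + m₄ + m₆ + m₇ + u) * fac q (m₆ + u) *
            fac q (a₁ + b₂ + m₂ - m₃ - m₄ - m₆ - u) *
            fac q (a₃ + b₁ - 2 * m₂ + m₆ + 1 + u) * ((fac q z)⁻¹ * (fac q (m₄ - z))⁻¹ *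
              (fac q (a₃ - m₂ - z))⁻¹ * (fac q (b₂ - m₃ - m₄ + z))⁻¹ * (fac q u)⁻¹ *
              (fac q (b₂ - m₄ - b₁ + b₃ + m₂ - m₆ - m₃ + m₇ - u))⁻¹ *
              (fac q (m₄ - m₃ - m₂ + m₆ + u))⁻¹ *
              (fac q (a₃ + b₁ - b₃ - 2 * m₂ + 2 * m₆ + 1 + u))⁻¹ *
              (fac q (a₁ + m₂ - m₆ - z - u))⁻¹ * (fac q (m₆ + 1 + b₁ - m₂ + z + u))⁻¹)) := by
  rw [sum_congr rfl fun i hi => wTerm_merged hq h (mem_Icc.1 hi).2, ← mul_sum]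
  unfold IntAdmissible at h
  simp only [dSum, mul_sum_range_mul_sum_range]
  rw [sum_comm, ← sum_range_reflect, mul_sum, mul_sum]
  refine sum_congr rfl fun z hz => ?_
  rw [mem_range] at hz
  rw [sum_comm, mul_sum, mul_sum]
  refine sum_congr rfl fun u hu => ?_
  rw [mem_range] at hu
  set B : ℤ := m₆ - m₂ - a₁ + u with hB
  set c : ℝ := (-1) ^ (m₄ - z) * fac q (a₁ - m₃ + m₄ - z) * fac q (a₃ - z) * fac q (b₂ - m₄ + z) *
    ((fac q z)⁻¹ * (fac q (m₄ - z))⁻¹ * (fac q (b₂ - m₃ - m₄ + z))⁻¹) *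
    ((-1) ^ u * fac q (-m₂ - m₃ + m₄ + m₆ + m₇ + u) * fac q (a₁ + b₂ + m₂ - m₃ - m₄ - m₆ - u) *
    ((fac q u)⁻¹ * (fac q (b₂ - m₄ - b₁ + b₃ + m₂ - m₆ - m₃ + m₇ - u))⁻¹ *
      (fac q (m₄ - m₃ - m₂ + m₆ + u))⁻¹ *
      (fac q (a₃ + b₁ - b₃ - 2 * m₂ + 2 * m₆ + 1 + u))⁻¹)) with hc
  -- For fixed indices of the second and third 6j sums the x-sum is very-well-poised: D = m₂ - a₃
  -- comes from the two single terms, K = b₁ - m₂ from the triangle (k₁,k₂,x), and M = -z from the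
  -- second 6j.
  have key : ∑ x ∈ Icc B (-(z : ℤ)), qi q (2 * x + (a₁ + a₃ + 1)) *
      fac q (x + B + (a₁ + a₃ + 1) - 1) * fac q (x + (m₂ - a₃) + (a₁ + a₃ + 1) - 1) *
        (fac q (b₁ - m₂ - x) * fac q (b₁ - m₂ + x + (a₁ + a₃ + 1))) *
        ((fac q (x - B))⁻¹ * (fac q (x - (m₂ - a₃)))⁻¹ *
          ((fac q (-z - x))⁻¹ * (fac q (-z + x + (a₁ + a₃ + 1)))⁻¹)) =
      fac q (b₁ - m₂ + z) * fac q (a₃ + b₁ - 2 * m₂ + m₆ + 1 + u) * fac q (b₁ + a₁ + 1) *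
        fac q (m₆ + u) * ((fac q (a₁ + m₂ - m₆ - z - u))⁻¹ * (fac q (a₃ - m₂ - z))⁻¹ *
          (fac q (m₆ + 1 + b₁ - m₂ + z + u))⁻¹) := by
    rcases lt_or_ge (-(z : ℤ)) B with hBz | hBz
    · rw [Icc_eq_empty (by omega), sum_empty, fac_of_neg q (n := a₁ + m₂ - m₆ - z - u) (by omega)]
      simp
    · rw [sum_wellpoised hq (by omega) (by omega) (by omega)]
      rw [show b₁ - m₂ - -(z : ℤ) = b₁ - m₂ + z by ring,
        show b₁ - m₂ + B + (a₁ + a₃ + 1) = a₃ + b₁ - 2 * m₂ + m₆ + 1 + u by omega,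
        show b₁ - m₂ + (m₂ - a₃) + (a₁ + a₃ + 1) = b₁ + a₁ + 1 by ring,
        show B + (m₂ - a₃) + (a₁ + a₃ + 1) - 1 = m₆ + u by omega,
        show -(z : ℤ) - B = a₁ + m₂ - m₆ - z - u by omega,
        show -(z : ℤ) - (m₂ - a₃) = a₃ - m₂ - z by ring,
        show B + (m₂ - a₃) + (a₁ + a₃ + 1) + (b₁ - m₂) - -(z : ℤ) =
          m₆ + 1 + b₁ - m₂ + z + u by omega]
  have hz' : ((m₄.toNat + 1 - 1 - z : ℕ) : ℤ) = m₄ - z := by omega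
  trans (-1) ^ (m₄ + m₇) * mergedConst q a₁ a₃ b₁ b₂ b₃ m₂ m₃ m₄ m₆ m₇ *
    (c * ∑ x ∈ Icc B (-(z : ℤ)), qi q (2 * x + (a₁ + a₃ + 1)) *
      fac q (x + B + (a₁ + a₃ + 1) - 1) * fac q (x + (m₂ - a₃) + (a₁ + a₃ + 1) - 1) *
        (fac q (b₁ - m₂ - x) * fac q (b₁ - m₂ + x + (a₁ + a₃ + 1))) *
        ((fac q (x - B))⁻¹ * (fac q (x - (m₂ - a₃)))⁻¹ *
          ((fac q (-z - x))⁻¹ * (fac q (-z + x + (a₁ + a₃ + 1)))⁻¹)))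
  · congr 1
    rw [mul_sum, sum_Icc_congr_of_ne_zero (a := B) (c := L) (d := 0)]
    · refine sum_congr rfl fun i _ => ?_
      unfold dTerm
      rw [hz', hc, show a₃ - m₂ + m₆ + i + u = i + B + (a₁ + a₃ + 1) - 1 by omega,
        show a₁ + m₂ - m₆ + i - u = i - B by omega,
        show a₁ - m₃ + (m₄ - z) = a₁ - m₃ + m₄ - z by ring,
        show a₃ - m₄ + (m₄ - z) = a₃ - z by ring, show b₂ - (m₄ - z) = b₂ - m₄ + z by ring,
        show m₄ - (m₄ - (z : ℤ)) = z by ring,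
        show b₂ - m₃ - (m₄ - z) = b₂ - m₃ - m₄ + z by ring,
        show -m₄ - i + (m₄ - z) = -z - i by ring,
        show -m₄ + i + (a₁ + a₃ + 1) + (m₄ - z) = -z + i + (a₁ + a₃ + 1) by ring, zpow_natCast]
      simp only [div_eq_mul_inv, mul_inv]
      ring
    · intro i h0
      simp only [ne_eq, mul_eq_zero, not_or, inv_eq_zero, fac_eq_zero_iff hq] at h0
      omega
  · rw [key, hc]
    have hsg : (-1 : ℝ) ^ (m₄ + m₇) * (-1) ^ (m₄ - z) = (-1) ^ m₇ * (-1) ^ z := by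
      rw [← zpow_natCast, ← zpow_add₀ (by norm_num), ← zpow_add₀ (by norm_num)]
      exact neg_one_zpow_congr (by omega)
    have hg : ∀ s K s' X Y Z W : ℝ, s * K * (s' * X * Y * Z * W * (Z) * (Y)) =
      s * s' * (K * X * Y * Z * W * Z * Y) := by intros; ring
    rw [pow_add]
    linear_combination (fac q (a₁ - m₃ + m₄ - z) * fac q (a₃ - z) * fac q (b₂ - m₄ + z) *
    ((fac q z)⁻¹ * (fac q (m₄ - z))⁻¹ * (fac q (b₂ - m₃ - m₄ + z))⁻¹) *
    ((-1) ^ u * fac q (-m₂ - m₃ + m₄ + m₆ + m₇ + u) * fac q (a₁ + b₂ + m₂ - m₃ - m₄ - m₆ - u) *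
    ((fac q u)⁻¹ * (fac q (b₂ - m₄ - b₁ + b₃ + m₂ - m₆ - m₃ + m₇ - u))⁻¹ *
      (fac q (m₄ - m₃ - m₂ + m₆ + u))⁻¹ *
      (fac q (a₃ + b₁ - b₃ - 2 * m₂ + 2 * m₆ + 1 + u))⁻¹)) *
      mergedConst q a₁ a₃ b₁ b₂ b₃ m₂ m₃ m₄ m₆ m₇ *
      (fac q (b₁ - m₂ + z) * fac q (a₃ + b₁ - 2 * m₂ + m₆ + 1 + u) * fac q (b₁ + a₁ + 1) *
        fac q (m₆ + u) * ((fac q (a₁ + m₂ - m₆ - z - u))⁻¹ * (fac q (a₃ - m₂ - z))⁻¹ *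
          (fac q (m₆ + 1 + b₁ - m₂ + z + u))⁻¹))) * hsg

variable {j₁ j₂ j₃ j₄ l₁ l₂ l₃ l₄ k₁ k₂ k₃ k₄ : ℝ}

theorem sqrt_merged (hq : 0 < q) {a b d e c : ℝ} {x y w t s : ℤ} (hx : 2 * a = x)
    (hy : 2 * b = y) (hw : 2 * d = w) (ht : 2 * e = t) (hc : c = a + b) (hc' : c = d + e)
    (hs : s = x + y + 1) (h : 0 ≤ x ∧ 0 ≤ y ∧ 0 ≤ w ∧ 0 ≤ t) :
    √(qFac q (2 * a) * qFac q (2 * b) * qFac q (2 * d) * qFac q (2 * e)) =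
      tri q a b c * tri q d e c * (fac q s)⁻¹ := by
  have hs' : 2 * c + 1 = s := by rw [hs, hc]; push_cast; linarith
  have hs₂ : s = w + t + 1 := by
    have : (s : ℝ) = w + t + 1 := by rw [← hs', hc']; linarith
    exact_mod_cast this
  rw [qFac_eq_fac q hx, qFac_eq_fac q hy, qFac_eq_fac q hw, qFac_eq_fac q ht]
  have f1 := fac_pos hq h.1
  have f2 := fac_pos hq h.2.1
  have f3 := fac_pos hq h.2.2.1
  have f4 := fac_pos hq h.2.2.2
  have f5 := fac_pos hq (show 0 ≤ s by omega)
  have e1 := tri_stretched hq hx hy hc hs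
  have e2 := tri_stretched hq hw ht hc' hs₂
  have := tri_nonneg q a b c
  have := tri_nonneg q d e c
  rw [Real.sqrt_eq_iff_mul_self_eq (by positivity) (by positivity)]
  field_simp
  linear_combination -(tri q d e c * tri q d e c * e1 + fac q x * fac q y * fac q s * e2)

/-- The double sum for merging stretched triangles. -/
noncomputable def mergedSum (q j₁ j₂ j₃ j₄ l₁ l₂ l₃ l₄ k₂ k₃ k₄ : ℝ) : ℝ :=
  ∑ z ∈ Finset.range (⌊l₂ + j₃ - k₄⌋₊ + 1), ∑ u ∈ Finset.range (⌊k₄ - j₄ + l₄⌋₊ + 1),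
    (-1) ^ (z + u) * qFac q (l₂ - j₃ + k₄ + z) * qFac q (l₁ + k₂ - j₃ + z)
      * qFac q (j₁ + j₃ + k₃ - k₄ - z) * qFac q (2 * j₃ - z)
      * qFac q (j₄ - k₄ + l₄ + u) * qFac q (j₄ + l₃ - k₂ + u)
      * qFac q (k₃ + k₄ + j₂ - j₄ - u) * qFac q (k₂ + l₃ + j₄ + u + 1) /
    (qFac q z * qFac q (l₂ + j₃ - k₄ - z) * qFac q (k₂ - l₁ + j₃ - z)
      * qFac q (k₃ + k₄ - j₁ - j₃ + z) * qFac q u * qFac q (k₄ - j₄ + l₄ - u)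
      * qFac q (k₃ - k₄ - j₂ + j₄ + u) * qFac q (2 * j₄ + u + 1)
      * qFac q (j₁ + j₂ + j₃ - j₄ - z - u) * qFac q (l₁ + l₃ - j₃ + j₄ + z + u + 1))

theorem sum_merged_eq
    (hp : HasParams j₁ j₂ j₃ j₄ l₁ l₂ l₃ l₄ k₁ k₂ k₃ k₄ a₁ a₃ b₁ b₂ b₃ 0 m₂ m₃ m₄ 0 m₆ m₇) :
    mergedSum q j₁ j₂ j₃ j₄ l₁ l₂ l₃ l₄ k₂ k₃ k₄ =
      ∑ z ∈ range (m₄.toNat + 1), ∑ u ∈ range ((b₂ - m₄ - b₁ + b₃ + m₂ - m₆ - m₃ + m₇).toNat + 1),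
          (-1) ^ (z + u) * fac q (b₂ - m₄ + z) * fac q (b₁ - m₂ + z) *
            fac q (a₁ - m₃ + m₄ - z) * fac q (a₃ - z) *
            fac q (-m₂ - m₃ + m₄ + m₆ + m₇ + u) * fac q (m₆ + u) *
            fac q (a₁ + b₂ + m₂ - m₃ - m₄ - m₆ - u) *
            fac q (a₃ + b₁ - 2 * m₂ + m₆ + 1 + u) * ((fac q z)⁻¹ * (fac q (m₄ - z))⁻¹ *
              (fac q (a₃ - m₂ - z))⁻¹ * (fac q (b₂ - m₃ - m₄ + z))⁻¹ * (fac q u)⁻¹ *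
              (fac q (b₂ - m₄ - b₁ + b₃ + m₂ - m₆ - m₃ + m₇ - u))⁻¹ *
              (fac q (m₄ - m₃ - m₂ + m₆ + u))⁻¹ *
              (fac q (a₃ + b₁ - b₃ - 2 * m₂ + 2 * m₆ + 1 + u))⁻¹ *
              (fac q (a₁ + m₂ - m₆ - z - u))⁻¹ * (fac q (m₆ + 1 + b₁ - m₂ + z + u))⁻¹) := by
  unfold mergedSum
  obtain ⟨⟨hj₁, hj₃, hl₁, hl₂, hl₃⟩, hk₁, hk₂, hk₃, hk₄, hj₂, hj₄, hl₄⟩ := hp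
  rw [Int.cast_zero] at hk₁ hj₂
  rw [natFloor_eq_toNat (show l₂ + j₃ - k₄ = m₄ by linarith),
    natFloor_eq_toNat (show k₄ - j₄ + l₄ = (b₂ - m₄ - b₁ + b₃ + m₂ - m₆ - m₃ + m₇ : ℤ) by
      push_cast; linarith)]
  refine sum_congr rfl fun z _ => sum_congr rfl fun u _ => ?_
  simp only [div_eq_mul_inv, mul_inv]
  repeat' apply mul_congr
  all_goals first
    | rfl
    | exact qFac_eq_fac q (by push_cast; linarith)
    | exact congrArg _ (qFac_eq_fac q (by push_cast; linarith))

theorem twelveJ_stretched_merged (hq : 0 < q)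
    (h : Admissible j₁ j₂ j₃ j₄ l₁ l₂ l₃ l₄ k₁ k₂ k₃ k₄) (hk : k₁ = j₁ + l₁) (hl : l₃ = k₁ - j₂) :
      twelveJ q j₁ j₂ j₃ j₄ l₁ l₂ l₃ l₄ k₁ k₂ k₃ k₄ =
        sign (j₁ + l₂ - k₃) *
          √(qFac q (2 * l₁) * qFac q (2 * j₁) * qFac q (2 * j₂) * qFac q (2 * l₃)) *
          nab q k₄ l₄ j₄ /
          (nab q l₃ k₂ j₄ * nab q j₁ l₂ k₃ * nab q k₄ j₃ l₂ * nab q j₂ k₃ l₄ * nab q l₁ k₂ j₃) *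
        mergedSum q j₁ j₂ j₃ j₄ l₁ l₂ l₃ l₄ k₂ k₃ k₄ := by
  obtain ⟨a₁, a₃, b₁, b₂, b₃, m₁, m₂, m₃, m₄, m₅, m₆, m₇, hp, hA⟩ := h.exists_params
  obtain rfl : m₁ = 0 := by
    have : (m₁ : ℝ) = 0 := by obtain ⟨-, h1, -⟩ := hp; linarith
    exact_mod_cast this
  obtain rfl : m₅ = 0 := by
    have : (m₅ : ℝ) = 0 := by obtain ⟨-, -, -, -, -, h1, -⟩ := hp; linarith
    exact_mod_cast this
  obtain ⟨e1, e2, -, -, e5⟩ := hp.inv_nab hq hA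
  have hsum := sum_merged_eq (q := q) hp
  obtain ⟨⟨hj₁, hj₃, hl₁, hl₂, hl₃⟩, hk₁, hk₂, hk₃, hk₄, hj₂, hj₄, hl₄⟩ := hp
  have hA' := hA
  unfold IntAdmissible at hA'
  rw [twelveJ_eq_sum_wTerm hq hj₁ hj₃ hl₁ hl₂ hl₃ hk₁ hk₂ hk₃ hk₄ hj₂ hj₄ hl₄ (L := -(a₁ + a₃))
    (by omega) le_rfl, sum_wTerm_merged hq hA le_rfl]
  rw [Int.cast_zero] at hk₁ hj₂
  have e3 := inv_nab_eq hq (a := j₂) (b := k₃) (c := l₄) (z := a₁ + b₁ - b₃ - m₇)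
    (y := m₇) (x := b₂ - b₁ + b₃ - 2 * m₃ + m₇) (s := a₁ + b₂ - 2 * m₃ + m₇ + 1)
    (by push_cast; linarith) (by linarith) (by push_cast; linarith) (by ring) (by omega)
  have e4 := inv_nab_eq hq (a := l₃) (b := k₂) (c := j₄) (z := b₃ - m₆)
    (y := m₆) (x := a₃ + b₁ - 2 * m₂ - b₃ + m₆) (s := a₃ + b₁ - 2 * m₂ + m₆ + 1)
    (by push_cast; linarith) (by linarith) (by push_cast; linarith) (by ring) (by omega)
  rw [hsum, ← mul_assoc]
  congr 1
  rw [sqrt_merged hq hl₁ hj₁ (w := a₁ + b₁ - b₃) (by push_cast; linarith) hl₃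
      (show k₁ = l₁ + j₁ by linarith) (show k₁ = j₂ + l₃ by linarith) (s := b₁ + a₁ + 1) (by ring)
      (by omega), sign_eq_zpow hk₃,
    nab_eq_tri_div hq (show l₄ + j₄ - k₄ = (-m₂ - m₃ + m₄ + m₆ + m₇ : ℤ) by push_cast; linarith)]
  have hc := mul_inv_cancel₀ (fac_ne_zero hq (show 0 ≤ b₁ + a₁ + 1 by omega))
  have hsg : (-1 : ℝ) ^ m₃ = (-1) ^ (0 - m₃ + m₇ - 0) * (-1) ^ m₇ := by
    rw [← zpow_add₀ (by norm_num)]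
    exact neg_one_zpow_congr (by omega)
  simp only [div_eq_mul_inv, mul_inv, e1, e2, e3, e4, e5]
  rw [hsg]
  refine Eq.trans ?_ ((congrArg (· * _) hc).trans (one_mul _))
  unfold mergedConst
  rw [tri_rotate q k₁ j₁, tri_swap q l₁ j₁, tri_reverse q j₃ k₂, tri_rotate q k₃ j₁,
    tri_swap q j₃ k₄, tri_swap q k₃ j₂, tri_rotate q k₄ l₄, tri_rotate q l₄ j₄,
    tri_rotate q k₁ j₂, tri_reverse q j₄ k₂]
  ring

end
end QRecoupling

/-! ### Antipode stretched triangles with sums k₁ and k₄ -/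

namespace QRecoupling
open Finset Polynomial Lagrange
section
variable {q : ℝ}

theorem eval_nodal_Ioc_eq_poch (hq : 0 < q) (σ C x : ℤ) (n : ℕ) :
    (nodal (Ioc C (C + n)) (nu q σ)).eval (nu q σ x) =
      poch q (x - C - n) n * poch q (x + C + 1 + σ) n := by
  rw [eval_nodal]
  induction n with
  | zero => simp [poch_zero]
  | succ n ih =>
    have h1 : Ioc C (C + (n + 1 : ℕ)) = insert (C + (n + 1 : ℕ)) (Ioc C (C + n)) := by
      ext y; simp only [mem_Ioc, mem_insert]; omega
    rw [h1, prod_insert (by simp), nu_sub_nu hq, ih, poch_succ', poch_succ,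
      show x - C - ((n + 1 : ℕ) : ℤ) + 1 = x - C - n by push_cast; ring,
      show x - (C + ((n + 1 : ℕ) : ℤ)) = x - C - ((n + 1 : ℕ) : ℤ) by ring,
      show x + (C + ((n + 1 : ℕ) : ℤ)) + σ = x + C + 1 + σ + n by push_cast; ring]
    ring

/-- A well-poised summation formula of Dougall's type with three symmetric parameters. -/
theorem sum_wellpoised_three (hq : 0 < q) {σ A B D : ℤ} (hA : A ≤ 0) (hAB : 0 ≤ A + B + σ - 1)
    (hAD : 0 ≤ A + D + σ - 1) (hBD : 0 ≤ B + D + σ - 1) :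
    ∑ x ∈ Icc D 0, (-1) ^ x * qi q (2 * x + σ) * (fac q (x + D + σ - 1) * (fac q (x - D))⁻¹) *
        ((fac q (-x))⁻¹ * (fac q (x + σ))⁻¹) * (fac q (x + A + σ - 1) * (fac q (x - A))⁻¹) *
        (fac q (x + B + σ - 1) * (fac q (x - B))⁻¹) =
      fac q (A + B + σ - 1) * fac q (A + D + σ - 1) * fac q (B + D + σ - 1) *
        ((fac q (-A))⁻¹ * (fac q (-B))⁻¹ * (fac q (-D))⁻¹ * (fac q (A + B + D + σ - 1))⁻¹) := by
  -- The factors containing A and B are the values at ν(x) of the nodal polynomial of the interval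
  -- from 1-B-σ to A-1, and D supplies the weight. The roots of this polynomial cover all coinciding
  -- nodes.
  have hdvd : nodal (Icc D (-σ - D)) (nu q σ) ∣ nodal (Ioc (-B - σ) (A - 1)) (nu q σ) := by
    unfold nodal
    apply prod_dvd_prod_of_subset
    intro y hy
    rw [mem_Icc] at hy
    rw [mem_Ioc]
    omega
  have key := divDiff_Icc_eq_sum hq (show 0 ≤ 0 + D + σ by omega) hdvd
  rw [divDiff_nodal_Ioc' hq (by omega) (by omega) (by omega)] at key
  refine Eq.trans (sum_congr rfl fun x hx => ?_) (key.symm.trans ?_)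
  · rw [mem_Icc] at hx
    have hK : A - 1 = -B - σ + ((A + B + σ - 1).toNat : ℤ) := by omega
    rw [hK, eval_nodal_Ioc_eq_poch hq,
      poch_eq_fac hq (b := x - A) (c := x + B + σ - 1) (by omega) (by omega) (by omega),
      poch_eq_fac hq (b := x - B) (c := x + A + σ - 1) (by omega) (by omega) (by omega),
      neg_one_zpow_congr (m := 0 - x) (n := x) (by omega), zero_sub, add_zero]
    simp only [div_eq_mul_inv, mul_inv]
    ring
  · rcases lt_or_ge (A + B + D + σ - 1) 0 with h0 | h0
    · rw [fac_of_neg q (n := D + (A - 1) - 0 - (-B - σ)) (by omega), fac_of_neg q h0]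
      simp
    · rw [poch_eq_fac hq (b := -B) (c := A + D + σ - 1) (by omega) (by omega) (by omega),
        show D - (-B - σ) - 1 = B + D + σ - 1 by ring, show A - 1 - (-B - σ) = A + B + σ - 1 by ring,
        show 0 - D = -D by ring, show 0 - (A - 1) - 1 = -A by ring,
        show D + (A - 1) - 0 - (-B - σ) = A + B + D + σ - 1 by ring]
      simp only [div_eq_mul_inv, mul_inv]
      ring

variable {a₁ a₃ b₁ b₂ b₃ m₂ m₃ m₄ m₅ m₆ m₇ : ℤ}

/-- The constant factor of the single sum for two antipode stretched triangles. -/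
noncomputable def antipodeConst (q : ℝ) (a₁ a₃ b₁ b₂ b₃ m₂ m₃ m₄ m₅ m₆ m₇ : ℤ) : ℝ :=
  (fac q (b₁ - m₂))⁻¹ * (fac q m₂)⁻¹ * (fac q (b₁ + a₁ + 1))⁻¹ * (fac q (b₁ - m₂ + a₃ + 1))⁻¹ *
    (fac q m₃)⁻¹ *
    ((fac q (b₂ - b₁ + b₃ - 2 * m₃ - 2 * m₅ + m₇))⁻¹ * (fac q m₇)⁻¹ *
      (fac q (a₁ + b₂ - 2 * m₃ + m₇ + 1))⁻¹ * (fac q (a₃ + b₂ - 2 * m₄ + 1))⁻¹) *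
    ((fac q m₅)⁻¹ * (fac q (a₃ + b₁ - 2 * m₂ - b₃ + m₆))⁻¹ * (fac q m₆)⁻¹ *
      (fac q (a₃ + b₁ - 2 * m₂ + m₆ + 1))⁻¹)

/-- The hypothesis `hm` says k₄ = j₄ + l₄; with m₁ = 0 the first and third 6j coefficients become
single terms. The other two are written so that each summand has the shape [x+B+σ-1]!/[x-B]!. -/
theorem wTerm_antipode_of_pos (hq : 0 < q)
    (h : IntAdmissible a₁ a₃ b₁ b₂ b₃ 0 m₂ m₃ m₄ m₅ m₆ m₇) (hm : m₇ = m₂ + m₃ - m₄ + m₅ - m₆) {i : ℤ}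
    (hi : InRange a₁ a₃ b₁ b₂ b₃ 0 m₂ m₃ m₄ m₅ m₆ i) :
    wTerm q a₁ a₃ b₁ b₂ b₃ 0 m₂ m₃ m₄ m₅ m₆ m₇ i = (-1) ^ m₆ *
      (antipodeConst q a₁ a₃ b₁ b₂ b₃ m₂ m₃ m₄ m₅ m₆ m₇ * (fac q (b₂ - m₄))⁻¹) *
      ((-1) ^ i * qi q (2 * i + (a₁ + a₃ + 1)) *
        (fac q (a₃ + m₃ - m₄ + i) * (fac q (a₁ - m₃ + m₄ + i))⁻¹) *
        ((fac q (-i))⁻¹ * (fac q (i + (a₁ + a₃ + 1)))⁻¹) *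
        dSum q m₃ (b₂ - m₄) (a₁ + a₃ - m₃ + i) (a₁ - m₃) (a₃ - m₄) (m₃ + i) (b₂ + 1) *
        dSum q (a₁ + m₂ + m₅ - m₆ + i) m₅ (a₃ + b₁ - 2 * m₂ - m₅ + m₆) (b₃ - m₅)
          (a₃ - m₂ + m₆ - m₅ + i) (m₅ - m₆) (a₁ + b₁ - b₃ + 2 * m₅ + 1)) := by
  unfold IntAdmissible at h
  unfold InRange at hi
  unfold wTerm
  simp only [sub_zero, add_zero, mul_zero, zero_add, zero_sub] at h ⊢
  rw [sixRed_swap₁₂ q (b₁ - m₂ - i),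
    sixRed_eq_single hq (e := b₁ - m₂ + a₁ + a₃ + i) (t₂ := i + (a₁ + a₃ + 1))
      (t₃ := b₁ + a₁ + 1) (t₄ := b₁ - m₂ + a₃ + 1) (r₂ := b₁ - m₂) (r₃ := a₃ - m₂ + i)
      (r₄ := a₁ + i) (s := m₂) (by ring) (by ring) (by ring) (by ring) (by ring) (by ring) (by ring)
      (by ring) (by omega) (by omega),
    sixRed_eq_dSum hq (p₁ := a₁ - m₃) (e := b₂ - m₃ - m₄ + a₁ + a₃) (u₁ := m₃) (u₂ := b₂ - m₄)
      (u₃ := a₁ + a₃ - m₃ + i) (v₁ := a₁ - m₃) (v₂ := a₃ - m₄) (v₃ := m₃ + i) (v₄ := b₂ + 1)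
      (r₁ := a₁ - m₃ + m₄ + i) (r₂ := a₃ + i) (t₃ := b₂ - m₃ - m₄ + i + (a₁ + a₃ + 1))
      (t₄ := i + (a₁ + a₃ + 1)) (by ring) (by ring) (by ring) (by ring) (by ring) (by ring) (by ring)
      (by ring) (by ring) (by ring) (by ring) (by omega) (by omega),
    sixRed_swap₁₂ q (b₂ - m₃ - m₄ - i), sixRed_swap_s q (b₁ - m₂ - b₃ + m₅ + m₆ - i),
    sixRed_eq_single hq (p₁ := b₁ - m₂ - b₃ + m₅ + m₆ - i) (e := b₂ - m₃ - m₄ + a₁ + a₃ + i)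
      (t₂ := b₁ - m₂ - b₃ + m₅ + m₆ + i + (a₁ + a₃ + 1)) (t₃ := a₁ + b₂ - 2 * m₃ + m₇ + 1)
      (t₄ := a₃ + b₂ - 2 * m₄ + 1) (r₂ := b₂ - b₁ + b₃ - 2 * m₃ - 2 * m₅ + m₇)
      (r₃ := a₃ - m₂ + m₆ - m₅ + i) (r₄ := a₁ - m₃ + m₄ + i) (s := m₇) (by omega) (by omega)
      (by omega) (by omega) (by omega) (by omega) (by omega) (by omega) (by omega) (by omega),
    sixRed_shift q (p₁ := a₁ + b₁ - b₃ + m₅) (p₁' := a₁ + m₂ + i) (p₂' := a₃ - m₂ + m₆ - m₅ + i)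
      (p₃' := m₆) (p₄' := b₃ - m₅) (s₁' := m₅ - m₆) (s₂' := b₁ - m₂ - b₃ + m₅ - i) (by ring)
      (by ring) (by ring) (by ring) (by ring) (by ring),
    sixRed_swap₁₂ q (a₁ + m₂ + i) (a₃ - m₂ + m₆ - m₅ + i),
    sixRed_swap₂₃ q (a₃ - m₂ + m₆ - m₅ + i) (a₁ + m₂ + i),
    sixRed_swap_pairs q (a₃ - m₂ + m₆ - m₅ + i) m₆, sixRed_swap₁₂ q (a₁ + m₂ + i) (b₃ - m₅),
    sixRed_swap₂₃ q (b₃ - m₅) (a₁ + m₂ + i),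
    sixRed_eq_dSum hq (p₁ := b₃ - m₅) (e := a₃ + b₁ - m₂ + m₆ + a₁ + i)
      (u₁ := a₁ + m₂ + m₅ - m₆ + i) (u₂ := m₅)
      (u₃ := a₃ + b₁ - 2 * m₂ - m₅ + m₆) (v₁ := b₃ - m₅) (v₂ := a₃ - m₂ + m₆ - m₅ + i)
      (v₃ := m₅ - m₆) (v₄ := a₁ + b₁ - b₃ + 2 * m₅ + 1) (r₁ := b₁ - m₂ - i)
      (r₂ := a₃ + b₁ - 2 * m₂ - b₃ + m₆) (t₃ := a₃ + b₁ - 2 * m₂ + m₆ + 1)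
      (t₄ := b₁ - m₂ + i + (a₁ + a₃ + 1))
      (by ring) (by ring) (by ring) (by ring) (by ring) (by ring) (by ring) (by ring) (by ring)
      (by ring) (by ring) (by omega) (by omega)]
  have hsg : (-1 : ℝ) ^ (b₁ - m₂ + a₁ + a₃ + i) * (-1) ^ (b₂ - m₃ - m₄ + a₁ + a₃) *
      (-1) ^ (b₂ - m₃ - m₄ + a₁ + a₃ + i) * (-1) ^ (a₃ + b₁ - m₂ + m₆ + a₁ + i) =
      (-1) ^ m₆ * (-1) ^ i := by
    simp only [← zpow_add₀ (show (-1 : ℝ) ≠ 0 by norm_num)]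
    apply neg_one_zpow_congr
    omega
  have hpairs := prod_fac_mul_inv hq [a₃ - m₂ + i, a₁ + m₂ + i, b₁ - m₂ - i,
      b₁ - m₂ + i + (a₁ + a₃ + 1), a₁ + i, a₃ + i, -i, i + (a₁ + a₃ + 1), a₁ - m₃ + m₄ + i,
      b₂ - m₃ - m₄ - i, b₂ - m₃ - m₄ + i + (a₁ + a₃ + 1), a₁ + m₂ + m₅ - m₆ + i,
      a₃ - m₂ + m₆ - m₅ + i, b₁ - m₂ - b₃ + m₅ + m₆ - i,
      b₁ - m₂ - b₃ + m₅ + m₆ + i + (a₁ + a₃ + 1)]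
    (by simp only [List.Forall]; omega)
  simp only [List.map_cons, List.map_nil, List.prod_cons, List.prod_nil] at hpairs
  have hg : ∀ C s t a b c d e f : ℝ, s * C * (t * a * b * c * d * e) =
      s * t * (C * (a * b * c * d * e)) := by intros; ring
  refine Eq.trans ?_ (hg _ _ _ _ _ _ _ _ 0).symm
  refine Eq.trans ?_ (congrArg (· * _) hsg)
  refine Eq.trans ?_ ((congrArg (· * _) hpairs).trans (one_mul _))
  unfold antipodeConst
  ring

/-- Off the triangular region the right side is 0; the bound x ≤ j₂ + j₄, which the index ranges do
not show, comes from `dSum_eq_zero` for the fourth 6j. -/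
theorem wTerm_antipode (hq : 0 < q)
    (h : IntAdmissible a₁ a₃ b₁ b₂ b₃ 0 m₂ m₃ m₄ m₅ m₆ m₇) (hm : m₇ = m₂ + m₃ - m₄ + m₅ - m₆) {i : ℤ}
    (hi : i ≤ 0) :
    wTerm q a₁ a₃ b₁ b₂ b₃ 0 m₂ m₃ m₄ m₅ m₆ m₇ i = (-1) ^ m₆ *
      (antipodeConst q a₁ a₃ b₁ b₂ b₃ m₂ m₃ m₄ m₅ m₆ m₇ * (fac q (b₂ - m₄))⁻¹) *
      ((-1) ^ i * qi q (2 * i + (a₁ + a₃ + 1)) *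
        (fac q (a₃ + m₃ - m₄ + i) * (fac q (a₁ - m₃ + m₄ + i))⁻¹) *
        ((fac q (-i))⁻¹ * (fac q (i + (a₁ + a₃ + 1)))⁻¹) *
        dSum q m₃ (b₂ - m₄) (a₁ + a₃ - m₃ + i) (a₁ - m₃) (a₃ - m₄) (m₃ + i) (b₂ + 1) *
        dSum q (a₁ + m₂ + m₅ - m₆ + i) m₅ (a₃ + b₁ - 2 * m₂ - m₅ + m₆) (b₃ - m₅)
          (a₃ - m₂ + m₆ - m₅ + i) (m₅ - m₆) (a₁ + b₁ - b₃ + 2 * m₅ + 1)) := by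
  by_cases hp : InRange a₁ a₃ b₁ b₂ b₃ 0 m₂ m₃ m₄ m₅ m₆ i
  · exact wTerm_antipode_of_pos hq h hm hp
  rw [wTerm_eq_zero hq hp]
  symm
  by_contra h0
  apply hp
  unfold InRange
  unfold IntAdmissible at h
  rw [mul_eq_zero, not_or] at h0
  obtain ⟨-, h0⟩ := h0
  rw [mul_eq_zero, not_or, mul_eq_zero, not_or] at h0
  obtain ⟨⟨h1, h2⟩, h3⟩ := h0
  simp only [mul_eq_zero, not_or, inv_eq_zero, fac_eq_zero_iff hq] at h1
  obtain ⟨y, hy⟩ := exists_dTerm_ne_zero h3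
  have hy := dTerm_ne_zero hy
  obtain ⟨w, hw⟩ := exists_dTerm_ne_zero h2
  have hw := dTerm_ne_zero hw
  have e3 : ¬ b₁ - m₂ - b₃ + m₅ + m₆ - i < 0 := fun hn => h3 (dSum_eq_zero hq (by omega) (by omega)
    (by omega) (by omega) (by omega) (by omega) (by omega) (by ring) (by omega))
  omega

theorem sum_wTerm_antipode (hq : 0 < q)
    (h : IntAdmissible a₁ a₃ b₁ b₂ b₃ 0 m₂ m₃ m₄ m₅ m₆ m₇) (hm : m₇ = m₂ + m₃ - m₄ + m₅ - m₆)
    {L : ℤ} (hL : L ≤ -(a₁ + a₃)) :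
    ∑ i ∈ Icc L 0, wTerm q a₁ a₃ b₁ b₂ b₃ 0 m₂ m₃ m₄ m₅ m₆ m₇ i = (-1) ^ m₆ *
      (antipodeConst q a₁ a₃ b₁ b₂ b₃ m₂ m₃ m₄ m₅ m₆ m₇ *
        ((fac q (a₁ - m₃))⁻¹ * (fac q m₄)⁻¹ * (fac q (a₁ + b₂ - m₃ + 1))⁻¹)) *
      ∑ z ∈ range ((b₃ - m₅).toNat + 1),
        (-1) ^ z * fac q (m₅ + z) * fac q (a₃ + b₁ - 2 * m₂ - m₅ + m₆ - z) * fac q (m₇ + z) *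
          fac q (m₂ + m₅ - m₆ + z) * fac q (a₁ + b₂ - 2 * m₃ + m₇ + 1 + z) *
          ((fac q z)⁻¹ * (fac q (b₃ - m₅ - z))⁻¹ * (fac q (m₅ - m₆ + z))⁻¹ *
            (fac q (a₃ - m₂ - m₅ + m₆ - z))⁻¹ * (fac q (m₇ - m₃ + z))⁻¹ *
            (fac q (a₁ + b₁ - b₃ + 2 * m₅ + 1 + z))⁻¹ * (fac q (b₂ - m₃ + m₇ + 1 + z))⁻¹) := by
  rw [sum_congr rfl fun i hi => wTerm_antipode hq h hm (mem_Icc.1 hi).2, ← mul_sum]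
  unfold IntAdmissible at h
  simp only [dSum, fun X f g m n => (mul_sum_range_mul_sum_range X f g m n).trans sum_comm]
  rw [sum_comm, mul_sum, mul_sum]
  refine sum_congr rfl fun z hz => ?_
  rw [mem_range] at hz
  rw [sum_comm]
  by_cases hzc : 0 ≤ m₅ - m₆ + z
  swap
  · rw [fac_of_neg q (n := m₅ - m₆ + z) (by omega)]
    rw [sum_eq_zero fun w _ => sum_eq_zero fun i _ => ?_]
    · simp
    · unfold dTerm
      rw [fac_of_neg q (n := m₅ - m₆ + z) (by omega)]
      simp
  set B : ℤ := m₂ + m₅ - m₆ - a₃ + z with hB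
  set c : ℝ := (-1) ^ z * fac q (m₅ + z) * fac q (a₃ + b₁ - 2 * m₂ - m₅ + m₆ - z) *
    ((fac q z)⁻¹ * (fac q (b₃ - m₅ - z))⁻¹ * (fac q (m₅ - m₆ + z))⁻¹ *
            (fac q (a₁ + b₁ - b₃ + 2 * m₅ + 1 + z))⁻¹) with hc
  -- For fixed indices w and z the x-sum is `sum_wellpoised_three` with A = -m₃-w and D = m₃-m₄-a₁.
  -- In its value w occurs as in a Saalschütz sum, so that only z remains in the end.
  have hin : ∀ w ∈ range ((a₁ - m₃).toNat + 1), ∑ i ∈ Icc L 0,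
      (-1) ^ i * qi q (2 * i + (a₁ + a₃ + 1)) *
        (fac q (a₃ + m₃ - m₄ + i) * (fac q (a₁ - m₃ + m₄ + i))⁻¹) *
        ((fac q (-i))⁻¹ * (fac q (i + (a₁ + a₃ + 1)))⁻¹) *
        dTerm q m₃ (b₂ - m₄) (a₁ + a₃ - m₃ + i) (a₁ - m₃) (a₃ - m₄) (m₃ + i) (b₂ + 1) w *
        dTerm q (a₁ + m₂ + m₅ - m₆ + i) m₅ (a₃ + b₁ - 2 * m₂ - m₅ + m₆) (b₃ - m₅)
          (a₃ - m₂ + m₆ - m₅ + i) (m₅ - m₆) (a₁ + b₁ - b₃ + 2 * m₅ + 1) z =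
      c * fac q (m₇ + z) * ((fac q (a₃ - m₂ - m₅ + m₆ - z))⁻¹ * (fac q (a₁ - m₃ + m₄))⁻¹) *
        ((-1) ^ w * fac q (b₂ - m₄ + w) * fac q (a₁ - m₃ + m₂ + m₅ - m₆ + z - w) /
          (fac q w * fac q ((a₁ - m₃).toNat - w) * fac q (m₇ - m₃ + z - w) *
            fac q (b₂ + 1 + w))) := by
    intro w hw
    rw [mem_range] at hw
    -- For w > a₃ - m₄ the summation formula is not applicable, but both sides are 0: on the right
    -- a₃-m₂-m₅+m₆-z and m₇-m₃+z-w add up to a₃-m₄-w.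
    rcases lt_or_ge (a₃ - m₄ - w) 0 with hw' | hw'
    · have hr : (fac q (a₃ - m₂ - m₅ + m₆ - z))⁻¹ * (fac q (m₇ - m₃ + z - w))⁻¹ = 0 := by
        rcases lt_or_ge (a₃ - m₂ - m₅ + m₆ - z) 0 with h0 | h0
        · rw [fac_of_neg q h0]; simp
        · rw [fac_of_neg q (n := m₇ - m₃ + z - w) (by omega)]; simp
      simp only [dTerm, fac_of_neg q hw', mul_zero, zero_mul, inv_zero, sum_const_zero,
        div_eq_mul_inv, mul_inv]
      linear_combination -(c * fac q (m₇ + z) * (fac q (a₁ - m₃ + m₄))⁻¹ *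
        ((-1) ^ w * fac q (b₂ - m₄ + w) * fac q (a₁ - m₃ + m₂ + m₅ - m₆ + z - w) *
          ((fac q w)⁻¹ * (fac q ((a₁ - m₃).toNat - w))⁻¹ * (fac q (b₂ + 1 + w))⁻¹))) * hr
    have key := sum_wellpoised_three hq (σ := a₁ + a₃ + 1) (A := -m₃ - w) (B := B)
      (D := m₃ - m₄ - a₁) (by omega) (by omega) (by omega) (by omega)
    rw [show -m₃ - w + B + (a₁ + a₃ + 1) - 1 = a₁ - m₃ + m₂ + m₅ - m₆ + z - w by omega,
      show -m₃ - w + (m₃ - m₄ - a₁) + (a₁ + a₃ + 1) - 1 = a₃ - m₄ - w by ring,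
      show B + (m₃ - m₄ - a₁) + (a₁ + a₃ + 1) - 1 = m₇ + z by omega,
      show -(-m₃ - w) = m₃ + (w : ℤ) by ring, show -B = a₃ - m₂ - m₅ + m₆ - z by omega,
      show -(m₃ - m₄ - a₁) = a₁ - m₃ + m₄ by ring,
      show -m₃ - w + B + (m₃ - m₄ - a₁) + (a₁ + a₃ + 1) - 1 = m₇ - m₃ + z - w by omega] at key
    have h1 := mul_inv_cancel₀ (fac_ne_zero hq (show 0 ≤ m₃ + (w : ℤ) by omega))
    have h2 := mul_inv_cancel₀ (fac_ne_zero hq hw')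
    rw [sum_Icc_congr_of_ne_zero (c := m₃ - m₄ - a₁) (d := 0)]
    · refine Eq.trans (b := c * (fac q (m₃ + w) * (fac q (a₃ - m₄ - w))⁻¹) *
        ((-1) ^ w * fac q (b₂ - m₄ + w) * ((fac q w)⁻¹ * (fac q (a₁ - m₃ - w))⁻¹ *
          (fac q (b₂ + 1 + w))⁻¹)) * _) ?_ (congrArg _ key |>.trans ?_)
      · rw [mul_sum]
        refine sum_congr rfl fun i _ => ?_
        unfold dTerm
        rw [hc, show i + (m₃ - m₄ - a₁) + (a₁ + a₃ + 1) - 1 = a₃ + m₃ - m₄ + i by ring,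
          show i - (m₃ - m₄ - a₁) = a₁ - m₃ + m₄ + i by ring,
          show i + (-m₃ - w) + (a₁ + a₃ + 1) - 1 = a₁ + a₃ - m₃ + i - w by ring,
          show i - (-m₃ - w) = m₃ + i + w by ring,
          show i + B + (a₁ + a₃ + 1) - 1 = a₁ + m₂ + m₅ - m₆ + i + z by omega,
          show i - B = a₃ - m₂ + m₆ - m₅ + i - z by omega, zpow_natCast, zpow_natCast]
        simp only [div_eq_mul_inv, mul_inv]
        ring
      · rw [Int.toNat_of_nonneg (show 0 ≤ a₁ - m₃ by omega)]
        simp only [div_eq_mul_inv, mul_inv]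
        refine Eq.trans ?_ ((congrArg (· * _) (show (fac q (m₃ + w) * (fac q (m₃ + w))⁻¹) *
          (fac q (a₃ - m₄ - w) * (fac q (a₃ - m₄ - w))⁻¹) = 1 by rw [h1, h2, one_mul])).trans
            (one_mul _))
        ring
    · intro i h0
      simp only [ne_eq, mul_eq_zero, not_or, inv_eq_zero, fac_eq_zero_iff hq] at h0
      omega
  rw [sum_congr rfl hin, ← mul_sum, saalschuetz_fac hq _ (by omega) (by omega) (by omega) (by omega),
    Int.toNat_of_nonneg (show 0 ≤ a₁ - m₃ by omega),
    show a₁ - m₃ + m₂ + m₅ - m₆ + z - (a₁ - m₃) = m₂ + m₅ - m₆ + z by ring,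
    show b₂ + 1 - (b₂ - m₄) + (a₁ - m₃) - 1 = a₁ - m₃ + m₄ by ring,
    show b₂ + 1 + (m₇ - m₃ + z) + (a₁ - m₃) = a₁ + b₂ - 2 * m₃ + m₇ + 1 + z by ring,
    show b₂ + 1 + (a₁ - m₃) = a₁ + b₂ - m₃ + 1 by ring,
    show b₂ + 1 - (b₂ - m₄) - 1 = m₄ by ring,
    show b₂ + 1 + (m₇ - m₃ + z) = b₂ - m₃ + m₇ + 1 + z by ring]
  have h1 := mul_inv_cancel₀ (fac_ne_zero hq (show 0 ≤ b₂ - m₄ by omega))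
  have h2 := mul_inv_cancel₀ (fac_ne_zero hq (show 0 ≤ a₁ - m₃ + m₄ by omega))
  refine Eq.trans ?_ ((congrArg (· * _) (show (fac q (b₂ - m₄) * (fac q (b₂ - m₄))⁻¹) *
    (fac q (a₁ - m₃ + m₄) * (fac q (a₁ - m₃ + m₄))⁻¹) = 1 by rw [h1, h2, one_mul])).trans
      (one_mul _))
  rw [hc]
  simp only [div_eq_mul_inv, mul_inv]
  ring_nf

end
end QRecoupling

/-! ### The second antipode formula in spins and its ₆F₅ form -/

namespace QRecoupling
open Finset
section
variable {q : ℝ}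
variable {j₁ j₂ j₃ j₄ l₁ l₂ l₃ l₄ k₁ k₂ k₃ k₄ : ℝ} {a₁ a₃ b₁ b₂ b₃ m₂ m₃ m₄ m₅ m₆ m₇ : ℤ}

/-- The single sum for antipode stretched triangles with sums `k₁` and `k₄`. -/
noncomputable def antipodeSum' (q j₁ j₂ j₃ j₄ l₂ l₃ l₄ k₁ k₂ k₃ : ℝ) : ℝ :=
  ∑ z ∈ Finset.range (⌊k₁ - j₂ + l₃⌋₊ + 1),
    (-1) ^ z * qFac q (j₂ + l₃ - k₁ + z) * qFac q (k₁ + k₂ - j₂ + j₄ - z)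
      * qFac q (l₄ - k₃ + j₂ + z) * qFac q (j₃ - j₄ + j₂ - j₁ + z)
      * qFac q (j₂ + k₃ + l₄ + z + 1) /
    (qFac q z * qFac q (k₁ - j₂ + l₃ - z) * qFac q (k₂ + j₂ - k₁ - j₄ + z)
      * qFac q (j₁ - j₂ + j₃ + j₄ - z) * qFac q (l₄ - l₂ - j₁ + j₂ + z)
      * qFac q (2 * j₂ + z + 1) * qFac q (l₂ + l₄ - j₁ + j₂ + z + 1))

theorem HasParams.sum_antipode_eq
    (hp : HasParams j₁ j₂ j₃ j₄ l₁ l₂ l₃ l₄ k₁ k₂ k₃ k₄ a₁ a₃ b₁ b₂ b₃ 0 m₂ m₃ m₄ m₅ m₆ m₇) :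
    antipodeSum' q j₁ j₂ j₃ j₄ l₂ l₃ l₄ k₁ k₂ k₃ =
      ∑ z ∈ range ((b₃ - m₅).toNat + 1),
        (-1) ^ z * fac q (m₅ + z) * fac q (a₃ + b₁ - 2 * m₂ - m₅ + m₆ - z) * fac q (m₇ + z) *
          fac q (m₂ + m₅ - m₆ + z) * fac q (a₁ + b₂ - 2 * m₃ + m₇ + 1 + z) *
          ((fac q z)⁻¹ * (fac q (b₃ - m₅ - z))⁻¹ * (fac q (m₅ - m₆ + z))⁻¹ *
            (fac q (a₃ - m₂ - m₅ + m₆ - z))⁻¹ * (fac q (m₇ - m₃ + z))⁻¹ *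
            (fac q (a₁ + b₁ - b₃ + 2 * m₅ + 1 + z))⁻¹ * (fac q (b₂ - m₃ + m₇ + 1 + z))⁻¹) := by
  unfold antipodeSum'
  obtain ⟨⟨hj₁, hj₃, hl₁, hl₂, hl₃⟩, hk₁, hk₂, hk₃, hk₄, hj₂, hj₄, hl₄⟩ := hp
  rw [Int.cast_zero] at hk₁
  rw [natFloor_eq_toNat (show k₁ - j₂ + l₃ = (b₃ - m₅ : ℤ) by push_cast; linarith)]
  refine sum_congr rfl fun z _ => ?_
  simp only [div_eq_mul_inv, mul_inv]
  repeat' apply mul_congr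
  all_goals first
    | rfl
    | exact qFac_eq_fac q (by push_cast; linarith)
    | exact congrArg _ (qFac_eq_fac q (by push_cast; linarith))

theorem twelveJ_stretched_antipode' (hq : 0 < q)
    (h : Admissible j₁ j₂ j₃ j₄ l₁ l₂ l₃ l₄ k₁ k₂ k₃ k₄) (hk : k₁ = j₁ + l₁) (hj : k₄ = j₄ + l₄) :
      twelveJ q j₁ j₂ j₃ j₄ l₁ l₂ l₃ l₄ k₁ k₂ k₃ k₄ =
        sign (l₁ - l₂ - k₂ + k₄) * nab q k₁ j₂ l₃ * nab q k₄ j₃ l₂ /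
          (nab q j₁ l₂ k₃ * nab q l₄ k₃ j₂ * nab q j₄ l₃ k₂ * nab q l₁ k₂ j₃) *
        √(qFac q (2 * l₁) * qFac q (2 * j₁) * qFac q (2 * l₄) * qFac q (2 * j₄) /
          (qFac q (2 * k₁ + 1) * qFac q (2 * k₄ + 1))) *
        antipodeSum' q j₁ j₂ j₃ j₄ l₂ l₃ l₄ k₁ k₂ k₃ := by
  obtain ⟨a₁, a₃, b₁, b₂, b₃, m₁, m₂, m₃, m₄, m₅, m₆, m₇, hp, hA⟩ := h.exists_params
  obtain rfl : m₁ = 0 := by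
    have : (m₁ : ℝ) = 0 := by obtain ⟨-, h1, -⟩ := hp; linarith
    exact_mod_cast this
  rw [hp.sum_antipode_eq]
  obtain ⟨e1, -, -, -, e5⟩ := hp.inv_nab hq hA
  obtain ⟨⟨hj₁, hj₃, hl₁, hl₂, hl₃⟩, hk₁, hk₂, hk₃, hk₄, hj₂, hj₄, hl₄⟩ := hp
  have hm : m₇ = m₂ + m₃ - m₄ + m₅ - m₆ := by
    have : (m₇ : ℝ) = m₂ + m₃ - m₄ + m₅ - m₆ := by push_cast at hk₁; linarith
    exact_mod_cast this
  have hA' := hA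
  unfold IntAdmissible at hA'
  rw [twelveJ_eq_sum_wTerm hq hj₁ hj₃ hl₁ hl₂ hl₃ hk₁ hk₂ hk₃ hk₄ hj₂ hj₄ hl₄ (L := -(a₁ + a₃))
    (by omega) le_rfl, sum_wTerm_antipode hq hA hm le_rfl]
  rw [Int.cast_zero] at hk₁
  have e3 := inv_nab_eq hq (a := l₄) (b := k₃) (c := j₂) (z := b₂ - b₁ + b₃ - 2 * m₃ - 2 * m₅ + m₇)
    (y := m₇) (x := a₁ + b₁ - b₃ + 2 * m₅ - m₇) (s := a₁ + b₂ - 2 * m₃ + m₇ + 1)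
    (by push_cast; linarith) (by linarith) (by push_cast; linarith) (by ring) (by omega)
  have e4 := inv_nab_eq hq (a := j₄) (b := l₃) (c := k₂) (z := m₆)
    (y := a₃ + b₁ - 2 * m₂ - b₃ + m₆) (x := b₃ - m₆) (s := a₃ + b₁ - 2 * m₂ + m₆ + 1)
    (by linarith) (by push_cast; linarith) (by push_cast; linarith) (by ring) (by omega)
  rw [← mul_assoc]
  congr 1
  rw [sqrt_stretched₂ hq hl₁ hj₁ (by rw [hk, add_comm]) (s := b₁ + a₁ + 1) (by ring)
    (x' := b₂ - b₁ + b₃ - 2 * m₃ - 2 * m₅ + 2 * m₇)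
    (y' := a₃ + b₁ - 2 * m₂ - b₃ + 2 * m₆) (by push_cast; linarith)
    (by push_cast; linarith) (by rw [hj, add_comm])
    (s' := a₃ + b₂ - 2 * m₄ + 1) (by omega) (by omega),
    sign_eq_zpow (show l₁ - l₂ - k₂ + k₄ = (m₂ - m₄ : ℤ) by push_cast; linarith),
    nab_eq_tri_div hq (show j₂ + l₃ - k₁ = m₅ by linarith),
    nab_eq_tri_div hq (show j₃ + l₂ - k₄ = m₄ by linarith)]
  have hsg : (-1 : ℝ) ^ (m₂ - m₄) = (-1) ^ (0 - m₃ + m₇ - m₅) * (-1) ^ m₆ := by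
    rw [← zpow_add₀ (by norm_num)]
    exact neg_one_zpow_congr (by omega)
  simp only [div_eq_mul_inv, mul_inv, e1, e3, e4, e5]
  rw [hsg]
  unfold antipodeConst
  rw [tri_rotate q k₃ j₁, tri_swap q j₃ k₄, tri_rotate q l₄ k₃, tri_rotate q j₄ k₂,
    tri_rotate q k₂ l₃, tri_swap q l₃ j₄, tri_reverse q l₁ k₂, tri_reverse q l₁ j₁,
    tri_rotate q l₄ j₄]
  ring

theorem qPoch_eq_fac (hq : 0 < q) {α : ℝ} {a : ℤ} (h : α = a + 1) (ha : 0 ≤ a) (n : ℕ) :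
    qPoch q α n = fac q (a + n) * (fac q a)⁻¹ := by
  rw [← poch_eq_fac hq (a := a + 1) (n := n) (by ring) rfl (by omega)]
  exact prod_congr rfl fun k _ => by rw [qi, h]; push_cast; rfl

theorem qPoch_neg_eq_fac (hq : 0 < q) {α : ℝ} {u : ℤ} (h : α = -u) (hu : 0 ≤ u) (n : ℕ) :
    qPoch q α n = (-1) ^ n * (fac q u * (fac q (u - n))⁻¹) := by
  rw [← poch_neg_eq_fac hq rfl hu]
  exact prod_congr rfl fun k _ => by rw [qi, h]; push_cast; rfl

theorem inv_qPoch_eq_fac (hq : 0 < q) {α : ℝ} {a : ℤ} (h : α = a + 1) (ha : 0 ≤ a) (n : ℕ) :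
    (qPoch q α n)⁻¹ = fac q a * (fac q (a + n))⁻¹ := by
  rw [qPoch_eq_fac hq h ha, mul_inv, inv_inv, mul_comm]

theorem inv_qPoch_neg_eq_fac (hq : 0 < q) {α : ℝ} {u : ℤ} (h : α = -u) (hu : 0 ≤ u) (n : ℕ) :
    (qPoch q α n)⁻¹ = (-1) ^ n * ((fac q u)⁻¹ * fac q (u - n)) := by
  rw [qPoch_neg_eq_fac hq h hu, mul_inv, mul_inv, inv_inv, ← inv_pow, inv_neg, inv_one]

theorem inv_qPoch_one (hq : 0 < q) (n : ℕ) : (qPoch q 1 n)⁻¹ = (fac q n)⁻¹ := by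
  rw [inv_qPoch_eq_fac hq (a := 0) (by simp) le_rfl, fac_zero, one_mul, zero_add]

/-- The terms beyond N vanish, so the infinite series is the finite sum; what remains is termwise
proportionality. -/
theorem sum_range_eq_mul_qHyp {s : ℕ → ℝ} {T : ℝ} {N : ℕ} {α β : List ℝ}
    (h0 : ∀ k, N < k → s k = 0)
    (h : ∀ k, s k = T * ((α.map fun r => qPoch q r k).prod /
      ((β.map fun r => qPoch q r k).prod * qPoch q 1 k))) :
    ∑ k ∈ range (N + 1), s k = T * qHyp q α β 1 := by
  unfold qHyp
  rw [← tsum_mul_left, ← tsum_eq_sum (f := s) (L := .unconditional ℕ)]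
  · exact tsum_congr fun k => by rw [h k, one_pow, mul_one]
  · intro k hk
    rw [mem_range] at hk
    exact h0 k (by omega)

theorem sum_antipode'_eq_qHyp (hq : 0 < q)
    (h : Admissible j₁ j₂ j₃ j₄ l₁ l₂ l₃ l₄ k₁ k₂ k₃ k₄) (hk : k₁ = j₁ + l₁)
    (h₁ : 0 ≤ j₃ - j₄ + j₂ - j₁) (h₂ : 0 ≤ k₂ + j₂ - k₁ - j₄) (h₃ : 0 ≤ j₁ - j₂ + j₃ + j₄)
    (h₄ : 0 ≤ l₄ - l₂ - j₁ + j₂) :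
        antipodeSum' q j₁ j₂ j₃ j₄ l₂ l₃ l₄ k₁ k₂ k₃ =
        qFac q (j₂ + l₃ - k₁) * qFac q (k₁ + k₂ - j₂ + j₄)
            * qFac q (l₄ - k₃ + j₂) * qFac q (j₃ - j₄ + j₂ - j₁) * qFac q (j₂ + k₃ + l₄ + 1) /
          (qFac q (k₁ - j₂ + l₃) * qFac q (k₂ + j₂ - k₁ - j₄)
            * qFac q (j₁ - j₂ + j₃ + j₄) * qFac q (l₄ - l₂ - j₁ + j₂)
            * qFac q (2 * j₂ + 1) * qFac q (l₂ + l₄ - j₁ + j₂ + 1)) *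
          qHyp q
            [j₂ + l₃ - k₁ + 1, l₄ - k₃ + j₂ + 1, j₃ - j₄ + j₂ - j₁ + 1, j₂ + k₃ + l₄ + 2,
              -(k₁ - j₂ + l₃), -(j₁ - j₂ + j₃ + j₄)]
            [-(k₁ + k₂ - j₂ + j₄), k₂ + j₂ - k₁ - j₄ + 1, l₄ - l₂ - j₁ + j₂ + 1,
              2 * j₂ + 2, l₂ + l₄ - j₁ + j₂ + 2] 1 := by
  obtain ⟨a₁, a₃, b₁, b₂, b₃, m₁, m₂, m₃, m₄, m₅, m₆, m₇, hp, hA⟩ := h.exists_params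
  obtain rfl : m₁ = 0 := by
    have : (m₁ : ℝ) = 0 := by obtain ⟨-, h1, -⟩ := hp; linarith
    exact_mod_cast this
  rw [hp.sum_antipode_eq]
  unfold IntAdmissible at hA
  obtain ⟨⟨hj₁, hj₃, hl₁, hl₂, hl₃⟩, hk₁, hk₂, hk₃, hk₄, hj₂, hj₄, hl₄⟩ := hp
  rw [Int.cast_zero] at hk₁
  have i₁ : 0 ≤ m₂ + m₅ - m₆ := by
    have : (0 : ℝ) ≤ m₂ + m₅ - m₆ := by linarith
    exact_mod_cast this
  have i₂ : 0 ≤ m₅ - m₆ := by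
    have : (0 : ℝ) ≤ m₅ - m₆ := by linarith
    exact_mod_cast this
  have i₃ : 0 ≤ a₃ - m₂ - m₅ + m₆ := by
    have : (0 : ℝ) ≤ a₃ - m₂ - m₅ + m₆ := by linarith
    exact_mod_cast this
  have i₄ : 0 ≤ m₇ - m₃ := by
    have : (0 : ℝ) ≤ m₇ - m₃ := by linarith
    exact_mod_cast this
  apply sum_range_eq_mul_qHyp
  · intro k hk
    rw [fac_of_neg q (n := b₃ - m₅ - k) (by omega)]
    simp
  intro k
  simp only [List.map_cons, List.map_nil, List.prod_cons, List.prod_nil, mul_one,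
    div_eq_mul_inv, mul_inv]
  -- The intermediate expression lists the Pochhammer symbols as quotients of factorials in the
  -- order of the parameter lists. It is compared with the summand by cancelling pairs, and with the
  -- series factor by factor. The three parameters written as negatives leave the sign (-1)^k.
  refine Eq.trans (b := (fac q m₅ * fac q (a₃ + b₁ - 2 * m₂ - m₅ + m₆) * fac q m₇ * fac q (m₂ + m₅ - m₆) * fac q (a₁ + b₂ - 2 * m₃ + m₇ + 1) * ((fac q (b₃ - m₅))⁻¹ * (fac q (m₅ - m₆))⁻¹ * (fac q (a₃ - m₂ - m₅ + m₆))⁻¹ * (fac q (m₇ - m₃))⁻¹ * (fac q (a₁ + b₁ - b₃ + 2 * m₅ + 1))⁻¹ * (fac q (b₂ - m₃ + m₇ + 1))⁻¹) *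
    (((fac q (m₅ + k) * (fac q m₅)⁻¹) *
      ((fac q (m₇ + k) * (fac q m₇)⁻¹) *
      ((fac q (m₂ + m₅ - m₆ + k) * (fac q (m₂ + m₅ - m₆))⁻¹) *
      ((fac q (a₁ + b₂ - 2 * m₃ + m₇ + 1 + k) * (fac q (a₁ + b₂ - 2 * m₃ + m₇ + 1))⁻¹) *
      (((-1) ^ k * (fac q (b₃ - m₅) * (fac q (b₃ - m₅ - k))⁻¹)) *
      ((-1) ^ k * (fac q (a₃ - m₂ - m₅ + m₆) * (fac q (a₃ - m₂ - m₅ + m₆ - k))⁻¹))))))) *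
      ((((-1) ^ k * ((fac q (a₃ + b₁ - 2 * m₂ - m₅ + m₆))⁻¹ * fac q (a₃ + b₁ - 2 * m₂ - m₅ + m₆ - k))) *
      ((fac q (m₅ - m₆) * (fac q (m₅ - m₆ + k))⁻¹) *
      ((fac q (m₇ - m₃) * (fac q (m₇ - m₃ + k))⁻¹) *
      ((fac q (a₁ + b₁ - b₃ + 2 * m₅ + 1) * (fac q (a₁ + b₁ - b₃ + 2 * m₅ + 1 + k))⁻¹) *
      (fac q (b₂ - m₃ + m₇ + 1) * (fac q (b₂ - m₃ + m₇ + 1 + k))⁻¹))))) * (fac q k)⁻¹)))) ?_ (Eq.symm ?_)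
  · have hpairs := prod_fac_mul_inv hq [m₅, a₃ + b₁ - 2 * m₂ - m₅ + m₆, m₇, m₂ + m₅ - m₆,
        a₁ + b₂ - 2 * m₃ + m₇ + 1, b₃ - m₅, m₅ - m₆, a₃ - m₂ - m₅ + m₆, m₇ - m₃,
        a₁ + b₁ - b₃ + 2 * m₅ + 1, b₂ - m₃ + m₇ + 1]
      (by simp only [List.Forall]; omega)
    simp only [List.map_cons, List.map_nil, List.prod_cons, List.prod_nil] at hpairs
    have hsg : ((-1 : ℝ) ^ k * (-1) ^ k) = 1 := by
      simp only [neg_one_pow_mul_self]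
    refine Eq.trans ((one_mul _).symm.trans (congrArg (· * _) hsg.symm)) ?_
    refine Eq.trans ((one_mul _).symm.trans (congrArg (· * _) hpairs.symm)) ?_
    ring
  · repeat' apply mul_congr
    all_goals first
      | rfl
      | exact qFac_eq_fac q (by push_cast; linarith)
      | exact congrArg _ (qFac_eq_fac q (by push_cast; linarith))
      | exact qPoch_eq_fac hq (by push_cast; linarith) (by omega) _
      | exact qPoch_neg_eq_fac hq (by push_cast; linarith) (by omega) _
      | exact inv_qPoch_eq_fac hq (by push_cast; linarith) (by omega) _
      | exact inv_qPoch_neg_eq_fac hq (by push_cast; linarith) (by omega) _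
      | exact inv_qPoch_one hq _

end
end QRecoupling

/-! ### The first antipode ₆F₅ and the Kampé de Fériet series -/

namespace QRecoupling
open Finset
section
variable {q : ℝ}
variable {j₁ j₂ j₃ j₄ l₁ l₂ l₃ l₄ k₁ k₂ k₃ k₄ : ℝ}

/-- The hypotheses h₁ and h₂ are the balancing conditions; they turn both powers of q in `qKampe`
into 1. -/
theorem sum_range_eq_mul_qKampe {s : ℕ → ℕ → ℝ} {T : ℝ} {M N : ℕ} {a c b d b' d' : List ℝ}
    (h₁ : a.sum + b.sum - c.sum - d.sum + 1 = 0) (h₂ : a.sum + b'.sum - c.sum - d'.sum + 1 = 0)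
    (h0 : ∀ k l, M < k ∨ N < l → s k l = 0)
    (h : ∀ k l, s k l = T * ((a.map fun r => qPoch q r (k + l)).prod /
      (c.map fun r => qPoch q r (k + l)).prod * ((b.map fun r => qPoch q r k).prod *
        (b'.map fun r => qPoch q r l).prod / ((d.map fun r => qPoch q r k).prod *
          (d'.map fun r => qPoch q r l).prod)) * (fac q k * fac q l)⁻¹)) :
    ∑ k ∈ range (M + 1), ∑ l ∈ range (N + 1), s k l = T * qKampe q a c b d b' d' := by
  unfold qKampe
  rw [h₁, h₂, ← sum_product', ← tsum_mul_left,
    ← tsum_eq_sum (f := fun st : ℕ × ℕ => s st.1 st.2) (L := .unconditional (ℕ × ℕ))]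
  · refine tsum_congr fun st => ?_
    rw [h, qFac_eq_fac q (n := (st.1 : ℤ)) (by simp), qFac_eq_fac q (n := (st.2 : ℤ)) (by simp)]
    simp
  · intro st hst
    rw [mem_product, mem_range, mem_range] at hst
    exact h0 _ _ (by omega)

theorem sum_antipode_eq_qHyp (hq : 0 < q)
    (h : Admissible j₁ j₂ j₃ j₄ l₁ l₂ l₃ l₄ k₁ k₂ k₃ k₄) (hk : k₁ = j₁ + l₁)
    (h₁ : 0 ≤ j₄ - j₃ + j₂ - j₁) (h₂ : 0 ≤ j₁ + j₂ + j₃ - j₄) (h₃ : 0 ≤ k₃ + k₄ - j₁ - j₃)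
    (h₄ : 0 ≤ l₁ - l₃ - j₃ + j₄) :
        antipodeSum q j₁ j₂ j₃ j₄ l₁ l₂ l₃ k₂ k₃ k₄ =
        qFac q (l₂ - j₃ + k₄) * qFac q (j₄ - j₃ + j₂ - j₁)
            * qFac q (l₁ + k₂ - j₃) * qFac q (2 * j₃) * qFac q (j₁ + j₃ + k₃ - k₄) /
          (qFac q (l₂ + j₃ - k₄) * qFac q (j₁ + j₂ + j₃ - j₄)
            * qFac q (k₂ + j₃ - l₁) * qFac q (k₃ + k₄ - j₁ - j₃)
            * qFac q (l₁ - l₃ - j₃ + j₄) * qFac q (l₁ + l₃ - j₃ + j₄ + 1)) *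
          qHyp q
            [l₂ - j₃ + k₄ + 1, j₄ - j₃ + j₂ - j₁ + 1, l₁ + k₂ - j₃ + 1,
              -(l₂ + j₃ - k₄), -(j₁ + j₂ + j₃ - j₄), -(k₂ + j₃ - l₁)]
            [-(2 * j₃), -(j₁ + j₃ + k₃ - k₄), k₃ + k₄ - j₁ - j₃ + 1,
              l₁ - l₃ - j₃ + j₄ + 1, l₁ + l₃ - j₃ + j₄ + 2] 1 := by
  obtain ⟨a₁, a₃, b₁, b₂, b₃, m₁, m₂, m₃, m₄, m₅, m₆, m₇, hp, hA⟩ := h.exists_params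
  obtain rfl : m₁ = 0 := by
    have : (m₁ : ℝ) = 0 := by obtain ⟨-, h1, -⟩ := hp; linarith
    exact_mod_cast this
  unfold IntAdmissible at hA
  obtain ⟨⟨hj₁, hj₃, hl₁, hl₂, hl₃⟩, hk₁, hk₂, hk₃, hk₄, hj₂, hj₄, hl₄⟩ := hp
  rw [Int.cast_zero] at hk₁
  have i₁ : 0 ≤ b₁ - b₃ - m₂ + m₅ + m₆ := by
    have : (0 : ℝ) ≤ b₁ - b₃ - m₂ + m₅ + m₆ := by linarith
    exact_mod_cast this
  have i₂ : 0 ≤ a₁ + m₂ + m₅ - m₆ := by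
    have : (0 : ℝ) ≤ a₁ + m₂ + m₅ - m₆ := by linarith
    exact_mod_cast this
  have i₃ : 0 ≤ b₂ - m₃ - m₄ := by
    have : (0 : ℝ) ≤ b₂ - m₃ - m₄ := by linarith
    exact_mod_cast this
  have i₄ : 0 ≤ b₁ - b₃ - m₂ + m₆ := by
    have : (0 : ℝ) ≤ b₁ - b₃ - m₂ + m₆ := by linarith
    exact_mod_cast this
  unfold antipodeSum
  trans ∑ z ∈ range (m₄.toNat + 1), (-1) ^ z * fac q (b₂ - m₄ + z) *
      fac q (b₁ - b₃ - m₂ + m₅ + m₆ + z) *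
      fac q (b₁ - m₂ + z) *
      fac q (a₃ - z) *
      fac q (a₁ - m₃ + m₄ - z) *
      ((fac q z)⁻¹ * (fac q (m₄ - z))⁻¹ *
      (fac q (a₁ + m₂ + m₅ - m₆ - z))⁻¹ *
      (fac q (a₃ - m₂ - z))⁻¹ *
      (fac q (b₂ - m₃ - m₄ + z))⁻¹ *
      (fac q (b₁ - b₃ - m₂ + m₆ + z))⁻¹ *
      (fac q (b₁ - m₂ + m₆ + 1 + z))⁻¹)
  · rw [natFloor_eq_toNat (show l₂ + j₃ - k₄ = m₄ by linarith)]
    refine sum_congr rfl fun z _ => ?_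
    simp only [div_eq_mul_inv, mul_inv]
    repeat' apply mul_congr
    all_goals first
      | rfl
      | exact qFac_eq_fac q (by push_cast; linarith)
      | exact congrArg _ (qFac_eq_fac q (by push_cast; linarith))
  apply sum_range_eq_mul_qHyp
  · intro k hk
    rw [fac_of_neg q (n := m₄ - k) (by omega)]
    simp
  intro k
  simp only [List.map_cons, List.map_nil, List.prod_cons, List.prod_nil, mul_one,
    div_eq_mul_inv, mul_inv]
  refine Eq.trans (b := fac q (b₂ - m₄) *
      fac q (b₁ - b₃ - m₂ + m₅ + m₆) *
      fac q (b₁ - m₂) *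
      fac q a₃ *
      fac q (a₁ - m₃ + m₄) * ((fac q m₄)⁻¹ *
      (fac q (a₁ + m₂ + m₅ - m₆))⁻¹ *
      (fac q (a₃ - m₂))⁻¹ *
      (fac q (b₂ - m₃ - m₄))⁻¹ *
      (fac q (b₁ - b₃ - m₂ + m₆))⁻¹ *
      (fac q (b₁ - m₂ + m₆ + 1))⁻¹) *
    (((fac q (b₂ - m₄ + k) * (fac q (b₂ - m₄))⁻¹) *
      ((fac q (b₁ - b₃ - m₂ + m₅ + m₆ + k) * (fac q (b₁ - b₃ - m₂ + m₅ + m₆))⁻¹) *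
      ((fac q (b₁ - m₂ + k) * (fac q (b₁ - m₂))⁻¹) *
      (((-1) ^ k * (fac q m₄ * (fac q (m₄ - k))⁻¹)) *
      (((-1) ^ k * (fac q (a₁ + m₂ + m₅ - m₆) * (fac q (a₁ + m₂ + m₅ - m₆ - k))⁻¹)) *
      ((-1) ^ k * (fac q (a₃ - m₂) * (fac q (a₃ - m₂ - k))⁻¹))))))) *
      ((((-1) ^ k * ((fac q a₃)⁻¹ * fac q (a₃ - k))) *
      (((-1) ^ k * ((fac q (a₁ - m₃ + m₄))⁻¹ * fac q (a₁ - m₃ + m₄ - k))) *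
      ((fac q (b₂ - m₃ - m₄) * (fac q (b₂ - m₃ - m₄ + k))⁻¹) *
      ((fac q (b₁ - b₃ - m₂ + m₆) * (fac q (b₁ - b₃ - m₂ + m₆ + k))⁻¹) *
      (fac q (b₁ - m₂ + m₆ + 1) * (fac q (b₁ - m₂ + m₆ + 1 + k))⁻¹))))) * (fac q k)⁻¹))) ?_ (Eq.symm ?_)
  · have hpairs := prod_fac_mul_inv hq [b₂ - m₄, b₁ - b₃ - m₂ + m₅ + m₆, b₁ - m₂, a₃,
        a₁ - m₃ + m₄, m₄, a₁ + m₂ + m₅ - m₆, a₃ - m₂, b₂ - m₃ - m₄, b₁ - b₃ - m₂ + m₆,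
        b₁ - m₂ + m₆ + 1]
      (by simp only [List.Forall]; omega)
    simp only [List.map_cons, List.map_nil, List.prod_cons, List.prod_nil] at hpairs
    have hsg : ((-1 : ℝ) ^ k * (-1) ^ k) * ((-1 : ℝ) ^ k * (-1) ^ k) = 1 := by
      simp only [neg_one_pow_mul_self, one_mul]
    refine Eq.trans ((one_mul _).symm.trans (congrArg (· * _) hsg.symm)) ?_
    refine Eq.trans ((one_mul _).symm.trans (congrArg (· * _) hpairs.symm)) ?_
    ring
  · repeat' apply mul_congr
    all_goals first
      | rfl
      | exact qFac_eq_fac q (by push_cast; linarith)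
      | exact congrArg _ (qFac_eq_fac q (by push_cast; linarith))
      | exact qPoch_eq_fac hq (by push_cast; linarith) (by omega) _
      | exact qPoch_neg_eq_fac hq (by push_cast; linarith) (by omega) _
      | exact inv_qPoch_eq_fac hq (by push_cast; linarith) (by omega) _
      | exact inv_qPoch_neg_eq_fac hq (by push_cast; linarith) (by omega) _
      | exact inv_qPoch_one hq _

/-- The three inequalities are those nonnegativity conditions on the initial summand that
admissibility and the stretched triangles do not imply. The balance of the series uses l₃ = k₁ - j₂
and k₁ = j₁ + l₁. -/
theorem sum_merged_eq_qKampe (hq : 0 < q)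
    (h : Admissible j₁ j₂ j₃ j₄ l₁ l₂ l₃ l₄ k₁ k₂ k₃ k₄) (hk : k₁ = j₁ + l₁)
    (hl : l₃ = k₁ - j₂) (h₁ : 0 ≤ k₃ + k₄ - j₁ - j₃) (h₂ : 0 ≤ k₃ - k₄ - j₂ + j₄)
    (h₃ : 0 ≤ j₁ + j₂ + j₃ - j₄) :
        mergedSum q j₁ j₂ j₃ j₄ l₁ l₂ l₃ l₄ k₂ k₃ k₄ =
        qFac q (l₂ - j₃ + k₄) * qFac q (l₁ + k₂ - j₃) * qFac q (j₁ + j₃ + k₃ - k₄)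
            * qFac q (2 * j₃) * qFac q (j₄ - k₄ + l₄) * qFac q (j₄ + l₃ - k₂)
            * qFac q (k₃ + k₄ + j₂ - j₄) * qFac q (k₂ + l₃ + j₄ + 1) /
          (qFac q (l₂ + j₃ - k₄) * qFac q (k₂ - l₁ + j₃)
            * qFac q (k₃ + k₄ - j₁ - j₃) * qFac q (k₄ - j₄ + l₄)
            * qFac q (k₃ - k₄ - j₂ + j₄) * qFac q (2 * j₄ + 1)
            * qFac q (j₁ + j₂ + j₃ - j₄) * qFac q (l₁ + l₃ - j₃ + j₄ + 1)) *
          qKampe q [-(j₁ + j₂ + j₃ - j₄)] [l₁ + l₃ - j₃ + j₄ + 2]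
            [l₂ - j₃ + k₄ + 1, l₁ + k₂ - j₃ + 1, -(l₂ + j₃ - k₄), -(k₂ - l₁ + j₃)]
            [-(j₁ + j₃ + k₃ - k₄), -(2 * j₃), k₃ + k₄ - j₁ - j₃ + 1]
            [j₄ - k₄ + l₄ + 1, j₄ + l₃ - k₂ + 1, k₂ + l₃ + j₄ + 2, -(k₄ - j₄ + l₄)]
            [-(k₃ + k₄ + j₂ - j₄), k₃ - k₄ - j₂ + j₄ + 1, 2 * j₄ + 2] := by
  obtain ⟨a₁, a₃, b₁, b₂, b₃, m₁, m₂, m₃, m₄, m₅, m₆, m₇, hp, hA⟩ := h.exists_params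
  obtain rfl : m₁ = 0 := by
    have : (m₁ : ℝ) = 0 := by obtain ⟨-, h1, -⟩ := hp; linarith
    exact_mod_cast this
  obtain rfl : m₅ = 0 := by
    have : (m₅ : ℝ) = 0 := by obtain ⟨-, -, -, -, -, h1, -⟩ := hp; linarith
    exact_mod_cast this
  rw [sum_merged_eq hp]
  unfold IntAdmissible at hA
  obtain ⟨⟨hj₁, hj₃, hl₁, hl₂, hl₃⟩, hk₁, hk₂, hk₃, hk₄, hj₂, hj₄, hl₄⟩ := hp
  rw [Int.cast_zero] at hk₁ hj₂
  have i₁ : 0 ≤ b₂ - m₃ - m₄ := by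
    have : (0 : ℝ) ≤ b₂ - m₃ - m₄ := by linarith
    exact_mod_cast this
  have i₂ : 0 ≤ m₄ - m₃ - m₂ + m₆ := by
    have : (0 : ℝ) ≤ m₄ - m₃ - m₂ + m₆ := by linarith
    exact_mod_cast this
  have i₃ : 0 ≤ a₁ + m₂ - m₆ := by
    have : (0 : ℝ) ≤ a₁ + m₂ - m₆ := by linarith
    exact_mod_cast this
  apply sum_range_eq_mul_qKampe
  · simp only [List.sum_cons, List.sum_nil]
    linarith
  · simp only [List.sum_cons, List.sum_nil]
    linarith
  · rintro k l (hkl | hkl)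
    · rw [fac_of_neg q (n := m₄ - k) (by omega)]
      simp
    · rw [fac_of_neg q (n := b₂ - m₄ - b₁ + b₃ + m₂ - m₆ - m₃ + m₇ - l) (by omega)]
      simp
  intro k l
  simp only [List.map_cons, List.map_nil, List.prod_cons, List.prod_nil, mul_one,
    div_eq_mul_inv, mul_inv]
  refine Eq.trans (b := fac q (b₂ - m₄) *
      fac q (b₁ - m₂) *
      fac q (a₁ - m₃ + m₄) *
      fac q a₃ *
      fac q (-m₂ - m₃ + m₄ + m₆ + m₇) *
      fac q m₆ *
      fac q (a₁ + b₂ + m₂ - m₃ - m₄ - m₆) *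
      fac q (a₃ + b₁ - 2 * m₂ + m₆ + 1) * ((fac q m₄)⁻¹ *
      (fac q (a₃ - m₂))⁻¹ *
      (fac q (b₂ - m₃ - m₄))⁻¹ *
      (fac q (b₂ - m₄ - b₁ + b₃ + m₂ - m₆ - m₃ + m₇))⁻¹ *
      (fac q (m₄ - m₃ - m₂ + m₆))⁻¹ *
      (fac q (a₃ + b₁ - b₃ - 2 * m₂ + 2 * m₆ + 1))⁻¹ *
      (fac q (a₁ + m₂ - m₆))⁻¹ *
      (fac q (m₆ + 1 + b₁ - m₂))⁻¹) *
    (((-1) ^ (k + l : ℕ) * (fac q (a₁ + m₂ - m₆) * (fac q (a₁ + m₂ - m₆ - (k + l : ℕ)))⁻¹)) * (fac q (m₆ + 1 + b₁ - m₂) * (fac q (m₆ + 1 + b₁ - m₂ + (k + l : ℕ)))⁻¹) *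
      (((fac q (b₂ - m₄ + k) * (fac q (b₂ - m₄))⁻¹) *
      ((fac q (b₁ - m₂ + k) * (fac q (b₁ - m₂))⁻¹) *
      (((-1) ^ k * (fac q m₄ * (fac q (m₄ - k))⁻¹)) *
      ((-1) ^ k * (fac q (a₃ - m₂) * (fac q (a₃ - m₂ - k))⁻¹))))) * ((fac q (-m₂ - m₃ + m₄ + m₆ + m₇ + l) * (fac q (-m₂ - m₃ + m₄ + m₆ + m₇))⁻¹) *
      ((fac q (m₆ + l) * (fac q m₆)⁻¹) *
      ((fac q (a₃ + b₁ - 2 * m₂ + m₆ + 1 + l) * (fac q (a₃ + b₁ - 2 * m₂ + m₆ + 1))⁻¹) *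
      ((-1) ^ l * (fac q (b₂ - m₄ - b₁ + b₃ + m₂ - m₆ - m₃ + m₇) * (fac q (b₂ - m₄ - b₁ + b₃ + m₂ - m₆ - m₃ + m₇ - l))⁻¹))))) *
        ((((-1) ^ k * ((fac q (a₁ - m₃ + m₄))⁻¹ * fac q (a₁ - m₃ + m₄ - k))) *
      (((-1) ^ k * ((fac q a₃)⁻¹ * fac q (a₃ - k))) *
      (fac q (b₂ - m₃ - m₄) * (fac q (b₂ - m₃ - m₄ + k))⁻¹))) * (((-1) ^ l * ((fac q (a₁ + b₂ + m₂ - m₃ - m₄ - m₆))⁻¹ * fac q (a₁ + b₂ + m₂ - m₃ - m₄ - m₆ - l))) *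
      ((fac q (m₄ - m₃ - m₂ + m₆) * (fac q (m₄ - m₃ - m₂ + m₆ + l))⁻¹) *
      (fac q (a₃ + b₁ - b₃ - 2 * m₂ + 2 * m₆ + 1) * (fac q (a₃ + b₁ - b₃ - 2 * m₂ + 2 * m₆ + 1 + l))⁻¹))))) *
      ((fac q k)⁻¹ * (fac q l)⁻¹))) ?_ (Eq.symm ?_)
  · have hpairs := prod_fac_mul_inv hq [b₂ - m₄, b₁ - m₂, a₁ - m₃ + m₄, a₃,
        -m₂ - m₃ + m₄ + m₆ + m₇, m₆, a₁ + b₂ + m₂ - m₃ - m₄ - m₆, a₃ + b₁ - 2 * m₂ + m₆ + 1, m₄,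
        a₃ - m₂, b₂ - m₃ - m₄, b₂ - m₄ - b₁ + b₃ + m₂ - m₆ - m₃ + m₇, m₄ - m₃ - m₂ + m₆,
        a₃ + b₁ - b₃ - 2 * m₂ + 2 * m₆ + 1, a₁ + m₂ - m₆, m₆ + 1 + b₁ - m₂]
      (by simp only [List.Forall]; omega)
    simp only [List.map_cons, List.map_nil, List.prod_cons, List.prod_nil] at hpairs
    have hsg : ((-1 : ℝ) ^ k * (-1) ^ k) * ((-1 : ℝ) ^ k * (-1) ^ k) * ((-1 : ℝ) ^ l * (-1) ^ l) = 1 := by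
      simp only [neg_one_pow_mul_self, one_mul]
    refine Eq.trans ((one_mul _).symm.trans (congrArg (· * _) hsg.symm)) ?_
    refine Eq.trans ((one_mul _).symm.trans (congrArg (· * _) hpairs.symm)) ?_
    rw [show a₁ + m₂ - m₆ - (k : ℤ) - l = a₁ + m₂ - m₆ - (k + l : ℕ) by push_cast; ring,
      show m₆ + 1 + b₁ - m₂ + (k : ℤ) + l = m₆ + 1 + b₁ - m₂ + (k + l : ℕ) by push_cast; ring]
    ring
  · repeat' apply mul_congr
    all_goals first
      | rfl
      | exact qFac_eq_fac q (by push_cast; linarith)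
      | exact congrArg _ (qFac_eq_fac q (by push_cast; linarith))
      | exact qPoch_eq_fac hq (by push_cast; linarith) (by omega) _
      | exact qPoch_neg_eq_fac hq (by push_cast; linarith) (by omega) _
      | exact inv_qPoch_eq_fac hq (by push_cast; linarith) (by omega) _
      | exact inv_qPoch_neg_eq_fac hq (by push_cast; linarith) (by omega) _

theorem sum_remote_eq_qKampe (hq : 0 < q)
    (h : Admissible j₁ j₂ j₃ j₄ l₁ l₂ l₃ l₄ k₁ k₂ k₃ k₄) (hk : k₁ = j₁ + l₁)
    (hl : l₃ = k₂ + j₄) (h₁ : 0 ≤ l₁ + l₂ + l₄ - l₃) (h₂ : 0 ≤ k₂ + k₄ - l₁ - l₂)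
    (h₃ : 0 ≤ k₃ - k₁ + l₃ - l₄) :
        remoteSum q j₁ j₂ j₃ j₄ l₁ l₂ l₃ l₄ k₁ k₂ k₃ k₄ =
        sign (l₂ + j₃ - k₄) * qFac q (2 * l₂) * qFac q (j₁ + k₃ - l₂) * qFac q (j₃ - l₂ + k₄)
            * qFac q (2 * l₄) * qFac q (j₄ + k₄ - l₄) * qFac q (j₂ + k₃ - l₄) /
          (qFac q (l₂ + j₃ - k₄) * qFac q (k₂ + k₄ - l₁ - l₂) * qFac q (j₂ - k₃ + l₄)
            * qFac q (l₁ + l₂ + l₄ - l₃) * qFac q (k₃ - k₁ + l₃ - l₄)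
            * qFac q (k₃ + k₄ + j₁ + j₄ - l₂ - l₄ + 1)) *
          qKampe q [-(l₁ + l₂ + l₄ - l₃)] [k₃ + k₄ + j₁ + j₄ - l₂ - l₄ + 2]
            [j₁ + k₃ - l₂ + 1, j₃ - l₂ + k₄ + 1, -(l₂ + j₃ - k₄)]
            [-(2 * l₂), k₂ + k₄ - l₁ - l₂ + 1]
            [j₄ + k₄ - l₄ + 1, j₂ + k₃ - l₄ + 1, -(j₂ - k₃ + l₄)]
            [-(2 * l₄), k₃ - k₁ + l₃ - l₄ + 1] := by
  obtain ⟨a₁, a₃, b₁, b₂, b₃, m₁, m₂, m₃, m₄, m₅, m₆, m₇, hp, hA⟩ := h.exists_params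
  obtain rfl : m₁ = 0 := by
    have : (m₁ : ℝ) = 0 := by obtain ⟨-, h1, -⟩ := hp; linarith
    exact_mod_cast this
  unfold IntAdmissible at hA
  obtain ⟨⟨hj₁, hj₃, hl₁, hl₂, hl₃⟩, hk₁, hk₂, hk₃, hk₄, hj₂, hj₄, hl₄⟩ := hp
  rw [Int.cast_zero] at hk₁
  have i₁ : 0 ≤ b₂ - m₃ - m₅ + m₇ := by
    have : (0 : ℝ) ≤ b₂ - m₃ - m₅ + m₇ := by linarith
    exact_mod_cast this
  have i₂ : 0 ≤ a₃ - m₂ - m₄ := by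
    have : (0 : ℝ) ≤ a₃ - m₂ - m₄ := by linarith
    exact_mod_cast this
  have i₃ : 0 ≤ m₅ - m₇ := by
    have : (0 : ℝ) ≤ m₅ - m₇ := by linarith
    exact_mod_cast this
  unfold remoteSum
  -- The sum over z₁ is reversed, because the joint factorials depend on z₁ - z₃, while a Kampé de
  -- Fériet series needs the sum of its indices. This is the source of the sign (-1)^{m₄}.
  trans ∑ k ∈ range (m₄.toNat + 1), ∑ l ∈ range (m₇.toNat + 1), ((-1) ^ m₄ * (-1) ^ k * (-1) ^ l) *
      fac q (b₂ - k) *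
      fac q (a₁ - m₃ + k) *
      fac q (a₃ - m₄ + k) *
      fac q (b₂ - b₁ + b₃ - 2 * m₃ - 2 * m₅ + 2 * m₇ - l) *
      fac q (a₃ + b₁ - b₃ - m₄ - m₂ + m₆ + m₃ + m₅ - m₇ + l) *
      fac q (a₁ + b₁ - b₃ + 2 * m₅ - m₇ + l) *
      ((fac q (m₄ - k))⁻¹ *
      (fac q k)⁻¹ *
      (fac q (a₃ - m₂ - m₄ + k))⁻¹ *
      (fac q l)⁻¹ *
      (fac q (m₇ - l))⁻¹ *
      (fac q (b₂ - m₃ - m₅ + m₇ - k - l))⁻¹ *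
      (fac q (m₅ - m₇ + l))⁻¹ *
      (fac q (a₁ + a₃ + 1 + b₁ - m₂ - b₃ + m₅ + m₆ - m₇ - m₄ + k + l))⁻¹)
  · rw [natFloor_eq_toNat (show l₂ + j₃ - k₄ = m₄ by linarith),
      natFloor_eq_toNat (show j₂ - k₃ + l₄ = m₇ by linarith), ← sum_range_reflect]
    refine sum_congr rfl fun k hk => sum_congr rfl fun l _ => ?_
    rw [mem_range] at hk
    have hk' : ((m₄.toNat + 1 - 1 - k : ℕ) : ℤ) = m₄ - k := by omega
    have hkr : ((m₄.toNat + 1 - 1 - k : ℕ) : ℝ) = m₄ - k := by exact_mod_cast hk'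
    have hsg : (-1 : ℝ) ^ (m₄.toNat + 1 - 1 - k + l) = (-1) ^ m₄ * (-1) ^ k * (-1) ^ l := by
      rw [← zpow_natCast, ← zpow_natCast, ← zpow_natCast, ← zpow_add₀ (by norm_num),
        ← zpow_add₀ (by norm_num)]
      exact neg_one_zpow_congr (by omega)
    simp only [div_eq_mul_inv, mul_inv]
    repeat' apply mul_congr
    · exact hsg
    all_goals first
      | rfl
      | exact qFac_eq_fac q (by rw [hkr]; push_cast; linarith)
      | exact congrArg _ (qFac_eq_fac q (by rw [hkr]; push_cast; linarith))
      | exact qFac_eq_fac q (by push_cast; linarith)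
      | exact congrArg _ (qFac_eq_fac q (by push_cast; linarith))
  apply sum_range_eq_mul_qKampe
  · simp only [List.sum_cons, List.sum_nil]
    linarith
  · simp only [List.sum_cons, List.sum_nil]
    linarith
  · rintro k l (hkl | hkl)
    · rw [fac_of_neg q (n := m₄ - k) (by omega)]
      simp
    · rw [fac_of_neg q (n := m₇ - l) (by omega)]
      simp
  intro k l
  simp only [List.map_cons, List.map_nil, List.prod_cons, List.prod_nil, mul_one,
    div_eq_mul_inv, mul_inv]
  refine Eq.trans (b := (-1) ^ m₄ * fac q b₂ *
      fac q (a₁ - m₃) *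
      fac q (a₃ - m₄) *
      fac q (b₂ - b₁ + b₃ - 2 * m₃ - 2 * m₅ + 2 * m₇) *
      fac q (a₃ + b₁ - b₃ - m₄ - m₂ + m₆ + m₃ + m₅ - m₇) *
      fac q (a₁ + b₁ - b₃ + 2 * m₅ - m₇) * ((fac q m₄)⁻¹ *
      (fac q (a₃ - m₂ - m₄))⁻¹ *
      (fac q m₇)⁻¹ *
      (fac q (b₂ - m₃ - m₅ + m₇))⁻¹ *
      (fac q (m₅ - m₇))⁻¹ *
      (fac q (a₁ + a₃ + 1 + b₁ - m₂ - b₃ + m₅ + m₆ - m₇ - m₄))⁻¹) *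
    (((-1) ^ (k + l : ℕ) * (fac q (b₂ - m₃ - m₅ + m₇) * (fac q (b₂ - m₃ - m₅ + m₇ - (k + l : ℕ)))⁻¹)) * (fac q (a₁ + a₃ + 1 + b₁ - m₂ - b₃ + m₅ + m₆ - m₇ - m₄) * (fac q (a₁ + a₃ + 1 + b₁ - m₂ - b₃ + m₅ + m₆ - m₇ - m₄ + (k + l : ℕ)))⁻¹) *
      (((fac q (a₁ - m₃ + k) * (fac q (a₁ - m₃))⁻¹) *
      ((fac q (a₃ - m₄ + k) * (fac q (a₃ - m₄))⁻¹) *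
      ((-1) ^ k * (fac q m₄ * (fac q (m₄ - k))⁻¹)))) * ((fac q (a₃ + b₁ - b₃ - m₄ - m₂ + m₆ + m₃ + m₅ - m₇ + l) * (fac q (a₃ + b₁ - b₃ - m₄ - m₂ + m₆ + m₃ + m₅ - m₇))⁻¹) *
      ((fac q (a₁ + b₁ - b₃ + 2 * m₅ - m₇ + l) * (fac q (a₁ + b₁ - b₃ + 2 * m₅ - m₇))⁻¹) *
      ((-1) ^ l * (fac q m₇ * (fac q (m₇ - l))⁻¹)))) *
        ((((-1) ^ k * ((fac q b₂)⁻¹ * fac q (b₂ - k))) *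
      (fac q (a₃ - m₂ - m₄) * (fac q (a₃ - m₂ - m₄ + k))⁻¹)) * (((-1) ^ l * ((fac q (b₂ - b₁ + b₃ - 2 * m₃ - 2 * m₅ + 2 * m₇))⁻¹ * fac q (b₂ - b₁ + b₃ - 2 * m₃ - 2 * m₅ + 2 * m₇ - l))) *
      (fac q (m₅ - m₇) * (fac q (m₅ - m₇ + l))⁻¹)))) *
      ((fac q k)⁻¹ * (fac q l)⁻¹))) ?_ (Eq.symm ?_)
  · have hpairs := prod_fac_mul_inv hq [b₂, a₁ - m₃, a₃ - m₄,
        b₂ - b₁ + b₃ - 2 * m₃ - 2 * m₅ + 2 * m₇, a₃ + b₁ - b₃ - m₄ - m₂ + m₆ + m₃ + m₅ - m₇,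
        a₁ + b₁ - b₃ + 2 * m₅ - m₇, m₄, a₃ - m₂ - m₄, m₇, b₂ - m₃ - m₅ + m₇, m₅ - m₇,
        a₁ + a₃ + 1 + b₁ - m₂ - b₃ + m₅ + m₆ - m₇ - m₄]
      (by simp only [List.Forall]; omega)
    simp only [List.map_cons, List.map_nil, List.prod_cons, List.prod_nil] at hpairs
    have hsg : ((-1 : ℝ) ^ k * (-1) ^ k) * ((-1 : ℝ) ^ l * (-1) ^ l) = 1 := by
      simp only [neg_one_pow_mul_self, one_mul]
    refine Eq.trans ((one_mul _).symm.trans (congrArg (· * _) hsg.symm)) ?_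
    refine Eq.trans ((one_mul _).symm.trans (congrArg (· * _) hpairs.symm)) ?_
    rw [show b₂ - m₃ - m₅ + m₇ - (k : ℤ) - l = b₂ - m₃ - m₅ + m₇ - (k + l : ℕ) by push_cast; ring,
      show a₁ + a₃ + 1 + b₁ - m₂ - b₃ + m₅ + m₆ - m₇ - m₄ + (k : ℤ) + l = a₁ + a₃ + 1 + b₁ - m₂ - b₃ + m₅ + m₆ - m₇ - m₄ + (k + l : ℕ) by push_cast; ring]
    ring
  · repeat' apply mul_congr
    all_goals first
      | rfl
      | exact qFac_eq_fac q (by push_cast; linarith)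
      | exact congrArg _ (qFac_eq_fac q (by push_cast; linarith))
      | exact qPoch_eq_fac hq (by push_cast; linarith) (by omega) _
      | exact qPoch_neg_eq_fac hq (by push_cast; linarith) (by omega) _
      | exact inv_qPoch_eq_fac hq (by push_cast; linarith) (by omega) _
      | exact inv_qPoch_neg_eq_fac hq (by push_cast; linarith) (by omega) _
      | exact inv_qPoch_one hq _
      | exact sign_eq_zpow (by linarith)

end
end QRecoupling

/-! ### Four linearly dependent spins -/

namespace QRecoupling
open Finset Polynomial Lagrange
section
variable {q : ℝ}

theorem natDegree_racahPoly_le (q : ℝ) (σ α β γ m C : ℤ) (n : ℕ) :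
    (racahPoly q σ α β γ m C n).natDegree ≤ n := by
  refine natDegree_sum_le_of_forall_le _ _ fun k _ => (natDegree_smul_le _ _).trans ?_
  rw [show ((-1 : ℝ[X]) ^ (n - k)) = Polynomial.C ((-1) ^ (n - k)) by simp]
  refine (natDegree_C_mul_le _ _).trans ?_
  rw [natDegree_nodal, Int.card_Ioc]
  omega

/-- Only the summand k = 0 has all n linear factors, so it alone determines the coefficient in
degree n. -/
theorem coeff_racahPoly (q : ℝ) (σ α β γ m C : ℤ) (n : ℕ) :
    (racahPoly q σ α β γ m C n).coeff n =
      (-1) ^ n * (fac q α * fac q β * fac q γ * ((fac q n)⁻¹ * (fac q m)⁻¹)) := by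
  unfold racahPoly
  rw [finsetSum_coeff, sum_eq_single_of_mem 0 (by simp)]
  · have hm : (nodal (Ioc C (C + n)) (nu q σ)).coeff n = 1 := by
      have := (nodal_monic (s := Ioc C (C + n)) (v := nu q σ)).coeff_natDegree
      rwa [natDegree_nodal, Int.card_Ioc, show (C + n - C).toNat = n by omega] at this
    rw [coeff_smul, show ((-1 : ℝ[X]) ^ (n - 0)) = Polynomial.C ((-1) ^ n) by simp, coeff_C_mul]
    simp only [Nat.cast_zero, add_zero, sub_zero, fac_zero, pow_zero, hm, smul_eq_mul,
      div_eq_mul_inv, mul_inv, inv_one]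
    ring
  · intro k hk hk'
    rw [mem_range] at hk
    rw [coeff_smul, show ((-1 : ℝ[X]) ^ (n - k)) = Polynomial.C ((-1) ^ (n - k)) by simp,
      coeff_C_mul, coeff_eq_zero_of_natDegree_lt, mul_zero, smul_zero]
    rw [natDegree_nodal, Int.card_Ioc]
    omega

variable {a₁ a₃ b₁ b₂ b₃ m₁ m₂ m₃ m₄ m₅ m₆ m₇ : ℤ}

/-- The constant factor of the summand for four linearly dependent spins. -/
noncomputable def dependentConst (q : ℝ) (a₁ a₃ b₁ b₂ b₃ m₁ m₂ m₃ m₄ m₅ m₆ : ℤ) : ℝ :=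
  (fac q m₁)⁻¹ * (fac q (b₁ - m₂))⁻¹ * (fac q (a₁ + b₁ - m₁ + 1))⁻¹ *
    (fac q (a₃ + b₁ - m₂ + 1))⁻¹ *
    ((fac q m₄)⁻¹ * (fac q (b₂ - m₃))⁻¹ * (fac q (a₃ + b₂ - m₄ + 1))⁻¹ *
      (fac q (a₁ + b₂ - m₃ + 1))⁻¹) *
    ((fac q (b₃ - m₅))⁻¹ * (fac q m₆)⁻¹ * (fac q (a₃ + b₁ - 2 * m₂ + m₆ + 1))⁻¹ *
      (fac q (a₁ + b₁ - 2 * m₁ + m₅ + 1))⁻¹)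

/-- No 6j coefficient collapses here. The first and fourth take the form of Racah polynomials, while
each pair of summands of the second and third supplies a complete Lagrange weight. -/
theorem wTerm_dependent_of_pos (hq : 0 < q)
    (h : IntAdmissible a₁ a₃ b₁ b₂ b₃ m₁ m₂ m₃ m₄ m₅ m₆ m₇) (hm : m₇ = b₁ - m₁ + m₃ + m₅) {i : ℤ}
    (hi : InRange a₁ a₃ b₁ b₂ b₃ m₁ m₂ m₃ m₄ m₅ m₆ i) :
    wTerm q a₁ a₃ b₁ b₂ b₃ m₁ m₂ m₃ m₄ m₅ m₆ m₇ i = (-1) ^ (b₁ + m₁ + b₃ + m₆ + m₃) *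
      (dependentConst q a₁ a₃ b₁ b₂ b₃ m₁ m₂ m₃ m₄ m₅ m₆ *
      ((fac q (a₃ - m₂))⁻¹ * (fac q (a₁ - m₁))⁻¹ * (fac q (a₁ - m₃))⁻¹ * (fac q (a₃ - m₄))⁻¹ *
        (fac q (a₁ + b₁ - 2 * m₁ - b₃ + m₅))⁻¹ * (fac q (a₃ + b₁ - 2 * m₂ - b₃ + m₆))⁻¹ *
        (fac q (b₂ - m₄ + b₃ + m₂ - m₆))⁻¹ * (fac q m₇)⁻¹)) *
      ((-1) ^ i * qi q (2 * i + (a₁ + a₃ + 1)) *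
        (fac q (-i) * fac q (i + (a₁ + a₃ + 1)) *
          dSum q (a₃ - m₂) (a₁ - m₁) b₁ m₂ (b₁ - m₁) (-m₂ - i) (-m₂ + i + (a₁ + a₃ + 1))) *
        (fac q (b₁ - m₁ - m₂ - i) * fac q (b₁ - m₁ - m₂ + i + (a₁ + a₃ + 1)) *
          dSum q (a₁ + b₁ - 2 * m₁ - b₃ + m₅) (a₃ + b₁ - 2 * m₂ - b₃ + m₆) b₃ (b₃ - m₆) m₅
            (b₁ - m₁ - m₂ - b₃ + m₆ - i) (b₁ - m₁ - m₂ - b₃ + m₆ + i + (a₁ + a₃ + 1))) *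
        dSum q (a₁ - m₃) (a₃ - m₄) b₂ m₃ (b₂ - m₄) (-m₃ - i) (-m₃ + i + (a₁ + a₃ + 1)) *
        dSum q (b₂ - m₄ + b₃ + m₂ - m₆) m₇ (i - m₂ - b₃ + m₆ - m₃ + (a₁ + a₃ + 1) - 1)
          (a₁ - m₁ - b₃ + m₅ - m₃) (a₃ - b₃ - m₄ - m₂ + m₆) (i + m₂ + b₃ - m₆ + m₃)
          (b₁ + b₂ + b₃ + 1)) := by
  unfold IntAdmissible at h
  unfold InRange at hi
  unfold wTerm
  rw [sixRed_swap₁₂ q (b₁ - m₁ - m₂ - i) (-i), sixRed_swap_s q (-i) (b₁ - m₁ - m₂ - i),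
    sixRed_eq_dSum_shift hq (p₁ := -i) (e := b₁ + m₁ + a₁ + a₃ + i) (w₁ := a₃ - m₂)
      (w₂ := a₁ - m₁) (u₃ := b₁) (v₁ := m₂) (v₂ := b₁ - m₁) (v₃ := -m₂ - i)
      (v₄ := -m₂ + i + (a₁ + a₃ + 1)) (u₁ := a₃ + i) (u₂ := a₁ - m₁ + m₂ + i) (r₁ := m₁)
      (r₂ := b₁ - m₂) (t₃ := a₁ + b₁ - m₁ + 1) (t₄ := a₃ + b₁ - m₂ + 1) (by ring) (by ring)
      (by ring) (by ring) (by ring) (by ring) (by ring) (by ring) (by ring) (by ring) (by ring)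
      (by ring) (by ring) (by omega) (by omega),
    sixRed_swap_pairs q (a₁ - m₃) (a₃ - m₄),
    sixRed_eq_dSum_shift hq (p₁ := -i) (p₂ := b₂ - m₃ - m₄ - i) (e := b₂ + a₁ + a₃ + m₄ + i)
      (w₁ := a₁ - m₃)
      (w₂ := a₃ - m₄) (u₃ := b₂) (v₁ := m₃) (v₂ := b₂ - m₄) (v₃ := -m₃ - i)
      (v₄ := -m₃ + i + (a₁ + a₃ + 1)) (u₁ := a₁ + i) (u₂ := a₃ + m₃ - m₄ + i) (r₁ := m₄)
      (r₂ := b₂ - m₃) (t₃ := a₃ + b₂ - m₄ + 1) (t₄ := a₁ + b₂ - m₃ + 1) (by ring) (by ring)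
      (by ring) (by ring) (by ring) (by ring) (by ring) (by ring) (by ring) (by ring) (by ring)
      (by ring) (by ring) (by omega) (by omega),
    sixRed_swap_pairs q (b₂ - m₃ - m₄ - i),
    sixRed_swap₁₂ q (a₃ + b₁ - b₃ - m₄ - m₂ + m₆ + m₃ - m₁ + m₅ - m₇),
    sixRed_eq_dSum hq (p₁ := a₁ + b₁ - 2 * m₁ - b₃ + 2 * m₅ - m₇)
      (e := b₁ + m₁ + m₂ + b₃ + m₅ + m₆ + a₁ + a₃ + b₂ + m₃ + m₄)
      (u₁ := b₂ - m₄ + b₃ + m₂ - m₆) (u₂ := m₇)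
      (u₃ := i - m₂ - b₃ + m₆ - m₃ + (a₁ + a₃ + 1) - 1) (v₁ := a₁ - m₁ - b₃ + m₅ - m₃)
      (v₂ := a₃ - b₃ - m₄ - m₂ + m₆) (v₃ := i + m₂ + b₃ - m₆ + m₃) (v₄ := b₁ + b₂ + b₃ + 1)
      (r₁ := a₁ - m₃ + m₄ + i) (r₂ := a₃ + m₁ - m₂ + m₆ - m₅ + i)
      (t₃ := b₁ - m₁ - m₂ - b₃ + m₅ + m₆ + i + (a₁ + a₃ + 1))
      (t₄ := b₂ - m₃ - m₄ + i + (a₁ + a₃ + 1)) (by omega) (by omega) (by omega) (by omega)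
      (by omega) (by omega) (by omega) (by omega) (by omega) (by omega) (by omega) (by omega)
      (by omega),
    sixRed_swap_pairs q (a₁ + b₁ - 2 * m₁ - b₃ + m₅),
    sixRed_swap₁₂ q (b₁ - m₁ - m₂ - b₃ + m₅ + m₆ - i) (b₁ - m₁ - m₂ - i),
    sixRed_eq_dSum_shift hq (p₁ := b₁ - m₁ - m₂ - i) (p₂ := b₁ - m₁ - m₂ - b₃ + m₅ + m₆ - i)
      (e := b₁ + m₁ + m₂ + m₅ + a₁ + a₃ + i)
      (w₁ := a₁ + b₁ - 2 * m₁ - b₃ + m₅) (w₂ := a₃ + b₁ - 2 * m₂ - b₃ + m₆) (u₃ := b₃)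
      (v₁ := b₃ - m₆) (v₂ := m₅) (v₃ := b₁ - m₁ - m₂ - b₃ + m₆ - i)
      (v₄ := b₁ - m₁ - m₂ - b₃ + m₆ + i + (a₁ + a₃ + 1)) (u₁ := a₁ - m₁ + m₂ + m₅ - m₆ + i)
      (u₂ := a₃ + m₁ - m₂ + i) (r₁ := b₃ - m₅)
      (r₂ := m₆) (t₃ := a₃ + b₁ - 2 * m₂ + m₆ + 1) (t₄ := a₁ + b₁ - 2 * m₁ + m₅ + 1) (by ring)
      (by ring) (by ring) (by ring) (by ring) (by ring) (by ring) (by ring) (by ring) (by ring)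
      (by ring) (by ring) (by ring) (by omega) (by omega)]
  have hsg : (-1 : ℝ) ^ (b₁ + m₁ + a₁ + a₃ + i) * (-1) ^ (b₂ + a₁ + a₃ + m₄ + i) *
      (-1) ^ (b₁ + m₁ + m₂ + b₃ + m₅ + m₆ + a₁ + a₃ + b₂ + m₃ + m₄) *
      (-1) ^ (b₁ + m₁ + m₂ + m₅ + a₁ + a₃ + i) =
      (-1) ^ (b₁ + m₁ + b₃ + m₆ + m₃) * (-1) ^ i := by
    simp only [← zpow_add₀ (show (-1 : ℝ) ≠ 0 by norm_num)]
    apply neg_one_zpow_congr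
    omega
  have hpairs := prod_fac_mul_inv hq [a₃ + m₁ - m₂ + i, a₁ - m₁ + m₂ + i, a₁ + i, a₃ + i,
      a₃ + m₃ - m₄ + i, a₁ - m₃ + m₄ + i, b₂ - m₃ - m₄ - i, b₂ - m₃ - m₄ + i + (a₁ + a₃ + 1),
      a₁ - m₁ + m₂ + m₅ - m₆ + i, a₃ + m₁ - m₂ + m₆ - m₅ + i, b₁ - m₁ - m₂ - b₃ + m₅ + m₆ - i,
      b₁ - m₁ - m₂ - b₃ + m₅ + m₆ + i + (a₁ + a₃ + 1)]
    (by simp only [List.Forall]; omega)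
  simp only [List.map_cons, List.map_nil, List.prod_cons, List.prod_nil] at hpairs
  have hg : ∀ C s t a b c d e : ℝ, s * C * (t * a * b * c * d * e) =
      s * t * (C * (a * b * c * d * e)) := by intros; ring
  refine Eq.trans ?_ (hg _ _ _ _ _ _ _ _).symm
  refine Eq.trans ?_ (congrArg (· * _) hsg)
  refine Eq.trans ?_ ((congrArg (· * _) hpairs).trans (one_mul _))
  unfold dependentConst
  ring

end
end QRecoupling

namespace QRecoupling
open Finset Polynomial Lagrange
section
variable {q : ℝ} {a₁ a₃ b₁ b₂ b₃ m₁ m₂ m₃ m₄ m₅ m₆ m₇ : ℤ}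

theorem wTerm_dependent (hq : 0 < q)
    (h : IntAdmissible a₁ a₃ b₁ b₂ b₃ m₁ m₂ m₃ m₄ m₅ m₆ m₇) (hm : m₇ = b₁ - m₁ + m₃ + m₅) {i : ℤ}
    (hi : i ≤ 0) :
    wTerm q a₁ a₃ b₁ b₂ b₃ m₁ m₂ m₃ m₄ m₅ m₆ m₇ i = (-1) ^ (b₁ + m₁ + b₃ + m₆ + m₃) *
      (dependentConst q a₁ a₃ b₁ b₂ b₃ m₁ m₂ m₃ m₄ m₅ m₆ *
      ((fac q (a₃ - m₂))⁻¹ * (fac q (a₁ - m₁))⁻¹ * (fac q (a₁ - m₃))⁻¹ * (fac q (a₃ - m₄))⁻¹ *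
        (fac q (a₁ + b₁ - 2 * m₁ - b₃ + m₅))⁻¹ * (fac q (a₃ + b₁ - 2 * m₂ - b₃ + m₆))⁻¹ *
        (fac q (b₂ - m₄ + b₃ + m₂ - m₆))⁻¹ * (fac q m₇)⁻¹)) *
      ((-1) ^ i * qi q (2 * i + (a₁ + a₃ + 1)) *
        ((racahPoly q (a₁ + a₃ + 1) (a₃ - m₂) (a₁ - m₁) b₁ (b₁ - m₁) (-m₂) m₂.toNat *
          racahPoly q (a₁ + a₃ + 1) (a₁ + b₁ - 2 * m₁ - b₃ + m₅) (a₃ + b₁ - 2 * m₂ - b₃ + m₆) b₃ m₅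
            (b₁ - m₁ - m₂ - b₃ + m₆) (b₃ - m₆).toNat).eval (nu q (a₁ + a₃ + 1) i)) *
        dSum q (a₁ - m₃) (a₃ - m₄) b₂ m₃ (b₂ - m₄) (-m₃ - i) (-m₃ + i + (a₁ + a₃ + 1)) *
        dSum q (b₂ - m₄ + b₃ + m₂ - m₆) m₇ (i - m₂ - b₃ + m₆ - m₃ + (a₁ + a₃ + 1) - 1)
          (a₁ - m₁ - b₃ + m₅ - m₃) (a₃ - b₃ - m₄ - m₂ + m₆) (i + m₂ + b₃ - m₆ + m₃)
          (b₁ + b₂ + b₃ + 1)) := by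
  have hA := h
  unfold IntAdmissible at h
  by_cases hp : InRange a₁ a₃ b₁ b₂ b₃ m₁ m₂ m₃ m₄ m₅ m₆ i
  · rw [wTerm_dependent_of_pos hq hA hm hp]
    unfold InRange at hp
    rw [eval_mul, racahPoly_eval hq (by omega) (by omega),
      racahPoly_eval hq (by omega) (by omega), Int.toNat_of_nonneg (by omega),
      Int.toNat_of_nonneg (by omega)]
    rw [show -m₂ + m₂ - i = -i by ring, show -m₂ + m₂ + i = i by ring,
      show b₁ - m₁ - m₂ - b₃ + m₆ + (b₃ - m₆) = b₁ - m₁ - m₂ by ring]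
    simp only [mul_assoc]
  rw [wTerm_eq_zero hq hp]
  symm
  by_contra h0
  apply hp
  unfold InRange
  rw [mul_eq_zero, not_or] at h0
  obtain ⟨-, h0⟩ := h0
  rw [mul_eq_zero, not_or, mul_eq_zero, not_or, mul_eq_zero, not_or, eval_mul] at h0
  obtain ⟨⟨⟨-, e14⟩, h2⟩, h3⟩ := h0
  have e1 := left_ne_zero_of_mul e14
  have e4 := right_ne_zero_of_mul e14
  obtain ⟨y, hy⟩ := exists_dTerm_ne_zero h3
  have hy := dTerm_ne_zero hy
  obtain ⟨w, hw⟩ := exists_dTerm_ne_zero h2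
  have hw := dTerm_ne_zero hw
  have h1 := e1
  rw [racahPoly_eval hq (by omega) (by omega)] at h1
  obtain ⟨w₁, hw₁⟩ := exists_dTerm_ne_zero (right_ne_zero_of_mul h1)
  have hw₁ := dTerm_ne_zero hw₁
  have h4 := e4
  rw [racahPoly_eval hq (by omega) (by omega)] at h4
  obtain ⟨w₄, hw₄⟩ := exists_dTerm_ne_zero (right_ne_zero_of_mul h4)
  have hw₄ := dTerm_ne_zero hw₄
  have e2 : (racahPoly q (a₁ + a₃ + 1) (a₁ - m₃) (a₃ - m₄) b₂ (b₂ - m₄) (-m₃) m₃.toNat).eval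
      (nu q (a₁ + a₃ + 1) i) ≠ 0 := by
    rw [racahPoly_eval hq (by omega) (by omega), Int.toNat_of_nonneg (by omega)]
    exact mul_ne_zero (mul_ne_zero (fac_ne_zero hq (by omega)) (fac_ne_zero hq (by omega))) h2
  have e1' := mt (racahPoly_eval_eq_zero hq (L := -a₃) (R := -a₃ + m₂ - m₁) (by omega) (by omega)
    (by omega) (by omega) (by omega) (by omega) (by omega) (by omega)) e1
  have e2' := mt (racahPoly_eval_eq_zero hq (L := -a₁) (R := -a₁ + m₃ - m₄) (by omega) (by omega)
    (by omega) (by omega) (by omega) (by omega) (by omega) (by omega)) e2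
  have e4' := mt (racahPoly_eval_eq_zero hq (L := m₁ - m₂ + m₆ - m₅ - a₁) (R := m₁ - m₂ - a₁)
    (by omega) (by omega) (by omega) (by omega) (by omega) (by omega) (by omega) (by omega)) e4
  omega

/-- For indices y, z of the second and third 6j sums the x-sum is a divided difference of P * R over
m₂ + (b₃-m₆) + y + z + 1 nodes. The degree of P * R is at most m₂ + (b₃-m₆), so everything with y +
z > 0 vanishes, and y = z = 0 gives the product of the leading coefficients. -/
theorem sum_wTerm_dependent_of_le (hq : 0 < q)
    (h : IntAdmissible a₁ a₃ b₁ b₂ b₃ m₁ m₂ m₃ m₄ m₅ m₆ m₇) (hm : m₇ = b₁ - m₁ + m₃ + m₅)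
    (hw : a₁ + 2 * (m₂ + m₅) ≤ a₃ + 2 * (m₁ + m₆)) {L : ℤ} (hL : L ≤ -(a₁ + a₃)) :
    ∑ i ∈ Icc L 0, wTerm q a₁ a₃ b₁ b₂ b₃ m₁ m₂ m₃ m₄ m₅ m₆ m₇ i = (-1) ^ (b₁ + m₁ + m₂) *
      (dependentConst q a₁ a₃ b₁ b₂ b₃ m₁ m₂ m₃ m₄ m₅ m₆ * (fac q b₁ * fac q b₂ * fac q b₃) *
      ((fac q m₂)⁻¹ * (fac q (b₁ - m₁))⁻¹ * (fac q m₃)⁻¹ * (fac q (b₂ - m₄))⁻¹ *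
        (fac q (b₃ - m₆))⁻¹ * (fac q m₅)⁻¹ * (fac q (a₁ - m₁ - b₃ + m₅ - m₃))⁻¹ *
        (fac q (a₃ - b₃ - m₄ - m₂ + m₆))⁻¹ * (fac q (b₁ + b₂ + b₃ + 1))⁻¹)) := by
  rw [sum_congr rfl fun i hi => wTerm_dependent hq h hm (mem_Icc.1 hi).2, ← mul_sum]
  unfold IntAdmissible at h
  set P := racahPoly q (a₁ + a₃ + 1) (a₃ - m₂) (a₁ - m₁) b₁ (b₁ - m₁) (-m₂) m₂.toNat with hP
  set R := racahPoly q (a₁ + a₃ + 1) (a₁ + b₁ - 2 * m₁ - b₃ + m₅) (a₃ + b₁ - 2 * m₂ - b₃ + m₆) b₃ m₅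
            (b₁ - m₁ - m₂ - b₃ + m₆) (b₃ - m₆).toNat with hR
  have hPd : P.natDegree ≤ m₂.toNat := natDegree_racahPoly_le ..
  have hRd : R.natDegree ≤ (b₃ - m₆).toNat := natDegree_racahPoly_le ..
  set σ : ℤ := a₁ + a₃ + 1 with hσ
  set c : ℕ → ℕ → ℝ := fun y z =>
    (-1) ^ y * fac q (a₁ - m₃ + y) * fac q (a₃ - m₄ + y) * fac q (b₂ - y) *
    ((fac q y)⁻¹ * (fac q (m₃ - y))⁻¹ * (fac q (b₂ - m₄ - y))⁻¹) *
    ((-1) ^ z * fac q (b₂ - m₄ + b₃ + m₂ - m₆ + z) * fac q (m₇ + z) *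
    ((fac q z)⁻¹ * (fac q (a₁ - m₁ - b₃ + m₅ - m₃ - z))⁻¹ *
      (fac q (a₃ - b₃ - m₄ - m₂ + m₆ - z))⁻¹ * (fac q (b₁ + b₂ + b₃ + 1 + z))⁻¹)) with hc
  have key : ∀ y ∈ range (m₃.toNat + 1), ∀ z ∈ range ((a₁ - m₁ - b₃ + m₅ - m₃).toNat + 1),
      ∑ i ∈ Icc L 0, (-1) ^ i * qi q (2 * i + σ) * (P * R).eval (nu q σ i) *
        dTerm q (a₁ - m₃) (a₃ - m₄) b₂ m₃ (b₂ - m₄) (-m₃ - i) (-m₃ + i + σ) y *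
        dTerm q (b₂ - m₄ + b₃ + m₂ - m₆) m₇ (i - m₂ - b₃ + m₆ - m₃ + σ - 1)
          (a₁ - m₁ - b₃ + m₅ - m₃) (a₃ - b₃ - m₄ - m₂ + m₆) (i + m₂ + b₃ - m₆ + m₃)
          (b₁ + b₂ + b₃ + 1) z =
      c y z * ((-1) ^ (-m₃ + y) * (P * R).coeff (m₂.toNat + (b₃ - m₆).toNat + (y + z))) := by
    intro y hy z hz
    rw [mem_range] at hy hz
    set M : ℤ := -m₃ + y with hM
    set A : ℤ := -m₂ - b₃ + m₆ - m₃ - z with hA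
    have hcard : #(Icc A M) - 1 = m₂.toNat + (b₃ - m₆).toNat + (y + z) := by
      rw [Int.card_Icc]; omega
    -- The hypothesis `hw`, which is j₂ ≤ j₄ in spins, makes 2A + σ positive, so no two nodes
    -- coincide and the divisibility condition is empty.
    rw [← hcard, ← divDiff_of_natDegree_lt (v := nu q σ) (lt_of_le_of_lt natDegree_mul_le
      (by rw [Int.card_Icc]; omega)), divDiff_Icc_eq_sum hq (by omega) (by
        rw [Icc_eq_empty (by omega), nodal_empty]; exact one_dvd _),
      sum_Icc_congr_of_ne_zero (c := A) (d := M)]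
    · rw [mul_sum, mul_sum]
      refine sum_congr rfl fun i _ => ?_
      have hs : (-1 : ℝ) ^ i = (-1) ^ M * (-1) ^ (M - i) := by
        rw [← zpow_add₀ (by norm_num)]
        exact neg_one_zpow_congr (by omega)
      unfold dTerm
      rw [hs, hc, show -m₃ - i + y = M - i by omega, show -m₃ + i + σ + y = i + M + σ by omega,
        show i - m₂ - b₃ + m₆ - m₃ + σ - 1 - z = i + A + σ - 1 by omega,
        show i + m₂ + b₃ - m₆ + m₃ + z = i - A by omega, zpow_natCast, zpow_natCast]
      simp only [div_eq_mul_inv, mul_inv]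
      ring
    · intro i h0
      simp only [dTerm, div_eq_mul_inv, mul_inv, ne_eq, mul_eq_zero, not_or, inv_eq_zero,
        fac_eq_zero_iff hq] at h0
      omega
  simp only [dSum, mul_sum_range_mul_sum_range]
  rw [sum_comm, sum_congr rfl fun y hy => by rw [sum_comm, sum_congr rfl (key y hy)]]
  have hz : ∀ y z : ℕ, y + z ≠ 0 →
      (P * R).coeff (m₂.toNat + (b₃ - m₆).toNat + (y + z)) = 0 := fun y z hyz =>
    coeff_eq_zero_of_natDegree_lt (lt_of_le_of_lt natDegree_mul_le (by omega))
  rw [sum_eq_single_of_mem 0 (by simp) fun y _ hy => sum_eq_zero fun z _ => by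
      rw [hz y z (by omega), mul_zero, mul_zero],
    sum_eq_single_of_mem 0 (by simp) fun z _ hz' => by
      rw [hz 0 z (by omega), mul_zero, mul_zero],
    add_zero, add_zero, coeff_mul_add_eq_of_natDegree_le hPd hRd, hP, hR, coeff_racahPoly,
    coeff_racahPoly, hc, Int.toNat_of_nonneg (show 0 ≤ m₂ by omega),
    Int.toNat_of_nonneg (show 0 ≤ b₃ - m₆ by omega)]
  simp only [Nat.cast_zero, add_zero, sub_zero, pow_zero, fac_zero, inv_one, one_mul]
  have hsg : (-1 : ℝ) ^ (b₁ + m₁ + b₃ + m₆ + m₃) * ((-1) ^ (-m₃) *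
      ((-1) ^ m₂.toNat * (-1) ^ (b₃ - m₆).toNat)) = (-1) ^ (b₁ + m₁ + m₂) := by
    rw [← zpow_natCast, ← zpow_natCast, Int.toNat_of_nonneg (by omega),
      Int.toNat_of_nonneg (by omega)]
    simp only [← zpow_add₀ (show (-1 : ℝ) ≠ 0 by norm_num)]
    exact neg_one_zpow_congr (by omega)
  have hpairs := prod_fac_mul_inv hq [a₃ - m₂, a₁ - m₁, a₁ - m₃, a₃ - m₄,
      a₁ + b₁ - 2 * m₁ - b₃ + m₅, a₃ + b₁ - 2 * m₂ - b₃ + m₆, b₂ - m₄ + b₃ + m₂ - m₆, m₇]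
    (by simp only [List.Forall]; omega)
  simp only [List.map_cons, List.map_nil, List.prod_cons, List.prod_nil] at hpairs
  rw [← hsg]
  refine Eq.trans ?_ ((congrArg (· * _) hpairs).trans (one_mul _))
  ring

end
end QRecoupling

namespace QRecoupling
open Finset
section
variable {q : ℝ} {a₁ a₃ b₁ b₂ b₃ m₁ m₂ m₃ m₄ m₅ m₆ m₇ m₈ : ℤ}

/-- The reflection j₁ ↔ j₃, j₂ ↔ j₄, k₁ ↔ k₂, k₃ ↔ k₄ fixes every l and only exchanges parameters
within the four 6j coefficients. -/
theorem wTerm_flip (q : ℝ) (hm : m₈ = m₁ - m₂ - m₃ + m₄ - m₅ + m₆ + m₇) (i : ℤ) :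
    wTerm q a₁ a₃ b₁ b₂ b₃ m₁ m₂ m₃ m₄ m₅ m₆ m₇ i =
      wTerm q a₃ a₁ b₁ b₂ b₃ m₂ m₁ m₄ m₃ m₆ m₅ m₈ i := by
  obtain rfl : m₇ = m₈ - (m₁ - m₂ - m₃ + m₄ - m₅ + m₆) := by omega
  unfold wTerm
  rw [sixRed_swap_pairs q (b₁ - m₁ - m₂ - i) (-i), sixRed_swap₁₂ q (a₃ - m₂),
    sixRed_swap_pairs q (a₁ - m₁), sixRed_swap_s q (b₁ - m₁ - m₂ - i) (-i),
    sixRed_swap₁₂ q (a₁ - m₃), sixRed_swap_s q (a₃ - m₄),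
    sixRed_swap_pairs q (b₂ - m₃ - m₄ - i) (b₁ - m₁ - m₂ - b₃ + m₅ + m₆ - i),
    sixRed_swap₁₂ q (a₃ + b₁ - b₃ - m₄ - m₂ + m₆ + m₃ - m₁ + m₅ - _),
    sixRed_swap_pairs q _ _ (b₂ - m₃ - m₄ - i),
    sixRed_swap_s q (b₂ - m₃ - m₄ - i),
    sixRed_swap₁₂ q (a₁ + b₁ - 2 * m₁ - b₃ + m₅), sixRed_swap_s q (a₃ + b₁ - 2 * m₂ - b₃ + m₆)]
  ring_nf

theorem IntAdmissible.flip (h : IntAdmissible a₁ a₃ b₁ b₂ b₃ m₁ m₂ m₃ m₄ m₅ m₆ m₇)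
    (hm : m₈ = m₁ - m₂ - m₃ + m₄ - m₅ + m₆ + m₇) :
    IntAdmissible a₃ a₁ b₁ b₂ b₃ m₂ m₁ m₄ m₃ m₆ m₅ m₈ := by
  unfold IntAdmissible at *
  omega

/-- By the reflection symmetry one may assume j₂ ≤ j₄; the right side is itself invariant under it.
-/
theorem sum_wTerm_dependent (hq : 0 < q)
    (h : IntAdmissible a₁ a₃ b₁ b₂ b₃ m₁ m₂ m₃ m₄ m₅ m₆ m₇) (hm : m₇ = b₁ - m₁ + m₃ + m₅)
    {L : ℤ} (hL : L ≤ -(a₁ + a₃)) :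
    ∑ i ∈ Icc L 0, wTerm q a₁ a₃ b₁ b₂ b₃ m₁ m₂ m₃ m₄ m₅ m₆ m₇ i = (-1) ^ (b₁ + m₁ + m₂) *
      (dependentConst q a₁ a₃ b₁ b₂ b₃ m₁ m₂ m₃ m₄ m₅ m₆ * (fac q b₁ * fac q b₂ * fac q b₃) *
      ((fac q m₂)⁻¹ * (fac q (b₁ - m₁))⁻¹ * (fac q m₃)⁻¹ * (fac q (b₂ - m₄))⁻¹ *
        (fac q (b₃ - m₆))⁻¹ * (fac q m₅)⁻¹ * (fac q (a₁ - m₁ - b₃ + m₅ - m₃))⁻¹ *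
        (fac q (a₃ - b₃ - m₄ - m₂ + m₆))⁻¹ * (fac q (b₁ + b₂ + b₃ + 1))⁻¹)) := by
  rcases le_total (a₁ + 2 * (m₂ + m₅)) (a₃ + 2 * (m₁ + m₆)) with hw | hw
  · exact sum_wTerm_dependent_of_le hq h hm hw hL
  · rw [sum_congr rfl fun i _ => wTerm_flip q rfl i,
      sum_wTerm_dependent_of_le hq (h.flip rfl) (by omega) hw (by omega),
      show b₁ + m₂ + m₁ = b₁ + m₁ + m₂ by ring,
      show a₃ - m₂ - b₃ + m₆ - m₄ = a₃ - b₃ - m₄ - m₂ + m₆ by ring,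
      show a₁ - b₃ - m₃ - m₁ + m₅ = a₁ - m₁ - b₃ + m₅ - m₃ by ring]
    unfold dependentConst
    ring

theorem twelveJ_dependent (hq : 0 < q) {j₁ j₂ j₃ j₄ l₁ l₂ l₃ l₄ k₁ k₂ k₃ k₄ : ℝ}
    (h : Admissible j₁ j₂ j₃ j₄ l₁ l₂ l₃ l₄ k₁ k₂ k₃ k₄) (hl : l₄ = l₁ + l₂ + l₃) :
      twelveJ q j₁ j₂ j₃ j₄ l₁ l₂ l₃ l₄ k₁ k₂ k₃ k₄ =
        sign (j₁ - j₃ - k₁ + k₂) * qFac q (2 * l₁) * qFac q (2 * l₂) * qFac q (2 * l₃)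
            * nab q l₄ k₃ j₂ * nab q l₄ j₄ k₄ /
          (qFac q (2 * l₄ + 1) * nab q l₁ j₁ k₁ * nab q l₁ k₂ j₃ * nab q l₂ j₁ k₃
            * nab q l₂ j₃ k₄ * nab q l₃ j₂ k₁ * nab q l₃ k₂ j₄) := by
  obtain ⟨a₁, a₃, b₁, b₂, b₃, m₁, m₂, m₃, m₄, m₅, m₆, m₇, hp, hA⟩ := h.exists_params
  obtain ⟨⟨hj₁, hj₃, hl₁, hl₂, hl₃⟩, hk₁, hk₂, hk₃, hk₄, hj₂, hj₄, hl₄⟩ := hp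
  have hm : m₇ = b₁ - m₁ + m₃ + m₅ := by
    have : (m₇ : ℝ) = b₁ - m₁ + m₃ + m₅ := by linarith
    exact_mod_cast this
  have hA' := hA
  unfold IntAdmissible at hA'
  rw [twelveJ_eq_sum_wTerm hq hj₁ hj₃ hl₁ hl₂ hl₃ hk₁ hk₂ hk₃ hk₄ hj₂ hj₄ hl₄ (L := -(a₁ + a₃))
    (by omega) le_rfl, sum_wTerm_dependent hq hA hm le_rfl,
    sign_eq_zpow (show j₁ - j₃ - k₁ + k₂ = (m₁ - m₂ : ℤ) by push_cast; linarith),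
    qFac_eq_fac q hl₁, qFac_eq_fac q hl₂, qFac_eq_fac q hl₃,
    qFac_eq_fac q (show 2 * l₄ + 1 = (b₁ + b₂ + b₃ + 1 : ℤ) by push_cast; linarith),
    nab_eq_tri_div hq (show k₃ + j₂ - l₄ = (a₁ - m₁ - b₃ + m₅ - m₃ : ℤ) by push_cast; linarith),
    nab_eq_tri_div hq (show j₄ + k₄ - l₄ = (a₃ - b₃ - m₄ - m₂ + m₆ : ℤ) by push_cast; linarith)]
  have e1 := inv_nab_eq hq (a := l₁) (b := j₁) (c := k₁) (z := m₁) (y := b₁ - m₁) (x := a₁ - m₁)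
    (s := a₁ + b₁ - m₁ + 1) (by linarith) (by push_cast; linarith) (by push_cast; linarith)
    (by ring) (by omega)
  have e2 := inv_nab_eq hq (a := l₁) (b := k₂) (c := j₃) (z := b₁ - m₂) (y := m₂) (x := a₃ - m₂)
    (s := a₃ + b₁ - m₂ + 1) (by push_cast; linarith) (by linarith) (by push_cast; linarith)
    (by ring) (by omega)
  have e3 := inv_nab_eq hq (a := l₂) (b := j₁) (c := k₃) (z := m₃) (y := b₂ - m₃) (x := a₁ - m₃)
    (s := a₁ + b₂ - m₃ + 1) (by linarith) (by push_cast; linarith) (by push_cast; linarith)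
    (by ring) (by omega)
  have e4 := inv_nab_eq hq (a := l₂) (b := j₃) (c := k₄) (z := m₄) (y := b₂ - m₄) (x := a₃ - m₄)
    (s := a₃ + b₂ - m₄ + 1) (by linarith) (by push_cast; linarith) (by push_cast; linarith)
    (by ring) (by omega)
  have e5 := inv_nab_eq hq (a := l₃) (b := j₂) (c := k₁) (z := m₅) (y := b₃ - m₅)
    (x := a₁ + b₁ - 2 * m₁ - b₃ + m₅) (s := a₁ + b₁ - 2 * m₁ + m₅ + 1) (by linarith)
    (by push_cast; linarith) (by push_cast; linarith) (by ring) (by omega)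
  have e6 := inv_nab_eq hq (a := l₃) (b := k₂) (c := j₄) (z := b₃ - m₆) (y := m₆)
    (x := a₃ + b₁ - 2 * m₂ - b₃ + m₆) (s := a₃ + b₁ - 2 * m₂ + m₆ + 1) (by push_cast; linarith)
    (by linarith) (by push_cast; linarith) (by ring) (by omega)
  have hsg : (-1 : ℝ) ^ (m₁ - m₂) = (-1) ^ (m₁ - m₃ + m₇ - m₅) * (-1) ^ (b₁ + m₁ + m₂) := by
    rw [← zpow_add₀ (by norm_num)]
    exact neg_one_zpow_congr (by omega)
  simp only [div_eq_mul_inv, mul_inv, e1, e2, e3, e4, e5, e6]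
  rw [hsg]
  unfold dependentConst
  rw [tri_reverse q k₁ j₁, tri_reverse q j₃ k₂, tri_reverse q k₃ j₁, tri_rotate q j₃ k₄,
    tri_rotate q k₄ l₂, tri_rotate q k₃ j₂, tri_rotate q j₂ l₄, tri_rotate q j₄ k₄,
    tri_rotate q k₄ l₄, tri_reverse q k₁ j₂, tri_reverse q j₄ k₂]
  ring

end
end QRecoupling

/-! ### The theorem -/

theorem mainTheorem7 (q : ℝ) (hq : 0 < q)
    (j₁ j₂ j₃ j₄ l₁ l₂ l₃ l₄ k₁ k₂ k₃ k₄ : ℝ)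
    (h : Admissible j₁ j₂ j₃ j₄ l₁ l₂ l₃ l₄ k₁ k₂ k₃ k₄) :
    -- one stretched triangle: triple sum
    (k₁ = j₁ + l₁ →
      twelveJ q j₁ j₂ j₃ j₄ l₁ l₂ l₃ l₄ k₁ k₂ k₃ k₄ =
        sign (j₁ + l₂ - k₃) * nab q k₁ j₂ l₃ * nab q j₄ k₂ l₃ /
          (nab q j₁ l₂ k₃ * nab q k₄ j₃ l₂ * nab q k₃ j₂ l₄ * nab q j₄ k₄ l₄ * nab q l₁ k₂ j₃) *
        √(qFac q (2 * l₁) * qFac q (2 * j₁) / qFac q (2 * k₁ + 1)) *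
        ∑ z₁ ∈ Finset.range (⌊l₂ + j₃ - k₄⌋₊ + 1), ∑ z₃ ∈ Finset.range (⌊j₂ - k₃ + l₄⌋₊ + 1),
          ∑ z₄ ∈ Finset.range (⌊k₁ + j₂ - l₃⌋₊ + 1),
          (-1) ^ (z₁ + z₃) * qFac q (l₂ - j₃ + k₄ + z₁) * qFac q (j₁ + j₃ + k₃ - k₄ - z₁)
            * qFac q (2 * j₃ - z₁) * qFac q (j₄ + k₄ - l₄ + z₃) * qFac q (j₂ + k₃ - l₄ + z₃)
            * qFac q (2 * l₄ - z₃) * qFac q (j₂ + l₃ - k₁ + z₄) * qFac q (k₂ + l₃ - j₄ + z₄)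
            * qFac q (k₁ + k₃ + k₄ + j₄ - l₃ - z₄ + 1) /
          (qFac q z₁ * qFac q z₃ * qFac q z₄ * qFac q (l₂ + j₃ - k₄ - z₁)
            * qFac q (j₃ - j₄ - l₁ + l₃ + z₄ - z₁) * qFac q (j₂ - k₃ + l₄ - z₃)
            * qFac q (k₃ + j₁ + j₃ + j₄ - l₄ - z₁ + z₃ + 1)
            * qFac q (k₄ + l₁ - l₃ + l₄ - j₃ + z₁ - z₃ - z₄)
            * qFac q (k₃ - k₁ + l₃ - l₄ + z₃ + z₄) * qFac q (k₁ + j₂ - l₃ - z₄)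
            * qFac q (k₂ - l₃ + j₄ - z₄) * qFac q (2 * l₃ + z₄ + 1))) ∧
    -- adjacent consecutive stretched triangles: a product times a 6j coefficient
    (k₁ = j₁ + l₁ → l₃ = k₁ + j₂ →
      twelveJ q j₁ j₂ j₃ j₄ l₁ l₂ l₃ l₄ k₁ k₂ k₃ k₄ =
        sign (j₁ + l₂ - k₃ + j₄ + k₄ + l₄) * nab q l₃ j₄ k₂ * nab q (j₁ + j₂) l₂ l₄ /
          (nab q j₁ l₂ k₃ * nab q j₂ k₃ l₄ * nab q l₁ k₂ j₃ * nab q (j₁ + j₂) j₃ j₄) *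
        √(qFac q (2 * l₁) * qFac q (2 * j₁) * qFac q (2 * j₂) /
          (qNum q (2 * k₁ + 1) * qFac q (2 * l₃ + 1))) *
        sixJ q (j₁ + j₂) l₄ l₂ k₄ j₃ j₄) ∧
    -- merging adjacent stretched triangles: double sum
    (k₁ = j₁ + l₁ → l₃ = k₁ - j₂ → ∃ S : ℝ,
      S = ∑ z ∈ Finset.range (⌊l₂ + j₃ - k₄⌋₊ + 1), ∑ u ∈ Finset.range (⌊k₄ - j₄ + l₄⌋₊ + 1),
          (-1) ^ (z + u) * qFac q (l₂ - j₃ + k₄ + z) * qFac q (l₁ + k₂ - j₃ + z)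
            * qFac q (j₁ + j₃ + k₃ - k₄ - z) * qFac q (2 * j₃ - z)
            * qFac q (j₄ - k₄ + l₄ + u) * qFac q (j₄ + l₃ - k₂ + u)
            * qFac q (k₃ + k₄ + j₂ - j₄ - u) * qFac q (k₂ + l₃ + j₄ + u + 1) /
          (qFac q z * qFac q (l₂ + j₃ - k₄ - z) * qFac q (k₂ - l₁ + j₃ - z)
            * qFac q (k₃ + k₄ - j₁ - j₃ + z) * qFac q u * qFac q (k₄ - j₄ + l₄ - u)
            * qFac q (k₃ - k₄ - j₂ + j₄ + u) * qFac q (2 * j₄ + u + 1)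
            * qFac q (j₁ + j₂ + j₃ - j₄ - z - u) * qFac q (l₁ + l₃ - j₃ + j₄ + z + u + 1)) ∧
      twelveJ q j₁ j₂ j₃ j₄ l₁ l₂ l₃ l₄ k₁ k₂ k₃ k₄ =
        sign (j₁ + l₂ - k₃) *
          √(qFac q (2 * l₁) * qFac q (2 * j₁) * qFac q (2 * j₂) * qFac q (2 * l₃)) *
          nab q k₄ l₄ j₄ /
          (nab q l₃ k₂ j₄ * nab q j₁ l₂ k₃ * nab q k₄ j₃ l₂ * nab q j₂ k₃ l₄ * nab q l₁ k₂ j₃) *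
        S ∧
      (0 ≤ k₃ + k₄ - j₁ - j₃ → 0 ≤ k₃ - k₄ - j₂ + j₄ → 0 ≤ j₁ + j₂ + j₃ - j₄ →
        S = qFac q (l₂ - j₃ + k₄) * qFac q (l₁ + k₂ - j₃) * qFac q (j₁ + j₃ + k₃ - k₄)
            * qFac q (2 * j₃) * qFac q (j₄ - k₄ + l₄) * qFac q (j₄ + l₃ - k₂)
            * qFac q (k₃ + k₄ + j₂ - j₄) * qFac q (k₂ + l₃ + j₄ + 1) /
          (qFac q (l₂ + j₃ - k₄) * qFac q (k₂ - l₁ + j₃)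
            * qFac q (k₃ + k₄ - j₁ - j₃) * qFac q (k₄ - j₄ + l₄)
            * qFac q (k₃ - k₄ - j₂ + j₄) * qFac q (2 * j₄ + 1)
            * qFac q (j₁ + j₂ + j₃ - j₄) * qFac q (l₁ + l₃ - j₃ + j₄ + 1)) *
          qKampe q [-(j₁ + j₂ + j₃ - j₄)] [l₁ + l₃ - j₃ + j₄ + 2]
            [l₂ - j₃ + k₄ + 1, l₁ + k₂ - j₃ + 1, -(l₂ + j₃ - k₄), -(k₂ - l₁ + j₃)]
            [-(j₁ + j₃ + k₃ - k₄), -(2 * j₃), k₃ + k₄ - j₁ - j₃ + 1]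
            [j₄ - k₄ + l₄ + 1, j₄ + l₃ - k₂ + 1, k₂ + l₃ + j₄ + 2, -(k₄ - j₄ + l₄)]
            [-(k₃ + k₄ + j₂ - j₄), k₃ - k₄ - j₂ + j₄ + 1, 2 * j₄ + 2])) ∧
    -- antipode stretched triangles, with sums k₁ and j₄: single sum
    (k₁ = j₁ + l₁ → j₄ = l₄ + k₄ → ∃ S : ℝ,
      S = ∑ z ∈ Finset.range (⌊l₂ + j₃ - k₄⌋₊ + 1),
          (-1) ^ z * qFac q (l₂ - j₃ + k₄ + z) * qFac q (j₄ - j₃ + j₂ - j₁ + z)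
            * qFac q (l₁ + k₂ - j₃ + z) * qFac q (2 * j₃ - z)
            * qFac q (j₁ + j₃ + k₃ - k₄ - z) /
          (qFac q z * qFac q (l₂ + j₃ - k₄ - z) * qFac q (j₁ + j₂ + j₃ - j₄ - z)
            * qFac q (k₂ + j₃ - l₁ - z) * qFac q (k₃ + k₄ - j₁ - j₃ + z)
            * qFac q (l₁ - l₃ - j₃ + j₄ + z) * qFac q (l₁ + l₃ - j₃ + j₄ + z + 1)) ∧
      twelveJ q j₁ j₂ j₃ j₄ l₁ l₂ l₃ l₄ k₁ k₂ k₃ k₄ =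
        sign (j₁ + l₂ - k₃) * nab q k₁ j₂ l₃ * nab q j₄ k₂ l₃ /
          (nab q j₁ l₂ k₃ * nab q k₄ j₃ l₂ * nab q l₄ k₃ j₂ * nab q l₁ k₂ j₃) *
        √(qFac q (2 * l₁) * qFac q (2 * j₁) * qFac q (2 * l₄) * qFac q (2 * k₄) /
          (qFac q (2 * k₁ + 1) * qFac q (2 * j₄ + 1))) *
        S ∧
      (0 ≤ j₄ - j₃ + j₂ - j₁ → 0 ≤ j₁ + j₂ + j₃ - j₄ → 0 ≤ k₃ + k₄ - j₁ - j₃ →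
        0 ≤ l₁ - l₃ - j₃ + j₄ →
        S = qFac q (l₂ - j₃ + k₄) * qFac q (j₄ - j₃ + j₂ - j₁)
            * qFac q (l₁ + k₂ - j₃) * qFac q (2 * j₃) * qFac q (j₁ + j₃ + k₃ - k₄) /
          (qFac q (l₂ + j₃ - k₄) * qFac q (j₁ + j₂ + j₃ - j₄)
            * qFac q (k₂ + j₃ - l₁) * qFac q (k₃ + k₄ - j₁ - j₃)
            * qFac q (l₁ - l₃ - j₃ + j₄) * qFac q (l₁ + l₃ - j₃ + j₄ + 1)) *
          qHyp q
            [l₂ - j₃ + k₄ + 1, j₄ - j₃ + j₂ - j₁ + 1, l₁ + k₂ - j₃ + 1,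
              -(l₂ + j₃ - k₄), -(j₁ + j₂ + j₃ - j₄), -(k₂ + j₃ - l₁)]
            [-(2 * j₃), -(j₁ + j₃ + k₃ - k₄), k₃ + k₄ - j₁ - j₃ + 1,
              l₁ - l₃ - j₃ + j₄ + 1, l₁ + l₃ - j₃ + j₄ + 2] 1)) ∧
    -- antipode stretched triangles, with sums k₁ and k₄: single sum
    (k₁ = j₁ + l₁ → k₄ = j₄ + l₄ → ∃ S : ℝ,
      S = ∑ z ∈ Finset.range (⌊k₁ - j₂ + l₃⌋₊ + 1),
          (-1) ^ z * qFac q (j₂ + l₃ - k₁ + z) * qFac q (k₁ + k₂ - j₂ + j₄ - z)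
            * qFac q (l₄ - k₃ + j₂ + z) * qFac q (j₃ - j₄ + j₂ - j₁ + z)
            * qFac q (j₂ + k₃ + l₄ + z + 1) /
          (qFac q z * qFac q (k₁ - j₂ + l₃ - z) * qFac q (k₂ + j₂ - k₁ - j₄ + z)
            * qFac q (j₁ - j₂ + j₃ + j₄ - z) * qFac q (l₄ - l₂ - j₁ + j₂ + z)
            * qFac q (2 * j₂ + z + 1) * qFac q (l₂ + l₄ - j₁ + j₂ + z + 1)) ∧
      twelveJ q j₁ j₂ j₃ j₄ l₁ l₂ l₃ l₄ k₁ k₂ k₃ k₄ =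
        sign (l₁ - l₂ - k₂ + k₄) * nab q k₁ j₂ l₃ * nab q k₄ j₃ l₂ /
          (nab q j₁ l₂ k₃ * nab q l₄ k₃ j₂ * nab q j₄ l₃ k₂ * nab q l₁ k₂ j₃) *
        √(qFac q (2 * l₁) * qFac q (2 * j₁) * qFac q (2 * l₄) * qFac q (2 * j₄) /
          (qFac q (2 * k₁ + 1) * qFac q (2 * k₄ + 1))) *
        S ∧
      (0 ≤ j₃ - j₄ + j₂ - j₁ → 0 ≤ k₂ + j₂ - k₁ - j₄ → 0 ≤ j₁ - j₂ + j₃ + j₄ →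
        0 ≤ l₄ - l₂ - j₁ + j₂ →
        S = qFac q (j₂ + l₃ - k₁) * qFac q (k₁ + k₂ - j₂ + j₄)
            * qFac q (l₄ - k₃ + j₂) * qFac q (j₃ - j₄ + j₂ - j₁) * qFac q (j₂ + k₃ + l₄ + 1) /
          (qFac q (k₁ - j₂ + l₃) * qFac q (k₂ + j₂ - k₁ - j₄)
            * qFac q (j₁ - j₂ + j₃ + j₄) * qFac q (l₄ - l₂ - j₁ + j₂)
            * qFac q (2 * j₂ + 1) * qFac q (l₂ + l₄ - j₁ + j₂ + 1)) *
          qHyp q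
            [j₂ + l₃ - k₁ + 1, l₄ - k₃ + j₂ + 1, j₃ - j₄ + j₂ - j₁ + 1, j₂ + k₃ + l₄ + 2,
              -(k₁ - j₂ + l₃), -(j₁ - j₂ + j₃ + j₄)]
            [-(k₁ + k₂ - j₂ + j₄), k₂ + j₂ - k₁ - j₄ + 1, l₄ - l₂ - j₁ + j₂ + 1,
              2 * j₂ + 2, l₂ + l₄ - j₁ + j₂ + 2] 1)) ∧
    -- remote stretched triangles of the adjacent type: double sum
    (k₁ = j₁ + l₁ → l₃ = k₂ + j₄ → ∃ S : ℝ,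
      S = ∑ z₁ ∈ Finset.range (⌊l₂ + j₃ - k₄⌋₊ + 1), ∑ z₃ ∈ Finset.range (⌊j₂ - k₃ + l₄⌋₊ + 1),
          (-1) ^ (z₁ + z₃) * qFac q (l₂ - j₃ + k₄ + z₁) * qFac q (j₁ + j₃ + k₃ - k₄ - z₁)
            * qFac q (2 * j₃ - z₁) * qFac q (2 * l₄ - z₃) * qFac q (j₄ + k₄ - l₄ + z₃)
            * qFac q (j₂ + k₃ - l₄ + z₃) /
          (qFac q z₁ * qFac q (l₂ + j₃ - k₄ - z₁) * qFac q (j₃ + k₂ - l₁ - z₁)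
            * qFac q z₃ * qFac q (j₂ - k₃ + l₄ - z₃)
            * qFac q (k₄ + l₁ - l₃ + l₄ - j₃ + z₁ - z₃) * qFac q (k₃ - k₁ + l₃ - l₄ + z₃)
            * qFac q (k₃ + j₁ + j₃ + j₄ - l₄ - z₁ + z₃ + 1)) ∧
      twelveJ q j₁ j₂ j₃ j₄ l₁ l₂ l₃ l₄ k₁ k₂ k₃ k₄ =
        sign (j₁ + l₂ - k₃) * nab q l₃ j₂ k₁ * qFac q (k₁ + k₃ + k₄ + j₄ - l₃ + 1) /
          (nab q j₁ l₂ k₃ * nab q k₄ j₃ l₂ * nab q k₃ j₂ l₄ * nab q j₄ k₄ l₄ * nab q l₁ k₂ j₃) *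
        √(qFac q (2 * l₁) * qFac q (2 * j₁) * qFac q (2 * k₂) * qFac q (2 * j₄) /
          (qFac q (2 * k₁ + 1) * qFac q (2 * l₃ + 1))) *
        S ∧
      (0 ≤ l₁ + l₂ + l₄ - l₃ → 0 ≤ k₂ + k₄ - l₁ - l₂ → 0 ≤ k₃ - k₁ + l₃ - l₄ →
        S = sign (l₂ + j₃ - k₄) * qFac q (2 * l₂) * qFac q (j₁ + k₃ - l₂) * qFac q (j₃ - l₂ + k₄)
            * qFac q (2 * l₄) * qFac q (j₄ + k₄ - l₄) * qFac q (j₂ + k₃ - l₄) /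
          (qFac q (l₂ + j₃ - k₄) * qFac q (k₂ + k₄ - l₁ - l₂) * qFac q (j₂ - k₃ + l₄)
            * qFac q (l₁ + l₂ + l₄ - l₃) * qFac q (k₃ - k₁ + l₃ - l₄)
            * qFac q (k₃ + k₄ + j₁ + j₄ - l₂ - l₄ + 1)) *
          qKampe q [-(l₁ + l₂ + l₄ - l₃)] [k₃ + k₄ + j₁ + j₄ - l₂ - l₄ + 2]
            [j₁ + k₃ - l₂ + 1, j₃ - l₂ + k₄ + 1, -(l₂ + j₃ - k₄)]
            [-(2 * l₂), k₂ + k₄ - l₁ - l₂ + 1]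
            [j₄ + k₄ - l₄ + 1, j₂ + k₃ - l₄ + 1, -(j₂ - k₃ + l₄)]
            [-(2 * l₄), k₃ - k₁ + l₃ - l₄ + 1])) ∧
    -- four linearly dependent spins: a single term
    (l₄ = l₁ + l₂ + l₃ →
      twelveJ q j₁ j₂ j₃ j₄ l₁ l₂ l₃ l₄ k₁ k₂ k₃ k₄ =
        sign (j₁ - j₃ - k₁ + k₂) * qFac q (2 * l₁) * qFac q (2 * l₂) * qFac q (2 * l₃)
            * nab q l₄ k₃ j₂ * nab q l₄ j₄ k₄ /
          (qFac q (2 * l₄ + 1) * nab q l₁ j₁ k₁ * nab q l₁ k₂ j₃ * nab q l₂ j₁ k₃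
            * nab q l₂ j₃ k₄ * nab q l₃ j₂ k₁ * nab q l₃ k₂ j₄)) := by
  -- In the existential clauses `rfl` fixes S as the displayed sum; `mergedSum` and its companions
  -- unfold to it definitionally.
  refine ⟨fun hk => twelveJ_stretched hq h hk, fun hk hl => twelveJ_stretched_adjacent hq h hk hl,
    fun hk hl => ⟨_, rfl, twelveJ_stretched_merged hq h hk hl,
      sum_merged_eq_qKampe hq h hk hl⟩,
    fun hk hj => ⟨_, rfl, twelveJ_stretched_antipode hq h hk hj,
      sum_antipode_eq_qHyp hq h hk⟩,
    fun hk hj => ⟨_, rfl, twelveJ_stretched_antipode' hq h hk hj,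
      sum_antipode'_eq_qHyp hq h hk⟩,
    fun hk hl => ⟨_, rfl, twelveJ_stretched_remote hq h hk hl,
      sum_remote_eq_qKampe hq h hk hl⟩,
    fun hl => twelveJ_dependent hq h hl⟩
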